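/- **Setting.** Let $d\ge 1$ and let $\phi:[0,\infty)\to[0,\infty)$ be continuous and strictly increasing with $\phi(0)=0$, $\phi(1)=1$ and $c_0^\phi:=\int_0^\infty\frac{r^2\wedge 1}{r\phi(r)}\,dr<\infty$. Say that $\phi$ is in Case 1 if $\int_{0+}\frac{dr}{\phi(r)}<\infty$, in Case 2 if $\int_{0+}\frac{dr}{\phi(r)}=\infty=\int_1^\infty\frac{dr}{\phi(r)}$, and in Case 3 if $\int_{0+}\frac{dr}{\phi(r)}=\infty>\int_1^\infty\frac{dr}{\phi(r)}$. For $z\in\mathbb R^d$ put $z^{(\phi)}:=0$, $z\mathbf 1_{\{|z|\le1\}}$, $z$ in Cases 1, 2, 3, respectively. Assume that for constants $0<c_1^\phi\le c_2^\phi$ and $0<\beta_1\le\beta_2<\infty$, $$c_1^\phi\Big(\frac Rr\Big)^{\beta_1}\mathbf 1_{\{R\le1\}}\le\frac{\phi(R)}{\phi(r)}\le c_2^\phi\Big(\frac Rr\Big)^{\beta_2},\qquad 0<r<R<\infty .\tag{1}$$ For $i=0,1$ let $\mathcal A^{(i)}_\phi:=\sup_{\lambda\in(0,1]}\int_0^\infty\frac{\phi(\lambda)\gamma^{(i)}_\phi(r)}{r\,\phi(\lambda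 r)}\,dr\in[0,\infty]$, where $\gamma^{(0)}_\phi(r)=r^2\wedge1$ and $\gamma^{(1)}_\phi(r)=r\wedge 1$, $r^2\wedge1$, $r^2\wedge r$ in Cases 1, 2, 3. Let $\ell:(0,1]\to(0,\infty)$ be continuous, increasing, slowly varying at $0$ (i.e. $\lim_{t\to0}\ell(\lambda t)/\ell(t)=1$ for all $\lambda>0$) and Dini, i.e. $\int_0^1\ell(t)\,\frac{dt}t<\infty$; extend it by $\ell(t)=\ell(1)$ for $t\ge1$. Let $\kappa:[0,\infty)\times\mathbb R^d\times\mathbb R^d\to\mathbb R$ be measurable and, for some $\kappa_0\ge1$, $$\kappa_0^{-1}\le\kappa(t,x,z)\le\kappa_0,\qquad |\kappa(t,x,z)-\kappa(t,y,z)|\le\ell^2(|x-y|)\quad(x\ne y).\tag{2}$$ Assume one of the following. * **(H1)** $\kappa(t,x,z)=\kappa(t,x,-z)$ for all $(t,x,z)$, and (1), (2), $\mathcal A^{(0)}_\phi<\infty$ hold. * **(H2$'$)** $\kappa$ is not symmetric in $z$ in this sense, (1), (2), $\mathcal A^{(1)}_\phi<\infty$ hold, and in Case 2, $\int_{|z|\le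 r}z\,\kappa(t,x,z)\,dz=0$ for all $r>0$, $t\ge0$, $x\in\mathbb R^d$. Set $\Delta_f(x,z):=\frac{f(x+z)+f(x-z)-2f(x)}{2|z|^d\phi(|z|)}$ under (H1), $\Delta_f(x,z):=\frac{f(x+z)-f(x)-z^{(\phi)}\cdot\nabla f(x)}{|z|^d\phi(|z|)}$ under (H2$'$), and $\mathscr L^{\kappa_w}_tf(x):=\int_{\mathbb R^d}\Delta_f(x,z)\,\kappa(t,w,z)\,dz$. For $0\le t<s$ and $y\in\mathbb R^d$ let $$p^{(y)}_{t,s}(x):=(2\pi)^{-d}\int_{\mathbb R^d}e^{ix\cdot\xi}\exp\Big(\int_t^s\!\!\int_{\mathbb R^d}\big(e^{i\xi\cdot z}-1-i\xi\cdot z^{(\phi)}\big)\frac{\kappa(r,y,z)}{|z|^d\phi(|z|)}\,dz\,dr\Big)d\xi ,$$ the heat kernel (with terminal point $0$) of the frozen operator $\mathscr L^{\kappa_y}_t$. Define $$q^{(0)}_{t,s}(x,y):=\big((\mathscr L^{\kappa_x}_t-\mathscr L^{\kappa_y}_t)p^{(y)}_{t,s}\big)(x-y),\qquad q^{(n)}_{t,s}(x,y):=\int_t^s\!\!\int_{\mathbb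 R^d}q^{(0)}_{t,r}(x,z)\,q^{(n-1)}_{r,s}(z,y)\,dz\,dr\quad(n\ge1).$$ Finally put $\ell_\phi(t):=\ell(\phi^{-1}(t))$, $\rho_\phi(t,x):=\dfrac1{t\,\phi^{-1}(t)^d+|x|^d\phi(|x|)}$, and $h^{g}_\phi(t,x):=g(\phi^{-1}(t)+|x|)\,\rho_\phi(t,x)$ for a function $g$ on $(0,\infty)$; let $\mathbb D^{\varepsilon}_0$ be the set of $(t,x;s,y)$ with $x,y\in\mathbb R^d$, $s,t\ge0$, $0<s-t<\varepsilon$; and let $\Theta:=(d,\kappa_0,c_0^\phi,c_1^\phi,c_2^\phi,\beta_1,\beta_2,\mathcal A^{(0)}_\phi,\mathcal A^{(1)}_\phi)$. **Theorem.** There are an $\varepsilon_0>0$, depending only on $\ell$ and $\Theta$, and a constant $c_1=c_1(\varepsilon_0,\Theta)>0$ such that under (H1) or (H2$'$) the following hold. 1. On $\mathbb D^{\varepsilon_0}_0$ the integrals defining the $q^{(n)}$ converge absolutely, and the series $q_{t,s}(x,y):=\sum_{n\ge0}q^{(n)}_{t,s}(x,y)$ is absolutely and locally uniformly convergent (so that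 $\sum_n|q^{(n)}|$ also converges locally uniformly). 2. For all $(t,x;s,y)\in\mathbb D^{\varepsilon_0}_0$, with an absolutely convergent integral, $$q_{t,s}(x,y)=q^{(0)}_{t,s}(x,y)+\int_t^s\!\!\int_{\mathbb R^d}q^{(0)}_{t,r}(x,z)\,q_{r,s}(z,y)\,dz\,dr .$$ 3. For each $t>0$, $(s,x,y)\mapsto q_{t,s}(x,y)$ is jointly continuous on $(t,t+\varepsilon_0)\times\mathbb R^d\times\mathbb R^d$. 4. On $\mathbb D^{\varepsilon_0}_0$, with $\|\ell\|_\infty:=\sup_{r>0}|\ell(r)|$, $$|q_{t,s}(x,y)|\le c_1h^{\ell^2}_\phi(s-t,x-y)\le c_1\|\ell\|_\infty h^{\ell}_\phi(s-t,x-y).$$ 5. For $(t,x;s,y)\in\mathbb D^{\varepsilon_0}_0$ and $x'\in\mathbb R^d$ with $x'\neq x$, $$|q_{t,s}(x,y)-q_{t,s}(x',y)|\le c_1\frac{\ell(|x-x'|)}{\ell_\phi(s-t)}\Big(h^{\ell}_\phi(s-t,x-y)+h^{\ell}_\phi(s-t,x'-y)\Big).$$ -/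

import Mathlib

open MeasureTheory Set Filter Topology
open scoped ENNReal

noncomputable section

namespace LevyLevi

/-- The Euclidean space `ℝ^d`. -/
abbrev E (d : ℕ) : Type := EuclideanSpace ℝ (Fin d)

/-! ### The scale function `φ` -/

/-- `c₀^φ = ∫₀^∞ (r² ∧ 1) / (r φ(r)) dr`, as an extended nonnegative number. -/
def c0 (φ : ℝ → ℝ) : ℝ≥0∞ :=
  ∫⁻ r in Ioi (0 : ℝ), ENNReal.ofReal (min (r ^ 2) 1 / (r * φ r))

/-- The standing assumptions on `φ : [0, ∞) → [0, ∞)`; the values of `φ` on the negative half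
line are never used. -/
structure IsScale (φ : ℝ → ℝ) : Prop where
  strictMonoOn : StrictMonoOn φ (Ici 0)
  continuousOn : ContinuousOn φ (Ici 0)
  map_zero : φ 0 = 0
  map_one : φ 1 = 1
  c0_lt_top : c0 φ < ∞

/-- The inverse function of `φ` on `[0, ∞)`. -/
def phiInv (φ : ℝ → ℝ) (t : ℝ) : ℝ := Function.invFunOn φ (Ici 0) t

/-- `∫_{0+} dr / φ(r) < ∞`. -/
def Case1 (φ : ℝ → ℝ) : Prop := IntegrableOn (fun r => 1 / φ r) (Ioc 0 1)

/-- `∫_{0+} dr / φ(r) = ∞` and `∫_1^∞ dr / φ(r) = ∞`. -/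
def Case2 (φ : ℝ → ℝ) : Prop :=
  ¬ IntegrableOn (fun r => 1 / φ r) (Ioc 0 1) ∧ ¬ IntegrableOn (fun r => 1 / φ r) (Ici 1)

/-- `∫_{0+} dr / φ(r) = ∞` and `∫_1^∞ dr / φ(r) < ∞`. -/
def Case3 (φ : ℝ → ℝ) : Prop :=
  ¬ IntegrableOn (fun r => 1 / φ r) (Ioc 0 1) ∧ IntegrableOn (fun r => 1 / φ r) (Ici 1)

/-- The weak scaling condition: for `0 < r < R`,
`c₁ (R/r)^β₁ 1_{R ≤ 1} ≤ φ(R)/φ(r) ≤ c₂ (R/r)^β₂`. -/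
structure WeakScaling (φ : ℝ → ℝ) (c₁ c₂ β₁ β₂ : ℝ) : Prop where
  c₁_pos : 0 < c₁
  c₁_le_c₂ : c₁ ≤ c₂
  β₁_pos : 0 < β₁
  β₁_le_β₂ : β₁ ≤ β₂
  lower : ∀ r R : ℝ, 0 < r → r < R → R ≤ 1 → c₁ * (R / r) ^ β₁ ≤ φ R / φ r
  upper : ∀ r R : ℝ, 0 < r → r < R → φ R / φ r ≤ c₂ * (R / r) ^ β₂

/-- `γ^{(0)}(r) = r² ∧ 1`. -/
def gamma0 (r : ℝ) : ℝ := min (r ^ 2) 1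

open Classical in
/-- `γ^{(1)}_φ(r)`: `r ∧ 1` in case 1, `r² ∧ 1` in case 2, `r² ∧ r` in case 3. -/
def gamma1 (φ : ℝ → ℝ) (r : ℝ) : ℝ :=
  if Case1 φ then min r 1 else if Case2 φ then min (r ^ 2) 1 else min (r ^ 2) r

/-- `sup_{λ ∈ (0,1]} ∫₀^∞ φ(λ) γ(r) / (r φ(λ r)) dr`. -/
def supA (φ γ : ℝ → ℝ) : ℝ≥0∞ :=
  ⨆ l ∈ Ioc (0 : ℝ) 1, ∫⁻ r in Ioi (0 : ℝ), ENNReal.ofReal (φ l * γ r / (r * φ (l * r)))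

/-- `𝒜^{(0)}_φ`. -/
def A0 (φ : ℝ → ℝ) : ℝ≥0∞ := supA φ gamma0

/-- `𝒜^{(1)}_φ`. -/
def A1 (φ : ℝ → ℝ) : ℝ≥0∞ := supA φ (gamma1 φ)

/-! ### Slowly varying functions and Dini functions

Functions on `(0, 1]` are extended to `(0, ∞)` by `ℓ(t) = ℓ(1)` for `t ≥ 1`. The values of `ℓ`
on `(-∞, 0]` play no role. -/

/-- The class `𝒮₀` of slowly varying functions at zero. -/
structure SlowlyVarying (ℓ : ℝ → ℝ) : Prop where
  continuousOn : ContinuousOn ℓ (Ioc 0 1)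
  pos : ∀ t ∈ Ioc (0 : ℝ) 1, 0 < ℓ t
  extend : ∀ t : ℝ, 1 ≤ t → ℓ t = ℓ 1
  tendsto : ∀ l : ℝ, 0 < l → Tendsto (fun t => ℓ (l * t) / ℓ t) (𝓝[>] 0) (𝓝 1)
  away_from_zero : ∀ ε ∈ Ioo (0 : ℝ) 1, ∃ m : ℝ, 0 < m ∧ ∀ t ∈ Icc ε 1, m ≤ ℓ t

/-- The class `𝒟₀` of Dini functions. -/
structure IsDini (ℓ : ℝ → ℝ) : Prop where
  continuousOn : ContinuousOn ℓ (Ioc 0 1)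
  pos : ∀ t ∈ Ioc (0 : ℝ) 1, 0 < ℓ t
  extend : ∀ t : ℝ, 1 ≤ t → ℓ t = ℓ 1
  monotoneOn : MonotoneOn ℓ (Ioc 0 1)
  integrableOn : IntegrableOn (fun t => ℓ t / t) (Ioc 0 1)

/-- `ℓ_φ(t) = ℓ(φ⁻¹(t))`. -/
def ellPhi (φ ℓ : ℝ → ℝ) (t : ℝ) : ℝ := ℓ (phiInv φ t)

/-- The sup norm `‖ℓ‖_∞` of `ℓ` on `(0, ∞)`. -/
def supNorm (ℓ : ℝ → ℝ) : ℝ := ⨆ r : Ioi (0 : ℝ), |ℓ r|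

variable {d : ℕ}

/-- `ρ_φ(t, x) = 1 / (t φ⁻¹(t)^d + |x|^d φ(|x|))`. -/
def rho (φ : ℝ → ℝ) (t : ℝ) (x : E d) : ℝ :=
  1 / (t * phiInv φ t ^ d + ‖x‖ ^ d * φ ‖x‖)

/-- `h^ℓ_φ(t, x) = ℓ(φ⁻¹(t) + |x|) ρ_φ(t, x)`. -/
def hfun (φ ℓ : ℝ → ℝ) (t : ℝ) (x : E d) : ℝ := ℓ (phiInv φ t + ‖x‖) * rho φ t x

/-! ### The kernel `κ(t, x, z)`, `t ≥ 0` -/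

/-- `κ(t, x, z) = κ(t, x, -z)` for all `t ≥ 0`, `x`, `z`. -/
def SymmKernel (κ : ℝ → E d → E d → ℝ) : Prop :=
  ∀ t : ℝ, 0 ≤ t → ∀ x z : E d, κ t x z = κ t x (-z)

/-- `κ` is measurable, bounded between `κ₀⁻¹` and `κ₀`, and continuous in `x` with modulus `ℓ²`,
uniformly in `(t, z)`. -/
structure KernelBounds (κ : ℝ → E d → E d → ℝ) (κ₀ : ℝ) (ℓ : ℝ → ℝ) : Prop where
  measurable : Measurable (fun p : ℝ × E d × E d => κ p.1 p.2.1 p.2.2)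
  one_le : 1 ≤ κ₀
  lower : ∀ t : ℝ, 0 ≤ t → ∀ x z : E d, κ₀⁻¹ ≤ κ t x z
  upper : ∀ t : ℝ, 0 ≤ t → ∀ x z : E d, κ t x z ≤ κ₀
  modulus : ∀ t : ℝ, 0 ≤ t → ∀ x y z : E d, |κ t x z - κ t y z| ≤ ℓ ‖x - y‖ ^ 2

/-- In case 2, `∫_{|z| ≤ r} z κ(t, x, z) dz = 0` for every `r > 0`. -/
def KernelCentered (φ : ℝ → ℝ) (κ : ℝ → E d → E d → ℝ) : Prop :=
  Case2 φ → ∀ t : ℝ, 0 ≤ t → ∀ x : E d, ∀ r : ℝ, 0 < r →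
    ∫ z in Metric.closedBall (0 : E d) r, κ t x z • z = 0

/-! ### The operators -/

open Classical in
/-- `z^{(φ)} = z 1_{|z| ≤ 1}` in case 2, `z` in case 3, `0` in case 1. -/
def zphi (φ : ℝ → ℝ) (z : E d) : E d :=
  if Case2 φ then (if ‖z‖ ≤ 1 then z else 0) else if Case3 φ then z else 0

open Classical in
/-- The difference operator `Δ^{(φ)}_f(x, z)`, whose form depends on whether `κ` is symmetric;
`fderiv ℝ f x v` is `v · ∇f(x)`. -/
def Delta (φ : ℝ → ℝ) (κ : ℝ → E d → E d → ℝ) (f : E d → ℝ) (x z : E d) : ℝ :=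
  if SymmKernel κ then
    (f (x + z) + f (x - z) - 2 * f x) / (2 * (‖z‖ ^ d * φ ‖z‖))
  else
    (f (x + z) - f x - fderiv ℝ f x (zphi φ z)) / (‖z‖ ^ d * φ ‖z‖)

/-- The operator `ℒ^{κ_w}_t f(x) = ∫ Δ^{(φ)}_f(x, z) κ(t, w, z) dz` with coefficients frozen
at `w`. -/
def Lfrozen (φ : ℝ → ℝ) (κ : ℝ → E d → E d → ℝ) (t : ℝ) (w : E d) (f : E d → ℝ) (x : E d) : ℝ :=
  ∫ z, Delta φ κ f x z * κ t w z

/-- The characteristic exponent of the time-inhomogeneous Lévy process with coefficients frozen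
at `y`:
`∫_t^s ∫ (e^{i ξ·z} - 1 - i ξ·z^{(φ)}) κ(r, y, z) / (|z|^d φ(|z|)) dz dr`. -/
def charExponent (φ : ℝ → ℝ) (κ : ℝ → E d → E d → ℝ) (y : E d) (t s : ℝ) (ξ : E d) : ℂ :=
  ∫ r in t..s, ∫ z : E d,
    (Complex.exp (Complex.I * ((inner ℝ ξ z : ℝ) : ℂ)) - 1
        - Complex.I * ((inner ℝ ξ (zphi φ z) : ℝ) : ℂ))
      * ((κ r y z / (‖z‖ ^ d * φ ‖z‖) : ℝ) : ℂ)

/-- The density `p^{κ_y}_{t,s}` of the increment over `(t, s]` of that process, by Fourier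
inversion. -/
def density (φ : ℝ → ℝ) (κ : ℝ → E d → E d → ℝ) (y : E d) (t s : ℝ) (x : E d) : ℝ :=
  ((2 * Real.pi) ^ d)⁻¹ *
    (∫ ξ : E d, Complex.exp (-Complex.I * ((inner ℝ x ξ : ℝ) : ℂ))
      * Complex.exp (charExponent φ κ y t s ξ)).re

/-- The frozen heat kernel `p^{(y)}_{t,s}(x) = p^{κ_y}_{t,s}(-x)`. -/
def frozenKernel (φ : ℝ → ℝ) (κ : ℝ → E d → E d → ℝ) (y : E d) (t s : ℝ) (x : E d) : ℝ :=
  density φ κ y t s (-x)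

/-! ### The Levi series -/

/-- `q^{(0)}_{t,s}(x, y) = (ℒ^{κ_x}_t - ℒ^{κ_y}_t) p^{(y)}_{t,s}(·) (x - y)`. -/
def q0 (φ : ℝ → ℝ) (κ : ℝ → E d → E d → ℝ) (t s : ℝ) (x y : E d) : ℝ :=
  Lfrozen φ κ t x (frozenKernel φ κ y t s) (x - y)
    - Lfrozen φ κ t y (frozenKernel φ κ y t s) (x - y)

/-- `q^{(n)}_{t,s}(x, y) = ∫_t^s ∫ q^{(0)}_{t,r}(x, z) q^{(n-1)}_{r,s}(z, y) dz dr`. -/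
def qn (φ : ℝ → ℝ) (κ : ℝ → E d → E d → ℝ) : ℕ → ℝ → ℝ → E d → E d → ℝ
  | 0 => q0 φ κ
  | n + 1 => fun t s x y =>
      ∫ r in t..s, ∫ z : E d, q0 φ κ t r x z * qn φ κ n r s z y

/-- `q_{t,s}(x, y) = ∑_{n ≥ 0} q^{(n)}_{t,s}(x, y)`. -/
def qsum (φ : ℝ → ℝ) (κ : ℝ → E d → E d → ℝ) (t s : ℝ) (x y : E d) : ℝ :=
  ∑' n : ℕ, qn φ κ n t s x y

/-- `𝔻^T_ε = {(t, x; s, y) : s, t ≥ 0, ε < s - t < T}`. -/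
def domD (d : ℕ) (ε T : ℝ) : Set (ℝ × E d × ℝ × E d) :=
  {p | 0 ≤ p.1 ∧ 0 ≤ p.2.2.1 ∧ ε < p.2.2.1 - p.1 ∧ p.2.2.1 - p.1 < T}

/-- `𝕂^ε_t = (t, t + ε) × ℝ^d × ℝ^d`, with points `(s, x, y)`. -/
def domK (d : ℕ) (ε t : ℝ) : Set (ℝ × E d × E d) := Ioo t (t + ε) ×ˢ univ

/-! ### The parameters and the hypotheses -/

/-- The list of parameters `Θ = (d, κ₀, c₀^φ, c₁^φ, c₂^φ, β₁, β₂, 𝒜^{(0)}_φ, 𝒜^{(1)}_φ)`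
on which constants may depend. -/
structure Theta where
  d : ℕ
  κ₀ : ℝ
  c₀ : ℝ≥0∞
  c₁ : ℝ
  c₂ : ℝ
  β₁ : ℝ
  β₂ : ℝ
  A₀ : ℝ≥0∞
  A₁ : ℝ≥0∞

/-- The parameters `c₀^φ, 𝒜^{(0)}_φ, 𝒜^{(1)}_φ` in `Θ` are those of `φ`. (`𝒜^{(1)}_φ = ∞` is
possible for symmetric kernels.) -/
structure Theta.Fits (Θ : Theta) (φ : ℝ → ℝ) : Prop where
  c₀_eq : Θ.c₀ = c0 φ
  A₀_eq : Θ.A₀ = A0 φ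
  A₁_eq : Θ.A₁ = A1 φ

/-- (H1): the symmetric case. -/
structure H1 (Θ : Theta) (φ ℓ : ℝ → ℝ) (κ : ℝ → E Θ.d → E Θ.d → ℝ) : Prop where
  symm : SymmKernel κ
  scaling : WeakScaling φ Θ.c₁ Θ.c₂ Θ.β₁ Θ.β₂
  A0_lt_top : A0 φ < ∞
  bounds : KernelBounds κ Θ.κ₀ ℓ

/-- (H2'): the non-symmetric case. -/
structure H2' (Θ : Theta) (φ ℓ : ℝ → ℝ) (κ : ℝ → E Θ.d → E Θ.d → ℝ) : Prop where
  not_symm : ¬ SymmKernel κ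
  scaling : WeakScaling φ Θ.c₁ Θ.c₂ Θ.β₁ Θ.β₂
  A1_lt_top : A1 φ < ∞
  bounds : KernelBounds κ Θ.κ₀ ℓ
  centered : KernelCentered φ κ

end LevyLevi

end

/-!
The parametrix method. Write `V(r) = r^d φ(r)` and `a(τ) = φ⁻¹(τ)`, so that `h^g_φ(τ, x)` is
comparable with `g / V` evaluated at `a(τ) + |x|` (`kerF`). The proof has three parts.

*The frozen heat kernel.* After rescaling space by `a = a(s - t)`, the frozen density is the law of
a Lévy process at time one. Its jumps are split at size one. The characteristic function of the
small jumps is smooth and, by the lower bound `exists_symbol_lower` for the symbol, decays like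
`exp(-c |ξ|^β)`, so their density and its derivatives decay faster than any power
(`exists_decay_small_jumps`). The large jumps form a compound Poisson law, and convolution with it
preserves the weight `1 / V` up to a constant (`exists_density_bound`). This gives
`|∇^k p(x)| ≤ C a^{-k} (s - t) / V(a + |x|)` for `k ≤ 3` (`exists_frozenKernel_bound`). The drift
left over by the truncation at level `a` is bounded by symmetry, by the centering of the kernel, or
by the moment `𝒜^{(1)}_φ`, according to the case.

*The parametrix error.* The same splitting of jumps at the level `a` bounds the difference operator
applied to the frozen kernel (`exists_lintegral_levelDiff_le`). As `q^{(0)}` integrates it against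
`κ(t, x, z) - κ(t, y, z)`, which is at most `ℓ²(|x - y|)`, it is dominated by `ℓ² / V`, and its
oscillation in `x` is controlled with the help of the third derivative (`exists_q0_kerF_bound`).
Joint measurability and continuity come from the Fourier representation.

*The Levi series.* Since `ℓ²` varies more slowly than any power, the spatial convolution of
`ℓ² / V` at times `u` and `v` is at most a multiple of `ℓ² / V` at time `u + v`, times
`ℓ²(a(u)) / u + ℓ²(a(v)) / v` (`exists_lintegral_kerF_mul_le`). The Dini condition makes this
integrable in time, so that over short time intervals the space-time convolution of `ℓ² / V` with
itself is a small multiple of `ℓ² / V` (`exists_small_time`). Hence the terms of the series decay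
geometrically. The number `ε₀` depends on `ℓ`, but the constants in front do not: `ℓ` enters only
through the smallness of the convolution. The oscillation of `q` in `x` follows from the Volterra
equation, with the weight `1 / ℓ_φ(r - t)` in the time integral: spending one of the two factors
`ℓ` of `ℓ²` on this weight leaves the other one for the Dini condition.
-/

noncomputable section

namespace LevyLevi

set_option linter.unusedSectionVars false

section

open scoped FourierTransform ContDiff

/-! ### The characteristic exponent of small jumps -/

section SmallJumps

variable {H : Type*} [NormedAddCommGroup H] [InnerProductSpace ℝ H]

/-- The linear form `η ↦ ⟨η, z⟩`, with complex values. -/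
def innerForm (z : H) : H →L[ℝ] ℂ := Complex.ofRealCLM ∘L innerSL ℝ z

lemma innerForm_apply (z η : H) : innerForm z η = ((inner ℝ η z : ℝ) : ℂ) := by
  simp [innerForm, real_inner_comm]

lemma norm_innerForm_le (z : H) : ‖innerForm z‖ ≤ ‖z‖ := by
  refine ContinuousLinearMap.opNorm_le_bound _ (norm_nonneg _) fun η => ?_
  rw [innerForm_apply, Complex.norm_real, mul_comm]
  exact norm_inner_le_norm η z

lemma continuous_innerForm : Continuous (innerForm : H → H →L[ℝ] ℂ) := by
  unfold innerForm
  fun_prop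

lemma norm_exp_I_mul (x : ℝ) : ‖Complex.exp (Complex.I * (x : ℂ))‖ = 1 := by
  rw [mul_comm]; exact Complex.norm_exp_ofReal_mul_I x

lemma norm_exp_I_sub_one_le (x : ℝ) : ‖Complex.exp (Complex.I * (x : ℂ)) - 1‖ ≤ |x| := by
  simpa using Real.norm_exp_I_mul_ofReal_sub_one_le (x := x)

lemma norm_exp_I_sub_one_sub_le (x : ℝ) :
    ‖Complex.exp (Complex.I * (x : ℂ)) - 1 - Complex.I * x‖ ≤ 2 * x ^ 2 := by
  rcases le_or_gt |x| 1 with h | h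
  · have := Complex.norm_exp_sub_one_sub_id_le (x := Complex.I * (x : ℂ)) (by simpa using h)
    simp only [norm_mul, Complex.norm_I, Complex.norm_real, one_mul, Real.norm_eq_abs,
      sq_abs] at this
    nlinarith [sq_nonneg x]
  · have h1 := norm_exp_I_sub_one_le x
    have h2 := norm_sub_le (Complex.exp (Complex.I * (x : ℂ)) - 1) (Complex.I * x)
    simp only [norm_mul, Complex.norm_I, Complex.norm_real, one_mul, Real.norm_eq_abs] at h2
    have : |x| ≤ x ^ 2 := by rw [← sq_abs]; nlinarith
    linarith

lemma abs_inner_le (η z : H) : |inner ℝ η z| ≤ ‖η‖ * ‖z‖ := abs_real_inner_le_norm η z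

/-- The bilinear form `(v, w) ↦ -⟨v,z⟩⟨w,z⟩`, the coefficient of `e^{i⟨η,z⟩}` in the Hessian of
the characteristic exponent. -/
def innerFormSq (z : H) : H →L[ℝ] H →L[ℝ] ℂ := (innerSL ℝ z).smulRight (-innerForm z)

lemma innerFormSq_apply (z v w : H) :
    innerFormSq z v w = -(((inner ℝ v z : ℝ) : ℂ) * ((inner ℝ w z : ℝ) : ℂ)) := by
  simp [innerFormSq, innerForm_apply, real_inner_comm]

lemma norm_innerForm (z : H) : ‖innerForm z‖ = ‖z‖ := by
  refine le_antisymm (norm_innerForm_le z) ?_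
  have h := (innerForm z).le_opNorm z
  rw [innerForm_apply, Complex.norm_real, real_inner_self_eq_norm_sq, Real.norm_eq_abs,
    abs_of_nonneg (by positivity), pow_two] at h
  rcases eq_or_ne z 0 with rfl | hz
  · simp
  · exact le_of_mul_le_mul_right h (norm_pos_iff.2 hz)

lemma norm_innerFormSq (z : H) : ‖innerFormSq z‖ = ‖z‖ ^ 2 := by
  unfold innerFormSq
  rw [ContinuousLinearMap.norm_smulRight_apply, norm_neg, pow_two, norm_innerForm,
    innerSL_apply_norm]

lemma continuous_innerFormSq : Continuous (innerFormSq : H → H →L[ℝ] H →L[ℝ] ℂ) := by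
  have h := continuous_innerForm (H := H)
  have : (innerFormSq : H → H →L[ℝ] H →L[ℝ] ℂ) = fun z =>
      ContinuousLinearMap.smulRightL ℝ H (H →L[ℝ] ℂ) (innerSL ℝ z) (-innerForm z) := by
    ext z; rfl
  rw [this]
  exact ((ContinuousLinearMap.smulRightL ℝ H (H →L[ℝ] ℂ)).continuous.comp
    (innerSL ℝ).continuous).clm_apply h.neg

/-- The bilinear map `L` for which `e(-L(z, η)) = e^{i⟨η,z⟩}`, `e(x) = e^{2πix}`. -/
def fourierForm (H : Type*) [NormedAddCommGroup H] [InnerProductSpace ℝ H] : H →L[ℝ] H →L[ℝ] ℝ :=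
  (-(2 * Real.pi)⁻¹) • innerSL ℝ

lemma fourierForm_apply (z η : H) : fourierForm H z η = -(2 * Real.pi)⁻¹ * inner ℝ η z := by
  rw [real_inner_comm]; rfl

lemma norm_fourierForm_le : 2 * Real.pi * ‖fourierForm H‖ ≤ 1 := by
  have : ‖fourierForm H‖ ≤ (2 * Real.pi)⁻¹ := by
    refine ContinuousLinearMap.opNorm_le_bound _ (by positivity) fun z =>
      ContinuousLinearMap.opNorm_le_bound _ (by positivity) fun η => ?_
    rw [fourierForm_apply, norm_mul, norm_neg, Real.norm_of_nonneg (by positivity), mul_assoc,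
      mul_comm ‖z‖]
    gcongr
    exact norm_inner_le_norm _ _
  calc 2 * Real.pi * ‖fourierForm H‖ ≤ 2 * Real.pi * (2 * Real.pi)⁻¹ := by gcongr
    _ = 1 := mul_inv_cancel₀ (by positivity)

lemma fourierChar_fourierForm {F : Type*} [NormedAddCommGroup F] [NormedSpace ℂ F] (z η : H)
    (f : F) : 𝐞 (-(fourierForm H z η)) • f
      = Complex.exp (Complex.I * ((inner ℝ η z : ℝ) : ℂ)) • f := by
  rw [Circle.smul_def, Real.fourierChar_apply, fourierForm_apply]
  congr 2
  push_cast
  have : (Real.pi : ℂ) ≠ 0 := by exact_mod_cast Real.pi_ne_zero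
  field_simp

variable [MeasurableSpace H]

/-- The characteristic exponent `∫ (e^{i⟨η,z⟩} - 1 - i⟨η,z⟩) ν(dz)` of a fully compensated
Lévy process with Lévy measure `ν`. -/
def smallExponent (ν : Measure H) (η : H) : ℂ :=
  ∫ z, (Complex.exp (Complex.I * ((inner ℝ η z : ℝ) : ℂ)) - 1
    - Complex.I * ((inner ℝ η z : ℝ) : ℂ)) ∂ν

variable [FiniteDimensional ℝ H] [BorelSpace H]

lemma integrable_smallExponent {ν : Measure H} (hν : Integrable (fun z => ‖z‖ ^ 2) ν) (η : H) :
    Integrable (fun z => Complex.exp (Complex.I * ((inner ℝ η z : ℝ) : ℂ)) - 1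
      - Complex.I * ((inner ℝ η z : ℝ) : ℂ)) ν := by
  refine (hν.const_mul (2 * ‖η‖ ^ 2)).mono' (by fun_prop) (ae_of_all _ fun z => ?_)
  refine (norm_exp_I_sub_one_sub_le _).trans ?_
  have := abs_inner_le η z
  rw [← sq_abs, mul_assoc, ← mul_pow]
  gcongr

lemma hasFDerivAt_inner_ofReal (z η : H) :
    HasFDerivAt (fun η : H => ((inner ℝ η z : ℝ) : ℂ)) (innerForm z) η := by
  have := (innerForm z).hasFDerivAt (x := η)
  simpa only [innerForm_apply] using! this.congr_of_eventuallyEq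
    (Eventually.of_forall fun η => (innerForm_apply z η).symm)

lemma hasFDerivAt_exp_inner (z η : H) :
    HasFDerivAt (fun η : H => Complex.exp (Complex.I * ((inner ℝ η z : ℝ) : ℂ)))
      ((Complex.exp (Complex.I * ((inner ℝ η z : ℝ) : ℂ)) * Complex.I) • innerForm z) η := by
  have := ((hasFDerivAt_inner_ofReal z η).const_mul Complex.I).cexp
  simpa [smul_smul] using this

/-- The gradient of `smallExponent`. -/
def smallExponentDeriv (ν : Measure H) (η : H) : H →L[ℝ] ℂ :=
  ∫ z, (Complex.I * (Complex.exp (Complex.I * ((inner ℝ η z : ℝ) : ℂ)) - 1)) • innerForm z ∂ν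

lemma norm_smallExponentDeriv_integrand_le (z η : H) :
    ‖(Complex.I * (Complex.exp (Complex.I * ((inner ℝ η z : ℝ) : ℂ)) - 1)) • innerForm z‖
      ≤ ‖η‖ * ‖z‖ ^ 2 := by
  rw [norm_smul, norm_mul, Complex.norm_I, one_mul, pow_two, ← mul_assoc]
  gcongr
  · exact (norm_exp_I_sub_one_le _).trans (abs_inner_le η z)
  · exact norm_innerForm_le z

lemma aestronglyMeasurable_smallExponentDeriv (ν : Measure H) (η : H) : AEStronglyMeasurable
    (fun z => (Complex.I * (Complex.exp (Complex.I * ((inner ℝ η z : ℝ) : ℂ)) - 1)) •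
      innerForm z) ν := by
  have : Continuous (innerForm : H → H →L[ℝ] ℂ) := continuous_innerForm
  exact Continuous.aestronglyMeasurable (by fun_prop)

lemma hasFDerivAt_smallExponent {ν : Measure H} (hν : Integrable (fun z => ‖z‖ ^ 2) ν) (η : H) :
    HasFDerivAt (smallExponent ν) (smallExponentDeriv ν η) η := by
  refine hasFDerivAt_integral_of_dominated_of_fderiv_le (Metric.ball_mem_nhds η one_pos)
    (F' := fun η z => (Complex.I * (Complex.exp (Complex.I * ((inner ℝ η z : ℝ) : ℂ)) - 1)) •
      innerForm z)
    (bound := fun z => (‖η‖ + 1) * ‖z‖ ^ 2) ?_ (integrable_smallExponent hν η)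
    (aestronglyMeasurable_smallExponentDeriv ν η) ?_ (hν.const_mul _) ?_
  · exact Eventually.of_forall fun η => (integrable_smallExponent hν η).aestronglyMeasurable
  · refine ae_of_all _ fun z ξ hξ => (norm_smallExponentDeriv_integrand_le z ξ).trans ?_
    gcongr
    have := norm_sub_norm_le ξ η
    rw [Metric.mem_ball, dist_eq_norm] at hξ
    linarith
  · refine ae_of_all _ fun z ξ _ => ?_
    convert ((hasFDerivAt_exp_inner z ξ).sub_const 1).sub
      ((hasFDerivAt_inner_ofReal z ξ).const_mul Complex.I) using 1
    · rfl
    · rw [← sub_smul]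
      congr 1
      ring

/-- The second derivative of the exponent is a Fourier transform of the vector measure `z ⊗ z dν`,
to which Mathlib's theory of derivatives of Fourier integrals applies. -/
lemma hasFDerivAt_smallExponentDeriv {ν : Measure H} (hν : Integrable (fun z => ‖z‖ ^ 2) ν)
    (η : H) : HasFDerivAt (smallExponentDeriv ν)
      (VectorFourier.fourierIntegral 𝐞 ν (fourierForm H).toLinearMap₁₂ innerFormSq η) η := by
  have key : VectorFourier.fourierIntegral 𝐞 ν (fourierForm H).toLinearMap₁₂ innerFormSq η =
      ∫ z, Complex.exp (Complex.I * ((inner ℝ η z : ℝ) : ℂ)) • innerFormSq z ∂ν := by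
    unfold VectorFourier.fourierIntegral
    exact integral_congr_ae (ae_of_all _ fun z => fourierChar_fourierForm z η _)
  rw [key]
  have hc : Continuous (innerFormSq : H → H →L[ℝ] H →L[ℝ] ℂ) := continuous_innerFormSq
  refine hasFDerivAt_integral_of_dominated_of_fderiv_le (Metric.ball_mem_nhds η one_pos)
    (F' := fun η z => Complex.exp (Complex.I * ((inner ℝ η z : ℝ) : ℂ)) • innerFormSq z)
    (bound := fun z => ‖z‖ ^ 2) ?_ ?_ ?_ ?_ hν ?_
  · exact Eventually.of_forall fun η => aestronglyMeasurable_smallExponentDeriv ν η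
  · exact (hν.const_mul ‖η‖).mono' (aestronglyMeasurable_smallExponentDeriv ν η)
      (ae_of_all _ fun z => norm_smallExponentDeriv_integrand_le z η)
  · exact Continuous.aestronglyMeasurable (by fun_prop)
  · refine ae_of_all _ fun z ξ hξ => ?_
    rw [norm_smul, norm_exp_I_mul, one_mul]
    exact (norm_innerFormSq z).le
  · refine ae_of_all _ fun z ξ _ => ?_
    convert (((hasFDerivAt_exp_inner z ξ).sub_const 1).const_mul Complex.I).smul_const
      (innerForm z) using 1
    ext v w
    simp only [smul_apply, ContinuousLinearMap.smulRight_apply,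
      innerFormSq_apply, innerForm_apply, smul_eq_mul]
    linear_combination (-Complex.exp (Complex.I * ↑(inner ℝ ξ z)) * ((inner ℝ v z : ℝ) : ℂ) *
      ((inner ℝ w z : ℝ) : ℂ)) * Complex.I_mul_I

end SmallJumps

end

section

open scoped FourierTransform ContDiff

/-! ### Densities of laws with small jumps -/

section SmallJumpsDecay

variable {H : Type*} [NormedAddCommGroup H] [InnerProductSpace ℝ H]
  [MeasurableSpace H] [FiniteDimensional ℝ H] [BorelSpace H]

lemma integrable_pow_mul_innerFormSq {ν : Measure H} (h1 : ∀ᵐ z ∂ν, ‖z‖ ≤ 1)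
    (hν : Integrable (fun z => ‖z‖ ^ 2) ν) (n : ℕ) :
    Integrable (fun z => ‖z‖ ^ n * ‖innerFormSq z‖) ν := by
  simp only [norm_innerFormSq]
  refine hν.mono' (by fun_prop) ?_
  filter_upwards [h1] with z hz
  rw [Real.norm_of_nonneg (by positivity)]
  exact mul_le_of_le_one_left (by positivity) (pow_le_one₀ (norm_nonneg _) hz)

lemma aestronglyMeasurable_innerFormSq (ν : Measure H) :
    AEStronglyMeasurable (innerFormSq : H → H →L[ℝ] H →L[ℝ] ℂ) ν :=
  continuous_innerFormSq.aestronglyMeasurable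

lemma fderiv_smallExponent {ν : Measure H} (hν : Integrable (fun z => ‖z‖ ^ 2) ν) :
    fderiv ℝ (smallExponent ν) = smallExponentDeriv ν :=
  funext fun η => (hasFDerivAt_smallExponent hν η).fderiv

lemma fderiv_smallExponentDeriv {ν : Measure H} (hν : Integrable (fun z => ‖z‖ ^ 2) ν) :
    fderiv ℝ (smallExponentDeriv ν) =
      VectorFourier.fourierIntegral 𝐞 ν (fourierForm H).toLinearMap₁₂ innerFormSq :=
  funext fun η => (hasFDerivAt_smallExponentDeriv hν η).fderiv

lemma contDiff_smallExponent {ν : Measure H} (h1 : ∀ᵐ z ∂ν, ‖z‖ ≤ 1)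
    (hν : Integrable (fun z => ‖z‖ ^ 2) ν) : ContDiff ℝ ∞ (smallExponent ν) := by
  rw [contDiff_infty_iff_fderiv, fderiv_smallExponent hν, contDiff_infty_iff_fderiv,
    fderiv_smallExponentDeriv hν]
  refine ⟨fun η => (hasFDerivAt_smallExponent hν η).differentiableAt,
    fun η => (hasFDerivAt_smallExponentDeriv hν η).differentiableAt, ?_⟩
  exact VectorFourier.contDiff_fourierIntegral _
    fun n _ => integrable_pow_mul_innerFormSq h1 hν n

/-- The exponent grows at most linearly in its first derivative, and its higher derivatives are
bounded; the form of the bound is the one that Faà di Bruno's formula asks for. -/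
lemma norm_iteratedFDeriv_smallExponent_le {ν : Measure H} (h1 : ∀ᵐ z ∂ν, ‖z‖ ≤ 1)
    (hν : Integrable (fun z => ‖z‖ ^ 2) ν) {M : ℝ} (hM1 : 1 ≤ M)
    (hM : ∫ z, ‖z‖ ^ 2 ∂ν ≤ M) {i : ℕ} (hi : 1 ≤ i) (η : H) :
    ‖iteratedFDeriv ℝ i (smallExponent ν) η‖ ≤ (M * (1 + ‖η‖)) ^ i := by
  have hle : ∀ j : ℕ, 1 ≤ j → M ≤ (M * (1 + ‖η‖)) ^ j := fun j hj => by
    have h2 : 1 ≤ 1 + ‖η‖ := by linarith [norm_nonneg η]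
    have h3 : M ≤ M * (1 + ‖η‖) := by nlinarith
    exact h3.trans (le_self_pow₀ (by linarith) (by omega))
  obtain ⟨j, rfl⟩ := Nat.exists_eq_add_of_le' hi
  rw [← norm_iteratedFDeriv_fderiv, fderiv_smallExponent hν]
  rcases Nat.eq_zero_or_pos j with rfl | hj
  · rw [norm_iteratedFDeriv_zero, zero_add, pow_one]
    calc ‖smallExponentDeriv ν η‖ ≤ ∫ z, ‖η‖ * ‖z‖ ^ 2 ∂ν :=
          norm_integral_le_of_norm_le (hν.const_mul _)
            (ae_of_all _ fun z => norm_smallExponentDeriv_integrand_le z η)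
      _ = ‖η‖ * ∫ z, ‖z‖ ^ 2 ∂ν := integral_const_mul _ _
      _ ≤ ‖η‖ * M := by gcongr
      _ ≤ M * (1 + ‖η‖) := by nlinarith [norm_nonneg η]
  · obtain ⟨k, rfl⟩ := Nat.exists_eq_add_of_le' hj
    have hmeas : AEStronglyMeasurable (innerFormSq : H → H →L[ℝ] H →L[ℝ] ℂ) ν :=
      aestronglyMeasurable_innerFormSq ν
    rw [← norm_iteratedFDeriv_fderiv, fderiv_smallExponentDeriv hν,
      VectorFourier.iteratedFDeriv_fourierIntegral (N := ⊤) _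
        (fun n _ => integrable_pow_mul_innerFormSq h1 hν n)
        hmeas (n := k) (by exact_mod_cast le_top)]
    refine le_trans ?_ (hle _ (by omega))
    refine (VectorFourier.norm_fourierIntegral_le_integral_norm _ _ _ _ _).trans
      (le_trans ?_ hM)
    refine integral_mono_of_nonneg (ae_of_all _ fun z => norm_nonneg _) hν ?_
    filter_upwards [h1] with z hz
    refine (VectorFourier.norm_fourierPowSMulRight_le _ _ _ _).trans ?_
    have h3 : (2 * Real.pi * ‖fourierForm H‖) ^ k ≤ 1 :=
      pow_le_one₀ (by positivity) norm_fourierForm_le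
    calc (2 * Real.pi * ‖fourierForm H‖) ^ k * ‖z‖ ^ k * ‖innerFormSq z‖
        ≤ 1 * 1 * ‖z‖ ^ 2 := by
          gcongr
          · exact pow_le_one₀ (norm_nonneg _) hz
          · exact (norm_innerFormSq z).le
      _ = _ := by ring

lemma norm_iteratedFDeriv_cexp (i : ℕ) (w : ℂ) :
    ‖iteratedFDeriv ℝ i Complex.exp w‖ = ‖Complex.exp w‖ := by
  rw [← ContDiffAt.restrictScalars_iteratedFDeriv (𝕜' := ℂ)
    (Complex.contDiff_exp.contDiffAt (n := i)), Function.comp_apply,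
    ContinuousMultilinearMap.norm_restrictScalars, norm_iteratedFDeriv_eq_norm_iteratedDeriv,
    iteratedDeriv_eq_iterate, Complex.iter_deriv_exp]

/-- Derivatives of the characteristic function cost powers of `1 + ‖η‖` only, which its decay
absorbs. -/
lemma norm_iteratedFDeriv_exp_smallExponent_le {ν : Measure H} (h1 : ∀ᵐ z ∂ν, ‖z‖ ≤ 1)
    (hν : Integrable (fun z => ‖z‖ ^ 2) ν) {M : ℝ} (hM1 : 1 ≤ M)
    (hM : ∫ z, ‖z‖ ^ 2 ∂ν ≤ M) (n : ℕ) (η : H) :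
    ‖iteratedFDeriv ℝ n (fun η => Complex.exp (smallExponent ν η)) η‖
      ≤ n.factorial * ‖Complex.exp (smallExponent ν η)‖ * (M * (1 + ‖η‖)) ^ n :=
  norm_iteratedFDeriv_comp_le (g := Complex.exp) (N := ∞)
    (Complex.contDiff_exp.of_le le_top) (contDiff_smallExponent h1 hν)
    (by exact_mod_cast le_top) η
    (fun i _ => (norm_iteratedFDeriv_cexp i _).le)
    (fun i hi _ => norm_iteratedFDeriv_smallExponent_le h1 hν hM1 hM hi η)

lemma re_smallExponent {ν : Measure H} (hν : Integrable (fun z => ‖z‖ ^ 2) ν) (η : H) :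
    (smallExponent ν η).re = - ∫ z, (1 - Real.cos (inner ℝ η z)) ∂ν := by
  have := integral_re (integrable_smallExponent hν η)
  simp only [RCLike.re_to_complex] at this
  rw [smallExponent, ← this, ← integral_neg]
  refine integral_congr_ae (ae_of_all _ fun z => ?_)
  simp [Complex.exp_re]

/-- Stretched exponentials decay faster than any power. -/
lemma exists_exp_neg_rpow_le {c β : ℝ} (hc : 0 < c) (hβ : 0 < β) (p : ℕ) :
    ∃ C : ℝ, 0 < C ∧ ∀ r : ℝ, 1 ≤ r → Real.exp (-(c * r ^ β)) * (1 + r) ^ p ≤ C := by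
  obtain ⟨n, hn⟩ := exists_nat_ge (p / β)
  refine ⟨n.factorial * (c ^ n)⁻¹ * 2 ^ p, by positivity, fun r hr => ?_⟩
  have hr0 : 0 < r := by linarith
  have h1 := Real.pow_div_factorial_le_exp (c * r ^ β) (by positivity) n
  have h2 : r ^ p ≤ (r ^ β) ^ n := by
    rw [← Real.rpow_natCast r p, ← Real.rpow_natCast (r ^ β) n, ← Real.rpow_mul hr0.le]
    exact Real.rpow_le_rpow_of_exponent_le hr (by rwa [div_le_iff₀' hβ] at hn)
  have h3 : (1 + r) ^ p ≤ 2 ^ p * r ^ p := by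
    rw [← mul_pow]; gcongr; linarith
  rw [Real.exp_neg, ← div_eq_inv_mul, div_le_iff₀ (Real.exp_pos _)]
  calc (1 + r) ^ p ≤ 2 ^ p * (r ^ β) ^ n := h3.trans (by gcongr)
    _ = n.factorial * (c ^ n)⁻¹ * 2 ^ p * ((c * r ^ β) ^ n / n.factorial) := by
        rw [mul_pow]; field_simp
    _ ≤ _ := by gcongr

/-- The real part of the exponent gives a decay of `e^Ψ` faster than any power. -/
lemma exists_norm_exp_smallExponent_le {c β : ℝ} (hc : 0 < c) (hβ : 0 < β) (p : ℕ) :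
    ∃ C : ℝ, 0 < C ∧ ∀ ν : Measure H, Integrable (fun z => ‖z‖ ^ 2) ν →
      (∀ η : H, 1 ≤ ‖η‖ → c * ‖η‖ ^ β ≤ ∫ z, (1 - Real.cos (inner ℝ η z)) ∂ν) →
      ∀ η : H, ‖Complex.exp (smallExponent ν η)‖ * (1 + ‖η‖) ^ p ≤ C := by
  obtain ⟨C, hC, h⟩ := exists_exp_neg_rpow_le hc hβ p
  refine ⟨C + 2 ^ p, by positivity, fun ν hν hl η => ?_⟩
  rw [Complex.norm_exp, re_smallExponent hν]
  rcases le_or_gt 1 ‖η‖ with h1 | h1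
  · calc _ ≤ Real.exp (-(c * ‖η‖ ^ β)) * (1 + ‖η‖) ^ p := by
          gcongr; exact hl η h1
      _ ≤ C := h _ h1
      _ ≤ _ := by linarith [show (0 : ℝ) < 2 ^ p by positivity]
  · have h0 : 0 ≤ ∫ z, (1 - Real.cos (inner ℝ η z)) ∂ν :=
      integral_nonneg fun z => by simpa using Real.cos_le_one _
    calc _ ≤ 1 * (2 : ℝ) ^ p := by
          gcongr
          · exact Real.exp_le_one_iff.2 (by linarith)
          · linarith
      _ ≤ _ := by linarith

/-- The inverse Fourier transform `∫ e^{i⟨x,η⟩} m(η) dη`, without normalising factor. -/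
def invFourier (m : H → ℂ) (x : H) : ℂ :=
  ∫ η : H, Complex.exp (Complex.I * ((inner ℝ x η : ℝ) : ℂ)) * m η

lemma invFourier_eq (m : H → ℂ) : invFourier m =
    VectorFourier.fourierIntegral 𝐞 volume (fourierForm H).toLinearMap₁₂ m := by
  ext x
  unfold VectorFourier.fourierIntegral invFourier
  refine integral_congr_ae (ae_of_all _ fun η => ?_)
  simpa using (fourierChar_fourierForm η x (m η)).symm

lemma one_add_pow_le {a : ℝ} (ha : 0 ≤ a) (N : ℕ) : (1 + a) ^ N ≤ 2 ^ N * (1 + a ^ N) := by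
  have h : 1 + a ≤ 2 * max 1 a := by
    linarith [le_max_left 1 a, le_max_right 1 a]
  calc (1 + a) ^ N ≤ (2 * max 1 a) ^ N := by gcongr
    _ = 2 ^ N * (max 1 a) ^ N := mul_pow _ _ _
    _ ≤ _ := by
      gcongr
      rcases max_choice 1 a with h | h <;> rw [h]
      · simp; positivity
      · linarith

/-- For a Lévy measure on the unit ball whose exponent has power growth, the density and its
derivatives decay faster than any power, with constants depending only on the second moment and on
the growth. -/
theorem exists_decay_small_jumps {M c β : ℝ} (hM1 : 1 ≤ M) (hc : 0 < c) (hβ : 0 < β) (N : ℕ) :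
    ∃ C : ℝ, 0 < C ∧ ∀ ν : Measure H, (∀ᵐ z ∂ν, ‖z‖ ≤ 1) → Integrable (fun z => ‖z‖ ^ 2) ν →
      ∫ z, ‖z‖ ^ 2 ∂ν ≤ M →
      (∀ η : H, 1 ≤ ‖η‖ → c * ‖η‖ ^ β ≤ ∫ z, (1 - Real.cos (inner ℝ η z)) ∂ν) →
      Integrable (fun η => Complex.exp (smallExponent ν η)) ∧
      ContDiff ℝ ∞ (invFourier fun η => Complex.exp (smallExponent ν η)) ∧
      ∀ k ≤ 3, ∀ x : H,
        ‖iteratedFDeriv ℝ k (invFourier fun η => Complex.exp (smallExponent ν η)) x‖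
          * (1 + ‖x‖) ^ N ≤ C := by
  set D : ℕ := Module.finrank ℝ H + 1
  have hDint : Integrable (fun x : H => (1 + ‖x‖) ^ (-(D : ℝ))) :=
    integrable_one_add_norm (by simp [D])
  set J : ℝ := ∫ x : H, (1 + ‖x‖) ^ (-(D : ℝ))
  have hJ : 0 ≤ J := integral_nonneg fun x => by positivity
  choose C hC hCb using fun p : ℕ => exists_norm_exp_smallExponent_le (H := H) hc hβ p
  -- bound for `∫ ‖η‖ ^ k ‖D ^ n m(η)‖ dη`
  let B : ℕ → ℕ → ℝ := fun k n => n.factorial * M ^ n * C (k + n + D) * J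
  have hB : ∀ k n, 0 ≤ B k n := fun k n => by have := hC (k + n + D); positivity
  let S : ℕ → ℕ → ℝ := fun k n => (2 * k + 2) ^ n *
      ∑ p ∈ Finset.range (k + 1) ×ˢ Finset.range (n + 1), B p.1 p.2
  have hS : ∀ k n, 0 ≤ S k n := fun k n => mul_nonneg (by positivity)
    (Finset.sum_nonneg fun p _ => hB _ _)
  refine ⟨1 + ∑ k ∈ Finset.range 4, 2 ^ N * (2 * S k 0 + (2 * Real.pi) ^ N * S k N), ?_, ?_⟩
  · have : 0 ≤ ∑ k ∈ Finset.range 4, 2 ^ N * (2 * S k 0 + (2 * Real.pi) ^ N * S k N) :=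
      Finset.sum_nonneg fun k _ => by have := hS k 0; have := hS k N; positivity
    linarith
  intro ν h1 hν hM hl
  set m : H → ℂ := fun η => Complex.exp (smallExponent ν η) with hm
  have hmd : ContDiff ℝ ∞ m := (Complex.contDiff_exp.of_le le_top).comp
    (contDiff_smallExponent h1 hν)
  have hpt : ∀ k n (η : H), ‖η‖ ^ k * ‖iteratedFDeriv ℝ n m η‖ ≤
      (n.factorial * M ^ n * C (k + n + D)) * (1 + ‖η‖) ^ (-(D : ℝ)) := fun k n η => by
    have h := norm_iteratedFDeriv_exp_smallExponent_le h1 hν hM1 hM n η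
    have h2 := hCb (k + n + D) ν hν hl η
    have hp : 0 < 1 + ‖η‖ := by positivity
    rw [Real.rpow_neg hp.le, Real.rpow_natCast, ← div_eq_mul_inv, le_div_iff₀ (by positivity)]
    calc ‖η‖ ^ k * ‖iteratedFDeriv ℝ n m η‖ * (1 + ‖η‖) ^ D
        ≤ (1 + ‖η‖) ^ k * (n.factorial * ‖m η‖ * (M * (1 + ‖η‖)) ^ n) * (1 + ‖η‖) ^ D := by
          gcongr
          linarith
      _ = n.factorial * M ^ n * (‖m η‖ * (1 + ‖η‖) ^ (k + n + D)) := by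
          rw [mul_pow, pow_add, pow_add]; ring
      _ ≤ _ := by gcongr
  have hint : ∀ k n, Integrable (fun η => ‖η‖ ^ k * ‖iteratedFDeriv ℝ n m η‖) := fun k n => by
    refine (hDint.const_mul (n.factorial * M ^ n * C (k + n + D))).mono' ?_
      (ae_of_all _ fun η => ?_)
    · have := hmd.continuous_iteratedFDeriv (m := n) (by exact_mod_cast le_top)
      exact Continuous.aestronglyMeasurable (by fun_prop)
    · rw [Real.norm_of_nonneg (by positivity)]
      exact hpt k n η
  have hintle : ∀ k n, ∫ η, ‖η‖ ^ k * ‖iteratedFDeriv ℝ n m η‖ ≤ B k n := fun k n => by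
    calc _ ≤ ∫ η : H, (n.factorial * M ^ n * C (k + n + D)) * (1 + ‖η‖) ^ (-(D : ℝ)) :=
          integral_mono (hint k n) (hDint.const_mul _) (hpt k n)
      _ = B k n := by rw [integral_const_mul]
  refine ⟨?_, ?_, ?_⟩
  · have := hint 0 0
    simp only [pow_zero, one_mul, norm_iteratedFDeriv_zero] at this
    exact (integrable_norm_iff hmd.continuous.aestronglyMeasurable).1 this
  · rw [invFourier_eq]
    refine VectorFourier.contDiff_fourierIntegral (N := ⊤) _ fun n _ => ?_
    simpa using hint n 0
  intro k hk x
  have hL : (2 * Real.pi * ‖fourierForm H‖) ^ k ≤ 1 :=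
    pow_le_one₀ (by positivity) norm_fourierForm_le
  have key : ∀ n, |fourierForm H x x| ^ n * ‖iteratedFDeriv ℝ k (invFourier m) x‖ ≤
      ‖x‖ ^ n * S k n := fun n => by
    rw [invFourier_eq]
    refine (VectorFourier.pow_mul_norm_iteratedFDeriv_fourierIntegral_le (K := ⊤) (N := ⊤)
      (fourierForm H) hmd (fun k n _ _ => hint k n) (by exact_mod_cast le_top)
      (by exact_mod_cast le_top) x x).trans ?_
    have h0 : ∑ p ∈ Finset.range (k + 1) ×ˢ Finset.range (n + 1),
        ∫ η, ‖η‖ ^ p.1 * ‖iteratedFDeriv ℝ p.2 m η‖ ≤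
        ∑ p ∈ Finset.range (k + 1) ×ˢ Finset.range (n + 1), B p.1 p.2 :=
      Finset.sum_le_sum fun p _ => hintle p.1 p.2
    have h1 : 0 ≤ ∑ p ∈ Finset.range (k + 1) ×ˢ Finset.range (n + 1), B p.1 p.2 :=
      Finset.sum_nonneg fun p _ => hB _ _
    calc _ ≤ ‖x‖ ^ n * 1 * (2 * k + 2) ^ n *
          ∑ p ∈ Finset.range (k + 1) ×ˢ Finset.range (n + 1), B p.1 p.2 := by gcongr
      _ = _ := by simp only [S]; ring
  have key0 : ‖iteratedFDeriv ℝ k (invFourier m) x‖ ≤ S k 0 := by simpa using key 0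
  have keyN : ‖iteratedFDeriv ℝ k (invFourier m) x‖ * ‖x‖ ^ N ≤
      S k 0 + (2 * Real.pi) ^ N * S k N := by
    rcases eq_or_ne x 0 with rfl | hx
    · rcases Nat.eq_zero_or_pos N with hN | hN
      · subst hN
        have := hS k 0
        simp only [pow_zero, mul_one, one_mul]
        linarith
      · rw [norm_zero, zero_pow hN.ne', mul_zero]
        have := hS k 0; have := hS k N; positivity
    · have h := key N
      rw [fourierForm_apply, abs_mul, abs_neg, abs_of_nonneg (by positivity : 0 ≤ (2 * Real.pi)⁻¹),
        real_inner_self_eq_norm_sq, abs_of_nonneg (by positivity)] at h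
      have hx' : 0 < ‖x‖ ^ N := by have := norm_pos_iff.2 hx; positivity
      have h2 : ((2 * Real.pi)⁻¹ * ‖x‖ ^ 2) ^ N =
          ((2 * Real.pi) ^ N)⁻¹ * ‖x‖ ^ N * ‖x‖ ^ N := by
        rw [mul_pow, inv_pow]; ring
      rw [h2] at h
      have h3 : ((2 * Real.pi) ^ N)⁻¹ * ‖x‖ ^ N * ‖iteratedFDeriv ℝ k (invFourier m) x‖ ≤ S k N := by
        refine le_of_mul_le_mul_left ?_ hx'
        calc _ = _ := by ring
          _ ≤ _ := h
      have h4 : ‖x‖ ^ N * ‖iteratedFDeriv ℝ k (invFourier m) x‖ ≤ (2 * Real.pi) ^ N * S k N := by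
        rw [mul_assoc, inv_mul_le_iff₀ (by positivity)] at h3
        exact h3
      linarith [hS k 0]
  calc _ ≤ ‖iteratedFDeriv ℝ k (invFourier m) x‖ * (2 ^ N * (1 + ‖x‖ ^ N)) := by
        gcongr; exact one_add_pow_le (norm_nonneg _) N
    _ = 2 ^ N * (‖iteratedFDeriv ℝ k (invFourier m) x‖ +
          ‖iteratedFDeriv ℝ k (invFourier m) x‖ * ‖x‖ ^ N) := by ring
    _ ≤ 2 ^ N * (S k 0 + (S k 0 + (2 * Real.pi) ^ N * S k N)) := by gcongr
    _ = 2 ^ N * (2 * S k 0 + (2 * Real.pi) ^ N * S k N) := by ring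
    _ ≤ _ := by
      have := Finset.single_le_sum (f := fun k => 2 ^ N * (2 * S k 0 + (2 * Real.pi) ^ N * S k N))
        (s := Finset.range 4) (fun k _ => by have := hS k 0; have := hS k N; positivity)
        (Finset.mem_range.2 (by omega : k < 4))
      linarith

end SmallJumpsDecay

end

section

open scoped ContDiff

/-! ### Compound Poisson laws and convolution with large jumps -/

section CompoundPoisson

variable {H : Type*} [NormedAddCommGroup H] [InnerProductSpace ℝ H]
  [MeasurableSpace H] [FiniteDimensional ℝ H] [BorelSpace H]

/-- The convolution powers `ν^{*n}` of a measure. -/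
def convPow (ν : Measure H) : ℕ → Measure H
  | 0 => Measure.dirac 0
  | n + 1 => Measure.conv ν (convPow ν n)

instance isFiniteMeasure_convPow (ν : Measure H) [IsFiniteMeasure ν] (n : ℕ) :
    IsFiniteMeasure (convPow ν n) := by
  induction n with
  | zero => unfold convPow; infer_instance
  | succ n ih => unfold convPow; infer_instance

lemma charFun_convPow (ν : Measure H) [IsFiniteMeasure ν] (n : ℕ) (η : H) :
    charFun (convPow ν n) η = charFun ν η ^ n := by
  induction n with
  | zero => simp [convPow, charFun_dirac]
  | succ n ih => rw [convPow, charFun_conv, ih, pow_succ']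

/-- If convolution with `ν` maps the weight `W` below `B W`, then convolution with `ν^{*n}` maps it
below `B^n W`. -/
lemma lintegral_convPow_le {ν : Measure H} [IsFiniteMeasure ν] {W : H → ℝ≥0∞} (hW : Measurable W)
    {B : ℝ≥0∞} (hB : ∀ x, ∫⁻ z, W (x + z) ∂ν ≤ B * W x) (n : ℕ) (x : H) :
    ∫⁻ z, W (x + z) ∂(convPow ν n) ≤ B ^ n * W x := by
  induction n generalizing x with
  | zero => simp [convPow]
  | succ n ih =>
    have hWx : Measurable fun z => W (x + z) := hW.comp (measurable_const_add x)
    rw [convPow, Measure.lintegral_conv hWx]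
    calc ∫⁻ y, ∫⁻ z, W (x + (y + z)) ∂convPow ν n ∂ν
        ≤ ∫⁻ y, B ^ n * W (x + y) ∂ν := by
          refine lintegral_mono fun y => ?_
          simp only [← add_assoc]
          exact ih (x + y)
      _ = B ^ n * ∫⁻ y, W (x + y) ∂ν :=
          lintegral_const_mul _ (hW.comp (measurable_const_add x))
      _ ≤ B ^ n * (B * W x) := by gcongr; exact hB x
      _ = _ := by rw [pow_succ, mul_assoc]

/-- The compound Poisson law `e^{-ν(H)} ∑ ν^{*n} / n!`. -/
def compoundPoisson (ν : Measure H) : Measure H :=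
  Measure.sum fun n : ℕ =>
    ENNReal.ofReal (Real.exp (-ν.real univ) / n.factorial) • convPow ν n

lemma lintegral_compoundPoisson_le {ν : Measure H} [IsFiniteMeasure ν] {W : H → ℝ≥0∞}
    (hW : Measurable W) {B : ℝ} (hB0 : 0 ≤ B)
    (hB : ∀ x, ∫⁻ z, W (x + z) ∂ν ≤ ENNReal.ofReal B * W x) (x : H) :
    ∫⁻ z, W (x + z) ∂(compoundPoisson ν) ≤ ENNReal.ofReal (Real.exp B) * W x := by
  rw [compoundPoisson, lintegral_sum_measure]
  have h1 : ∀ n : ℕ, ∫⁻ z, W (x + z) ∂(ENNReal.ofReal (Real.exp (-ν.real univ) / n.factorial) •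
      convPow ν n) ≤ ENNReal.ofReal (B ^ n / n.factorial) * W x := fun n => by
    rw [lintegral_smul_measure, smul_eq_mul]
    calc _ ≤ ENNReal.ofReal (1 / n.factorial) * (ENNReal.ofReal B ^ n * W x) := by
          gcongr
          · exact Real.exp_le_one_iff.2 (by simp)
          · exact lintegral_convPow_le hW hB n x
      _ = _ := by
          rw [← ENNReal.ofReal_pow hB0, ← mul_assoc, ← ENNReal.ofReal_mul (by positivity)]
          congr 2; ring
  refine (ENNReal.tsum_le_tsum h1).trans ?_
  rw [ENNReal.tsum_mul_right, ← ENNReal.ofReal_tsum_of_nonneg (fun n => by positivity)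
    (Real.summable_pow_div_factorial B)]
  rw [Real.exp_eq_exp_ℝ, NormedSpace.exp_eq_tsum_div]

instance isFiniteMeasure_compoundPoisson (ν : Measure H) [IsFiniteMeasure ν] :
    IsFiniteMeasure (compoundPoisson ν) := by
  constructor
  have := lintegral_compoundPoisson_le (ν := ν) (W := fun _ => 1) measurable_const
    (B := ν.real univ) (by positivity) (by simp) 0
  simp only [lintegral_const, one_mul, mul_one] at this
  exact this.trans_lt ENNReal.ofReal_lt_top

lemma charFun_compoundPoisson (ν : Measure H) [IsFiniteMeasure ν] (η : H) :
    charFun (compoundPoisson ν) η = Complex.exp (charFun ν η - ν.real univ) := by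
  have hint : Integrable (fun z : H => Complex.exp ((inner ℝ z η : ℝ) * Complex.I))
      (compoundPoisson ν) := by
    refine (integrable_const (1 : ℝ)).mono' (by fun_prop) (ae_of_all _ fun z => ?_)
    rw [Complex.norm_exp_ofReal_mul_I]
  rw [charFun_apply, compoundPoisson, integral_sum_measure hint]
  have h1 : ∀ n : ℕ, ∫ z, Complex.exp ((inner ℝ z η : ℝ) * Complex.I)
      ∂(ENNReal.ofReal (Real.exp (-ν.real univ) / n.factorial) • convPow ν n) =
      Complex.exp (-ν.real univ) * (charFun ν η ^ n / n.factorial) := fun n => by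
    rw [integral_smul_measure, ← charFun_apply, charFun_convPow,
      ENNReal.toReal_ofReal (by positivity), Complex.real_smul]
    push_cast
    ring
  simp_rw [h1]
  rw [tsum_mul_left, sub_eq_neg_add, Complex.exp_add, Complex.exp_eq_exp_ℂ,
    NormedSpace.exp_eq_tsum_div (𝔸 := ℂ)]

/-- Differentiation of a convolution with a finite measure. -/
lemma hasFDerivAt_integral_add {F : Type*} [NormedAddCommGroup F] [NormedSpace ℝ F]
    [CompleteSpace F] (π : Measure H) [IsFiniteMeasure π] {u : H → F} {A : ℝ}
    (hu : ContDiff ℝ 1 u) (h0 : ∀ x, ‖u x‖ ≤ A) (h1 : ∀ x, ‖fderiv ℝ u x‖ ≤ A) (x : H) :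
    HasFDerivAt (fun x => ∫ z, u (x + z) ∂π) (∫ z, fderiv ℝ u (x + z) ∂π) x := by
  have hc := hu.continuous
  have hc' := hu.continuous_fderiv (by norm_num)
  have hm : ∀ x, AEStronglyMeasurable (fun z => u (x + z)) π := fun x =>
    (hc.comp (continuous_const.add continuous_id)).aestronglyMeasurable
  refine hasFDerivAt_integral_of_dominated_of_fderiv_le (Metric.ball_mem_nhds x one_pos)
    (F' := fun x z => fderiv ℝ u (x + z)) (bound := fun _ => A) (Eventually.of_forall hm)
    ((integrable_const A).mono' (hm x) (ae_of_all _ fun z => h0 _))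
    (hc'.comp (continuous_const.add continuous_id)).aestronglyMeasurable
    (ae_of_all _ fun z y _ => h1 _) (integrable_const A) (ae_of_all _ fun z y _ => ?_)
  simpa [Function.comp_def] using (hu.differentiable (by norm_num) (y + z)).hasFDerivAt.comp y
    ((hasFDerivAt_id y).add_const z)

end CompoundPoisson

section HeatKernel

variable {H : Type} [NormedAddCommGroup H] [InnerProductSpace ℝ H]
  [MeasurableSpace H] [FiniteDimensional ℝ H] [BorelSpace H]

/-- Smoothness and derivatives of a convolution with a finite measure. -/
lemma contDiff_integral_add (π : Measure H) [IsFiniteMeasure π] {A : ℝ} (n : ℕ) :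
    ∀ {F : Type} [NormedAddCommGroup F] [NormedSpace ℝ F] [CompleteSpace F] {u : H → F},
    ContDiff ℝ ∞ u → (∀ k ≤ n, ∀ x, ‖iteratedFDeriv ℝ k u x‖ ≤ A) →
    ContDiff ℝ n (fun x => ∫ z, u (x + z) ∂π) ∧ ∀ k ≤ n, ∀ x,
      ‖iteratedFDeriv ℝ k (fun x => ∫ z, u (x + z) ∂π) x‖ ≤
        ∫ z, ‖iteratedFDeriv ℝ k u (x + z)‖ ∂π := by
  induction n with
  | zero =>
    intro F _ _ _ u hu hA
    have hA0 : ∀ x, ‖u x‖ ≤ A := fun x => by simpa using hA 0 le_rfl x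
    have hc := hu.continuous
    refine ⟨contDiff_zero.2 ?_, fun k hk x => ?_⟩
    · refine continuous_of_dominated (F := fun x z => u (x + z)) (bound := fun _ => A)
        (fun x => (hc.comp (continuous_const.add continuous_id)).aestronglyMeasurable)
        (fun x => ae_of_all _ fun z => hA0 _) (integrable_const A)
        (ae_of_all _ fun z => hc.comp (continuous_id.add continuous_const))
    · obtain rfl : k = 0 := by omega
      simp only [norm_iteratedFDeriv_zero]
      exact norm_integral_le_integral_norm _
  | succ n ih =>
    intro F _ _ _ u hu hA
    have hA0 : ∀ x, ‖u x‖ ≤ A := fun x => by simpa using hA 0 (by omega) x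
    have hA1 : ∀ x, ‖fderiv ℝ u x‖ ≤ A := fun x => by
      simpa [norm_iteratedFDeriv_one] using hA 1 (by omega) x
    have hd := hasFDerivAt_integral_add π (hu.of_le (by exact_mod_cast le_top)) hA0 hA1
    have hfd : fderiv ℝ (fun x => ∫ z, u (x + z) ∂π) = fun x => ∫ z, fderiv ℝ u (x + z) ∂π :=
      funext fun x => (hd x).fderiv
    have hu' : ContDiff ℝ ∞ (fderiv ℝ u) := (contDiff_infty_iff_fderiv.1 hu).2
    obtain ⟨h1, h2⟩ := ih (u := fderiv ℝ u) hu' fun k hk x => by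
      rw [norm_iteratedFDeriv_fderiv]; exact hA (k + 1) (by omega) x
    refine ⟨?_, fun k hk x => ?_⟩
    · have := (contDiff_succ_iff_fderiv (𝕜 := ℝ) (n := (n : ℕ∞ω))
        (f := fun x => ∫ z, u (x + z) ∂π)).2
        ⟨fun x => (hd x).differentiableAt, by simp, by rw [hfd]; exact h1⟩
      exact_mod_cast this
    · rcases Nat.eq_zero_or_pos k with rfl | hk0
      · simp only [norm_iteratedFDeriv_zero]
        exact norm_integral_le_integral_norm _
      · obtain ⟨j, rfl⟩ := Nat.exists_eq_add_of_le' hk0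
        simp only [← norm_iteratedFDeriv_fderiv]
        rw [hfd]
        exact h2 j (by omega) x

/-- The Fourier transform of a finite measure acts on `invFourier` by convolution. -/
lemma invFourier_mul_charFun (π : Measure H) [IsFiniteMeasure π] {m : H → ℂ} (hm : Integrable m)
    (b x : H) :
    invFourier (fun η => m η * Complex.exp (Complex.I * ((inner ℝ η b : ℝ) : ℂ)) * charFun π η) x
      = ∫ z, invFourier m (x + z + b) ∂π := by
  unfold invFourier
  have h1 : ∀ η : H, Complex.exp (Complex.I * ((inner ℝ x η : ℝ) : ℂ)) *
      (m η * Complex.exp (Complex.I * ((inner ℝ η b : ℝ) : ℂ)) * charFun π η) =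
      ∫ z, Complex.exp (Complex.I * ((inner ℝ (x + z + b) η : ℝ) : ℂ)) * m η ∂π := fun η => by
    rw [charFun_apply, ← integral_const_mul, ← integral_const_mul]
    refine integral_congr_ae (ae_of_all _ fun z => ?_)
    simp only [inner_add_left, Complex.ofReal_add, mul_add, Complex.exp_add]
    rw [real_inner_comm b η, mul_comm Complex.I ((inner ℝ z η : ℝ) : ℂ)]
    ring
  simp_rw [h1]
  refine integral_integral_swap (f := fun η z =>
    Complex.exp (Complex.I * ((inner ℝ (x + z + b) η : ℝ) : ℂ)) * m η) ?_
  have h2 : Integrable (fun p : H × H => m p.1) (volume.prod π) := hm.comp_fst π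
  refine (h2.norm).mono' ?_ (ae_of_all _ fun p => ?_)
  · refine AEStronglyMeasurable.mul ?_ h2.aestronglyMeasurable
    exact Continuous.aestronglyMeasurable (by fun_prop)
  · simp only [Function.uncurry]
    rw [norm_mul, norm_exp_I_mul, one_mul]

/-- Upper bounds for the density of an infinitely divisible law, and for its derivatives, in terms
of a weight `W` that is almost preserved by convolution with the large jumps. The bounds depend on
the Lévy measure only through the constants in the hypotheses. -/
theorem exists_density_bound {M c β : ℝ} (hM1 : 1 ≤ M) (hc : 0 < c) (hβ : 0 < β) (N : ℕ)
    {B : ℝ} (hB : 0 < B) :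
    ∃ C : ℝ, 0 < C ∧ ∀ (ν₁ ν₂ : Measure H) (b : H) (W : H → ℝ), IsFiniteMeasure ν₂ →
      (∀ᵐ z ∂ν₁, ‖z‖ ≤ 1) → Integrable (fun z => ‖z‖ ^ 2) ν₁ → ∫ z, ‖z‖ ^ 2 ∂ν₁ ≤ M →
      (∀ η : H, 1 ≤ ‖η‖ → c * ‖η‖ ^ β ≤ ∫ z, (1 - Real.cos (inner ℝ η z)) ∂ν₁) →
      Measurable W → (∀ x, 0 ≤ W x) → (∀ x, 1 ≤ B * W x * (1 + ‖x‖) ^ N) →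
      (∀ x, ∫⁻ z, ENNReal.ofReal (W (x + z)) ∂ν₂ ≤ ENNReal.ofReal B * ENNReal.ofReal (W x)) →
      (∀ x, W (x + b) ≤ B * W x) →
      ∀ Q : H → ℂ, (∀ x, Q x = invFourier (fun η => Complex.exp (smallExponent ν₁ η +
        Complex.I * ((inner ℝ η b : ℝ) : ℂ) + (charFun ν₂ η - ν₂.real univ))) x) →
      ContDiff ℝ 3 Q ∧ ∀ k ≤ 3, ∀ x, ‖iteratedFDeriv ℝ k Q x‖ ≤ C * W x := by
  obtain ⟨C, hC, h⟩ := exists_decay_small_jumps (H := H) hM1 hc hβ N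
  refine ⟨C * B * B * Real.exp B, by positivity, ?_⟩
  intro ν₁ ν₂ b W hfin h1 hν hM hl hWm hW0 hWN hWB hWb Q hQ
  obtain ⟨hi, hs, hd⟩ := h ν₁ h1 hν hM hl
  set m : H → ℂ := fun η => Complex.exp (smallExponent ν₁ η) with hm
  set π := compoundPoisson ν₂
  -- the density of the small jumps, shifted by `b` and averaged over the sum `z` of the large jumps
  have hQ' : Q = fun x => ∫ z, (fun y => invFourier m (y + b)) (x + z) ∂π := by
    ext x
    rw [hQ, ← invFourier_mul_charFun π hi b x]
    congr 1
    ext η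
    rw [Complex.exp_add, Complex.exp_add, ← charFun_compoundPoisson]
  have hsb : ContDiff ℝ ∞ fun y => invFourier m (y + b) := hs.comp (contDiff_id.add contDiff_const)
  have hdb : ∀ k x, iteratedFDeriv ℝ k (fun y => invFourier m (y + b)) x =
      iteratedFDeriv ℝ k (invFourier m) (x + b) := fun k x => iteratedFDeriv_comp_add_right k b x
  have hC' : ∀ k ≤ 3, ∀ x, ‖iteratedFDeriv ℝ k (fun y => invFourier m (y + b)) x‖ ≤ C :=
    fun k hk x => by
      rw [hdb]
      refine le_trans ?_ (hd k hk (x + b))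
      exact le_mul_of_one_le_right (norm_nonneg _)
        (one_le_pow₀ (by linarith [norm_nonneg (x + b)]))
  obtain ⟨hQs, hQd⟩ := contDiff_integral_add π 3 hsb hC'
  rw [hQ']
  refine ⟨hQs, fun k hk x => (hQd k hk x).trans ?_⟩
  -- the decay of order `N` of the density of the small jumps beats the weight `W`
  have hpt : ∀ x, ‖iteratedFDeriv ℝ k (fun y => invFourier m (y + b)) x‖ ≤ C * B * B * W x :=
    fun x => by
      rw [hdb]
      have h2 := hd k hk (x + b)
      have h3 := hWN (x + b)
      have h4 : 0 < (1 + ‖x + b‖) ^ N := by positivity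
      calc ‖iteratedFDeriv ℝ k (invFourier m) (x + b)‖
          ≤ ‖iteratedFDeriv ℝ k (invFourier m) (x + b)‖ * (B * W (x + b) * (1 + ‖x + b‖) ^ N) :=
            le_mul_of_one_le_right (norm_nonneg _) h3
        _ = (‖iteratedFDeriv ℝ k (invFourier m) (x + b)‖ * (1 + ‖x + b‖) ^ N) *
            (B * W (x + b)) := by ring
        _ ≤ C * (B * (B * W x)) := by
            gcongr
            · exact mul_nonneg hB.le (hW0 _)
            · exact hWb x
        _ = _ := by ring
  have hm' : Measurable fun x => ENNReal.ofReal (W x) := hWm.ennreal_ofReal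
  rw [integral_eq_lintegral_of_nonneg_ae (ae_of_all _ fun z => norm_nonneg _)]
  · refine ENNReal.toReal_le_of_le_ofReal (by have := hW0 x; positivity) ?_
    calc ∫⁻ z, ENNReal.ofReal ‖iteratedFDeriv ℝ k (fun y => invFourier m (y + b)) (x + z)‖ ∂π
        ≤ ∫⁻ z, ENNReal.ofReal (C * B * B) * ENNReal.ofReal (W (x + z)) ∂π := by
          refine lintegral_mono fun z => ?_
          rw [← ENNReal.ofReal_mul (by positivity)]
          exact ENNReal.ofReal_le_ofReal (hpt _)
      _ = ENNReal.ofReal (C * B * B) * ∫⁻ z, ENNReal.ofReal (W (x + z)) ∂π :=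
          lintegral_const_mul _ (hm'.comp (measurable_const_add x))
      _ ≤ ENNReal.ofReal (C * B * B) * (ENNReal.ofReal (Real.exp B) * ENNReal.ofReal (W x)) := by
          gcongr
          exact lintegral_compoundPoisson_le hm' hB.le hWB x
      _ = _ := by
          rw [← ENNReal.ofReal_mul (by positivity), ← ENNReal.ofReal_mul (by positivity)]
          congr 1; ring
  · have := hsb.continuous_iteratedFDeriv (m := k) (by exact_mod_cast le_top)
    exact (this.comp (continuous_const.add continuous_id)).norm.aestronglyMeasurable

end HeatKernel

end

/-! ### The scale function and radial integrals -/

/-- A scale function whose structural constants are those of `Θ`. -/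
structure Adm (Θ : Theta) (φ : ℝ → ℝ) : Prop where
  d_pos : 1 ≤ Θ.d
  κ₀_ge : 1 ≤ Θ.κ₀
  scale : IsScale φ
  scaling : WeakScaling φ Θ.c₁ Θ.c₂ Θ.β₁ Θ.β₂
  c₀_eq : Θ.c₀ = c0 φ
  A₀_eq : Θ.A₀ = A0 φ
  A0_lt_top : A0 φ < ∞

/-- The volume scale `V(r) = r^d φ(r)`; the jump kernels are comparable with `1 / V(|z|)`. -/
def radVol (d : ℕ) (φ : ℝ → ℝ) (r : ℝ) : ℝ := r ^ d * φ r

/-- Constant in the lower scaling inequality. -/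
def lowC (Θ : Theta) : ℝ := max 1 Θ.c₁⁻¹

/-- Constant in the upper scaling inequality. -/
def upC (Θ : Theta) : ℝ := max 1 Θ.c₂

/-- Doubling constant of `V` for a dilation by `k`. -/
def dblC (Θ : Theta) (k : ℝ) : ℝ := upC Θ * k ^ ((Θ.d : ℝ) + Θ.β₂)

lemma one_le_lowC (Θ : Theta) : 1 ≤ lowC Θ := le_max_left _ _

lemma one_le_upC (Θ : Theta) : 1 ≤ upC Θ := le_max_left _ _

namespace Adm

variable {Θ : Theta} {φ : ℝ → ℝ} (h : Adm Θ φ)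

include h

lemma β₂_pos : 0 < Θ.β₂ := h.scaling.β₁_pos.trans_le h.scaling.β₁_le_β₂

lemma phi_pos {r : ℝ} (hr : 0 < r) : 0 < φ r := by
  have := h.scale.strictMonoOn (mem_Ici.2 le_rfl) (mem_Ici.2 hr.le) hr
  rwa [h.scale.map_zero] at this

lemma phi_nonneg {r : ℝ} (hr : 0 ≤ r) : 0 ≤ φ r := by
  rcases hr.eq_or_lt with rfl | hr
  · exact h.scale.map_zero.ge
  · exact (h.phi_pos hr).le

lemma phi_mono {r R : ℝ} (hr : 0 ≤ r) (hR : r ≤ R) : φ r ≤ φ R :=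
  h.scale.strictMonoOn.monotoneOn hr (mem_Ici.2 (hr.trans hR)) hR

lemma continuous_phi_norm {F : Type*} [SeminormedAddCommGroup F] :
    Continuous fun z : F => φ ‖z‖ :=
  h.scale.continuousOn.comp_continuous continuous_norm fun z => norm_nonneg z

lemma phi_lower {r R : ℝ} (hr : 0 < r) (hR : r ≤ R) (hR1 : R ≤ 1) :
    φ r ≤ lowC Θ * (r / R) ^ Θ.β₁ * φ R := by
  have hR0 : 0 < R := hr.trans_le hR
  rcases hR.eq_or_lt with rfl | hlt
  · rw [div_self hr.ne', Real.one_rpow, mul_one]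
    exact le_mul_of_one_le_left (h.phi_pos hr).le (one_le_lowC Θ)
  · have h1 := h.scaling.lower r R hr hlt hR1
    have hc := h.scaling.c₁_pos
    rw [le_div_iff₀ (h.phi_pos hr)] at h1
    have hx : (0 : ℝ) < (r / R) ^ Θ.β₁ := by positivity
    have hinv : (R / r) ^ Θ.β₁ = ((r / R) ^ Θ.β₁)⁻¹ := by
      rw [← Real.inv_rpow (by positivity), inv_div]
    rw [hinv] at h1
    have h2 : φ r ≤ Θ.c₁⁻¹ * (r / R) ^ Θ.β₁ * φ R := by
      calc φ r = Θ.c₁⁻¹ * (r / R) ^ Θ.β₁ * (Θ.c₁ * ((r / R) ^ Θ.β₁)⁻¹ * φ r) := by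
            field_simp
        _ ≤ _ := by gcongr
    refine h2.trans ?_
    have := h.phi_pos hR0
    gcongr
    exact le_max_right _ _

lemma phi_upper {r R : ℝ} (hr : 0 < r) (hR : r ≤ R) :
    φ R ≤ upC Θ * (R / r) ^ Θ.β₂ * φ r := by
  rcases hR.eq_or_lt with rfl | hlt
  · rw [div_self hr.ne', Real.one_rpow, mul_one]
    exact le_mul_of_one_le_left (h.phi_pos hr).le (one_le_upC Θ)
  · have h1 := h.scaling.upper r R hr hlt
    rw [div_le_iff₀ (h.phi_pos hr)] at h1
    refine h1.trans ?_
    have := h.phi_pos hr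
    have : 0 < R / r := div_pos (hr.trans hlt) hr
    gcongr
    exact le_max_right _ _

lemma radVol_pos {r : ℝ} (hr : 0 < r) : 0 < radVol Θ.d φ r := by
  have := h.phi_pos hr
  unfold radVol; positivity

lemma radVol_nonneg {r : ℝ} (hr : 0 ≤ r) : 0 ≤ radVol Θ.d φ r := by
  have := h.phi_nonneg hr
  unfold radVol; positivity

lemma radVol_mono {r R : ℝ} (hr : 0 ≤ r) (hR : r ≤ R) : radVol Θ.d φ r ≤ radVol Θ.d φ R := by
  unfold radVol
  have := h.phi_mono hr hR
  have := h.phi_nonneg hr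
  have := hr.trans hR
  gcongr

lemma radVol_upper {r R : ℝ} (hr : 0 < r) (hR : r ≤ R) :
    radVol Θ.d φ R ≤ upC Θ * (R / r) ^ ((Θ.d : ℝ) + Θ.β₂) * radVol Θ.d φ r := by
  have hR0 : 0 < R := hr.trans_le hR
  have h1 := h.phi_upper hr hR
  unfold radVol
  rw [Real.rpow_add (by positivity), Real.rpow_natCast]
  calc R ^ Θ.d * φ R ≤ R ^ Θ.d * (upC Θ * (R / r) ^ Θ.β₂ * φ r) := by gcongr
    _ = _ := by rw [div_pow]; field_simp

omit h in
lemma _root_.LevyLevi.dblC_pos (Θ : Theta) {k : ℝ} (hk : 0 < k) : 0 < dblC Θ k := by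
  have := one_le_upC Θ
  unfold dblC; positivity

lemma one_le_dblC {k : ℝ} (hk : 1 ≤ k) : 1 ≤ dblC Θ k := by
  unfold dblC
  have := h.β₂_pos
  exact one_le_mul_of_one_le_of_one_le (one_le_upC Θ) (Real.one_le_rpow hk (by positivity))

/-- The doubling property of `V`. -/
lemma radVol_dbl {r R k : ℝ} (hr : 0 < r) (hk : 1 ≤ k) (hR0 : 0 ≤ R) (hR : R ≤ k * r) :
    radVol Θ.d φ R ≤ dblC Θ k * radVol Θ.d φ r := by
  have hkr : r ≤ k * r := by nlinarith
  refine (h.radVol_mono hR0 hR).trans ((h.radVol_upper hr hkr).trans (le_of_eq ?_))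
  rw [mul_div_cancel_right₀ _ hr.ne']
  rfl

/-! #### The inverse function -/

lemma phiInv_mem {t : ℝ} (h0 : 0 ≤ t) (h1 : t ≤ 1) :
    phiInv φ t ∈ Icc (0 : ℝ) 1 ∧ φ (phiInv φ t) = t := by
  have hc : ContinuousOn φ (Icc 0 1) := h.scale.continuousOn.mono Icc_subset_Ici_self
  have hiv := intermediate_value_Icc zero_le_one hc
  rw [h.scale.map_zero, h.scale.map_one] at hiv
  obtain ⟨r, hr, hrt⟩ := hiv ⟨h0, h1⟩
  have hp := Function.invFunOn_pos (f := φ) (s := Ici 0) (b := t) ⟨r, hr.1, hrt⟩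
  refine ⟨⟨hp.1, ?_⟩, hp.2⟩
  by_contra hlt
  have := h.scale.strictMonoOn (mem_Ici.2 zero_le_one) hp.1 (not_le.1 hlt)
  rw [h.scale.map_one] at this
  exact absurd (hp.2 ▸ this) (not_lt.2 h1)

lemma phi_phiInv {t : ℝ} (h0 : 0 ≤ t) (h1 : t ≤ 1) : φ (phiInv φ t) = t := (h.phiInv_mem h0 h1).2

lemma phiInv_le_one {t : ℝ} (h0 : 0 ≤ t) (h1 : t ≤ 1) : phiInv φ t ≤ 1 := (h.phiInv_mem h0 h1).1.2

lemma phiInv_pos {t : ℝ} (h0 : 0 < t) (h1 : t ≤ 1) : 0 < phiInv φ t := by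
  obtain ⟨⟨h2, -⟩, h3⟩ := h.phiInv_mem h0.le h1
  refine h2.lt_of_ne fun he => ?_
  rw [← he, h.scale.map_zero] at h3
  linarith

lemma phiInv_mono {t s : ℝ} (h0 : 0 ≤ t) (hts : t ≤ s) (h1 : s ≤ 1) : phiInv φ t ≤ phiInv φ s := by
  obtain ⟨⟨h2, -⟩, h3⟩ := h.phiInv_mem h0 (hts.trans h1)
  obtain ⟨⟨h4, -⟩, h5⟩ := h.phiInv_mem (h0.trans hts) h1
  by_contra hlt
  have := h.scale.strictMonoOn h4 h2 (not_le.1 hlt)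
  linarith

lemma phiInv_le {t : ℝ} (h0 : 0 < t) (h1 : t ≤ 1) : phiInv φ t ≤ (upC Θ * t) ^ (1 / Θ.β₂) := by
  have hp := h.phiInv_pos h0 h1
  have h2 := h.phi_upper hp (h.phiInv_le_one h0.le h1)
  rw [h.scale.map_one, h.phi_phiInv h0.le h1, one_div, Real.inv_rpow hp.le] at h2
  have hβ := h.β₂_pos
  have hx : 0 < phiInv φ t ^ Θ.β₂ := by positivity
  have h3 : phiInv φ t ^ Θ.β₂ ≤ upC Θ * t := by
    have : phiInv φ t ^ Θ.β₂ * 1 ≤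
        phiInv φ t ^ Θ.β₂ * (upC Θ * (phiInv φ t ^ Θ.β₂)⁻¹ * t) := by gcongr
    calc _ = phiInv φ t ^ Θ.β₂ * 1 := (mul_one _).symm
      _ ≤ _ := this
      _ = _ := by field_simp
  calc phiInv φ t = (phiInv φ t ^ Θ.β₂) ^ (1 / Θ.β₂) := by
        rw [← Real.rpow_mul hp.le, mul_one_div_cancel hβ.ne', Real.rpow_one]
    _ ≤ _ := by gcongr

/-- The inverse of `φ` grows at most with the power `1 / β₁`. -/
lemma phiInv_ratio {u t : ℝ} (h0 : 0 < u) (hut : u ≤ t) (h1 : t ≤ 1) :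
    phiInv φ t / phiInv φ u ≤ (lowC Θ * (t / u)) ^ (1 / Θ.β₁) := by
  have ht0 := h0.trans_le hut
  have hpu := h.phiInv_pos h0 (hut.trans h1)
  have hpt := h.phiInv_pos ht0 h1
  have h2 := h.phi_lower hpu (h.phiInv_mono h0.le hut h1) (h.phiInv_le_one ht0.le h1)
  rw [h.phi_phiInv h0.le (hut.trans h1), h.phi_phiInv ht0.le h1] at h2
  have hβ := h.scaling.β₁_pos
  set q := phiInv φ t / phiInv φ u with hq
  have hq0 : 0 < q := by positivity
  have h3 : (phiInv φ u / phiInv φ t) ^ Θ.β₁ = (q ^ Θ.β₁)⁻¹ := by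
    rw [← Real.inv_rpow hq0.le, hq, inv_div]
  rw [h3] at h2
  have h4 : q ^ Θ.β₁ ≤ lowC Θ * (t / u) := by
    have : q ^ Θ.β₁ * u ≤ q ^ Θ.β₁ * (lowC Θ * (q ^ Θ.β₁)⁻¹ * t) := by gcongr
    rw [← mul_div_assoc, le_div_iff₀ h0]
    calc _ ≤ _ := this
      _ = _ := by field_simp
  calc q = (q ^ Θ.β₁) ^ (1 / Θ.β₁) := by
        rw [← Real.rpow_mul hq0.le, mul_one_div_cancel hβ.ne', Real.rpow_one]
    _ ≤ _ := by gcongr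

end Adm

/-! #### Polar coordinates -/

/-- The surface measure of the unit sphere of `ℝ^d`. -/
def sphereArea (d : ℕ) : ℝ :=
  ((volume : Measure (E d)).toSphere univ).toReal

/-- Integration of radial functions in polar coordinates. -/
lemma lintegral_norm {d : ℕ} (hd : 1 ≤ d) {f : ℝ → ℝ≥0∞}
    (hf : Measurable fun r : Ioi (0 : ℝ) => f r) :
    ∫⁻ z : E d, f ‖z‖ = ENNReal.ofReal (sphereArea d) *
      ∫⁻ r in Ioi (0 : ℝ), ENNReal.ofReal (r ^ (d - 1)) * f r := by
  have : Nonempty (Fin d) := ⟨⟨0, by omega⟩⟩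
  have hdim : Module.finrank ℝ (E d) = d := by simp
  calc ∫⁻ z : E d, f ‖z‖ = ∫⁻ z in ({0}ᶜ : Set (E d)), f ‖z‖ := by
        rw [restrict_compl_singleton]
    _ = ∫⁻ z : ({0}ᶜ : Set (E d)), f ‖z.1‖ ∂((volume : Measure (E d)).comap (↑)) :=
        (lintegral_subtype_comap (measurableSet_singleton _).compl (fun z : E d => f ‖z‖)).symm
    _ = ∫⁻ p, f p.2 ∂((volume : Measure (E d)).toSphere.prod (.volumeIoiPow (d - 1))) := by
        have := (volume : Measure (E d)).measurePreserving_homeomorphUnitSphereProd.lintegral_comp_emb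
          (Homeomorph.measurableEmbedding _) (fun p => f p.2)
        simp only [hdim] at this
        rw [← this]
        simp
    _ = (volume : Measure (E d)).toSphere univ *
          ∫⁻ r : Ioi (0 : ℝ), f r ∂(Measure.volumeIoiPow (d - 1)) := by
        have hm : Measurable fun p : Metric.sphere (0 : E d) 1 × Ioi (0 : ℝ) => f p.2 :=
          hf.comp measurable_snd
        rw [lintegral_prod _ hm.aemeasurable]
        simp [mul_comm]
    _ = _ := by
        rw [sphereArea, ENNReal.ofReal_toReal (measure_ne_top _ _), Measure.volumeIoiPow,
          lintegral_withDensity_eq_lintegral_mul _ (by fun_prop) hf]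
        congr 1
        exact lintegral_subtype_comap measurableSet_Ioi
          (fun r => ENNReal.ofReal (r ^ (d - 1)) * f r)

lemma sphereArea_nonneg (d : ℕ) : 0 ≤ sphereArea d := ENNReal.toReal_nonneg

lemma lintegral_Ioi_comp_mul {a : ℝ} (ha : 0 < a) (f : ℝ → ℝ≥0∞) :
    ∫⁻ u in Ioi (0 : ℝ), f (a * u) = ENNReal.ofReal a⁻¹ * ∫⁻ r in Ioi (0 : ℝ), f r := by
  have hemb : MeasurableEmbedding fun u : ℝ => a * u :=
    (Homeomorph.mulLeft₀ a ha.ne').measurableEmbedding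
  have h1 : ∫⁻ r in Ioi (0 : ℝ), f r ∂(Measure.map (a * ·) volume) =
      ∫⁻ u in (fun u => a * u) ⁻¹' Ioi (0 : ℝ), f (a * u) := by
    rw [hemb.restrict_map, hemb.lintegral_map]
  have h2 : (fun u => a * u) ⁻¹' Ioi (0 : ℝ) = Ioi 0 := by
    ext u; simp [ha]
  rw [h2, Real.map_volume_mul_left ha.ne', Measure.restrict_smul, lintegral_smul_measure,
    abs_of_pos (inv_pos.2 ha), smul_eq_mul] at h1
  exact h1.symm

lemma lintegral_Ioi_comp_add (a : ℝ) (f : ℝ → ℝ≥0∞) :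
    ∫⁻ u in Ioi (0 : ℝ), f (a + u) = ∫⁻ r in Ioi a, f r := by
  have := (measurePreserving_add_left (volume : Measure ℝ) a).setLIntegral_comp_preimage_emb
    (measurableEmbedding_addLeft a) f (Ioi a)
  rw [← this]
  congr 2
  ext u; simp

lemma measurable_subtype_of_continuousOn {f : ℝ → ℝ} (hf : ContinuousOn f (Ioi 0)) :
    Measurable fun r : Ioi (0 : ℝ) => f r :=
  (continuousOn_iff_continuous_domRestrict.1 hf).measurable

lemma Adm.continuousOn_phi {Θ : Theta} {φ : ℝ → ℝ} (h : Adm Θ φ) : ContinuousOn φ (Ioi 0) :=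
  h.scale.continuousOn.mono Ioi_subset_Ici_self

/-- Moments of the jump kernel at the scale `a ≤ 1` are controlled by `𝒜`. -/
lemma Adm.lintegral_gamma_le {Θ : Theta} {φ : ℝ → ℝ} (h : Adm Θ φ) {γ : ℝ → ℝ}
    (hγ : ContinuousOn γ (Ioi 0)) {a : ℝ} (ha : a ∈ Ioc (0 : ℝ) 1) :
    ∫⁻ z : E Θ.d, ENNReal.ofReal (γ (‖z‖ / a) / radVol Θ.d φ ‖z‖) ≤
      ENNReal.ofReal (sphereArea Θ.d) * (ENNReal.ofReal (φ a)⁻¹ * supA φ γ) := by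
  have ha0 := ha.1
  have hφa := h.phi_pos ha0
  have hd := h.d_pos
  have hcont : ContinuousOn (fun r => γ (r / a) / radVol Θ.d φ r) (Ioi 0) := by
    have h1 : ContinuousOn (fun r => γ (r / a)) (Ioi 0) :=
      hγ.comp (continuous_id.div_const a).continuousOn fun r hr => div_pos (mem_Ioi.1 hr) ha0
    refine h1.div ?_ fun r hr => (h.radVol_pos hr).ne'
    exact (continuousOn_id.pow _).mul h.continuousOn_phi
  rw [lintegral_norm hd (f := fun r => ENNReal.ofReal (γ (r / a) / radVol Θ.d φ r))
    (measurable_subtype_of_continuousOn hcont).ennreal_ofReal]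
  gcongr
  set F : ℝ → ℝ≥0∞ := fun r => ENNReal.ofReal (r ^ (Θ.d - 1)) *
    ENNReal.ofReal (γ (r / a) / radVol Θ.d φ r)
  have h1 := lintegral_Ioi_comp_mul ha0 F
  have h2 : ∫⁻ r in Ioi (0 : ℝ), F r = ENNReal.ofReal a * ∫⁻ u in Ioi (0 : ℝ), F (a * u) := by
    rw [h1, ← mul_assoc, ← ENNReal.ofReal_mul ha0.le, mul_inv_cancel₀ ha0.ne', ENNReal.ofReal_one,
      one_mul]
  rw [h2]
  have h3 : ENNReal.ofReal a * ∫⁻ u in Ioi (0 : ℝ), F (a * u) = ENNReal.ofReal (φ a)⁻¹ *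
      ∫⁻ r in Ioi (0 : ℝ), ENNReal.ofReal (φ a * γ r / (r * φ (a * r))) := by
    rw [← lintegral_const_mul' _ _ ENNReal.ofReal_ne_top,
      ← lintegral_const_mul' _ _ ENNReal.ofReal_ne_top]
    refine setLIntegral_congr_fun measurableSet_Ioi fun u hu => ?_
    have hu0 : 0 < u := hu
    have hφ := h.phi_pos (mul_pos ha0 hu0)
    simp only [F]
    rw [← ENNReal.ofReal_mul (by positivity), ← ENNReal.ofReal_mul (by positivity),
      ← ENNReal.ofReal_mul (by positivity)]
    congr 1
    unfold radVol
    obtain ⟨n, hn⟩ := Nat.exists_eq_add_of_le' hd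
    rw [hn, Nat.add_sub_cancel, mul_div_cancel_left₀ _ ha0.ne', pow_succ]
    field_simp
  rw [h3]
  gcongr
  exact le_iSup₂ (f := fun l (_ : l ∈ Ioc (0 : ℝ) 1) =>
    ∫⁻ r in Ioi (0 : ℝ), ENNReal.ofReal (φ l * γ r / (r * φ (l * r)))) a ha

/-- A nonnegative increasing function on `(0, ∞)`, constant on `[1, ∞)`, of growth at most that of
the power `b`: `g(R) ≤ K (R/r)^b g(r)` for `r ≤ R ≤ 1`. -/
structure PowerGrowth (g : ℝ → ℝ) (b K : ℝ) : Prop where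
  one_le : 1 ≤ K
  continuousOn : ContinuousOn g (Ioi 0)
  mono : MonotoneOn g (Ioi 0)
  nonneg : ∀ r, 0 < r → 0 ≤ g r
  const : ∀ r, 1 ≤ r → g r = g 1
  growth : ∀ r R, 0 < r → r ≤ R → R ≤ 1 → g R ≤ K * (R / r) ^ b * g r

/-- Integrals of `g / V` over the space behave as if `g` were constant. -/
lemma exists_lintegral_weight_le (Θ : Theta) : ∃ C : ℝ, 0 < C ∧ ∀ φ : ℝ → ℝ, Adm Θ φ →
    ∀ (g : ℝ → ℝ) (K : ℝ), PowerGrowth g (Θ.β₁ / 2) K → ∀ a ∈ Ioc (0 : ℝ) 1,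
      ∫⁻ z : E Θ.d, ENNReal.ofReal (g (a + ‖z‖) / radVol Θ.d φ (a + ‖z‖)) ≤
        ENNReal.ofReal (C * K * (g a / φ a)) := by
  refine ⟨1 + sphereArea Θ.d * (lowC Θ * |2 / Θ.β₁| + lowC Θ * Θ.c₀.toReal), ?_, ?_⟩
  · have := sphereArea_nonneg Θ.d
    have := one_le_lowC Θ
    positivity
  intro φ h g K hg a ha
  have ha0 := ha.1
  have hφa := h.phi_pos ha0
  have hd := h.d_pos
  have hβ := h.scaling.β₁_pos
  have hga := hg.nonneg a ha0
  have hK := hg.one_le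
  have hlow := one_le_lowC Θ
  have hcont : ContinuousOn (fun r => g (a + r) / radVol Θ.d φ (a + r)) (Ioi 0) := by
    have hmaps : MapsTo (fun r => a + r) (Ioi 0) (Ioi 0) := fun r hr => add_pos ha0 hr
    have h1 : ContinuousOn (fun r => g (a + r)) (Ioi 0) :=
      hg.continuousOn.comp (continuous_const.add continuous_id).continuousOn hmaps
    refine h1.div ?_ fun r hr => (h.radVol_pos (hmaps hr)).ne'
    have h2 : ContinuousOn (fun r => φ (a + r)) (Ioi 0) :=
      h.continuousOn_phi.comp (continuous_const.add continuous_id).continuousOn hmaps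
    exact ((continuous_const.add continuous_id).continuousOn.pow _).mul h2
  rw [lintegral_norm hd (f := fun r => ENNReal.ofReal (g (a + r) / radVol Θ.d φ (a + r)))
    (measurable_subtype_of_continuousOn hcont).ennreal_ofReal]
  have h1 : ∫⁻ r in Ioi (0 : ℝ), ENNReal.ofReal (r ^ (Θ.d - 1)) *
      ENNReal.ofReal (g (a + r) / radVol Θ.d φ (a + r)) ≤
      ∫⁻ r in Ioi a, ENNReal.ofReal (g r / (r * φ r)) := by
    rw [← lintegral_Ioi_comp_add a]
    refine setLIntegral_mono' measurableSet_Ioi fun r hr => ?_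
    have hr0 : 0 < r := hr
    have har : 0 < a + r := by positivity
    have hφ := h.phi_pos har
    have hgr := hg.nonneg _ har
    rw [← ENNReal.ofReal_mul (by positivity)]
    refine ENNReal.ofReal_le_ofReal ?_
    unfold radVol
    obtain ⟨n, hn⟩ := Nat.exists_eq_add_of_le' hd
    rw [hn, Nat.add_sub_cancel, pow_succ]
    calc r ^ n * (g (a + r) / ((a + r) ^ n * (a + r) * φ (a + r)))
        ≤ (a + r) ^ n * (g (a + r) / ((a + r) ^ n * (a + r) * φ (a + r))) := by
          gcongr; linarith
      _ = _ := by field_simp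
  -- the part `r ≤ 1`
  have h2 : ∫⁻ r in Ioc a 1, ENNReal.ofReal (g r / (r * φ r)) ≤
      ENNReal.ofReal (K * (g a / φ a) * (lowC Θ * |2 / Θ.β₁|)) := by
    have hexp : -1 - Θ.β₁ / 2 < -1 := by linarith
    set D : ℝ := K * lowC Θ * (g a / φ a) * a ^ (Θ.β₁ / 2) with hD
    have hD0 : 0 ≤ D := by positivity
    calc ∫⁻ r in Ioc a 1, ENNReal.ofReal (g r / (r * φ r))
        ≤ ∫⁻ r in Ioc a 1, ENNReal.ofReal (D * r ^ (-1 - Θ.β₁ / 2)) := by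
          refine setLIntegral_mono' measurableSet_Ioc fun r hr => ENNReal.ofReal_le_ofReal ?_
          have hr0 : 0 < r := ha0.trans hr.1
          have e1 := hg.growth a r ha0 hr.1.le hr.2
          have e2 := h.phi_lower ha0 hr.1.le hr.2
          have hφr := h.phi_pos hr0
          rw [div_le_iff₀ (by positivity)]
          have hx : (r / a) ^ (Θ.β₁ / 2) * (r / a) ^ (Θ.β₁ / 2) * (a / r) ^ Θ.β₁ = 1 := by
            rw [← Real.rpow_add (by positivity), add_halves, ← Real.mul_rpow (by positivity)
              (by positivity)]
            rw [div_mul_div_comm, mul_comm r a, div_self (by positivity), Real.one_rpow]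
          have hy : a ^ (Θ.β₁ / 2) * r ^ (-1 - Θ.β₁ / 2) * r = (a / r) ^ (Θ.β₁ / 2) := by
            rw [Real.rpow_sub hr0, Real.rpow_neg_one, Real.div_rpow ha0.le hr0.le]
            field_simp
          have hz : (a / r) ^ (Θ.β₁ / 2) = (r / a) ^ (Θ.β₁ / 2) * (a / r) ^ Θ.β₁ := by
            have : (a / r) ^ (Θ.β₁ / 2) * (r / a) ^ (Θ.β₁ / 2) = 1 := by
              rw [← Real.mul_rpow (by positivity) (by positivity), div_mul_div_comm, mul_comm r a,
                div_self (by positivity), Real.one_rpow]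
            calc (a / r) ^ (Θ.β₁ / 2) = (a / r) ^ (Θ.β₁ / 2) *
                  ((r / a) ^ (Θ.β₁ / 2) * (r / a) ^ (Θ.β₁ / 2) * (a / r) ^ Θ.β₁) := by
                  rw [hx, mul_one]
              _ = ((a / r) ^ (Θ.β₁ / 2) * (r / a) ^ (Θ.β₁ / 2)) *
                  ((r / a) ^ (Θ.β₁ / 2) * (a / r) ^ Θ.β₁) := by ring
              _ = _ := by rw [this, one_mul]
          calc g r ≤ K * (r / a) ^ (Θ.β₁ / 2) * g a := e1
            _ = K * (r / a) ^ (Θ.β₁ / 2) * (g a / φ a) * φ a := by field_simp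
            _ ≤ K * (r / a) ^ (Θ.β₁ / 2) * (g a / φ a) *
                (lowC Θ * (a / r) ^ Θ.β₁ * φ r) := by gcongr
            _ = K * lowC Θ * (g a / φ a) * ((r / a) ^ (Θ.β₁ / 2) * (a / r) ^ Θ.β₁) * φ r := by
                ring
            _ = K * lowC Θ * (g a / φ a) *
                (a ^ (Θ.β₁ / 2) * r ^ (-1 - Θ.β₁ / 2) * r) * φ r := by rw [hy, hz]
            _ = _ := by rw [hD]; ring
      _ ≤ ∫⁻ r in Ioi a, ENNReal.ofReal (D * r ^ (-1 - Θ.β₁ / 2)) :=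
          lintegral_mono_set Ioc_subset_Ioi_self
      _ = ENNReal.ofReal (∫ r in Ioi a, D * r ^ (-1 - Θ.β₁ / 2)) := by
          rw [ofReal_integral_eq_lintegral_ofReal]
          · exact (integrableOn_Ioi_rpow_of_lt hexp ha0).const_mul D
          · refine (ae_restrict_iff' measurableSet_Ioi).2 (ae_of_all _ fun r hr => ?_)
            have : 0 < r := ha0.trans hr
            simp only [Pi.zero_apply]; positivity
      _ = _ := by
          rw [integral_const_mul, integral_Ioi_rpow_of_lt hexp ha0, hD, abs_of_pos (by positivity)]
          congr 1
          have : a ^ (-1 - Θ.β₁ / 2 + 1) = (a ^ (Θ.β₁ / 2))⁻¹ := by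
            rw [← Real.rpow_neg ha0.le]; congr 1; ring
          rw [this]
          have hne : (-1 - Θ.β₁ / 2 + 1) = -(Θ.β₁ / 2) := by ring
          rw [hne]
          field_simp
  -- the part `r > 1`
  have h3 : ∫⁻ r in Ioi 1, ENNReal.ofReal (g r / (r * φ r)) ≤
      ENNReal.ofReal (K * (g a / φ a) * (lowC Θ * Θ.c₀.toReal)) := by
    have hg1 : g 1 ≤ K * (g a / φ a) * lowC Θ := by
      have e1 := hg.growth a 1 ha0 ha.2 le_rfl
      have e2 := h.phi_lower ha0 ha.2 le_rfl
      rw [h.scale.map_one, mul_one, div_one] at e2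
      have e3 : (1 / a) ^ (Θ.β₁ / 2) ≤ (a ^ Θ.β₁)⁻¹ := by
        rw [← Real.inv_rpow ha0.le, one_div]
        exact Real.rpow_le_rpow_of_exponent_le (one_le_inv_iff₀.2 ha) (by linarith)
      have hpos : 0 < a ^ Θ.β₁ := by positivity
      calc g 1 ≤ K * (1 / a) ^ (Θ.β₁ / 2) * g a := e1
        _ ≤ K * (a ^ Θ.β₁)⁻¹ * g a := by gcongr
        _ = K * (g a / φ a) * ((a ^ Θ.β₁)⁻¹ * φ a) := by field_simp
        _ ≤ K * (g a / φ a) * ((a ^ Θ.β₁)⁻¹ * (lowC Θ * a ^ Θ.β₁)) := by gcongr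
        _ = _ := by field_simp
    have hg1' := hg.nonneg 1 one_pos
    have hc0 : c0 φ ≠ ⊤ := h.scale.c0_lt_top.ne
    calc ∫⁻ r in Ioi 1, ENNReal.ofReal (g r / (r * φ r))
        = ∫⁻ r in Ioi 1, ENNReal.ofReal (g 1) * ENNReal.ofReal (min (r ^ 2) 1 / (r * φ r)) := by
          refine setLIntegral_congr_fun measurableSet_Ioi fun r hr => ?_
          have hr1 : (1 : ℝ) < r := hr
          rw [← ENNReal.ofReal_mul hg1', hg.const r hr1.le, min_eq_right (by nlinarith),
            mul_one_div]
      _ = ENNReal.ofReal (g 1) * ∫⁻ r in Ioi 1, ENNReal.ofReal (min (r ^ 2) 1 / (r * φ r)) :=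
          lintegral_const_mul' _ _ ENNReal.ofReal_ne_top
      _ ≤ ENNReal.ofReal (g 1) * c0 φ := by
          gcongr
          exact lintegral_mono_set (Ioi_subset_Ioi zero_le_one)
      _ = ENNReal.ofReal (g 1 * Θ.c₀.toReal) := by
          rw [ENNReal.ofReal_mul hg1', h.c₀_eq, ENNReal.ofReal_toReal hc0]
      _ ≤ _ := by
          refine ENNReal.ofReal_le_ofReal ?_
          rw [← mul_assoc]
          gcongr
  have h4 : ∫⁻ r in Ioi a, ENNReal.ofReal (g r / (r * φ r)) ≤
      ENNReal.ofReal (K * (g a / φ a) * (lowC Θ * |2 / Θ.β₁| + lowC Θ * Θ.c₀.toReal)) := by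
    rw [← Ioc_union_Ioi_eq_Ioi ha.2]
    refine (lintegral_union_le _ _ _).trans ((add_le_add h2 h3).trans ?_)
    rw [← ENNReal.ofReal_add (by positivity) (by positivity), mul_add]
  refine (mul_le_mul_right (h1.trans h4) _).trans ?_
  rw [← ENNReal.ofReal_mul (sphereArea_nonneg _)]
  refine ENNReal.ofReal_le_ofReal ?_
  have : 0 ≤ K * (g a / φ a) := by positivity
  nlinarith

/-! ### The characteristic exponent -/

lemma case1_or (φ : ℝ → ℝ) : Case1 φ ∨ (¬ Case1 φ ∧ Case2 φ) ∨
    (¬ Case1 φ ∧ ¬ Case2 φ ∧ Case3 φ) := by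
  unfold Case1 Case2 Case3
  tauto

lemma gamma0_nonneg (r : ℝ) : 0 ≤ gamma0 r := le_min (sq_nonneg r) zero_le_one

lemma gamma0_le_gamma1 (φ : ℝ → ℝ) {r : ℝ} (hr : 0 ≤ r) : gamma0 r ≤ gamma1 φ r := by
  unfold gamma0 gamma1
  split_ifs
  · rcases le_total r 1 with h | h
    · rw [min_eq_left h]; exact (min_le_left _ _).trans (by nlinarith)
    · rw [min_eq_right h]; exact min_le_right _ _
  · exact le_rfl
  · rcases le_total r 1 with h | h
    · rw [min_eq_left (by nlinarith : r ^ 2 ≤ r)]; exact min_le_left _ _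
    · rw [min_eq_right (by nlinarith : r ≤ r ^ 2)]; exact (min_le_right _ _).trans h

lemma gamma1_nonneg (φ : ℝ → ℝ) {r : ℝ} (hr : 0 ≤ r) : 0 ≤ gamma1 φ r :=
  (gamma0_nonneg r).trans (gamma0_le_gamma1 φ hr)

lemma continuous_gamma0 : Continuous gamma0 := by unfold gamma0; fun_prop

lemma continuous_gamma1 (φ : ℝ → ℝ) : Continuous (gamma1 φ) := by
  by_cases h1 : Case1 φ
  · simp only [funext (fun r => show gamma1 φ r = min r 1 by simp [gamma1, h1])]; fun_prop
  · by_cases h2 : Case2 φ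
    · simp only [funext (fun r => show gamma1 φ r = min (r ^ 2) 1 by simp [gamma1, h1, h2])]
      fun_prop
    · simp only [funext (fun r => show gamma1 φ r = min (r ^ 2) r by simp [gamma1, h1, h2])]
      fun_prop

lemma gamma1_case1 {φ : ℝ → ℝ} (h : Case1 φ) (r : ℝ) : gamma1 φ r = min r 1 := by
  simp [gamma1, h]

lemma gamma1_case2 {φ : ℝ → ℝ} (h1 : ¬ Case1 φ) (h : Case2 φ) (r : ℝ) :
    gamma1 φ r = min (r ^ 2) 1 := by
  simp [gamma1, h1, h]

lemma gamma1_case3 {φ : ℝ → ℝ} (h1 : ¬ Case1 φ) (h : ¬ Case2 φ) (r : ℝ) :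
    gamma1 φ r = min (r ^ 2) r := by
  simp [gamma1, h1, h]

lemma zphi_case1 {φ : ℝ → ℝ} {d : ℕ} (h : Case1 φ) (z : E d) : zphi φ z = 0 := by
  rw [zphi, if_neg fun h2 : Case2 φ => h2.1 h, if_neg fun h3 : Case3 φ => h3.1 h]

lemma zphi_case2 {φ : ℝ → ℝ} {d : ℕ} (h : Case2 φ) (z : E d) :
    zphi φ z = if ‖z‖ ≤ 1 then z else 0 := by
  simp [zphi, h]

lemma zphi_case3 {φ : ℝ → ℝ} {d : ℕ} (h : ¬ Case2 φ) (h3 : Case3 φ) (z : E d) :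
    zphi φ z = z := by
  simp [zphi, h, h3]

lemma measurable_zphi (φ : ℝ → ℝ) {d : ℕ} : Measurable (zphi φ : E d → E d) := by
  unfold zphi
  split_ifs
  · exact Measurable.ite (measurableSet_le measurable_norm measurable_const) measurable_id
      measurable_const
  · exact measurable_id
  · exact measurable_const

lemma zphi_neg (φ : ℝ → ℝ) {d : ℕ} (z : E d) : zphi φ (-z) = -zphi φ z := by
  unfold zphi
  split_ifs <;> simp_all

/-- The integrand `e^{i⟨ξ,z⟩} - 1 - i⟨ξ,z^{(φ)}⟩` of the characteristic exponent. -/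
def compInt (φ : ℝ → ℝ) {d : ℕ} (ξ z : E d) : ℂ :=
  Complex.exp (Complex.I * ((inner ℝ ξ z : ℝ) : ℂ)) - 1
    - Complex.I * ((inner ℝ ξ (zphi φ z) : ℝ) : ℂ)

lemma measurable_compInt_comp (φ : ℝ → ℝ) {d : ℕ} {α : Type*} [MeasurableSpace α]
    {f g : α → E d} (hf : Measurable f) (hg : Measurable g) :
    Measurable fun a => compInt φ (f a) (g a) := by
  have h1 : Measurable fun a => inner ℝ (f a) (zphi φ (g a)) :=
    hf.inner ((measurable_zphi φ).comp hg)
  have h2 : Measurable fun a => inner ℝ (f a) (g a) := hf.inner hg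
  unfold compInt
  fun_prop

lemma norm_exp_I_sub_one_le_two (x : ℝ) :
    ‖Complex.exp (Complex.I * (x : ℂ)) - 1‖ ≤ 2 := by
  refine (norm_sub_le _ _).trans ?_
  rw [norm_exp_I_mul, norm_one]; norm_num

/-- The compensated exponential is dominated by the moment function `γ^{(1)}_φ`. -/
lemma norm_compInt_le (φ : ℝ → ℝ) {d : ℕ} (ξ z : E d) :
    ‖compInt φ ξ z‖ ≤ 2 * (1 + ‖ξ‖) ^ 2 * gamma1 φ ‖z‖ := by
  have hx := abs_inner_le ξ z
  have h2 := norm_exp_I_sub_one_le_two (inner ℝ ξ z)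
  have h1 := norm_exp_I_sub_one_le (inner ℝ ξ z)
  have hs := norm_exp_I_sub_one_sub_le (inner ℝ ξ z)
  have hξ := norm_nonneg ξ
  have hz := norm_nonneg z
  have hsq : (inner ℝ ξ z : ℝ) ^ 2 ≤ (‖ξ‖ * ‖z‖) ^ 2 := by
    rw [← sq_abs]; gcongr
  have hs' : ‖Complex.exp (Complex.I * ((inner ℝ ξ z : ℝ) : ℂ)) - 1
      - Complex.I * ((inner ℝ ξ z : ℝ) : ℂ)‖ ≤ 2 * (1 + ‖ξ‖) ^ 2 * ‖z‖ ^ 2 := by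
    refine hs.trans ?_
    rw [mul_assoc]
    gcongr
    refine hsq.trans ?_
    rw [mul_pow]; gcongr; linarith
  unfold compInt
  rcases case1_or φ with h | ⟨h, h'⟩ | ⟨h, h', h''⟩
  · rw [zphi_case1 h, gamma1_case1 h, inner_zero_right, Complex.ofReal_zero, mul_zero, sub_zero]
    rcases le_total ‖z‖ 1 with hz1 | hz1
    · rw [min_eq_left hz1]; refine h1.trans (hx.trans ?_); gcongr; nlinarith
    · rw [min_eq_right hz1]; nlinarith
  · rw [zphi_case2 h', gamma1_case2 h h']
    split_ifs with hz1
    · rw [min_eq_left (by nlinarith)]; exact hs'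
    · rw [min_eq_right (by nlinarith), inner_zero_right, Complex.ofReal_zero, mul_zero, sub_zero]
      nlinarith
  · rw [zphi_case3 h' h'', gamma1_case3 h h']
    rcases le_total ‖z‖ 1 with hz1 | hz1
    · rw [min_eq_left (by nlinarith)]; exact hs'
    · rw [min_eq_right (by nlinarith)]
      refine (norm_sub_le _ _).trans ?_
      rw [norm_mul, Complex.norm_I, one_mul, Complex.norm_real, Real.norm_eq_abs]
      have : 2 * ‖z‖ + 2 * ‖ξ‖ * ‖z‖ ≤ 2 * (1 + ‖ξ‖) ^ 2 * ‖z‖ := by nlinarith [mul_nonneg hξ hz]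
      nlinarith [mul_nonneg hξ hz]

namespace Adm

variable {Θ : Theta} {φ : ℝ → ℝ} (h : Adm Θ φ)

include h

lemma lintegral_radial {f : ℝ → ℝ} (hf : ContinuousOn f (Ioi 0)) :
    ∫⁻ z : E Θ.d, ENNReal.ofReal (f ‖z‖ / radVol Θ.d φ ‖z‖) =
      ENNReal.ofReal (sphereArea Θ.d) *
        ∫⁻ r in Ioi (0 : ℝ), ENNReal.ofReal (f r / (r * φ r)) := by
  have hcont : ContinuousOn (fun r => f r / radVol Θ.d φ r) (Ioi 0) :=
    hf.div ((continuousOn_id.pow _).mul h.continuousOn_phi) fun r hr => (h.radVol_pos hr).ne'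
  rw [lintegral_norm h.d_pos (f := fun r => ENNReal.ofReal (f r / radVol Θ.d φ r))
    (measurable_subtype_of_continuousOn hcont).ennreal_ofReal]
  congr 1
  refine setLIntegral_congr_fun measurableSet_Ioi fun r hr => ?_
  have hr0 : 0 < r := hr
  have hφ := h.phi_pos hr0
  rw [← ENNReal.ofReal_mul (by positivity)]
  congr 1
  unfold radVol
  obtain ⟨n, hn⟩ := Nat.exists_eq_add_of_le' h.d_pos
  rw [hn, Nat.add_sub_cancel, pow_succ]
  field_simp

lemma continuous_radVol_norm : Continuous fun z : E Θ.d => radVol Θ.d φ ‖z‖ :=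
  (continuous_norm.pow _).mul h.continuous_phi_norm

/-- The Lévy measure `dz / V(|z|)` integrates `γ^{(1)}_φ`: near zero by the finiteness of `c₀` or,
in case 1, by that of `∫ dr / φ(r)`; at infinity by the finiteness of `c₀` or, in case 3, by that of
`∫ dr / φ(r)`. -/
lemma integrable_gamma1 :
    Integrable fun z : E Θ.d => gamma1 φ ‖z‖ / radVol Θ.d φ ‖z‖ := by
  have hm : Measurable fun z : E Θ.d => gamma1 φ ‖z‖ / radVol Θ.d φ ‖z‖ :=
    ((continuous_gamma1 φ).comp continuous_norm).measurable.div h.continuous_radVol_norm.measurable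
  have hnn : ∀ z : E Θ.d, 0 ≤ gamma1 φ ‖z‖ / radVol Θ.d φ ‖z‖ := fun z =>
    div_nonneg (gamma1_nonneg φ (norm_nonneg z)) (h.radVol_nonneg (norm_nonneg z))
  refine ⟨hm.aestronglyMeasurable, ?_⟩
  rw [hasFiniteIntegral_iff_ofReal (ae_of_all _ hnn),
    h.lintegral_radial (continuous_gamma1 φ).continuousOn]
  refine ENNReal.mul_lt_top ENNReal.ofReal_lt_top ?_
  have hsmall : ∫⁻ r in Ioc (0 : ℝ) 1, ENNReal.ofReal (gamma1 φ r / (r * φ r)) < ∞ := by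
    by_cases h1 : Case1 φ
    · have := h1.2
      rw [hasFiniteIntegral_iff_ofReal] at this
      · refine lt_of_le_of_lt (setLIntegral_mono' measurableSet_Ioc fun r hr => ?_) this
        have hr0 : 0 < r := hr.1
        have := h.phi_pos hr0
        rw [gamma1_case1 h1, min_eq_left hr.2]
        refine ENNReal.ofReal_le_ofReal (le_of_eq ?_)
        field_simp
      · refine (ae_restrict_iff' measurableSet_Ioc).2 (ae_of_all _ fun r hr => ?_)
        exact one_div_nonneg.2 (h.phi_pos hr.1).le
    · refine lt_of_le_of_lt ?_ h.scale.c0_lt_top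
      refine le_trans (setLIntegral_mono' measurableSet_Ioc fun r hr => ?_)
        (lintegral_mono_set Ioc_subset_Ioi_self)
      have hr0 : 0 < r := hr.1
      have := h.phi_pos hr0
      have hg : gamma1 φ r = min (r ^ 2) 1 := by
        by_cases h2 : Case2 φ
        · exact gamma1_case2 h1 h2 r
        · rw [gamma1_case3 h1 h2, min_eq_left (by nlinarith [hr.2]),
            min_eq_left (by nlinarith [hr.2])]
      rw [hg]
  have hlarge : ∫⁻ r in Ioi (1 : ℝ), ENNReal.ofReal (gamma1 φ r / (r * φ r)) < ∞ := by
    rcases case1_or φ with h1 | ⟨h1, h2⟩ | ⟨h1, h2, h3⟩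
    · refine lt_of_le_of_lt ?_ h.scale.c0_lt_top
      refine le_trans (setLIntegral_mono' measurableSet_Ioi fun r hr => ?_)
        (lintegral_mono_set (Ioi_subset_Ioi zero_le_one))
      have hr0 : 1 < r := hr
      rw [gamma1_case1 h1, min_eq_right hr0.le, min_eq_right (by nlinarith)]
    · refine lt_of_le_of_lt ?_ h.scale.c0_lt_top
      refine le_trans (setLIntegral_mono' measurableSet_Ioi fun r hr => ?_)
        (lintegral_mono_set (Ioi_subset_Ioi zero_le_one))
      rw [gamma1_case2 h1 h2]
    · have := h3.2.2
      rw [hasFiniteIntegral_iff_ofReal] at this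
      · refine lt_of_le_of_lt ?_ this
        refine le_trans (setLIntegral_mono' measurableSet_Ioi fun r hr => ?_)
          (lintegral_mono_set Ioi_subset_Ici_self)
        have hr0 : 1 < r := hr
        have := h.phi_pos (zero_lt_one.trans hr0)
        rw [gamma1_case3 h1 h2, min_eq_right (by nlinarith)]
        refine ENNReal.ofReal_le_ofReal (le_of_eq ?_)
        field_simp
      · refine (ae_restrict_iff' measurableSet_Ici).2 (ae_of_all _ fun r hr => ?_)
        exact one_div_nonneg.2 (h.phi_pos (zero_lt_one.trans_le hr)).le
  rw [← Ioc_union_Ioi_eq_Ioi (zero_le_one : (0 : ℝ) ≤ 1)]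
  exact (lintegral_union_le _ _ _).trans_lt (ENNReal.add_lt_top.2 ⟨hsmall, hlarge⟩)

/-- Functions dominated by `γ^{(1)}` are integrable against the jump kernel. -/
lemma integrable_of_gamma1 {F : Type*} [NormedAddCommGroup F] {f : E Θ.d → F} {A : ℝ}
    (hf : AEStronglyMeasurable f)
    (hle : ∀ z, ‖f z‖ ≤ A * (gamma1 φ ‖z‖ / radVol Θ.d φ ‖z‖)) : Integrable f :=
  (h.integrable_gamma1.const_mul A).mono' hf (ae_of_all _ hle)

end Adm

/-- Measurable functions with values in `[a, b]`. -/
structure KBound {d : ℕ} (k : E d → ℝ) (a b : ℝ) : Prop where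
  measurable : Measurable k
  pos : 0 < a
  lower : ∀ z, a ≤ k z
  upper : ∀ z, k z ≤ b

/-- The time integral `∫_t^s κ(r, y, z) dr`. -/
def timeKernel {d : ℕ} (κ : ℝ → E d → E d → ℝ) (y : E d) (t s : ℝ) (z : E d) : ℝ :=
  ∫ r in t..s, κ r y z

section Kernel

variable {Θ : Theta} {φ ℓ : ℝ → ℝ} {κ : ℝ → E Θ.d → E Θ.d → ℝ}

lemma KernelBounds.measurable_comp (hκ : KernelBounds κ Θ.κ₀ ℓ) {α : Type*} [MeasurableSpace α]
    {f : α → ℝ} {g k : α → E Θ.d} (hf : Measurable f) (hg : Measurable g) (hk : Measurable k) :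
    Measurable fun a => κ (f a) (g a) (k a) :=
  hκ.measurable.comp (hf.prodMk (hg.prodMk hk))

lemma KernelBounds.nonneg (hκ : KernelBounds κ Θ.κ₀ ℓ) {t : ℝ} (ht : 0 ≤ t) (x z : E Θ.d) :
    0 ≤ κ t x z :=
  (inv_nonneg.2 (zero_le_one.trans hκ.one_le)).trans (hκ.lower t ht x z)

lemma KernelBounds.intervalIntegrable (hκ : KernelBounds κ Θ.κ₀ ℓ) {t s : ℝ} (ht : 0 ≤ t)
    (hts : t ≤ s) (y z : E Θ.d) : IntervalIntegrable (fun r => κ r y z) volume t s := by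
  rw [intervalIntegrable_iff_integrableOn_Ioc_of_le hts]
  refine Measure.integrableOn_of_bounded (M := Θ.κ₀) (by simp)
    (hκ.measurable_comp measurable_id measurable_const measurable_const).aestronglyMeasurable ?_
  refine (ae_restrict_iff' measurableSet_Ioc).2 (ae_of_all _ fun r hr => ?_)
  have hr0 : 0 ≤ r := ht.trans hr.1.le
  rw [Real.norm_of_nonneg (hκ.nonneg hr0 _ _)]
  exact hκ.upper r hr0 y z

/-- The time integral of the kernel is comparable with the length of the time interval. -/
lemma KernelBounds.kBound (hκ : KernelBounds κ Θ.κ₀ ℓ) {t s : ℝ} (ht : 0 ≤ t) (hts : t < s)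
    (y : E Θ.d) : KBound (timeKernel κ y t s) (Θ.κ₀⁻¹ * (s - t)) (Θ.κ₀ * (s - t)) where
  measurable := by
    unfold timeKernel
    simp_rw [intervalIntegral.integral_of_le hts.le]
    have : StronglyMeasurable fun p : E Θ.d × ℝ => κ p.2 y p.1 :=
      (hκ.measurable_comp measurable_snd measurable_const measurable_fst).stronglyMeasurable
    exact this.integral_prod_right.measurable
  pos := by
    have := hκ.one_le
    have : 0 < s - t := by linarith
    positivity
  lower z := by
    have := intervalIntegral.integral_mono_on hts.le (intervalIntegrable_const (c := Θ.κ₀⁻¹))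
      (hκ.intervalIntegrable ht hts.le y z) fun r hr => hκ.lower r (ht.trans hr.1) y z
    rwa [intervalIntegral.integral_const, smul_eq_mul, mul_comm] at this
  upper z := by
    have := intervalIntegral.integral_mono_on hts.le (hκ.intervalIntegrable ht hts.le y z)
      (intervalIntegrable_const (c := Θ.κ₀)) fun r hr => hκ.upper r (ht.trans hr.1) y z
    rwa [intervalIntegral.integral_const, smul_eq_mul, mul_comm] at this

/-- The order of the integrals in time and space is exchanged, so that the frozen law is that of a
time-homogeneous Lévy process with jump kernel `timeKernel κ y t s`. -/
lemma charExponent_eq (h : Adm Θ φ) (hκ : KernelBounds κ Θ.κ₀ ℓ) {t s : ℝ} (ht : 0 ≤ t)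
    (hts : t ≤ s) (y ξ : E Θ.d) : charExponent φ κ y t s ξ =
      ∫ z, compInt φ ξ z * ((timeKernel κ y t s z / radVol Θ.d φ ‖z‖ : ℝ) : ℂ) := by
  have hV := h.continuous_radVol_norm.measurable
  have hce : charExponent φ κ y t s ξ = ∫ r in Ioc t s, ∫ z,
      compInt φ ξ z * ((κ r y z / radVol Θ.d φ ‖z‖ : ℝ) : ℂ) := by
    rw [← intervalIntegral.integral_of_le hts]
    rfl
  have hswap := integral_integral_swap (μ := volume.restrict (Ioc t s))
    (ν := (volume : Measure (E Θ.d)))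
    (f := fun r z => compInt φ ξ z * ((κ r y z / radVol Θ.d φ ‖z‖ : ℝ) : ℂ)) ?_
  · rw [hce, hswap]
    congr 1
    ext z
    rw [integral_const_mul, integral_complex_ofReal, integral_div, timeKernel,
      intervalIntegral.integral_of_le hts]
  · have hdom : Integrable (fun p : ℝ × E Θ.d => 2 * (1 + ‖ξ‖) ^ 2 * Θ.κ₀ *
        (gamma1 φ ‖p.2‖ / radVol Θ.d φ ‖p.2‖)) ((volume.restrict (Ioc t s)).prod volume) :=
      (h.integrable_gamma1.const_mul _).comp_snd _
    refine hdom.mono' ?_ ?_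
    · have h1 : Measurable fun p : ℝ × E Θ.d => compInt φ ξ p.2 :=
        measurable_compInt_comp φ measurable_const measurable_snd
      have h2 : Measurable fun p : ℝ × E Θ.d => κ p.1 y p.2 :=
        hκ.measurable_comp measurable_fst measurable_const measurable_snd
      have h3 : Measurable fun p : ℝ × E Θ.d => radVol Θ.d φ ‖p.2‖ := hV.comp measurable_snd
      exact (h1.mul (h2.div h3).complex_ofReal).aestronglyMeasurable
    · have : (volume.restrict (Ioc t s)).prod (volume : Measure (E Θ.d)) =
          (volume.prod volume).restrict (Ioc t s ×ˢ univ) := by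
        rw [← Measure.prod_restrict, Measure.restrict_univ]
      rw [this, ae_restrict_iff' (measurableSet_Ioc.prod MeasurableSet.univ)]
      refine ae_of_all _ fun p hp => ?_
      have hr0 : 0 ≤ p.1 := ht.trans hp.1.1.le
      have hV0 := h.radVol_nonneg (norm_nonneg p.2)
      simp only [Function.uncurry]
      rw [norm_mul, Complex.norm_real, Real.norm_of_nonneg (div_nonneg (hκ.nonneg hr0 _ _) hV0)]
      calc ‖compInt φ ξ p.2‖ * (κ p.1 y p.2 / radVol Θ.d φ ‖p.2‖)
          ≤ (2 * (1 + ‖ξ‖) ^ 2 * gamma1 φ ‖p.2‖) * (Θ.κ₀ / radVol Θ.d φ ‖p.2‖) :=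
            mul_le_mul (norm_compInt_le φ ξ p.2)
              (div_le_div_of_nonneg_right (hκ.upper _ hr0 _ _) hV0)
              (div_nonneg (hκ.nonneg hr0 _ _) hV0)
              (mul_nonneg (by positivity) (gamma1_nonneg φ (norm_nonneg _)))
        _ = _ := by ring

end Kernel

/-! ### Truncated and rescaled jump measures -/

/-- The image under `z ↦ z / a` of the jump measure `k(z) / V(|z|) dz` restricted to `s`. -/
def jumpMeasure {d : ℕ} (φ : ℝ → ℝ) (k : E d → ℝ) (a : ℝ) (s : Set (E d)) : Measure (E d) :=
  ((volume.restrict s).withDensity fun z => ENNReal.ofReal (k z / radVol d φ ‖z‖)).map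
    fun z => a⁻¹ • z

/-- The vector `z 1_{|z| ≤ a} - z^{(φ)}`, whose integral against the jump kernel is the drift that
arises when the compensation is moved to the level `a`. -/
def driftInt {d : ℕ} (φ : ℝ → ℝ) (a : ℝ) (z : E d) : E d := (if ‖z‖ ≤ a then z else 0) - zphi φ z

/-- The characteristic exponent of the Lévy process with jump kernel `k(z) / V(|z|)`. -/
def levyExponent {d : ℕ} (φ : ℝ → ℝ) (k : E d → ℝ) (ξ : E d) : ℂ :=
  ∫ z, compInt φ ξ z * ((k z / radVol d φ ‖z‖ : ℝ) : ℂ)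

/-- The function with Fourier transform `exp (levyExponent φ k)`. -/
def levyDensity {d : ℕ} (φ : ℝ → ℝ) (k : E d → ℝ) (x : E d) : ℝ :=
  ((2 * Real.pi) ^ d)⁻¹ * (invFourier (fun ξ => Complex.exp (levyExponent φ k ξ)) x).re

lemma measurable_driftInt {d : ℕ} (φ : ℝ → ℝ) (a : ℝ) :
    Measurable (driftInt φ a : E d → E d) :=
  (Measurable.ite (measurableSet_le measurable_norm measurable_const) measurable_id
    measurable_const).sub (measurable_zphi φ)

lemma gamma1_div_le (φ : ℝ → ℝ) {a r : ℝ} (ha : a ∈ Ioc (0 : ℝ) 1) (hr : 0 ≤ r) :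
    gamma1 φ (r / a) ≤ (a ^ 2)⁻¹ * gamma1 φ r := by
  obtain ⟨ha0, ha1⟩ := ha
  have h1 : 1 ≤ (a ^ 2)⁻¹ := one_le_inv_iff₀.2 ⟨by positivity, by nlinarith⟩
  have h2 : r / a ≤ (a ^ 2)⁻¹ * r := by
    rw [div_eq_mul_inv, mul_comm]
    gcongr
    nlinarith
  have h3 : (r / a) ^ 2 = (a ^ 2)⁻¹ * r ^ 2 := by rw [div_pow, div_eq_mul_inv, mul_comm]
  have h0 : 0 ≤ (a ^ 2)⁻¹ := by positivity
  unfold gamma1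
  split_ifs
  · rw [mul_min_of_nonneg _ _ h0]; exact min_le_min h2 (by linarith)
  · rw [mul_min_of_nonneg _ _ h0, h3]; exact min_le_min le_rfl (by linarith)
  · rw [mul_min_of_nonneg _ _ h0, h3]; exact min_le_min le_rfl h2

/-- In cases 1 and 3 the change of the compensation consists of the jumps below, respectively above,
the level `a` only, and gains a factor `a`. -/
lemma norm_driftInt_le_of_not_case2 {φ : ℝ → ℝ} (h2 : ¬ (¬ Case1 φ ∧ Case2 φ)) {d : ℕ} {a : ℝ}
    (ha : 0 < a) (z : E d) : ‖driftInt φ a z‖ ≤ a * gamma1 φ (‖z‖ / a) := by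
  have hz := norm_nonneg z
  unfold driftInt
  rcases case1_or φ with h | h | ⟨h, h', h''⟩
  · rw [zphi_case1 h, sub_zero, gamma1_case1 h]
    split_ifs with hza
    · rw [min_eq_left ((div_le_one ha).2 hza), mul_div_cancel₀ _ ha.ne']
    · rw [norm_zero]; positivity
  · exact absurd h h2
  · rw [zphi_case3 h' h'', gamma1_case3 h h']
    split_ifs with hza
    · rw [sub_self, norm_zero]; positivity
    · have : 1 ≤ ‖z‖ / a := (one_le_div ha).2 (not_le.1 hza).le
      rw [min_eq_right (by nlinarith), zero_sub, norm_neg, mul_div_cancel₀ _ ha.ne']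

/-- The change of the compensation when the truncation is moved to the level `a`. -/
lemma norm_driftInt_le (φ : ℝ → ℝ) {d : ℕ} {a : ℝ} (ha : a ∈ Ioc (0 : ℝ) 1) (z : E d) :
    ‖driftInt φ a z‖ ≤ gamma1 φ (‖z‖ / a) := by
  have ha0 := ha.1
  have hz := norm_nonneg z
  by_cases h2 : ¬ Case1 φ ∧ Case2 φ
  · unfold driftInt
    rw [zphi_case2 h2.2, gamma1_case2 h2.1 h2.2]
    split_ifs with h3 h4 h4
    · rw [sub_self, norm_zero]; positivity
    · exact absurd (h3.trans ha.2) h4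
    · have : 1 ≤ ‖z‖ / a := (one_le_div ha.1).2 (not_le.1 h3).le
      rw [min_eq_right (by nlinarith), zero_sub, norm_neg]; exact h4
    · rw [sub_self, norm_zero]; positivity
  · refine (norm_driftInt_le_of_not_case2 h2 ha.1 z).trans ?_
    exact mul_le_of_le_one_left (gamma1_nonneg φ (div_nonneg hz ha.1.le)) ha.2

section

variable {Θ : Theta} {φ : ℝ → ℝ} (h : Adm Θ φ) {k : E Θ.d → ℝ} {A B : ℝ} (hk : KBound k A B)

include h hk

lemma KBound.div_nonneg' (z : E Θ.d) : 0 ≤ k z / radVol Θ.d φ ‖z‖ :=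
  div_nonneg (hk.pos.le.trans (hk.lower z)) (h.radVol_nonneg (norm_nonneg z))

lemma KBound.upper_pos : 0 < B := hk.pos.trans_le ((hk.lower 0).trans (hk.upper 0))

lemma KBound.measurable_div : Measurable fun z => k z / radVol Θ.d φ ‖z‖ :=
  hk.measurable.div h.continuous_radVol_norm.measurable

lemma lintegral_jumpMeasure (a : ℝ) (s : Set (E Θ.d)) {F : E Θ.d → ℝ≥0∞}
    (hF : Measurable F) : ∫⁻ z, F z ∂(jumpMeasure φ k a s) =
      ∫⁻ z in s, ENNReal.ofReal (k z / radVol Θ.d φ ‖z‖) * F (a⁻¹ • z) := by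
  have hm : Measurable fun z : E Θ.d => a⁻¹ • z := measurable_const_smul _
  have hmF : Measurable fun z : E Θ.d => F (a⁻¹ • z) := hF.comp hm
  rw [jumpMeasure, lintegral_map hF hm, lintegral_withDensity_eq_lintegral_mul _
    (hk.measurable_div h).ennreal_ofReal hmF]
  rfl

lemma integrable_jumpMeasure_iff {F : Type*} [NormedAddCommGroup F] [NormedSpace ℝ F]
    [SecondCountableTopology F] [MeasurableSpace F] [BorelSpace F]
    (a : ℝ) (s : Set (E Θ.d)) {g : E Θ.d → F} (hg : Continuous g) :
    Integrable g (jumpMeasure φ k a s) ↔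
      IntegrableOn (fun z => (k z / radVol Θ.d φ ‖z‖) • g (a⁻¹ • z)) s := by
  have hm : Measurable fun z : E Θ.d => a⁻¹ • z := measurable_const_smul _
  rw [jumpMeasure, integrable_map_measure hg.aestronglyMeasurable hm.aemeasurable,
    integrable_withDensity_iff_integrable_smul' (hk.measurable_div h).ennreal_ofReal
      (ae_of_all _ fun z => ENNReal.ofReal_lt_top), IntegrableOn]
  simp only [ENNReal.toReal_ofReal (hk.div_nonneg' h _), Function.comp_def]

lemma integral_jumpMeasure {F : Type*} [NormedAddCommGroup F] [NormedSpace ℝ F]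
    [SecondCountableTopology F] [MeasurableSpace F] [BorelSpace F]
    (a : ℝ) (s : Set (E Θ.d)) {g : E Θ.d → F} (hg : Continuous g) :
    ∫ z, g z ∂(jumpMeasure φ k a s) =
      ∫ z in s, (k z / radVol Θ.d φ ‖z‖) • g (a⁻¹ • z) := by
  have hm : Measurable fun z : E Θ.d => a⁻¹ • z := measurable_const_smul _
  rw [jumpMeasure, integral_map hm.aemeasurable hg.aestronglyMeasurable,
    integral_withDensity_eq_integral_toReal_smul (hk.measurable_div h).ennreal_ofReal
      (ae_of_all _ fun z => ENNReal.ofReal_lt_top)]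
  simp only [ENNReal.toReal_ofReal (hk.div_nonneg' h _)]

/-- Functions dominated by `γ^{(1)}` are integrable against the jump measure. -/
lemma KBound.integrable_smul {F : Type*} [NormedAddCommGroup F] [NormedSpace ℝ F]
    {f : E Θ.d → F} {D : ℝ} (hf : AEStronglyMeasurable f)
    (hle : ∀ z, ‖f z‖ ≤ D * gamma1 φ ‖z‖) :
    Integrable fun z => (k z / radVol Θ.d φ ‖z‖) • f z := by
  refine h.integrable_of_gamma1 (A := B * D)
    ((hk.measurable_div h).aestronglyMeasurable.smul hf) fun z => ?_
  have hV := h.radVol_nonneg (norm_nonneg z)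
  have hB := hk.upper_pos h
  rw [norm_smul, Real.norm_of_nonneg (hk.div_nonneg' h z)]
  calc k z / radVol Θ.d φ ‖z‖ * ‖f z‖ ≤ B / radVol Θ.d φ ‖z‖ * (D * gamma1 φ ‖z‖) :=
        mul_le_mul (div_le_div_of_nonneg_right (hk.upper z) hV) (hle z) (norm_nonneg _)
          (div_nonneg hB.le hV)
    _ = _ := by ring

lemma KBound.integrable_driftInt {a : ℝ} (ha : a ∈ Ioc (0 : ℝ) 1) :
    Integrable fun z => (k z / radVol Θ.d φ ‖z‖) • driftInt φ a z :=
  hk.integrable_smul h (measurable_driftInt φ a).aestronglyMeasurable fun z =>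
    (norm_driftInt_le φ ha z).trans (gamma1_div_le φ ha (norm_nonneg z))

lemma KBound.integrable_sq {a : ℝ} (ha : a ∈ Ioc (0 : ℝ) 1) :
    IntegrableOn (fun z => (k z / radVol Θ.d φ ‖z‖) • ‖a⁻¹ • z‖ ^ 2)
      (Metric.closedBall 0 a) := by
  have ha0 := ha.1
  have h1 : Integrable fun z : E Θ.d => (k z / radVol Θ.d φ ‖z‖) •
      (Metric.closedBall (0 : E Θ.d) a).indicator (fun z => ‖a⁻¹ • z‖ ^ 2) z := by
    refine hk.integrable_smul h (D := (a ^ 2)⁻¹) ?_ fun z => ?_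
    · exact (Measurable.indicator (by fun_prop) measurableSet_closedBall).aestronglyMeasurable
    · by_cases hz : z ∈ Metric.closedBall (0 : E Θ.d) a
      · rw [indicator_of_mem hz, norm_smul, norm_inv, mul_pow, Real.norm_of_nonneg ha0.le, inv_pow,
          Real.norm_of_nonneg (by positivity)]
        gcongr
        refine le_trans (le_of_eq ?_) (gamma0_le_gamma1 φ (norm_nonneg z))
        have hz' : ‖z‖ ≤ 1 := (mem_closedBall_zero_iff.1 hz).trans ha.2
        rw [gamma0, min_eq_left (by nlinarith [norm_nonneg z])]
      · rw [indicator_of_notMem hz, norm_zero]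
        have := gamma1_nonneg φ (norm_nonneg z)
        positivity
  refine h1.integrableOn.congr_fun (fun z hz => ?_) measurableSet_closedBall
  simp only [indicator_of_mem hz]

lemma KBound.integrableOn_compl {a : ℝ} (ha : a ∈ Ioc (0 : ℝ) 1) :
    IntegrableOn (fun z => k z / radVol Θ.d φ ‖z‖) (Metric.closedBall 0 a)ᶜ := by
  have ha0 := ha.1
  have hs : MeasurableSet (Metric.closedBall (0 : E Θ.d) a)ᶜ := measurableSet_closedBall.compl
  have h1 : Integrable fun z : E Θ.d => (k z / radVol Θ.d φ ‖z‖) •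
      (Metric.closedBall (0 : E Θ.d) a)ᶜ.indicator (fun z => (1 : ℝ)) z := by
    refine hk.integrable_smul h (D := (a ^ 2)⁻¹)
      (measurable_const.indicator hs).aestronglyMeasurable fun z => ?_
    by_cases hz : z ∈ (Metric.closedBall (0 : E Θ.d) a)ᶜ
    · rw [indicator_of_mem hz, norm_one]
      have hz' : a < ‖z‖ := by simpa using hz
      have h1 : a ^ 2 ≤ gamma0 ‖z‖ := le_min (by gcongr) (pow_le_one₀ ha0.le ha.2)
      have h2 := h1.trans (gamma0_le_gamma1 φ (norm_nonneg z))
      rw [← div_eq_inv_mul, le_div_iff₀ (by positivity), one_mul]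
      exact h2
    · rw [indicator_of_notMem hz, norm_zero]
      have := gamma1_nonneg φ (norm_nonneg z)
      positivity
  refine h1.integrableOn.congr_fun (fun z hz => ?_) hs
  simp only [indicator_of_mem hz, smul_eq_mul, mul_one]

lemma isFiniteMeasure_jumpMeasure {a : ℝ} (ha : a ∈ Ioc (0 : ℝ) 1) :
    IsFiniteMeasure (jumpMeasure φ k a (Metric.closedBall 0 a)ᶜ) := by
  constructor
  have h1 := lintegral_jumpMeasure h hk a (Metric.closedBall 0 a)ᶜ
    (measurable_const (a := (1 : ℝ≥0∞)))
  simp only [lintegral_const, one_mul, mul_one] at h1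
  rw [h1]
  have h2 := (hk.integrableOn_compl h ha).2
  rwa [hasFiniteIntegral_iff_ofReal (ae_of_all _ fun z => hk.div_nonneg' h z)] at h2

/-- Decomposition of the rescaled exponent into small jumps, drift and large jumps. -/
lemma levyExponent_decomp {a : ℝ} (ha : a ∈ Ioc (0 : ℝ) 1) (η : E Θ.d) :
    levyExponent φ k (a⁻¹ • η) =
      smallExponent (jumpMeasure φ k a (Metric.closedBall 0 a)) η
      + Complex.I * ((inner ℝ η (a⁻¹ • ∫ z, (k z / radVol Θ.d φ ‖z‖) • driftInt φ a z) : ℝ) : ℂ)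
      + (charFun (jumpMeasure φ k a (Metric.closedBall 0 a)ᶜ) η
        - (jumpMeasure φ k a (Metric.closedBall 0 a)ᶜ).real univ) := by
  have ha0 := ha.1
  have hfin := isFiniteMeasure_jumpMeasure h hk ha
  set S := Metric.closedBall (0 : E Θ.d) a with hS
  have hSm : MeasurableSet S := measurableSet_closedBall
  set J : E Θ.d → ℝ := fun z => k z / radVol Θ.d φ ‖z‖ with hJ
  have hin : ∀ z : E Θ.d, inner ℝ η (a⁻¹ • z) = inner ℝ (a⁻¹ • η) z := fun z => by
    rw [real_inner_smul_right, real_inner_smul_left]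
  -- small jumps
  have e1 : smallExponent (jumpMeasure φ k a S) η = ∫ z in S, J z •
      (Complex.exp (Complex.I * ((inner ℝ (a⁻¹ • η) z : ℝ) : ℂ)) - 1
        - Complex.I * ((inner ℝ (a⁻¹ • η) z : ℝ) : ℂ)) := by
    rw [smallExponent, integral_jumpMeasure h hk a S (by fun_prop)]
    simp only [hin, hJ]
  have i1 : IntegrableOn (fun z => J z •
      (Complex.exp (Complex.I * ((inner ℝ (a⁻¹ • η) z : ℝ) : ℂ)) - 1
        - Complex.I * ((inner ℝ (a⁻¹ • η) z : ℝ) : ℂ))) S := by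
    have hsq : Integrable (fun z => ‖z‖ ^ 2) (jumpMeasure φ k a S) :=
      (integrable_jumpMeasure_iff h hk a S (by fun_prop)).2 (hk.integrable_sq h ha)
    have := (integrable_jumpMeasure_iff h hk a S (by fun_prop)).1 (integrable_smallExponent hsq η)
    simpa only [hin] using this
  -- large jumps
  have hexp : Integrable (fun z => Complex.exp (Complex.I * ((inner ℝ η z : ℝ) : ℂ)))
      (jumpMeasure φ k a Sᶜ) := by
    refine (integrable_const (1 : ℝ)).mono' (by fun_prop) (ae_of_all _ fun z => ?_)
    rw [norm_exp_I_mul]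
  have hcont : Continuous fun z : E Θ.d =>
      Complex.exp (Complex.I * ((inner ℝ η z : ℝ) : ℂ)) - 1 := by fun_prop
  have hsub : Integrable (fun z => Complex.exp (Complex.I * ((inner ℝ η z : ℝ) : ℂ)) - 1)
      (jumpMeasure φ k a Sᶜ) := hexp.sub (integrable_const 1)
  have e3 : charFun (jumpMeasure φ k a Sᶜ) η - (jumpMeasure φ k a Sᶜ).real univ =
      ∫ z in Sᶜ, J z • (Complex.exp (Complex.I * ((inner ℝ (a⁻¹ • η) z : ℝ) : ℂ)) - 1) := by
    have : charFun (jumpMeasure φ k a Sᶜ) η - (jumpMeasure φ k a Sᶜ).real univ =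
        ∫ z, (Complex.exp (Complex.I * ((inner ℝ η z : ℝ) : ℂ)) - 1) ∂(jumpMeasure φ k a Sᶜ) := by
      rw [integral_sub hexp (integrable_const 1), charFun_apply, integral_const, Complex.real_smul,
        mul_one]
      congr 2
      ext z
      rw [real_inner_comm, mul_comm]
    rw [this, integral_jumpMeasure h hk a Sᶜ hcont]
    simp only [hin, hJ]
  have i3 : IntegrableOn (fun z => J z •
      (Complex.exp (Complex.I * ((inner ℝ (a⁻¹ • η) z : ℝ) : ℂ)) - 1)) Sᶜ := by
    have := (integrable_jumpMeasure_iff h hk a Sᶜ hcont).1 hsub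
    simpa only [hin] using this
  -- drift
  have i2' := hk.integrable_driftInt h ha
  have i2 : Integrable fun z => Complex.I *
      ((inner ℝ (a⁻¹ • η) (J z • driftInt φ a z) : ℝ) : ℂ) :=
    ((i2'.const_inner (𝕜 := ℝ) (a⁻¹ • η)).ofReal).const_mul Complex.I
  have e2 : Complex.I * ((inner ℝ η (a⁻¹ • ∫ z, J z • driftInt φ a z) : ℝ) : ℂ) =
      ∫ z, Complex.I * ((inner ℝ (a⁻¹ • η) (J z • driftInt φ a z) : ℝ) : ℂ) := by
    rw [hin, integral_const_mul, integral_complex_ofReal, integral_inner i2']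
  have i12 : Integrable fun z => S.indicator (fun z => J z •
      (Complex.exp (Complex.I * ((inner ℝ (a⁻¹ • η) z : ℝ) : ℂ)) - 1
        - Complex.I * ((inner ℝ (a⁻¹ • η) z : ℝ) : ℂ))) z +
      Complex.I * ((inner ℝ (a⁻¹ • η) (J z • driftInt φ a z) : ℝ) : ℂ) :=
    ((integrable_indicator_iff hSm).2 i1).add i2
  rw [e1, e2, e3, ← integral_indicator hSm, ← integral_indicator hSm.compl,
    ← integral_add ((integrable_indicator_iff hSm).2 i1) i2,
    ← integral_add i12 ((integrable_indicator_iff hSm.compl).2 i3), levyExponent]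
  congr 1
  ext z
  have hzS : z ∈ S ↔ ‖z‖ ≤ a := mem_closedBall_zero_iff
  by_cases hz : z ∈ S
  · rw [indicator_of_mem hz, indicator_of_notMem (by simpa using hz), driftInt,
      if_pos (hzS.1 hz), inner_smul_right, inner_sub_right, compInt]
    simp only [Complex.real_smul, hJ]
    push_cast
    ring
  · rw [indicator_of_notMem hz, indicator_of_mem (mem_compl hz), driftInt,
      if_neg fun hh => hz (hzS.2 hh), inner_smul_right, inner_sub_right, inner_zero_right, compInt]
    simp only [Complex.real_smul, hJ]
    push_cast
    ring

end

/-- Lower bound for the real part of the exponent, from the jumps close to `ξ / (2|ξ|²)`. -/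
lemma exists_symbol_lower (Θ : Theta) : ∃ c : ℝ, 0 < c ∧ ∀ φ : ℝ → ℝ, Adm Θ φ →
    ∀ a ∈ Ioc (0 : ℝ) 1, ∀ (k : E Θ.d → ℝ) (A B : ℝ), KBound k A B → ∀ ξ : E Θ.d, 1 ≤ a * ‖ξ‖ →
      c * A / φ ‖ξ‖⁻¹ ≤ ∫ z in Metric.closedBall 0 a,
        (k z / radVol Θ.d φ ‖z‖) • (1 - Real.cos (inner ℝ ξ z)) := by
  set ω : ℝ := (volume : Measure (E Θ.d)).real (Metric.ball 0 1) with hω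
  have hω0 : 0 < ω :=
    ENNReal.toReal_pos (Metric.measure_ball_pos _ _ one_pos).ne' measure_ball_lt_top.ne
  have hcos : Real.cos (1 / 4) < 1 := by
    have := Real.cos_lt_cos_of_nonneg_of_le_pi (x := 0) (y := 1 / 4) le_rfl
      (by linarith [Real.pi_gt_three]) (by norm_num)
    rwa [Real.cos_zero] at this
  refine ⟨(1 - Real.cos (1 / 4)) * ((1 / 4) ^ Θ.d * ω), ?_, ?_⟩
  · have : 0 < 1 - Real.cos (1 / 4) := by linarith
    positivity
  intro φ h a ha k A B hk ξ hξ
  have ha0 := ha.1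
  have hξ0 : 0 < ‖ξ‖ := by
    by_contra hn
    have : ‖ξ‖ = 0 := le_antisymm (not_lt.1 hn) (norm_nonneg _)
    rw [this, mul_zero] at hξ
    linarith
  set r : ℝ := ‖ξ‖⁻¹ with hr
  have hr0 : 0 < r := by positivity
  have hra : r ≤ a := by rw [hr, inv_le_iff_one_le_mul₀ hξ0]; exact hξ
  have hrξ : ‖ξ‖ * r = 1 := mul_inv_cancel₀ hξ0.ne'
  -- on the ball of radius `r / 4` around `z0` the phase `⟨ξ, z⟩` lies between `1 / 4` and `3 / 4`
  set z0 : E Θ.d := (r ^ 2 / 2) • ξ with hz0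
  have hz0n : ‖z0‖ = r / 2 := by
    rw [hz0, norm_smul, Real.norm_of_nonneg (by positivity)]
    calc r ^ 2 / 2 * ‖ξ‖ = r / 2 * (‖ξ‖ * r) := by ring
      _ = _ := by rw [hrξ, mul_one]
  have hz0i : inner ℝ ξ z0 = 1 / 2 := by
    rw [hz0, real_inner_smul_right, real_inner_self_eq_norm_sq]
    calc r ^ 2 / 2 * ‖ξ‖ ^ 2 = (‖ξ‖ * r) ^ 2 / 2 := by ring
      _ = _ := by rw [hrξ, one_pow]
  have hball : ∀ z ∈ Metric.ball z0 (r / 4), ‖z‖ ≤ r ∧ 1 / 4 ≤ inner ℝ ξ z ∧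
      inner ℝ ξ z ≤ 3 / 4 := fun z hz => by
    rw [Metric.mem_ball, dist_eq_norm] at hz
    have h1 : ‖z‖ ≤ ‖z0‖ + ‖z - z0‖ := by
      calc ‖z‖ = ‖z0 + (z - z0)‖ := by rw [add_sub_cancel]
        _ ≤ _ := norm_add_le _ _
    have h2 : inner ℝ ξ z = 1 / 2 + inner ℝ ξ (z - z0) := by rw [inner_sub_right, hz0i]; ring
    have h3 := abs_le.1 (abs_inner_le ξ (z - z0))
    have h4 : ‖ξ‖ * ‖z - z0‖ ≤ 1 / 4 := by
      calc ‖ξ‖ * ‖z - z0‖ ≤ ‖ξ‖ * (r / 4) := by gcongr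
        _ = (‖ξ‖ * r) / 4 := by ring
        _ = _ := by rw [hrξ]
    refine ⟨by linarith, by linarith [h3.1], by linarith [h3.2]⟩
  have hsub : Metric.ball z0 (r / 4) ⊆ Metric.closedBall 0 a := fun z hz =>
    mem_closedBall_zero_iff.2 ((hball z hz).1.trans hra)
  have hint : IntegrableOn (fun z => (k z / radVol Θ.d φ ‖z‖) • (1 - Real.cos (inner ℝ ξ z)))
      (Metric.closedBall 0 a) := by
    refine ((hk.integrable_sq h ha).const_mul ((a * ‖ξ‖) ^ 2)).mono' ?_ ?_
    · refine (hk.measurable_div h).aestronglyMeasurable.smul ?_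
      exact Continuous.aestronglyMeasurable (by fun_prop)
    · refine ae_of_all _ fun z => ?_
      have h1 := Real.one_sub_sq_div_two_le_cos (x := inner ℝ ξ z)
      have h2 : (inner ℝ ξ z : ℝ) ^ 2 ≤ (‖ξ‖ * ‖z‖) ^ 2 := by
        rw [← sq_abs]; gcongr; exact abs_inner_le ξ z
      have h3 : 0 ≤ 1 - Real.cos (inner ℝ ξ z) := by linarith [Real.cos_le_one (inner ℝ ξ z)]
      have h5 : (a * ‖ξ‖) ^ 2 * ‖a⁻¹ • z‖ ^ 2 = (‖ξ‖ * ‖z‖) ^ 2 := by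
        rw [norm_smul, norm_inv, Real.norm_of_nonneg ha0.le]; field_simp
      rw [norm_smul, Real.norm_of_nonneg (hk.div_nonneg' h z), Real.norm_of_nonneg h3,
        smul_eq_mul, mul_left_comm, h5]
      have := hk.div_nonneg' h z
      gcongr
      nlinarith [sq_nonneg (‖ξ‖ * ‖z‖)]
  have hnn : ∀ z : E Θ.d, 0 ≤ (k z / radVol Θ.d φ ‖z‖) • (1 - Real.cos (inner ℝ ξ z)) := fun z =>
    mul_nonneg (hk.div_nonneg' h z) (by linarith [Real.cos_le_one (inner ℝ ξ z)])
  refine le_trans ?_ (setIntegral_mono_set hint (ae_of_all _ hnn)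
    (LE.le.eventuallyLE hsub))
  have hV : 0 < radVol Θ.d φ r := h.radVol_pos hr0
  have hvol : (volume : Measure (E Θ.d)).real (Metric.ball z0 (r / 4)) = (r / 4) ^ Θ.d * ω := by
    rw [Measure.real, Measure.addHaar_ball_of_pos _ _ (by positivity), ENNReal.toReal_mul,
      ENNReal.toReal_ofReal (by positivity), finrank_euclideanSpace, Fintype.card_fin]
    rfl
  calc (1 - Real.cos (1 / 4)) * ((1 / 4) ^ Θ.d * ω) * A / φ r
      = (A / radVol Θ.d φ r * (1 - Real.cos (1 / 4))) *
          (volume : Measure (E Θ.d)).real (Metric.ball z0 (r / 4)) := by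
        have := h.phi_pos hr0
        rw [hvol, radVol, div_pow, div_pow, one_pow]
        field_simp
    _ = ∫ z in Metric.ball z0 (r / 4), A / radVol Θ.d φ r * (1 - Real.cos (1 / 4)) := by
        rw [setIntegral_const, smul_eq_mul, mul_comm]
    _ ≤ _ := by
        refine setIntegral_mono_on (integrableOn_const measure_ball_lt_top.ne)
          (hint.mono_set hsub) measurableSet_ball fun z hz => ?_
        obtain ⟨h1, h2, h3⟩ := hball z hz
        have hz1 : 0 < ‖z‖ := by
          rw [norm_pos_iff]; rintro rfl
          rw [inner_zero_right] at h2; linarith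
        have hVz := h.radVol_pos hz1
        have hcz : Real.cos (inner ℝ ξ z) ≤ Real.cos (1 / 4) :=
          Real.cos_le_cos_of_nonneg_of_le_pi (by norm_num) (by linarith [Real.pi_gt_three]) h2
        rw [smul_eq_mul]
        have hA := hk.pos
        have hkz : 0 < k z := hA.trans_le (hk.lower z)
        have hc1 : 0 ≤ 1 - Real.cos (1 / 4) := by linarith
        gcongr
        · exact hk.lower z
        · exact h.radVol_mono hz1.le h1

/-! ### Densities of rescaled Lévy laws -/

/-- If `F` is almost decreasing, the product of two values is controlled by the value at the sum of
the arguments. -/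
lemma mul_le_of_almost_antitone {F : ℝ → ℝ} {C : ℝ} (hF : ∀ r, 0 < r → 0 ≤ F r)
    (hC : ∀ r R, 0 < r → 0 < R → R ≤ 2 * r → F r ≤ C * F R) {r₁ r₂ R : ℝ} (h₁ : 0 < r₁)
    (h₂ : 0 < r₂) (hR : 0 < R) (hle : R ≤ r₁ + r₂) :
    F r₁ * F r₂ ≤ C * F R * (F r₁ + F r₂) := by
  have e1 := hF r₁ h₁
  have e2 := hF r₂ h₂
  rcases le_total r₁ r₂ with h | h
  · have e3 := hC r₂ R h₂ hR (by linarith)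
    have : 0 ≤ C * F R := e2.trans e3
    nlinarith
  · have e3 := hC r₁ R h₁ hR (by linarith)
    have : 0 ≤ C * F R := e1.trans e3
    nlinarith

lemma powerGrowth_one {b : ℝ} (hb : 0 ≤ b) : PowerGrowth (fun _ => 1) b 1 where
  one_le := le_rfl
  continuousOn := continuousOn_const
  mono := fun _ _ _ _ _ => le_rfl
  nonneg _ _ := zero_le_one
  const _ _ := rfl
  growth r R hr hR _ := by
    rw [one_mul, mul_one]
    exact Real.one_le_rpow ((one_le_div hr).2 hR) hb

lemma Adm.inv_radVol_le {Θ : Theta} {φ : ℝ → ℝ} (h : Adm Θ φ) {r R k : ℝ} (hk : 1 ≤ k)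
    (hr : 0 < r) (hR : 0 < R) (hle : R ≤ k * r) :
    1 / radVol Θ.d φ r ≤ dblC Θ k * (1 / radVol Θ.d φ R) := by
  have h1 := h.radVol_dbl hr hk hR.le hle
  have hVr := h.radVol_pos hr
  have hVR := h.radVol_pos hR
  rw [mul_one_div, div_le_div_iff₀ hVr hVR, one_mul]
  exact h1

/-- Integral of `1 / V(a + |z|)`. -/
lemma exists_lintegral_inv_radVol_le (Θ : Theta) : ∃ C : ℝ, 0 < C ∧ ∀ φ : ℝ → ℝ, Adm Θ φ →
    ∀ a ∈ Ioc (0 : ℝ) 1, ∫⁻ z : E Θ.d, ENNReal.ofReal (1 / radVol Θ.d φ (a + ‖z‖)) ≤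
        ENNReal.ofReal (C / φ a) := by
  obtain ⟨C, hC, H⟩ := exists_lintegral_weight_le Θ
  refine ⟨C, hC, fun φ h a ha => ?_⟩
  have := H φ h (fun _ => 1) 1 (powerGrowth_one (by have := h.scaling.β₁_pos; positivity)) a ha
  rwa [mul_one, mul_one_div] at this

lemma Adm.measurable_radVol_add {Θ : Theta} {φ : ℝ → ℝ} (h : Adm Θ φ) {a : ℝ} (ha : 0 ≤ a) {α : Type*}
    [MeasurableSpace α] {f : α → E Θ.d} (hf : Measurable f) :
    Measurable fun x => radVol Θ.d φ (a + ‖f x‖) := by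
  have h1 : Continuous fun z : E Θ.d => radVol Θ.d φ (a + ‖z‖) := by
    refine Continuous.mul (by fun_prop) ?_
    exact h.scale.continuousOn.comp_continuous (by fun_prop) fun z => add_nonneg ha (norm_nonneg z)
  exact h1.measurable.comp hf

/-- The kernel `1 / V(a + |·|)` is almost preserved by convolution with itself. -/
lemma exists_lintegral_conv_le (Θ : Theta) : ∃ C : ℝ, 0 < C ∧ ∀ φ : ℝ → ℝ, Adm Θ φ →
    ∀ a ∈ Ioc (0 : ℝ) 1, ∀ x : E Θ.d,
      ∫⁻ z : E Θ.d, ENNReal.ofReal (1 / radVol Θ.d φ (a + ‖z‖)) *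
        ENNReal.ofReal (1 / radVol Θ.d φ (a + ‖x + z‖)) ≤
      ENNReal.ofReal (C / φ a * (1 / radVol Θ.d φ (a + ‖x‖))) := by
  obtain ⟨C, hC, H⟩ := exists_lintegral_inv_radVol_le Θ
  have hD := dblC_pos Θ (k := 2) two_pos
  refine ⟨2 * C * dblC Θ 2, by positivity, fun φ h a ha x => ?_⟩
  have ha0 := ha.1
  have hφ := h.phi_pos ha0
  have hpos : ∀ z : E Θ.d, 0 < radVol Θ.d φ (a + ‖z‖) := fun z => h.radVol_pos (by positivity)
  have hp := hpos x
  have hm : ∀ y : E Θ.d, Measurable fun z : E Θ.d =>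
      ENNReal.ofReal (1 / radVol Θ.d φ (a + ‖y + z‖)) := fun y =>
    ((h.measurable_radVol_add ha0.le (measurable_const_add y)).const_div 1).ennreal_ofReal
  calc _ ≤ ∫⁻ z : E Θ.d, ENNReal.ofReal (dblC Θ 2 * (1 / radVol Θ.d φ (a + ‖x‖))) *
        (ENNReal.ofReal (1 / radVol Θ.d φ (a + ‖z‖)) +
          ENNReal.ofReal (1 / radVol Θ.d φ (a + ‖x + z‖))) := by
        refine lintegral_mono fun z => ?_
        have h1 := hpos z
        have h2 := hpos (x + z)
        rw [← ENNReal.ofReal_add (by positivity) (by positivity),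
          ← ENNReal.ofReal_mul (by positivity), ← ENNReal.ofReal_mul (by positivity)]
        refine ENNReal.ofReal_le_ofReal ?_
        -- one of `a + |z|`, `a + |x + z|` is at least half of `a + |x|`, and `V` is doubling
        refine mul_le_of_almost_antitone (F := fun r => 1 / radVol Θ.d φ r) (fun r hr => ?_)
          (fun r R hr hR hle => h.inv_radVol_le one_le_two hr hR hle) (by positivity)
          (by positivity) (by positivity) ?_
        · have := h.radVol_pos hr; positivity
        · have : ‖x‖ ≤ ‖z‖ + ‖x + z‖ := by
            calc ‖x‖ = ‖(x + z) - z‖ := by rw [add_sub_cancel_right]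
              _ ≤ ‖x + z‖ + ‖z‖ := norm_sub_le _ _
              _ = _ := add_comm _ _
          linarith
    _ = ENNReal.ofReal (dblC Θ 2 * (1 / radVol Θ.d φ (a + ‖x‖))) *
        ((∫⁻ z : E Θ.d, ENNReal.ofReal (1 / radVol Θ.d φ (a + ‖z‖))) +
          ∫⁻ z : E Θ.d, ENNReal.ofReal (1 / radVol Θ.d φ (a + ‖x + z‖))) := by
        rw [lintegral_const_mul' _ _ ENNReal.ofReal_ne_top, lintegral_add_right _ (hm x)]
    _ = ENNReal.ofReal (dblC Θ 2 * (1 / radVol Θ.d φ (a + ‖x‖))) *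
        ((∫⁻ z : E Θ.d, ENNReal.ofReal (1 / radVol Θ.d φ (a + ‖z‖))) +
          ∫⁻ z : E Θ.d, ENNReal.ofReal (1 / radVol Θ.d φ (a + ‖z‖))) := by
        rw [lintegral_add_left_eq_self
          (fun z : E Θ.d => ENNReal.ofReal (1 / radVol Θ.d φ (a + ‖z‖))) x]
    _ ≤ ENNReal.ofReal (dblC Θ 2 * (1 / radVol Θ.d φ (a + ‖x‖))) *
        (ENNReal.ofReal (C / φ a) + ENNReal.ofReal (C / φ a)) := by
        gcongr <;> exact H φ h a ha
    _ = _ := by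
        rw [← ENNReal.ofReal_add (by positivity) (by positivity),
          ← ENNReal.ofReal_mul (by positivity)]
        congr 1; ring

lemma norm_iteratedFDeriv_scaled_re_le {H : Type*} [NormedAddCommGroup H] [NormedSpace ℝ H]
    {Q : H → ℂ} {n : ℕ} (hQ : ContDiff ℝ n Q) (c : ℝ) {b : ℝ} (hb : 0 ≤ b) {i : ℕ} (hi : i ≤ n)
    (x : H) : ‖iteratedFDeriv ℝ i (fun x => c * (Q (b • x)).re) x‖ ≤
      |c| * (b ^ i * ‖iteratedFDeriv ℝ i Q (b • x)‖) := by
  set A : H →L[ℝ] H := b • ContinuousLinearMap.id ℝ H with hA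
  have hAn : ‖A‖ ≤ b := by
    refine ContinuousLinearMap.opNorm_le_bound _ hb fun y => ?_
    simp [hA, norm_smul, abs_of_nonneg hb]
  have hQA : ContDiff ℝ n (Q ∘ A) := hQ.comp A.contDiff
  set L : ℂ →L[ℝ] ℝ := c • Complex.reCLM with hL
  have hLn : ‖L‖ ≤ |c| := by
    refine ContinuousLinearMap.opNorm_le_bound _ (abs_nonneg c) fun y => ?_
    simp only [hL, smul_apply, Complex.reCLM_apply, smul_eq_mul, norm_mul, Real.norm_eq_abs]
    gcongr
    exact Complex.abs_re_le_norm y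
  have heq : (fun x => c * (Q (b • x)).re) = L ∘ (Q ∘ A) := by
    ext x; simp [hL, hA]
  rw [heq]
  refine (L.norm_iteratedFDeriv_comp_left hQA.contDiffAt (by exact_mod_cast hi)).trans ?_
  gcongr
  rw [A.iteratedFDeriv_comp_right hQ x (by exact_mod_cast hi)]
  refine (ContinuousMultilinearMap.norm_compContinuousLinearMap_le _ _).trans ?_
  rw [Finset.prod_const, Finset.card_univ, Fintype.card_fin, mul_comm]
  have : A x = b • x := by simp [hA]
  rw [this]
  gcongr

/-- Upper bounds for the density, and its derivatives up to order three, of the Lévy process with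
jump kernel comparable with `φ(a) / V(|z|)`, provided the drift at level `a` is of order `a`. -/
theorem exists_levyDensity_bound (Θ : Theta) {b₀ : ℝ} (hb₀ : 0 ≤ b₀) : ∃ C : ℝ, 0 < C ∧
    ∀ φ : ℝ → ℝ, Adm Θ φ → ∀ a ∈ Ioc (0 : ℝ) 1, ∀ k : E Θ.d → ℝ,
      KBound k (Θ.κ₀⁻¹ * φ a) (Θ.κ₀ * φ a) →
      ‖∫ z, (k z / radVol Θ.d φ ‖z‖) • driftInt φ a z‖ ≤ b₀ * a →
      ContDiff ℝ 3 (levyDensity φ k) ∧ ∀ i ≤ 3, ∀ x,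
        ‖iteratedFDeriv ℝ i (levyDensity φ k) x‖ ≤
          C * a⁻¹ ^ i * (φ a / radVol Θ.d φ (a + ‖x‖)) := by
  by_cases hΘ : ∃ φ, Adm Θ φ
  swap
  · exact ⟨1, one_pos, fun φ h => absurd ⟨φ, h⟩ hΘ⟩
  obtain ⟨φ₀, h₀⟩ := hΘ
  have hκ := h₀.κ₀_ge
  have hκ0 : 0 < Θ.κ₀ := zero_lt_one.trans_le hκ
  have hβ := h₀.scaling.β₁_pos
  have hlow := one_le_lowC Θ
  have hup := one_le_upC Θ
  obtain ⟨c, hc, hcl⟩ := exists_symbol_lower Θ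
  obtain ⟨Cc, hCc, hconv⟩ := exists_lintegral_conv_le Θ
  have hD := dblC_pos Θ (k := 2) two_pos
  have hDb := dblC_pos Θ (k := 1 + b₀) (by positivity)
  set M : ℝ := max 1 (Θ.κ₀ * (sphereArea Θ.d * Θ.A₀.toReal)) with hM
  set N : ℕ := ⌈(Θ.d : ℝ) + Θ.β₂⌉₊ with hN
  set B : ℝ := upC Θ + Θ.κ₀ * dblC Θ 2 * Cc + dblC Θ (1 + b₀) with hB
  have hBpos : 0 < B := by positivity
  have hB1 : upC Θ ≤ B := by
    have : 0 < Θ.κ₀ * dblC Θ 2 * Cc := by positivity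
    linarith
  have hB2 : Θ.κ₀ * dblC Θ 2 * Cc ≤ B := by linarith
  have hB3 : dblC Θ (1 + b₀) ≤ B := by
    have : 0 < Θ.κ₀ * dblC Θ 2 * Cc := by positivity
    linarith
  obtain ⟨C, hC, hmain⟩ := exists_density_bound (H := E Θ.d) (M := M) (c := c * Θ.κ₀⁻¹ / lowC Θ)
    (le_max_left _ _) (by positivity) hβ N hBpos
  refine ⟨((2 * Real.pi) ^ Θ.d)⁻¹ * C, by positivity, ?_⟩
  intro φ h a ha k hk hdrift
  have ha0 := ha.1
  have hφa := h.phi_pos ha0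
  have hVa := h.radVol_pos ha0
  -- lengths are measured in units of `a`; jumps are split at length one
  set ν₁ := jumpMeasure φ k a (Metric.closedBall 0 a) with hν₁
  set ν₂ := jumpMeasure φ k a (Metric.closedBall 0 a)ᶜ with hν₂
  set b : E Θ.d := a⁻¹ • ∫ z, (k z / radVol Θ.d φ ‖z‖) • driftInt φ a z with hb
  have hbn : ‖b‖ ≤ b₀ := by
    rw [hb, norm_smul, norm_inv, Real.norm_of_nonneg ha0.le, inv_mul_le_iff₀ ha0, mul_comm]
    exact hdrift
  -- the weight `1 / V(a + |·|)` in the rescaled variable, normalised at the origin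
  set W : E Θ.d → ℝ := fun x => radVol Θ.d φ a / radVol Θ.d φ (a + ‖a • x‖) with hW
  have hVx : ∀ x : E Θ.d, 0 < radVol Θ.d φ (a + ‖x‖) := fun x => h.radVol_pos (by positivity)
  have hnorm : ∀ x : E Θ.d, ‖a • x‖ = a * ‖x‖ := fun x => by
    rw [norm_smul, Real.norm_of_nonneg ha0.le]
  set Q : E Θ.d → ℂ := invFourier fun η => Complex.exp (levyExponent φ k (a⁻¹ • η)) with hQ
  have hfin := isFiniteMeasure_jumpMeasure h hk ha
  have hsq : Integrable (fun z => ‖z‖ ^ 2) ν₁ :=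
    (integrable_jumpMeasure_iff h hk a _ (by fun_prop)).2 (hk.integrable_sq h ha)
  -- the second moment of the small jumps is controlled by `𝒜^{(0)}_φ`
  have hmom : ∫ z, ‖z‖ ^ 2 ∂ν₁ ≤ M := by
    rw [hν₁, integral_jumpMeasure h hk a _ (by fun_prop), integral_eq_lintegral_of_nonneg_ae]
    rotate_left
    · refine ae_of_all _ fun z => ?_
      have := hk.div_nonneg' h z
      simp only [Pi.zero_apply, smul_eq_mul]; positivity
    · exact (hk.integrable_sq h ha).aestronglyMeasurable
    have hsA := sphereArea_nonneg Θ.d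
    refine (ENNReal.toReal_le_of_le_ofReal (by positivity) ?_).trans (le_max_right _ _)
    have hA : supA φ gamma0 ≠ ⊤ := h.A0_lt_top.ne
    calc ∫⁻ z in Metric.closedBall 0 a, ENNReal.ofReal ((k z / radVol Θ.d φ ‖z‖) • ‖a⁻¹ • z‖ ^ 2)
        ≤ ∫⁻ z in Metric.closedBall (0 : E Θ.d) a, ENNReal.ofReal (Θ.κ₀ * φ a) *
            ENNReal.ofReal (gamma0 (‖z‖ / a) / radVol Θ.d φ ‖z‖) := by
          refine setLIntegral_mono' measurableSet_closedBall fun z hz => ?_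
          have hza : ‖z‖ ≤ a := mem_closedBall_zero_iff.1 hz
          have hV := h.radVol_nonneg (norm_nonneg z)
          rw [← ENNReal.ofReal_mul (by positivity)]
          refine ENNReal.ofReal_le_ofReal ?_
          have h1 : ‖z‖ / a ≤ 1 := (div_le_one ha0).2 hza
          rw [gamma0, min_eq_left (pow_le_one₀ (by positivity) h1), norm_smul, norm_inv,
            Real.norm_of_nonneg ha0.le, smul_eq_mul, ← div_eq_inv_mul]
          calc k z / radVol Θ.d φ ‖z‖ * (‖z‖ / a) ^ 2
              ≤ Θ.κ₀ * φ a / radVol Θ.d φ ‖z‖ * (‖z‖ / a) ^ 2 := by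
                gcongr; exact hk.upper z
            _ = _ := by ring
      _ ≤ ∫⁻ z : E Θ.d, ENNReal.ofReal (Θ.κ₀ * φ a) *
            ENNReal.ofReal (gamma0 (‖z‖ / a) / radVol Θ.d φ ‖z‖) := setLIntegral_le_lintegral _ _
      _ = ENNReal.ofReal (Θ.κ₀ * φ a) *
            ∫⁻ z : E Θ.d, ENNReal.ofReal (gamma0 (‖z‖ / a) / radVol Θ.d φ ‖z‖) :=
          lintegral_const_mul' _ _ ENNReal.ofReal_ne_top
      _ ≤ ENNReal.ofReal (Θ.κ₀ * φ a) * (ENNReal.ofReal (sphereArea Θ.d) *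
            (ENNReal.ofReal (φ a)⁻¹ * supA φ gamma0)) := by
          gcongr
          exact h.lintegral_gamma_le continuous_gamma0.continuousOn ha
      _ = _ := by
          rw [h.A₀_eq, ← ENNReal.ofReal_toReal hA, ← ENNReal.ofReal_mul (by positivity),
            ← ENNReal.ofReal_mul (sphereArea_nonneg _), ← ENNReal.ofReal_mul (by positivity)]
          congr 1
          rw [A0]
          field_simp
  -- the lower scaling condition turns `φ(a) / φ(a / |η|)` into a power of `|η|`
  have hlower : ∀ η : E Θ.d, 1 ≤ ‖η‖ → c * Θ.κ₀⁻¹ / lowC Θ * ‖η‖ ^ Θ.β₁ ≤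
      ∫ z, (1 - Real.cos (inner ℝ η z)) ∂ν₁ := fun η hη => by
    have hη0 : 0 < ‖η‖ := by linarith
    have hn : ‖a⁻¹ • η‖ = a⁻¹ * ‖η‖ := by
      rw [norm_smul, norm_inv, Real.norm_of_nonneg ha0.le]
    have h1 := hcl φ h a ha k _ _ hk (a⁻¹ • η) (by rw [hn, mul_inv_cancel_left₀ ha0.ne']; exact hη)
    rw [hν₁, integral_jumpMeasure h hk a _ (by fun_prop)]
    have hin : ∀ z : E Θ.d, inner ℝ η (a⁻¹ • z) = inner ℝ (a⁻¹ • η) z := fun z => by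
      rw [real_inner_smul_right, real_inner_smul_left]
    simp only [hin]
    refine le_trans ?_ h1
    have hr : ‖a⁻¹ • η‖⁻¹ = a / ‖η‖ := by rw [hn, mul_inv, inv_inv, div_eq_mul_inv]
    have hra : a / ‖η‖ ≤ a := div_le_self ha0.le hη
    have h2 := h.phi_lower (by positivity : 0 < a / ‖η‖) hra ha.2
    have h3 : a / ‖η‖ / a = ‖η‖⁻¹ := by field_simp
    rw [h3, Real.inv_rpow hη0.le] at h2
    rw [hr, le_div_iff₀ (h.phi_pos (by positivity))]
    have hη' : 0 < ‖η‖ ^ Θ.β₁ := by positivity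
    calc c * Θ.κ₀⁻¹ / lowC Θ * ‖η‖ ^ Θ.β₁ * φ (a / ‖η‖)
        ≤ c * Θ.κ₀⁻¹ / lowC Θ * ‖η‖ ^ Θ.β₁ * (lowC Θ * (‖η‖ ^ Θ.β₁)⁻¹ * φ a) := by gcongr
      _ = _ := by field_simp
  have hsupp : ∀ᵐ z ∂ν₁, ‖z‖ ≤ 1 := by
    have hm : Measurable fun z : E Θ.d => a⁻¹ • z := measurable_const_smul _
    rw [hν₁, jumpMeasure, ae_map_iff hm.aemeasurable (measurableSet_le measurable_norm
      measurable_const)]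
    refine (withDensity_absolutelyContinuous _ _).ae_le ?_
    refine (ae_restrict_iff' measurableSet_closedBall).2 (ae_of_all _ fun z hz => ?_)
    rw [norm_smul, norm_inv, Real.norm_of_nonneg ha0.le, inv_mul_le_iff₀ ha0, mul_one]
    exact mem_closedBall_zero_iff.1 hz
  have hWm : Measurable W := by
    have := h.measurable_radVol_add ha0.le (measurable_const_smul (α := E Θ.d) a)
    exact measurable_const.div this
  -- `W` decays at most polynomially, because `V` is doubling
  have hWN : ∀ x, 1 ≤ B * W x * (1 + ‖x‖) ^ N := fun x => by
    have hx : 1 ≤ 1 + ‖x‖ := by linarith [norm_nonneg x]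
    have h1 := h.radVol_dbl (R := a + ‖a • x‖) ha0 hx (by positivity) (by rw [hnorm]; linarith)
    have h2 : dblC Θ (1 + ‖x‖) ≤ B * (1 + ‖x‖) ^ N := by
      unfold dblC
      rw [← Real.rpow_natCast]
      gcongr
      exact Nat.le_ceil _
    simp only [hW]
    rw [mul_right_comm, ← mul_div_assoc, one_le_div (hVx _)]
    exact h1.trans (by gcongr)
  -- beyond the level `a` the Lévy measure has density at most a multiple of `φ(a) / V(a + |z|)`
  have hWB : ∀ x, ∫⁻ z, ENNReal.ofReal (W (x + z)) ∂ν₂ ≤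
      ENNReal.ofReal B * ENNReal.ofReal (W x) := fun x => by
    have hWxm : Measurable fun z => ENNReal.ofReal (W (x + z)) :=
      (hWm.comp (measurable_const_add x)).ennreal_ofReal
    rw [hν₂, lintegral_jumpMeasure h hk a _ hWxm]
    have hax := hVx (a • x)
    calc _ ≤ ∫⁻ z in (Metric.closedBall (0 : E Θ.d) a)ᶜ,
          ENNReal.ofReal (Θ.κ₀ * φ a * dblC Θ 2 * radVol Θ.d φ a) *
            (ENNReal.ofReal (1 / radVol Θ.d φ (a + ‖z‖)) *
              ENNReal.ofReal (1 / radVol Θ.d φ (a + ‖a • x + z‖))) := by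
          refine setLIntegral_mono' measurableSet_closedBall.compl fun z hz => ?_
          have hza : a < ‖z‖ := by simpa using hz
          have hz0 : 0 < ‖z‖ := ha0.trans hza
          have h1 := h.inv_radVol_le (R := a + ‖z‖) one_le_two hz0 (by positivity) (by linarith)
          have hk' := hk.upper z
          have hVz := h.radVol_pos hz0
          have h2 := hVx z
          have h3 := hVx (a • x + z)
          have hkz : 0 ≤ k z := hk.pos.le.trans (hk.lower z)
          have e : a • (x + a⁻¹ • z) = a • x + z := by
            rw [smul_add, smul_smul, mul_inv_cancel₀ ha0.ne', one_smul]
          simp only [hW]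
          rw [e, ← ENNReal.ofReal_mul (by positivity), ← ENNReal.ofReal_mul (by positivity),
            ← ENNReal.ofReal_mul (by positivity)]
          refine ENNReal.ofReal_le_ofReal ?_
          calc k z / radVol Θ.d φ ‖z‖ * (radVol Θ.d φ a / radVol Θ.d φ (a + ‖a • x + z‖))
              = k z * (1 / radVol Θ.d φ ‖z‖) * (radVol Θ.d φ a *
                  (1 / radVol Θ.d φ (a + ‖a • x + z‖))) := by ring
            _ ≤ (Θ.κ₀ * φ a) * (dblC Θ 2 * (1 / radVol Θ.d φ (a + ‖z‖))) * (radVol Θ.d φ a *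
                  (1 / radVol Θ.d φ (a + ‖a • x + z‖))) := by gcongr
            _ = _ := by ring
      _ ≤ ∫⁻ z : E Θ.d, ENNReal.ofReal (Θ.κ₀ * φ a * dblC Θ 2 * radVol Θ.d φ a) *
            (ENNReal.ofReal (1 / radVol Θ.d φ (a + ‖z‖)) *
              ENNReal.ofReal (1 / radVol Θ.d φ (a + ‖a • x + z‖))) :=
          setLIntegral_le_lintegral _ _
      _ = ENNReal.ofReal (Θ.κ₀ * φ a * dblC Θ 2 * radVol Θ.d φ a) *
            ∫⁻ z : E Θ.d, (ENNReal.ofReal (1 / radVol Θ.d φ (a + ‖z‖)) *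
              ENNReal.ofReal (1 / radVol Θ.d φ (a + ‖a • x + z‖))) :=
          lintegral_const_mul' _ _ ENNReal.ofReal_ne_top
      _ ≤ ENNReal.ofReal (Θ.κ₀ * φ a * dblC Θ 2 * radVol Θ.d φ a) *
            ENNReal.ofReal (Cc / φ a * (1 / radVol Θ.d φ (a + ‖a • x‖))) := by
          gcongr
          exact hconv φ h a ha (a • x)
      _ ≤ _ := by
          rw [← ENNReal.ofReal_mul (by positivity), ← ENNReal.ofReal_mul (by positivity)]
          refine ENNReal.ofReal_le_ofReal ?_
          simp only [hW]
          calc Θ.κ₀ * φ a * dblC Θ 2 * radVol Θ.d φ a *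
                (Cc / φ a * (1 / radVol Θ.d φ (a + ‖a • x‖)))
              = Θ.κ₀ * dblC Θ 2 * Cc * (radVol Θ.d φ a / radVol Θ.d φ (a + ‖a • x‖)) := by
                field_simp
            _ ≤ _ := by gcongr
  -- the rescaled drift is bounded, so a shift by it changes `W` by a factor only
  have hWb : ∀ x, W (x + b) ≤ B * W x := fun x => by
    have h1 := h.inv_radVol_le (r := a + ‖a • (x + b)‖) (R := a + ‖a • x‖) (k := 1 + b₀)
      (by linarith) (by positivity) (by positivity) (by
        rw [hnorm, hnorm]
        have h2 : ‖x‖ ≤ ‖x + b‖ + ‖b‖ := by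
          calc ‖x‖ = ‖(x + b) - b‖ := by rw [add_sub_cancel_right]
            _ ≤ _ := norm_sub_le _ _
        have h3 : a * ‖x‖ ≤ a * (‖x + b‖ + b₀) := by gcongr; linarith
        nlinarith [norm_nonneg (x + b), mul_nonneg hb₀ (mul_nonneg ha0.le (norm_nonneg (x + b)))])
    simp only [hW]
    have hp := hVx (a • x)
    calc radVol Θ.d φ a / radVol Θ.d φ (a + ‖a • (x + b)‖)
        = radVol Θ.d φ a * (1 / radVol Θ.d φ (a + ‖a • (x + b)‖)) := by ring
      _ ≤ radVol Θ.d φ a * (dblC Θ (1 + b₀) * (1 / radVol Θ.d φ (a + ‖a • x‖))) := by gcongr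
      _ = dblC Θ (1 + b₀) * (radVol Θ.d φ a / radVol Θ.d φ (a + ‖a • x‖)) := by ring
      _ ≤ _ := by gcongr
  obtain ⟨hQs, hQd⟩ := hmain ν₁ ν₂ b W hfin hsupp hsq hmom hlower hWm
    (fun x => (div_pos hVa (hVx _)).le) hWN hWB hWb Q fun x => by
      rw [hQ]
      congr 1
      ext η
      rw [levyExponent_decomp h hk ha η]
  -- undo the scaling
  have hrep : levyDensity φ k = fun x =>
      (((2 * Real.pi) ^ Θ.d)⁻¹ * (a ^ Θ.d)⁻¹) * (Q (a⁻¹ • x)).re := by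
    ext x
    have h1 : Q (a⁻¹ • x) =
        (a ^ Θ.d : ℝ) • invFourier (fun ξ => Complex.exp (levyExponent φ k ξ)) x := by
      have := Measure.integral_comp_inv_smul (volume : Measure (E Θ.d))
        (fun ξ => Complex.exp (Complex.I * ((inner ℝ x ξ : ℝ) : ℂ)) *
          Complex.exp (levyExponent φ k ξ)) a
      rw [finrank_euclideanSpace, Fintype.card_fin, abs_of_nonneg (by positivity)] at this
      rw [hQ, invFourier, invFourier, ← this]
      congr 1
      ext η
      rw [real_inner_smul_left, real_inner_smul_right]
    rw [h1, levyDensity, Complex.smul_re, smul_eq_mul]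
    field_simp
  rw [hrep]
  refine ⟨?_, fun i hi x => ?_⟩
  · have h1 : ContDiff ℝ 3 fun x => Q (a⁻¹ • x) := hQs.comp (contDiff_const_smul _)
    exact contDiff_const.mul (Complex.reCLM.contDiff.comp h1)
  · refine (norm_iteratedFDeriv_scaled_re_le (n := 3) (by exact_mod_cast hQs) _
      (inv_nonneg.2 ha0.le) hi x).trans ?_
    have h1 := hQd i hi (a⁻¹ • x)
    have e : a • a⁻¹ • x = x := by rw [smul_smul, mul_inv_cancel₀ ha0.ne', one_smul]
    simp only [hW, e] at h1
    have hp := hVx x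
    rw [abs_of_nonneg (by positivity)]
    calc ((2 * Real.pi) ^ Θ.d)⁻¹ * (a ^ Θ.d)⁻¹ * (a⁻¹ ^ i * ‖iteratedFDeriv ℝ i Q (a⁻¹ • x)‖)
        ≤ ((2 * Real.pi) ^ Θ.d)⁻¹ * (a ^ Θ.d)⁻¹ * (a⁻¹ ^ i *
            (C * (radVol Θ.d φ a / radVol Θ.d φ (a + ‖x‖)))) := by gcongr
      _ = _ := by
        have : radVol Θ.d φ a = a ^ Θ.d * φ a := rfl
        rw [this]
        field_simp

/-! ### The frozen heat kernel -/

/-- The hypotheses common to the symmetric and the non-symmetric case, with what is specific to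
each of them in the last field. -/
structure Setting (Θ : Theta) (φ ℓ : ℝ → ℝ) (κ : ℝ → E Θ.d → E Θ.d → ℝ) : Prop where
  adm : Adm Θ φ
  bounds : KernelBounds κ Θ.κ₀ ℓ
  cases : SymmKernel κ ∨ (¬ SymmKernel κ ∧ Θ.A₁ = A1 φ ∧ A1 φ < ∞ ∧ KernelCentered φ κ)

/-- A function whose integrals over centered balls vanish has vanishing integrals against radial
weights. -/
lemma integral_radial_mul_eq_zero {d : ℕ} {f : E d → ℝ} (hf : Measurable f) {R B : ℝ}
    (hB : ∀ z ∈ Metric.closedBall (0 : E d) R, |f z| ≤ B) (h0 : f 0 = 0)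
    (hz : ∀ r, 0 < r → r ≤ R → ∫ z in Metric.closedBall (0 : E d) r, f z = 0) {g : ℝ → ℝ}
    (hg : Measurable g)
    (hi : IntegrableOn (fun z => g ‖z‖ * f z) (Metric.closedBall (0 : E d) R)) :
    ∫ z in Metric.closedBall (0 : E d) R, g ‖z‖ * f z = 0 := by
  set S := Metric.closedBall (0 : E d) R with hS
  have hSm : MeasurableSet S := measurableSet_closedBall
  have hSf : volume S ≠ ∞ := measure_closedBall_lt_top.ne
  have hfS : IntegrableOn f S := Measure.integrableOn_of_bounded (M := B) hSf
    hf.aestronglyMeasurable ((ae_restrict_iff' hSm).2 (ae_of_all _ hB))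
  -- the images under the norm of the positive and the negative part of `f` agree
  set P : (E d → ℝ) → Measure ℝ := fun u =>
    ((volume.restrict S).withDensity fun z => ENNReal.ofReal (u z)).map norm with hP
  have hfin : ∀ u : E d → ℝ, IntegrableOn u S → IsFiniteMeasure (P u) := fun u hu => by
    have : IsFiniteMeasure ((volume.restrict S).withDensity fun z => ENNReal.ofReal (u z)) :=
      isFiniteMeasure_withDensity_ofReal hu.2
    infer_instance
  have hIic : ∀ u : E d → ℝ, Measurable u → u 0 = 0 → ∀ r, P u (Iic r) =
      ∫⁻ z in Metric.closedBall (0 : E d) (min r R), ENNReal.ofReal (u z) := fun u hu _ r => by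
    have hpre : norm ⁻¹' Iic r = Metric.closedBall (0 : E d) r := by ext; simp
    rw [hP]
    simp only
    rw [Measure.map_apply measurable_norm measurableSet_Iic, hpre,
      withDensity_apply _ measurableSet_closedBall, Measure.restrict_restrict
      measurableSet_closedBall, hS]
    congr 2
    ext z
    simp
  have hmeas : P f = P (fun z => -f z) := by
    have h1 := hfin f hfS
    have h2 := hfin (fun z => -f z) hfS.neg
    refine Measure.ext_of_Iic _ _ fun r => ?_
    rw [hIic f hf h0, hIic (fun z => -f z) hf.neg (by simp [h0])]
    set ρ := min r R with hρ
    rcases lt_trichotomy ρ 0 with hneg | hzero | hpos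
    · rw [Metric.closedBall_eq_empty.2 hneg]; simp
    · rw [hzero, Metric.closedBall_zero]; simp [h0]
    · have hint : IntegrableOn f (Metric.closedBall (0 : E d) ρ) :=
        hfS.mono_set (Metric.closedBall_subset_closedBall (min_le_right _ _))
      have e := hz ρ hpos (min_le_right _ _)
      rw [integral_eq_lintegral_pos_part_sub_lintegral_neg_part hint, sub_eq_zero] at e
      refine (ENNReal.toReal_eq_toReal_iff' ?_ ?_).1 e
      · exact hint.lintegral_lt_top.ne
      · exact hint.neg.lintegral_lt_top.ne
  have hpart : ∀ u : E d → ℝ, Measurable u →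
      ∫ r, g r ∂(P u) = ∫ z in S, g ‖z‖ * max (u z) 0 := fun u hu => by
    rw [hP]
    simp only
    rw [integral_map measurable_norm.aemeasurable hg.aestronglyMeasurable,
      integral_withDensity_eq_integral_toReal_smul hu.ennreal_ofReal (by simp)]
    congr 1
    ext z
    rw [ENNReal.toReal_ofReal', smul_eq_mul, mul_comm]
  have hgm : Measurable fun z : E d => g ‖z‖ := hg.comp measurable_norm
  have hi1 : IntegrableOn (fun z => g ‖z‖ * max (f z) 0) S := by
    refine Integrable.mono hi (hgm.mul (hf.max measurable_const)).aestronglyMeasurable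
      (ae_of_all _ fun z => ?_)
    rw [norm_mul, norm_mul]
    gcongr
    rw [Real.norm_eq_abs, Real.norm_eq_abs, abs_of_nonneg (le_max_right _ _)]
    exact max_le (le_abs_self _) (abs_nonneg _)
  have hi2 : IntegrableOn (fun z => g ‖z‖ * max (-f z) 0) S := by
    refine Integrable.mono hi (hgm.mul (hf.neg.max measurable_const)).aestronglyMeasurable
      (ae_of_all _ fun z => ?_)
    rw [norm_mul, norm_mul]
    gcongr
    rw [Real.norm_eq_abs, Real.norm_eq_abs, abs_of_nonneg (le_max_right _ _)]
    exact max_le (neg_le_abs _) (abs_nonneg _)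
  calc ∫ z in S, g ‖z‖ * f z = ∫ z in S, (g ‖z‖ * max (f z) 0 - g ‖z‖ * max (-f z) 0) := by
        congr 1; ext z
        rw [← mul_sub]
        congr 1
        rcases le_total (f z) 0 with h | h
        · rw [max_eq_right h, max_eq_left (by linarith)]; ring
        · rw [max_eq_left h, max_eq_right (by linarith)]; ring
    _ = 0 := by
        rw [integral_sub hi1 hi2, ← hpart f hf, ← hpart (fun z => -f z) hf.neg, hmeas, sub_self]

/-- A kernel whose first moments on centered balls vanish has vanishing first moments against
radial weights. -/
lemma integral_radial_smul_eq_zero {d : ℕ} {k : E d → ℝ} (hk : Measurable k) {R B : ℝ}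
    (hB : ∀ z, |k z| ≤ B)
    (hz : ∀ r, 0 < r → r ≤ R → ∫ z in Metric.closedBall (0 : E d) r, k z • z = 0) {g : ℝ → ℝ}
    (hg : Measurable g)
    (hi : IntegrableOn (fun z => (g ‖z‖ * k z) • z) (Metric.closedBall (0 : E d) R)) :
    ∫ z in Metric.closedBall (0 : E d) R, (g ‖z‖ * k z) • z = 0 := by
  have hB0 : 0 ≤ B := (abs_nonneg _).trans (hB 0)
  refine ext_inner_left ℝ fun v => ?_
  rw [inner_zero_right, ← integral_inner hi]
  have hkz : ∀ r, IntegrableOn (fun z => k z • z) (Metric.closedBall (0 : E d) r) := fun r => by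
    refine Measure.integrableOn_of_bounded (M := B * r) measure_closedBall_lt_top.ne
      (hk.smul measurable_id).aestronglyMeasurable
      ((ae_restrict_iff' measurableSet_closedBall).2 (ae_of_all _ fun z hz => ?_))
    rw [norm_smul]
    exact mul_le_mul (hB z) (mem_closedBall_zero_iff.1 hz) (norm_nonneg _) hB0
  have hfm : Measurable fun z : E d => inner ℝ v (k z • z) :=
    measurable_const.inner (hk.smul measurable_id)
  have := integral_radial_mul_eq_zero (R := R) (B := ‖v‖ * (B * R))
    (f := fun z => inner ℝ v (k z • z)) (g := g) hfm ?_ ?_ ?_ hg ?_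
  · rw [← this]
    congr 1
    ext z
    rw [mul_smul, real_inner_smul_right]
  · intro z hz
    refine (abs_real_inner_le_norm _ _).trans ?_
    gcongr
    rw [norm_smul]
    exact mul_le_mul (hB z) (mem_closedBall_zero_iff.1 hz) (norm_nonneg _) hB0
  · simp
  · intro r hr hrR
    rw [integral_inner (hkz r), hz r hr hrR, inner_zero_right]
  · refine (hi.const_inner v).congr (ae_of_all _ fun z => ?_)
    simp only
    rw [mul_smul, real_inner_smul_right]

namespace Setting

variable {Θ : Theta} {φ ℓ : ℝ → ℝ} {κ : ℝ → E Θ.d → E Θ.d → ℝ} (H : Setting Θ φ ℓ κ)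

include H

lemma timeKernel_neg (hs : SymmKernel κ) {t s : ℝ} (ht : 0 ≤ t) (hts : t ≤ s) (y z : E Θ.d) :
    timeKernel κ y t s (-z) = timeKernel κ y t s z := by
  unfold timeKernel
  refine intervalIntegral.integral_congr fun r hr => ?_
  rw [uIcc_of_le hts] at hr
  exact (hs r (ht.trans hr.1) y z).symm

lemma integral_timeKernel_smul (hc : KernelCentered φ κ) (h2 : Case2 φ) {t s : ℝ} (ht : 0 ≤ t)
    (hts : t ≤ s) (y : E Θ.d) {r : ℝ} (hr : 0 < r) :
    ∫ z in Metric.closedBall (0 : E Θ.d) r, timeKernel κ y t s z • z = 0 := by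
  have hswap := integral_integral_swap (μ := volume.restrict (Ioc t s))
    (ν := (volume : Measure (E Θ.d)).restrict (Metric.closedBall 0 r))
    (f := fun u z => κ u y z • z) ?_
  · have : ∀ z : E Θ.d, timeKernel κ y t s z • z = ∫ u in Ioc t s, κ u y z • z := fun z => by
      rw [integral_smul_const, timeKernel, intervalIntegral.integral_of_le hts]
    simp_rw [this]
    rw [← hswap]
    refine setIntegral_eq_zero_of_forall_eq_zero fun u hu => ?_
    exact hc h2 u (ht.trans hu.1.le) y r hr
  · rw [Measure.prod_restrict]
    refine Measure.integrableOn_of_bounded (M := Θ.κ₀ * r) ?_ ?_ ?_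
    · rw [Measure.prod_prod]
      exact (ENNReal.mul_lt_top measure_Ioc_lt_top measure_closedBall_lt_top).ne
    · exact ((H.bounds.measurable_comp measurable_fst measurable_const measurable_snd).smul
        measurable_snd).aestronglyMeasurable
    · refine (ae_restrict_iff' (measurableSet_Ioc.prod measurableSet_closedBall)).2
        (ae_of_all _ fun p hp => ?_)
      have h0 : 0 ≤ p.1 := ht.trans hp.1.1.le
      simp only [Function.uncurry]
      rw [norm_smul, Real.norm_of_nonneg (H.bounds.nonneg h0 _ _)]
      have := H.bounds.nonneg h0 y p.2
      exact mul_le_mul (H.bounds.upper _ h0 _ _) (mem_closedBall_zero_iff.1 hp.2) (norm_nonneg _)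
        (this.trans (H.bounds.upper _ h0 _ _))

/-- The frozen heat kernel is the density of a Lévy law. -/
lemma frozenKernel_eq {t s : ℝ} (ht : 0 ≤ t) (hts : t ≤ s) (y : E Θ.d) :
    frozenKernel φ κ y t s = levyDensity φ (timeKernel κ y t s) := by
  ext x
  unfold frozenKernel density levyDensity invFourier levyExponent
  simp_rw [charExponent_eq H.adm H.bounds ht hts]
  congr 3
  ext ξ
  rw [inner_neg_left]
  push_cast
  ring_nf

lemma driftInt_case2 (h2 : Case2 φ) {a : ℝ} (ha : a ∈ Ioc (0 : ℝ) 1) (z : E Θ.d) :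
    driftInt φ a z = -((Ioc a 1).indicator (fun _ => (1 : ℝ)) ‖z‖) • z := by
  unfold driftInt
  rw [zphi_case2 h2]
  rcases le_or_gt ‖z‖ a with h | h
  · rw [if_pos h, if_pos (h.trans ha.2), indicator_of_notMem (fun hm => absurd hm.1 (not_lt.2 h))]
    simp
  · rw [if_neg (not_le.2 h)]
    by_cases h1 : ‖z‖ ≤ 1
    · rw [if_pos h1, indicator_of_mem (show ‖z‖ ∈ Ioc a 1 from ⟨h, h1⟩)]; simp
    · rw [if_neg h1, indicator_of_notMem (fun hm => h1 hm.2)]; simp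

/-- A kernel that is centered has no drift when the compensation is moved to another level. -/
lemma integral_driftInt_case2 (h2 : Case2 φ) {a : ℝ} (ha : a ∈ Ioc (0 : ℝ) 1) {k : E Θ.d → ℝ}
    (hk : Measurable k) {B : ℝ} (hB : ∀ z, |k z| ≤ B)
    (hz : ∀ r, 0 < r → ∫ z in Metric.closedBall (0 : E Θ.d) r, k z • z = 0) :
    ∫ z, (k z / radVol Θ.d φ ‖z‖) • driftInt φ a z = 0 := by
  have h := H.adm
  have hB0 : 0 ≤ B := (abs_nonneg _).trans (hB 0)
  set g : ℝ → ℝ := (Ioc a 1).indicator fun r => -(radVol Θ.d φ r)⁻¹ with hg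
  have hgc : ContinuousOn (fun r => -(radVol Θ.d φ r)⁻¹) (Ioc a 1) := by
    have hsub : Ioc a 1 ⊆ Ioi 0 := fun r hr => ha.1.trans hr.1
    exact ((((continuousOn_id.pow _).mul (h.continuousOn_phi.mono hsub))).inv₀
      fun r hr => (h.radVol_pos (hsub hr)).ne').neg
  have hgm : Measurable g := by
    have := hgc.measurable_piecewise (s := Ioc a 1) (g := fun _ : ℝ => (0 : ℝ))
      continuousOn_const measurableSet_Ioc
    convert this using 1
    ext r
    by_cases hr : r ∈ Ioc a 1 <;> simp [hg, hr]
  have heq : ∀ z : E Θ.d, (k z / radVol Θ.d φ ‖z‖) • driftInt φ a z = (g ‖z‖ * k z) • z := by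
    intro z
    rw [driftInt_case2 H h2 ha, smul_smul, hg]
    congr 1
    by_cases hr : ‖z‖ ∈ Ioc a 1
    · rw [indicator_of_mem hr, indicator_of_mem hr]; ring
    · rw [indicator_of_notMem hr, indicator_of_notMem hr]; ring
  simp_rw [heq]
  have hsupp : (fun z : E Θ.d => (g ‖z‖ * k z) • z) =
      (Metric.closedBall (0 : E Θ.d) 1).indicator fun z => (g ‖z‖ * k z) • z := by
    ext1 z
    by_cases hz : z ∈ Metric.closedBall (0 : E Θ.d) 1
    · rw [indicator_of_mem hz]
    · rw [indicator_of_notMem hz, hg, indicator_of_notMem (fun hm => hz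
        (mem_closedBall_zero_iff.2 hm.2)), zero_mul, zero_smul]
  rw [hsupp, integral_indicator measurableSet_closedBall]
  refine integral_radial_smul_eq_zero hk hB (fun r hr _ => hz r hr) hgm ?_
  have hVa := h.radVol_pos ha.1
  refine Measure.integrableOn_of_bounded (M := (radVol Θ.d φ a)⁻¹ * B) measure_closedBall_lt_top.ne
    (((hgm.comp measurable_norm).mul hk).smul measurable_id).aestronglyMeasurable
    ((ae_restrict_iff' measurableSet_closedBall).2 (ae_of_all _ fun z hz => ?_))
  rw [norm_smul, norm_mul, Real.norm_eq_abs (k z)]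
  have hgz : ‖g ‖z‖‖ ≤ (radVol Θ.d φ a)⁻¹ := by
    rw [hg]
    by_cases hr : ‖z‖ ∈ Ioc a 1
    · rw [indicator_of_mem hr, norm_neg, norm_inv,
        Real.norm_of_nonneg (h.radVol_nonneg (norm_nonneg z))]
      exact inv_anti₀ hVa (h.radVol_mono ha.1.le hr.1.le)
    · rw [indicator_of_notMem hr, norm_zero]; positivity
  have hz1 : ‖z‖ ≤ 1 := mem_closedBall_zero_iff.1 hz
  have h3 := mul_le_mul hgz (hB z) (abs_nonneg _) (by positivity)
  have h4 := mul_le_mul h3 hz1 (norm_nonneg _) (by positivity)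
  linarith

/-- The drift left over by the truncation at the level `a` is of order `a`. -/
lemma norm_integral_driftInt_le {t s : ℝ} (ht : 0 ≤ t) (hts : t < s) (y : E Θ.d)
    {a : ℝ} (ha : a ∈ Ioc (0 : ℝ) 1) (hφa : φ a = s - t) :
    ‖∫ z, (timeKernel κ y t s z / radVol Θ.d φ ‖z‖) • driftInt φ a z‖ ≤
      Θ.κ₀ * (sphereArea Θ.d * Θ.A₁.toReal) * a := by
  have h := H.adm
  have hk := H.bounds.kBound ht hts y
  have hsA := sphereArea_nonneg Θ.d
  have hκ0 : 0 < Θ.κ₀ := zero_lt_one.trans_le h.κ₀_ge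
  have ha0 := ha.1
  have hpos := h.phi_pos ha0
  have hnn : 0 ≤ Θ.κ₀ * (sphereArea Θ.d * Θ.A₁.toReal) * a := by positivity
  rcases H.cases with hs | ⟨-, hA, hAt, hc⟩
  -- a symmetric kernel: the integrand is odd
  · have hodd : ∀ z : E Θ.d, (timeKernel κ y t s (-z) / radVol Θ.d φ ‖-z‖) • driftInt φ a (-z) =
        -((timeKernel κ y t s z / radVol Θ.d φ ‖z‖) • driftInt φ a z) := fun z => by
      rw [H.timeKernel_neg hs ht hts.le, norm_neg, ← smul_neg]
      congr 1
      unfold driftInt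
      rw [zphi_neg, norm_neg]
      split_ifs <;> simp [neg_add_eq_sub]
    have h1 := integral_neg_eq_self
      (fun z : E Θ.d => (timeKernel κ y t s z / radVol Θ.d φ ‖z‖) • driftInt φ a z) volume
    simp_rw [hodd] at h1
    rw [integral_neg] at h1
    have h3 : (2 : ℝ) • ∫ z, (timeKernel κ y t s z / radVol Θ.d φ ‖z‖) • driftInt φ a z = 0 := by
      rw [two_smul]; nth_rewrite 1 [← h1]; exact neg_add_cancel _
    rw [(smul_eq_zero.1 h3).resolve_left two_ne_zero, norm_zero]
    exact hnn
  -- otherwise the centering of the kernel in case 2, the moment `𝒜^{(1)}_φ` in cases 1 and 3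
  · by_cases h2 : ¬ Case1 φ ∧ Case2 φ
    · rw [H.integral_driftInt_case2 h2.2 ha hk.measurable (B := Θ.κ₀ * (s - t)) (fun z => ?_)
        fun r hr => H.integral_timeKernel_smul hc h2.2 ht hts.le y hr, norm_zero]
      · exact hnn
      · rw [abs_of_nonneg (hk.pos.le.trans (hk.lower z))]; exact hk.upper z
    · have hmono : ∀ z : E Θ.d, ‖(timeKernel κ y t s z / radVol Θ.d φ ‖z‖) • driftInt φ a z‖ ≤
          Θ.κ₀ * φ a * a * (gamma1 φ (‖z‖ / a) / radVol Θ.d φ ‖z‖) := fun z => by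
        have hV := h.radVol_nonneg (norm_nonneg z)
        have hg := gamma1_nonneg φ (div_nonneg (norm_nonneg z) ha0.le)
        rw [norm_smul, Real.norm_of_nonneg (hk.div_nonneg' h z)]
        calc timeKernel κ y t s z / radVol Θ.d φ ‖z‖ * ‖driftInt φ a z‖
            ≤ Θ.κ₀ * (s - t) / radVol Θ.d φ ‖z‖ * (a * gamma1 φ (‖z‖ / a)) := by
              have h1 := hk.upper z
              have h3 := norm_driftInt_le_of_not_case2 h2 ha0 z
              have h4 := hk.upper_pos h
              gcongr
          _ = _ := by rw [hφa]; ring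
      have hlin := h.lintegral_gamma_le (continuous_gamma1 φ).continuousOn ha
      have hA' : supA φ (gamma1 φ) ≠ ⊤ := hAt.ne
      refine (norm_integral_le_lintegral_norm _).trans (ENNReal.toReal_le_of_le_ofReal hnn ?_)
      calc ∫⁻ z, ENNReal.ofReal ‖(timeKernel κ y t s z / radVol Θ.d φ ‖z‖) • driftInt φ a z‖
          ≤ ∫⁻ z : E Θ.d, ENNReal.ofReal (Θ.κ₀ * φ a * a) *
              ENNReal.ofReal (gamma1 φ (‖z‖ / a) / radVol Θ.d φ ‖z‖) := by
            refine lintegral_mono fun z => ?_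
            rw [← ENNReal.ofReal_mul (by positivity)]
            exact ENNReal.ofReal_le_ofReal (hmono z)
        _ = ENNReal.ofReal (Θ.κ₀ * φ a * a) *
              ∫⁻ z : E Θ.d, ENNReal.ofReal (gamma1 φ (‖z‖ / a) / radVol Θ.d φ ‖z‖) :=
            lintegral_const_mul' _ _ ENNReal.ofReal_ne_top
        _ ≤ ENNReal.ofReal (Θ.κ₀ * φ a * a) * (ENNReal.ofReal (sphereArea Θ.d) *
              (ENNReal.ofReal (φ a)⁻¹ * supA φ (gamma1 φ))) := by gcongr
        _ = _ := by
            rw [hA, ← ENNReal.ofReal_toReal hA', ← ENNReal.ofReal_mul (by positivity),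
              ← ENNReal.ofReal_mul (sphereArea_nonneg _), ← ENNReal.ofReal_mul (by positivity)]
            congr 1
            rw [A1]
            field_simp

end Setting

/-- The frozen heat kernel is three times continuously differentiable; it and its derivatives are
bounded by the kernel `τ / V(a + |x|)`, `a = φ⁻¹(τ)`, each derivative costing a factor `1 / a`. -/
theorem exists_frozenKernel_bound (Θ : Theta) : ∃ C : ℝ, 0 < C ∧
    ∀ (φ ℓ : ℝ → ℝ) (κ : ℝ → E Θ.d → E Θ.d → ℝ), Setting Θ φ ℓ κ →
      ∀ (t s : ℝ) (y : E Θ.d), 0 ≤ t → t < s → s - t ≤ 1 →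
        ContDiff ℝ 3 (frozenKernel φ κ y t s) ∧ ∀ i ≤ 3, ∀ x,
          ‖iteratedFDeriv ℝ i (frozenKernel φ κ y t s) x‖ ≤ C * (phiInv φ (s - t))⁻¹ ^ i *
            ((s - t) / radVol Θ.d φ (phiInv φ (s - t) + ‖x‖)) := by
  by_cases hκ : 0 ≤ Θ.κ₀
  swap
  · exact ⟨1, one_pos, fun φ ℓ κ H => absurd (zero_le_one.trans H.adm.κ₀_ge) hκ⟩
  have hsA := sphereArea_nonneg Θ.d
  obtain ⟨C, hC, hmain⟩ := exists_levyDensity_bound Θ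
    (b₀ := Θ.κ₀ * (sphereArea Θ.d * Θ.A₁.toReal)) (by positivity)
  refine ⟨C, hC, fun φ ℓ κ H t s y ht hts hts1 => ?_⟩
  have h := H.adm
  have hτ : 0 < s - t := sub_pos.2 hts
  have ha : phiInv φ (s - t) ∈ Ioc (0 : ℝ) 1 :=
    ⟨h.phiInv_pos hτ hts1, h.phiInv_le_one hτ.le hts1⟩
  have hφa := h.phi_phiInv hτ.le hts1
  have := hmain φ h _ ha (timeKernel κ y t s) (by rw [hφa]; exact H.bounds.kBound ht hts y)
    (H.norm_integral_driftInt_le ht hts y ha hφa)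
  rw [H.frozenKernel_eq ht hts.le]
  rwa [hφa] at this

/-! ### The nonlocal operators applied to functions with heat kernel decay -/

/-- Functions that, together with their first `n` derivatives, decay like the frozen heat kernel
of time `φ(a)`; each derivative costs a factor `a⁻¹`. -/
structure Decay {d : ℕ} (φ : ℝ → ℝ) (a K : ℝ) (n : ℕ) (f : E d → ℝ) : Prop where
  contDiff : ContDiff ℝ n f
  bound : ∀ i ≤ n, ∀ x, ‖iteratedFDeriv ℝ i f x‖ ≤ K * a⁻¹ ^ i * (φ a / radVol d φ (a + ‖x‖))

/-- A bound for `f` gives a bound for `f(· + h) - f` with one derivative less and the additional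
factor `|h| / a`. -/
lemma Decay.shift_sub {Θ : Theta} {φ : ℝ → ℝ} (h : Adm Θ φ) {a K : ℝ} (ha : 0 < a) (hK : 0 ≤ K)
    {n : ℕ} {f : E Θ.d → ℝ} (hf : Decay φ a K (n + 1) f) {w : E Θ.d} (hw : ‖w‖ ≤ a) :
    Decay φ a (dblC Θ 2 * K * (‖w‖ / a)) n (fun x => f (x + w) - f x) := by
  have hcd : ContDiff ℝ n f := hf.contDiff.of_le (by exact_mod_cast Nat.le_succ n)
  have hcs : ContDiff ℝ n (fun x => f (x + w)) := hcd.comp (contDiff_id.add contDiff_const)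
  refine ⟨hcs.sub hcd, fun i hi x => ?_⟩
  have hφ := h.phi_pos ha
  have hi' : ContDiff ℝ i f := hcd.of_le (by exact_mod_cast hi)
  have e1 : iteratedFDeriv ℝ i (fun x => f (x + w) - f x) x =
      iteratedFDeriv ℝ i f (x + w) - iteratedFDeriv ℝ i f x := by
    rw [fun_iteratedFDeriv_sub_apply
      (hcs.of_le (by exact_mod_cast hi)).contDiffAt hi'.contDiffAt, iteratedFDeriv_comp_add_right]
  rw [e1]
  set M : ℝ := K * a⁻¹ ^ (i + 1) * (φ a * (dblC Θ 2 * (1 / radVol Θ.d φ (a + ‖x‖)))) with hM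
  have hdiff : Differentiable ℝ (iteratedFDeriv ℝ i f) :=
    hf.contDiff.differentiable_iteratedFDeriv (by exact_mod_cast Nat.lt_succ_of_le hi)
  have := (convex_segment (𝕜 := ℝ) x (x + w)).norm_image_sub_le_of_norm_fderiv_le (𝕜 := ℝ)
    (f := iteratedFDeriv ℝ i f) (C := M) (fun y _ => hdiff y) (fun y hy => ?_)
    (left_mem_segment _ _ _) (right_mem_segment _ _ _)
  · refine this.trans (le_of_eq ?_)
    rw [add_sub_cancel_left, hM, pow_succ]
    field_simp
  · rw [norm_fderiv_iteratedFDeriv]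
    refine (hf.bound (i + 1) (by omega) y).trans ?_
    rw [hM, div_eq_mul_one_div]
    have hyx : ‖y - x‖ ≤ ‖w‖ := by
      have := norm_sub_le_of_mem_segment hy
      simpa using this
    have h2 : a + ‖x‖ ≤ 2 * (a + ‖y‖) := by
      have : ‖x‖ ≤ ‖y‖ + ‖y - x‖ := by
        have := norm_sub_le y (y - x); rwa [sub_sub_cancel] at this
      have := norm_nonneg y
      linarith
    have := h.inv_radVol_le one_le_two (by positivity : 0 < a + ‖y‖)
      (by positivity : 0 < a + ‖x‖) h2
    gcongr

/-- Second order Taylor expansion. -/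
lemma norm_sub_fderiv_le {F : Type*} [NormedAddCommGroup F] [NormedSpace ℝ F] {f : F → ℝ}
    (hf : ContDiff ℝ 2 f) (x z : F) {M : ℝ}
    (hM : ∀ y, ‖y - x‖ ≤ ‖z‖ → ‖iteratedFDeriv ℝ 2 f y‖ ≤ M) :
    |f (x + z) - f x - fderiv ℝ f x z| ≤ M * ‖z‖ ^ 2 := by
  have hd : Differentiable ℝ f := hf.differentiable (by norm_num)
  have hd' : Differentiable ℝ (fderiv ℝ f) :=
    (hf.fderiv_right (m := 1) (by norm_num)).differentiable (by norm_num)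
  have hc : Convex ℝ (Metric.closedBall x ‖z‖) := convex_closedBall _ _
  have hx : x ∈ Metric.closedBall x ‖z‖ := Metric.mem_closedBall_self (norm_nonneg z)
  have hM0 : 0 ≤ M := (norm_nonneg _).trans (hM x (by simp))
  have := hc.norm_image_sub_le_of_norm_fderiv_le' (𝕜 := ℝ) (f := f) (φ := fderiv ℝ f x)
    (C := M * ‖z‖) (fun y _ => hd y) (fun y hy => ?_) hx
    (show x + z ∈ Metric.closedBall x ‖z‖ by simp)
  · rw [add_sub_cancel_left, Real.norm_eq_abs] at this
    linarith [this]
  · have h1 := hc.norm_image_sub_le_of_norm_fderiv_le (𝕜 := ℝ) (f := fderiv ℝ f)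
      (C := M) (fun y _ => hd' y) (fun y hy => ?_) hx hy
    · refine h1.trans ?_
      gcongr
      exact mem_closedBall_iff_norm.1 hy
    · rw [← norm_iteratedFDeriv_one, norm_iteratedFDeriv_fderiv]
      exact hM y (mem_closedBall_iff_norm.1 hy)

lemma norm_sub_le_of_norm_iteratedFDeriv_one_le {F : Type*} [NormedAddCommGroup F]
    [NormedSpace ℝ F] {f : F → ℝ} (hf : ContDiff ℝ 2 f) (x z : F) {M : ℝ}
    (hM : ∀ y, ‖y - x‖ ≤ ‖z‖ → ‖iteratedFDeriv ℝ 1 f y‖ ≤ M) :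
    |f (x + z) - f x| ≤ M * ‖z‖ := by
  have hd : Differentiable ℝ f := hf.differentiable (by norm_num)
  have := (convex_closedBall x ‖z‖).norm_image_sub_le_of_norm_fderiv_le (𝕜 := ℝ) (f := f)
    (C := M) (fun y _ => hd y) (fun y hy => ?_) (Metric.mem_closedBall_self (norm_nonneg z))
    (show x + z ∈ Metric.closedBall x ‖z‖ by simp)
  · rwa [add_sub_cancel_left] at this
  · rw [← norm_iteratedFDeriv_one]
    exact hM y (mem_closedBall_iff_norm.1 hy)

open Classical in
/-- The vector `z^{(φ)}` with the truncation of case 2 moved from the level one to the level `a`. -/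
def zlevel (φ : ℝ → ℝ) {d : ℕ} (a : ℝ) (z : E d) : E d :=
  if Case2 φ then (if ‖z‖ ≤ a then z else 0) else zphi φ z

open Classical in
/-- The numerator of the difference operator, truncated at the level `a`. -/
def levelDiff (φ : ℝ → ℝ) {d : ℕ} (κ : ℝ → E d → E d → ℝ) (a : ℝ) (f : E d → ℝ) (x z : E d) : ℝ :=
  if SymmKernel κ then (f (x + z) + f (x - z) - 2 * f x) / 2
  else f (x + z) - f x - fderiv ℝ f x (zlevel φ a z)

open Classical in
/-- The moment function that controls small and large jumps: `γ^{(0)}` for symmetric kernels and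
`γ^{(1)}_φ` otherwise. -/
def gammaK (φ : ℝ → ℝ) {d : ℕ} (κ : ℝ → E d → E d → ℝ) : ℝ → ℝ :=
  if SymmKernel κ then gamma0 else gamma1 φ

lemma Delta_eq (φ : ℝ → ℝ) {d : ℕ} (κ : ℝ → E d → E d → ℝ) (f : E d → ℝ) (x z : E d) :
    Delta φ κ f x z = levelDiff φ κ 1 f x z / radVol d φ ‖z‖ := by
  have hz : zlevel φ 1 z = zphi φ z := by
    unfold zlevel zphi
    split_ifs <;> rfl
  unfold Delta levelDiff
  rw [hz, radVol]
  split_ifs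
  · rw [div_div]
  · rfl

lemma measurable_zlevel (φ : ℝ → ℝ) {d : ℕ} (a : ℝ) : Measurable (zlevel φ a : E d → E d) := by
  unfold zlevel
  split_ifs
  · exact Measurable.ite (measurableSet_le measurable_norm measurable_const) measurable_id
      measurable_const
  · exact measurable_zphi φ

lemma measurable_levelDiff (φ : ℝ → ℝ) {d : ℕ} (κ : ℝ → E d → E d → ℝ) (a : ℝ) {f : E d → ℝ}
    (hf : Continuous f) (x : E d) : Measurable (levelDiff φ κ a f x) := by
  unfold levelDiff
  split_ifs
  · have h1 : Continuous fun z => f (x + z) := hf.comp (continuous_const.add continuous_id)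
    have h2 : Continuous fun z => f (x - z) := hf.comp (continuous_const.sub continuous_id)
    exact (((h1.add h2).sub continuous_const).div_const 2).measurable
  · have h1 : Continuous fun z => f (x + z) := hf.comp (continuous_const.add continuous_id)
    exact (h1.measurable.sub measurable_const).sub
      ((fderiv ℝ f x).continuous.measurable.comp (measurable_zlevel φ a))

lemma levelDiff_sub {φ : ℝ → ℝ} {d : ℕ} (κ : ℝ → E d → E d → ℝ) (a : ℝ) {f : E d → ℝ}
    (hf : Differentiable ℝ f) (x w z : E d) :
    levelDiff φ κ a (fun x => f (x + w) - f x) x z =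
      levelDiff φ κ a f (x + w) z - levelDiff φ κ a f x z := by
  unfold levelDiff
  split_ifs
  · beta_reduce
    rw [show x + z + w = x + w + z by abel, show x - z + w = x + w - z by abel]
    ring
  · have h1 : DifferentiableAt ℝ (fun x => f (x + w)) x :=
      (hf _).comp x ((differentiable_id.add_const w) x)
    rw [fderiv_fun_sub h1 (hf x), fderiv_comp_add_right]
    beta_reduce
    rw [show x + z + w = x + w + z by abel]
    simp only [sub_apply]
    ring

section

variable {Θ : Theta} {φ : ℝ → ℝ} (h : Adm Θ φ) {a K : ℝ} {f : E Θ.d → ℝ}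

lemma gamma_one_of_lt {r : ℝ} (hr : 1 ≤ r) (φ : ℝ → ℝ) {d : ℕ} (κ : ℝ → E d → E d → ℝ) :
    1 ≤ gammaK φ κ r := by
  have h0 : gamma0 r = 1 := min_eq_right (by nlinarith)
  unfold gammaK
  split_ifs
  · exact h0.ge
  · exact h0.ge.trans (gamma0_le_gamma1 φ (by linarith))

lemma gammaK_nonneg (φ : ℝ → ℝ) {d : ℕ} (κ : ℝ → E d → E d → ℝ) {r : ℝ} (hr : 0 ≤ r) :
    0 ≤ gammaK φ κ r := by
  unfold gammaK
  split_ifs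
  · exact gamma0_nonneg r
  · exact gamma1_nonneg φ hr

lemma continuous_gammaK (φ : ℝ → ℝ) {d : ℕ} (κ : ℝ → E d → E d → ℝ) :
    Continuous (gammaK φ κ) := by
  unfold gammaK
  split_ifs
  · exact continuous_gamma0
  · exact continuous_gamma1 φ

include h

/-- Small jumps: second order Taylor expansion, or first order in case 1. -/
lemma abs_levelDiff_le_small (κ : ℝ → E Θ.d → E Θ.d → ℝ) (ha : 0 < a)
    (hK : 0 ≤ K) (hf : Decay φ a K 2 f) (x : E Θ.d) {z : E Θ.d} (hz : ‖z‖ ≤ a) :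
    |levelDiff φ κ a f x z| ≤
      K * φ a * (dblC Θ 2 * (gammaK φ κ (‖z‖ / a) * (1 / radVol Θ.d φ (a + ‖x‖)))) := by
  have hφ := h.phi_pos ha
  have hV := h.radVol_pos (by positivity : 0 < a + ‖x‖)
  have hD := dblC_pos Θ (k := 2) two_pos
  have hz0 := norm_nonneg z
  have hr1 : ‖z‖ / a ≤ 1 := (div_le_one ha).2 hz
  have hr0 : 0 ≤ ‖z‖ / a := by positivity
  have hM : ∀ i ≤ 2, ∀ y, ‖y - x‖ ≤ ‖z‖ → ‖iteratedFDeriv ℝ i f y‖ ≤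
      K * a⁻¹ ^ i * (φ a * (dblC Θ 2 * (1 / radVol Θ.d φ (a + ‖x‖)))) := fun i hi y hy => by
    refine (hf.bound i hi y).trans ?_
    rw [div_eq_mul_one_div (φ a)]
    have h2 : a + ‖x‖ ≤ 2 * (a + ‖y‖) := by
      have : ‖x‖ ≤ ‖y‖ + ‖y - x‖ := by
        have := norm_sub_le y (y - x); rwa [sub_sub_cancel] at this
      have := norm_nonneg y
      linarith
    have := h.inv_radVol_le one_le_two (by positivity : 0 < a + ‖y‖)
      (by positivity : 0 < a + ‖x‖) h2
    gcongr
  have hsecond : ∀ w : E Θ.d, ‖w‖ = ‖z‖ → |f (x + w) - f x - fderiv ℝ f x w| ≤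
      K * φ a * (dblC Θ 2 * ((‖z‖ / a) ^ 2 * (1 / radVol Θ.d φ (a + ‖x‖)))) := fun w hw => by
    refine (norm_sub_fderiv_le hf.contDiff x w fun y hy => hM 2 le_rfl y (hw ▸ hy)).trans ?_
    rw [hw]
    refine le_of_eq ?_
    field_simp
  have hg0 : gamma0 (‖z‖ / a) = (‖z‖ / a) ^ 2 := min_eq_left (by nlinarith)
  unfold levelDiff gammaK
  split_ifs with hs
  · rw [hg0]
    have e1 := hsecond z rfl
    have e2 := hsecond (-z) (norm_neg z)
    rw [map_neg, ← sub_eq_add_neg] at e2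
    have e3 : (f (x + z) + f (x - z) - 2 * f x) / 2 =
        ((f (x + z) - f x - fderiv ℝ f x z) + (f (x - z) - f x - -fderiv ℝ f x z)) / 2 := by ring
    rw [e3, abs_div, abs_two, div_le_iff₀ two_pos]
    refine (abs_add_le _ _).trans ?_
    linarith
  · unfold zlevel
    rcases case1_or φ with h1 | ⟨h1, h2⟩ | ⟨h1, h2, h3⟩
    · have h2 : ¬ Case2 φ := fun h2 => h2.1 h1
      rw [if_neg h2, zphi_case1 h1, map_zero, sub_zero, gamma1_case1 h1, min_eq_left hr1]
      refine (norm_sub_le_of_norm_iteratedFDeriv_one_le hf.contDiff x z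
        (hM 1 one_le_two)).trans (le_of_eq ?_)
      field_simp
    · rw [if_pos h2, if_pos hz, gamma1_case2 h1 h2]
      exact (hsecond z rfl).trans (by rw [← gamma0, hg0])
    · rw [if_neg h2, zphi_case3 h2 h3, gamma1_case3 h1 h2, min_eq_left (by nlinarith)]
      exact hsecond z rfl

/-- Large jumps. -/
lemma abs_levelDiff_le_large (κ : ℝ → E Θ.d → E Θ.d → ℝ) (ha : 0 < a)
    (hK : 0 ≤ K) (hf : Decay φ a K 2 f) (x : E Θ.d) {z : E Θ.d} (hz : a < ‖z‖) :
    |levelDiff φ κ a f x z| ≤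
      K * φ a * (2 * (gammaK φ κ (‖z‖ / a) * (1 / radVol Θ.d φ (a + ‖x‖))) +
        (1 / radVol Θ.d φ (a + ‖x + z‖) + 1 / radVol Θ.d φ (a + ‖x - z‖))) := by
  have hφ := h.phi_pos ha
  have hz0 := norm_nonneg z
  have hr1 : 1 < ‖z‖ / a := (one_lt_div ha).2 hz
  have hV : ∀ y : E Θ.d, 0 < 1 / radVol Θ.d φ (a + ‖y‖) := fun y =>
    one_div_pos.2 (h.radVol_pos (by positivity))
  have hb : ∀ y, |f y| ≤ K * φ a * (1 / radVol Θ.d φ (a + ‖y‖)) := fun y => by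
    have := hf.bound 0 (by norm_num) y
    rw [norm_iteratedFDeriv_zero, pow_zero, mul_one, Real.norm_eq_abs] at this
    exact this.trans (le_of_eq (by ring))
  have hg := gamma_one_of_lt hr1.le φ κ
  have b0 := hb x
  have b1 := hb (x + z)
  have b2 := hb (x - z)
  have v0 := hV x
  have v1 := hV (x + z)
  have v2 := hV (x - z)
  have hx1 : K * φ a * (1 / radVol Θ.d φ (a + ‖x‖)) ≤
      K * φ a * (gammaK φ κ (‖z‖ / a) * (1 / radVol Θ.d φ (a + ‖x‖))) := by
    gcongr
    exact le_mul_of_one_le_left v0.le hg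
  have w1 : 0 ≤ K * φ a * (1 / radVol Θ.d φ (a + ‖x + z‖)) := by positivity
  have w2 : 0 ≤ K * φ a * (1 / radVol Θ.d φ (a + ‖x - z‖)) := by positivity
  rw [mul_add, mul_add]
  set A := K * φ a * (gammaK φ κ (‖z‖ / a) * (1 / radVol Θ.d φ (a + ‖x‖))) with hA
  have hA2 : K * φ a * (2 * (gammaK φ κ (‖z‖ / a) * (1 / radVol Θ.d φ (a + ‖x‖)))) = 2 * A := by
    rw [hA]; ring
  rw [hA2]
  unfold levelDiff
  split_ifs with hs
  · rw [abs_le] at *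
    constructor <;> linarith
  · have hderiv : |fderiv ℝ f x (zlevel φ a z)| ≤ A := by
      have hA0 : 0 ≤ A := ((abs_nonneg _).trans b0).trans hx1
      unfold zlevel
      rcases case1_or φ with h1 | ⟨h1, h2⟩ | ⟨h1, h2, h3⟩
      · have h2 : ¬ Case2 φ := fun h2 => h2.1 h1
        rw [if_neg h2, zphi_case1 h1, map_zero, abs_zero]; exact hA0
      · rw [if_pos h2, if_neg (not_le.2 hz), map_zero, abs_zero]; exact hA0
      · rw [if_neg h2, zphi_case3 h2 h3, hA, gammaK, if_neg hs, gamma1_case3 h1 h2,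
          min_eq_right (by nlinarith)]
        have := hf.bound 1 (by norm_num) x
        rw [norm_iteratedFDeriv_one, pow_one] at this
        refine ((fderiv ℝ f x).le_opNorm z).trans ?_
        refine (mul_le_mul_of_nonneg_right this hz0).trans (le_of_eq ?_)
        field_simp
    rw [abs_le] at *
    constructor <;> linarith

end

/-- Moments of the jumps at the scale `a`, from the finiteness of `𝒜^{(0)}_φ` or `𝒜^{(1)}_φ`. -/
lemma Setting.lintegral_gammaK_le {Θ : Theta} {φ ℓ : ℝ → ℝ} {κ : ℝ → E Θ.d → E Θ.d → ℝ}
    (H : Setting Θ φ ℓ κ) {a : ℝ} (ha : a ∈ Ioc (0 : ℝ) 1) :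
    ∫⁻ z : E Θ.d, ENNReal.ofReal (gammaK φ κ (‖z‖ / a) * (1 / radVol Θ.d φ ‖z‖)) ≤
      ENNReal.ofReal (sphereArea Θ.d * (Θ.A₀.toReal + Θ.A₁.toReal) / φ a) := by
  have h := H.adm
  have hφ := h.phi_pos ha.1
  have hsA := sphereArea_nonneg Θ.d
  have key : ∀ γ : ℝ → ℝ, Continuous γ → supA φ γ < ∞ →
      (supA φ γ).toReal ≤ Θ.A₀.toReal + Θ.A₁.toReal →
      ∫⁻ z : E Θ.d, ENNReal.ofReal (γ (‖z‖ / a) * (1 / radVol Θ.d φ ‖z‖)) ≤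
        ENNReal.ofReal (sphereArea Θ.d * (Θ.A₀.toReal + Θ.A₁.toReal) / φ a) :=
    fun γ hγ hfin hle => by
      have := h.lintegral_gamma_le hγ.continuousOn ha
      simp only [mul_one_div]
      refine this.trans ?_
      rw [← ENNReal.ofReal_toReal hfin.ne, ← ENNReal.ofReal_mul (by positivity),
        ← ENNReal.ofReal_mul hsA]
      refine ENNReal.ofReal_le_ofReal ?_
      rw [mul_div_assoc, div_eq_inv_mul]
      gcongr
  unfold gammaK
  rcases H.cases with hs | ⟨hs, hA, hAt, -⟩
  · rw [if_pos hs]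
    refine key _ continuous_gamma0 h.A0_lt_top ?_
    rw [h.A₀_eq, A0]
    exact le_add_of_nonneg_right ENNReal.toReal_nonneg
  · rw [if_neg hs]
    refine key _ (continuous_gamma1 φ) hAt ?_
    rw [hA, A1]
    exact le_add_of_nonneg_left ENNReal.toReal_nonneg

/-- The difference operator, truncated at the scale `a`, is bounded on functions that decay like the
heat kernel of time `φ(a)`. -/
theorem exists_lintegral_levelDiff_le (Θ : Theta) : ∃ C : ℝ, 0 < C ∧
    ∀ (φ ℓ : ℝ → ℝ) (κ : ℝ → E Θ.d → E Θ.d → ℝ), Setting Θ φ ℓ κ →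
      ∀ a ∈ Ioc (0 : ℝ) 1, ∀ (K : ℝ) (f : E Θ.d → ℝ), 0 ≤ K → Decay φ a K 2 f → ∀ x,
        ∫⁻ z, ENNReal.ofReal (|levelDiff φ κ a f x z| / radVol Θ.d φ ‖z‖) ≤
          ENNReal.ofReal (C * K * (1 / radVol Θ.d φ (a + ‖x‖))) := by
  obtain ⟨C, hC, hconv⟩ := exists_lintegral_conv_le Θ
  have hD := dblC_pos Θ (k := 2) two_pos
  have hsA := sphereArea_nonneg Θ.d
  set M : ℝ := sphereArea Θ.d * (Θ.A₀.toReal + Θ.A₁.toReal) with hM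
  have hM0 : 0 ≤ M := by positivity
  refine ⟨(dblC Θ 2 + 2) * M + dblC Θ 2 * (C + C), by positivity, ?_⟩
  intro φ ℓ κ H a ha K f hK hf x
  have h := H.adm
  have ha0 := ha.1
  have hφ := h.phi_pos ha0
  have hVp : ∀ y : E Θ.d, 0 < 1 / radVol Θ.d φ (a + ‖y‖) := fun y =>
    one_div_pos.2 (h.radVol_pos (by positivity))
  set G : E Θ.d → ℝ := fun z => gammaK φ κ (‖z‖ / a) * (1 / radVol Θ.d φ ‖z‖) with hG
  set J : E Θ.d → ℝ := fun z => 1 / radVol Θ.d φ (a + ‖z‖) with hJ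
  have hGm : Measurable G := (((continuous_gammaK φ κ).comp (by fun_prop)).measurable).mul
    (h.continuous_radVol_norm.measurable.const_div 1)
  have hJm : ∀ {u : E Θ.d → E Θ.d}, Measurable u → Measurable fun z => J (u z) := fun hu =>
    (h.measurable_radVol_add ha0.le hu).const_div 1
  have hG0 : ∀ z, 0 ≤ G z := fun z => mul_nonneg
    (gammaK_nonneg φ κ (by positivity)) (one_div_nonneg.2 (h.radVol_nonneg (norm_nonneg z)))
  -- small jumps are governed by the moments `G`, large jumps also by convolutions of `J`
  have hpt : ∀ z, |levelDiff φ κ a f x z| / radVol Θ.d φ ‖z‖ ≤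
      K * φ a * ((dblC Θ 2 + 2) * J x * G z +
        dblC Θ 2 * (J z * J (x + z) + J z * J (x - z))) := fun z => by
    have hVz := h.radVol_nonneg (norm_nonneg z)
    have e1 : 0 ≤ dblC Θ 2 * (J z * J (x + z) + J z * J (x - z)) := by
      have := hVp z; have := hVp (x + z); have := hVp (x - z)
      positivity
    rcases le_or_gt ‖z‖ a with hz | hz
    · have e2 := abs_levelDiff_le_small h κ ha0 hK hf x hz
      calc _ ≤ K * φ a * (dblC Θ 2 * (gammaK φ κ (‖z‖ / a) * (1 / radVol Θ.d φ (a + ‖x‖)))) /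
            radVol Θ.d φ ‖z‖ := by gcongr
        _ = K * φ a * (dblC Θ 2 * J x * G z) := by simp only [hG, hJ]; ring
        _ ≤ _ := by
            have := hG0 z
            have := hVp x
            refine mul_le_mul_of_nonneg_left ?_ (by positivity)
            have : 0 ≤ 2 * J x * G z := by positivity
            nlinarith
    · have e2 := abs_levelDiff_le_large h κ ha0 hK hf x hz
      have hz0 : 0 < ‖z‖ := ha0.trans hz
      have e3 : 1 / radVol Θ.d φ ‖z‖ ≤ dblC Θ 2 * J z :=
        h.inv_radVol_le one_le_two hz0 (by positivity) (by linarith)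
      have p1 := hVp (x + z)
      have p2 := hVp (x - z)
      have p3 := hVp x
      have p4 := hVp z
      calc _ ≤ K * φ a * (2 * (gammaK φ κ (‖z‖ / a) * (1 / radVol Θ.d φ (a + ‖x‖))) +
              (1 / radVol Θ.d φ (a + ‖x + z‖) + 1 / radVol Θ.d φ (a + ‖x - z‖))) /
              radVol Θ.d φ ‖z‖ := by gcongr
        _ = K * φ a * (2 * J x * G z + (J (x + z) + J (x - z)) * (1 / radVol Θ.d φ ‖z‖)) := by
            simp only [hG, hJ]; ring
        _ ≤ K * φ a * (2 * J x * G z + (J (x + z) + J (x - z)) * (dblC Θ 2 * J z)) := by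
            gcongr
        _ ≤ _ := by
            have := hG0 z
            refine mul_le_mul_of_nonneg_left ?_ (by positivity)
            have : 0 ≤ dblC Θ 2 * J x * G z := by positivity
            nlinarith
  have hc1 : ∫⁻ z : E Θ.d, ENNReal.ofReal (J z * J (x + z)) ≤ ENNReal.ofReal (C / φ a * J x) := by
    refine le_trans (le_of_eq ?_) (hconv φ h a ha x)
    congr 1; ext z
    rw [ENNReal.ofReal_mul (hVp z).le]
  have hc2 : ∫⁻ z : E Θ.d, ENNReal.ofReal (J z * J (x - z)) ≤ ENNReal.ofReal (C / φ a * J x) := by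
    rw [← lintegral_neg_eq_self]
    refine le_trans (le_of_eq ?_) (hconv φ h a ha x)
    congr 1; ext z
    rw [sub_neg_eq_add, ENNReal.ofReal_mul (hVp _).le]
    simp only [hJ, norm_neg]
  have hg := H.lintegral_gammaK_le ha
  have hJx := hVp x
  calc ∫⁻ z, ENNReal.ofReal (|levelDiff φ κ a f x z| / radVol Θ.d φ ‖z‖)
      ≤ ∫⁻ z, (ENNReal.ofReal (K * φ a * ((dblC Θ 2 + 2) * J x)) * ENNReal.ofReal (G z) +
          ENNReal.ofReal (K * φ a * dblC Θ 2) * (ENNReal.ofReal (J z * J (x + z)) +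
            ENNReal.ofReal (J z * J (x - z)))) := by
        refine lintegral_mono fun z => ?_
        have q1 := hVp (x + z)
        have q2 := hVp (x - z)
        have q4 := hVp z
        have q5 := hG0 z
        rw [← ENNReal.ofReal_mul (by positivity),
          ← ENNReal.ofReal_add (by positivity) (by positivity),
          ← ENNReal.ofReal_mul (by positivity), ← ENNReal.ofReal_add (by positivity)
            (by positivity)]
        refine ENNReal.ofReal_le_ofReal ((hpt z).trans (le_of_eq (by ring)))
    _ = ENNReal.ofReal (K * φ a * ((dblC Θ 2 + 2) * J x)) * (∫⁻ z, ENNReal.ofReal (G z)) +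
          ENNReal.ofReal (K * φ a * dblC Θ 2) * ((∫⁻ z, ENNReal.ofReal (J z * J (x + z))) +
            ∫⁻ z, ENNReal.ofReal (J z * J (x - z))) := by
        have m1 : Measurable fun z => ENNReal.ofReal (J z * J (x + z)) :=
          ((hJm measurable_id).mul (hJm (measurable_const_add x))).ennreal_ofReal
        rw [lintegral_add_left (hGm.ennreal_ofReal.const_mul _),
          lintegral_const_mul' _ _ ENNReal.ofReal_ne_top,
          lintegral_const_mul' _ _ ENNReal.ofReal_ne_top, lintegral_add_left m1]
    _ ≤ ENNReal.ofReal (K * φ a * ((dblC Θ 2 + 2) * J x)) * ENNReal.ofReal (M / φ a) +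
          ENNReal.ofReal (K * φ a * dblC Θ 2) * (ENNReal.ofReal (C / φ a * J x) +
            ENNReal.ofReal (C / φ a * J x)) := by gcongr
    _ = _ := by
        rw [← ENNReal.ofReal_mul (by positivity),
          ← ENNReal.ofReal_add (by positivity) (by positivity),
          ← ENNReal.ofReal_mul (by positivity), ← ENNReal.ofReal_add (by positivity)
            (by positivity)]
        congr 1
        simp only [hJ]
        field_simp

/-! ### Bounds for the parametrix error -/

/-- In case 2 the truncation can be moved from the level `1` to the level `a` at the expense of a
drift, which integrates to zero against centered kernels. -/
lemma levelDiff_eq_add (φ : ℝ → ℝ) {d : ℕ} (κ : ℝ → E d → E d → ℝ) (a : ℝ) (f : E d → ℝ)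
    (x z : E d) (hs : ¬ SymmKernel κ) (h2 : Case2 φ) :
    levelDiff φ κ 1 f x z = levelDiff φ κ a f x z + fderiv ℝ f x (driftInt φ a z) := by
  unfold levelDiff driftInt zlevel
  rw [if_neg hs, if_neg hs, if_pos h2, if_pos h2, zphi_case2 h2, map_sub]
  ring

/-- Outside case 2, and for symmetric kernels, the truncation level does not matter. -/
lemma levelDiff_eq_of_not (φ : ℝ → ℝ) {d : ℕ} (κ : ℝ → E d → E d → ℝ) (a : ℝ) (f : E d → ℝ)
    (x z : E d) (hs : ¬ (¬ SymmKernel κ ∧ Case2 φ)) :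
    levelDiff φ κ 1 f x z = levelDiff φ κ a f x z := by
  unfold levelDiff zlevel
  by_cases h1 : SymmKernel κ
  · rw [if_pos h1, if_pos h1]
  · have h2 : ¬ Case2 φ := fun h2 => hs ⟨h1, h2⟩
    rw [if_neg h1, if_neg h1, if_neg h2, if_neg h2]

section

variable {Θ : Theta} {φ ℓ : ℝ → ℝ} {κ : ℝ → E Θ.d → E Θ.d → ℝ} (H : Setting Θ φ ℓ κ)

include H

lemma Setting.integrable_levelDiff {a : ℝ} (ha : a ∈ Ioc (0 : ℝ) 1) {K : ℝ} {f : E Θ.d → ℝ}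
    (hK : 0 ≤ K) (hf : Decay φ a K 2 f) (x : E Θ.d) :
    Integrable fun z => levelDiff φ κ a f x z / radVol Θ.d φ ‖z‖ := by
  obtain ⟨C, -, hC⟩ := exists_lintegral_levelDiff_le Θ
  have h := H.adm
  refine ⟨((measurable_levelDiff φ κ a hf.contDiff.continuous x).div
    h.continuous_radVol_norm.measurable).aestronglyMeasurable, ?_⟩
  rw [hasFiniteIntegral_iff_norm]
  refine lt_of_le_of_lt (le_of_eq ?_)
    ((hC φ ℓ κ H a ha K f hK hf x).trans_lt ENNReal.ofReal_lt_top)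
  congr 1
  ext z
  rw [norm_div, Real.norm_eq_abs, Real.norm_of_nonneg (h.radVol_nonneg (norm_nonneg z))]

lemma Setting.measurable_kernel (t : ℝ) (w : E Θ.d) : Measurable fun z => κ t w z :=
  H.bounds.measurable_comp measurable_const measurable_const measurable_id

lemma Setting.abs_kernel_le {t : ℝ} (ht : 0 ≤ t) (w z : E Θ.d) : |κ t w z| ≤ Θ.κ₀ := by
  rw [abs_of_nonneg (H.bounds.nonneg ht w z)]; exact H.bounds.upper t ht w z

lemma Setting.abs_kernel_sub_le {t : ℝ} (ht : 0 ≤ t) (w w' z : E Θ.d) :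
    |κ t w z - κ t w' z| ≤ Θ.κ₀ := by
  have h1 := H.bounds.nonneg ht w z
  have h2 := H.bounds.nonneg ht w' z
  have h3 := H.bounds.upper t ht w z
  have h4 := H.bounds.upper t ht w' z
  rw [abs_le]; constructor <;> linarith

/-- The frozen operators may be computed with the compensation moved to the scale `a`. -/
lemma Setting.Lfrozen_eq {a : ℝ} (ha : a ∈ Ioc (0 : ℝ) 1) {K : ℝ} {f : E Θ.d → ℝ}
    (hK : 0 ≤ K) (hf : Decay φ a K 2 f) {t : ℝ} (ht : 0 ≤ t) (w x : E Θ.d) :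
    Integrable (fun z => Delta φ κ f x z * κ t w z) ∧
    Integrable (fun z => levelDiff φ κ a f x z / radVol Θ.d φ ‖z‖ * κ t w z) ∧
    Lfrozen φ κ t w f x = ∫ z, levelDiff φ κ a f x z / radVol Θ.d φ ‖z‖ * κ t w z := by
  have h := H.adm
  have hint : Integrable (fun z => levelDiff φ κ a f x z / radVol Θ.d φ ‖z‖ * κ t w z) :=
    (H.integrable_levelDiff ha hK hf x).mul_bdd (c := Θ.κ₀)
      (H.measurable_kernel t w).aestronglyMeasurable
      (ae_of_all _ fun z => H.abs_kernel_le ht w z)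
  unfold Lfrozen
  by_cases hs : ¬ SymmKernel κ ∧ Case2 φ
  · have hκ0 : 0 < Θ.κ₀ := zero_lt_one.trans_le h.κ₀_ge
    have hk : KBound (κ t w) Θ.κ₀⁻¹ Θ.κ₀ :=
      ⟨H.measurable_kernel t w, inv_pos.2 hκ0, fun z => H.bounds.lower t ht w z,
        fun z => H.bounds.upper t ht w z⟩
    have hdi := hk.integrable_driftInt h ha
    have heq : ∀ z, Delta φ κ f x z * κ t w z =
        levelDiff φ κ a f x z / radVol Θ.d φ ‖z‖ * κ t w z +
          fderiv ℝ f x ((κ t w z / radVol Θ.d φ ‖z‖) • driftInt φ a z) := fun z => by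
      rw [Delta_eq, levelDiff_eq_add φ κ a f x z hs.1 hs.2, map_smul, smul_eq_mul]
      ring
    have hc : KernelCentered φ κ := by
      rcases H.cases with h1 | h1
      · exact absurd h1 hs.1
      · exact h1.2.2.2
    have hdi' := (fderiv ℝ f x).integrable_comp hdi
    simp_rw [heq]
    refine ⟨hint.add hdi', hint, ?_⟩
    rw [integral_add hint hdi', (fderiv ℝ f x).integral_comp_comm hdi,
      H.integral_driftInt_case2 hs.2 ha (H.measurable_kernel t w) (H.abs_kernel_le ht w)
        (hc hs.2 t ht w), map_zero, add_zero]
  · have heq : ∀ z, Delta φ κ f x z * κ t w z =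
        levelDiff φ κ a f x z / radVol Θ.d φ ‖z‖ * κ t w z := fun z => by
      rw [Delta_eq, levelDiff_eq_of_not φ κ a f x z hs]
    simp_rw [heq]
    exact ⟨hint, hint, trivial⟩

lemma Setting.phiInv_mem {t s : ℝ} (hts : t < s) (hts1 : s - t ≤ 1) :
    phiInv φ (s - t) ∈ Ioc (0 : ℝ) 1 :=
  ⟨H.adm.phiInv_pos (sub_pos.2 hts) hts1, H.adm.phiInv_le_one (sub_pos.2 hts).le hts1⟩

end

lemma exists_decay_frozenKernel (Θ : Theta) : ∃ C : ℝ, 0 < C ∧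
    ∀ (φ ℓ : ℝ → ℝ) (κ : ℝ → E Θ.d → E Θ.d → ℝ), Setting Θ φ ℓ κ →
      ∀ (t s : ℝ) (y : E Θ.d), 0 ≤ t → t < s → s - t ≤ 1 →
        Decay φ (phiInv φ (s - t)) C 3 (frozenKernel φ κ y t s) := by
  obtain ⟨C, hC, hmain⟩ := exists_frozenKernel_bound Θ
  refine ⟨C, hC, fun φ ℓ κ H t s y ht hts hts1 => ?_⟩
  obtain ⟨h1, h2⟩ := hmain φ ℓ κ H t s y ht hts hts1
  refine ⟨h1, fun i hi x => ?_⟩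
  rw [H.adm.phi_phiInv (sub_pos.2 hts).le hts1]
  exact h2 i hi x

lemma Decay.of_le {φ : ℝ → ℝ} {d : ℕ} {a K : ℝ} {m n : ℕ} (hmn : m ≤ n) {f : E d → ℝ}
    (hf : Decay φ a K n f) : Decay φ a K m f :=
  ⟨hf.contDiff.of_le (by exact_mod_cast hmn), fun i hi x => hf.bound i (hi.trans hmn) x⟩

/-- Bounds for the parametrix error `q^{(0)}` and for its oscillation in the first variable, in
terms of bounds `M`, `M'` for the differences of the coefficients. -/
theorem exists_q0_bound (Θ : Theta) : ∃ C : ℝ, 0 < C ∧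
    ∀ (φ ℓ : ℝ → ℝ) (κ : ℝ → E Θ.d → E Θ.d → ℝ), Setting Θ φ ℓ κ →
      ∀ (t s : ℝ), 0 ≤ t → t < s → s - t ≤ 1 → ∀ x y : E Θ.d,
        Integrable (fun z => Delta φ κ (frozenKernel φ κ y t s) (x - y) z * κ t x z) ∧
        Integrable (fun z => Delta φ κ (frozenKernel φ κ y t s) (x - y) z * κ t y z) ∧
        ∀ M : ℝ, (∀ z, |κ t x z - κ t y z| ≤ M) →
          |q0 φ κ t s x y| ≤ C * M * (1 / radVol Θ.d φ (phiInv φ (s - t) + ‖x - y‖)) ∧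
          ∀ (x' : E Θ.d) (M' : ℝ), ‖x - x'‖ ≤ phiInv φ (s - t) →
            (∀ z, |κ t x z - κ t x' z| ≤ M') →
            |q0 φ κ t s x y - q0 φ κ t s x' y| ≤
              C * (M * (‖x - x'‖ / phiInv φ (s - t)) + M') *
                (1 / radVol Θ.d φ (phiInv φ (s - t) + ‖x' - y‖)) := by
  obtain ⟨Cp, hCp, hdec⟩ := exists_decay_frozenKernel Θ
  obtain ⟨Cd, hCd, hlev⟩ := exists_lintegral_levelDiff_le Θ
  have hD := dblC_pos Θ (k := 2) two_pos
  refine ⟨Cd * Cp * (1 + dblC Θ 2), by positivity, ?_⟩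
  intro φ ℓ κ H t s ht hts hts1 x y
  have h := H.adm
  have ha := H.phiInv_mem hts hts1
  have hp3 := hdec φ ℓ κ H t s y ht hts hts1
  have hp := hp3.of_le (show 2 ≤ 3 by norm_num)
  set a := phiInv φ (s - t) with hadef
  set p := frozenKernel φ κ y t s with hpdef
  have ha0 := ha.1
  have hVp : ∀ y : E Θ.d, 0 < 1 / radVol Θ.d φ (a + ‖y‖) := fun y =>
    one_div_pos.2 (h.radVol_pos (by positivity))
  -- integrals of the difference operator against bounded weights
  have hw : ∀ (K : ℝ) (f : E Θ.d → ℝ), 0 ≤ K → Decay φ a K 2 f → ∀ (x : E Θ.d) (w : E Θ.d → ℝ)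
      (m : ℝ), (∀ z, |w z| ≤ m) →
      |∫ z, levelDiff φ κ a f x z / radVol Θ.d φ ‖z‖ * w z| ≤
        Cd * K * m * (1 / radVol Θ.d φ (a + ‖x‖)) := by
    intro K f hK hf x w m hm
    have hm0 : 0 ≤ m := (abs_nonneg _).trans (hm 0)
    have hV := hVp x
    rw [← Real.norm_eq_abs]
    refine (norm_integral_le_lintegral_norm _).trans
      (ENNReal.toReal_le_of_le_ofReal (by positivity) ?_)
    calc ∫⁻ z, ENNReal.ofReal ‖levelDiff φ κ a f x z / radVol Θ.d φ ‖z‖ * w z‖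
        ≤ ∫⁻ z, ENNReal.ofReal (|levelDiff φ κ a f x z| / radVol Θ.d φ ‖z‖) *
            ENNReal.ofReal m := by
          refine lintegral_mono fun z => ?_
          have hVz := h.radVol_nonneg (norm_nonneg z)
          rw [← ENNReal.ofReal_mul (by positivity)]
          refine ENNReal.ofReal_le_ofReal ?_
          rw [norm_mul, norm_div, Real.norm_eq_abs, Real.norm_of_nonneg hVz]
          gcongr
          exact hm z
      _ = (∫⁻ z, ENNReal.ofReal (|levelDiff φ κ a f x z| / radVol Θ.d φ ‖z‖)) *
            ENNReal.ofReal m := lintegral_mul_const' _ _ ENNReal.ofReal_ne_top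
      _ ≤ ENNReal.ofReal (Cd * K * (1 / radVol Θ.d φ (a + ‖x‖))) * ENNReal.ofReal m := by
          gcongr
          exact hlev φ ℓ κ H a ha K f hK hf x
      _ = _ := by
          rw [← ENNReal.ofReal_mul (by positivity)]
          congr 1; ring
  have hL := fun w u : E Θ.d => H.Lfrozen_eq ha hCp.le hp ht w u
  have hq : ∀ x, q0 φ κ t s x y =
      ∫ z, levelDiff φ κ a p (x - y) z / radVol Θ.d φ ‖z‖ * (κ t x z - κ t y z) := fun x => by
    rw [q0, (hL x _).2.2, (hL y _).2.2, ← integral_sub (hL x _).2.1 (hL y _).2.1]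
    congr 1; ext z; ring
  refine ⟨(hL x _).1, (hL y _).1, fun M hM => ⟨?_, fun x' M' hx' hM' => ?_⟩⟩
  · rw [hq]
    have hM0 : 0 ≤ M := (abs_nonneg _).trans (hM 0)
    have hV := hVp (x - y)
    refine (hw Cp p hCp.le hp (x - y) _ M hM).trans ?_
    have : Cd * Cp ≤ Cd * Cp * (1 + dblC Θ 2) := le_mul_of_one_le_right (by positivity)
      (by linarith)
    gcongr
  · have hM0 : 0 ≤ M := (abs_nonneg _).trans (hM 0)
    have hM0' : 0 ≤ M' := (abs_nonneg _).trans (hM' 0)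
    have hV := hVp (x' - y)
    set w := x - x' with hwdef
    have hxw : x - y = x' - y + w := by rw [hwdef]; abel
    set g : E Θ.d → ℝ := fun u => p (u + w) - p u with hg
    have hgd : Decay φ a (dblC Θ 2 * Cp * (‖w‖ / a)) 2 g := hp3.shift_sub h ha0 hCp.le hx'
    have hgK : 0 ≤ dblC Θ 2 * Cp * (‖w‖ / a) := by positivity
    have hpd : Differentiable ℝ p := hp3.contDiff.differentiable (by norm_num)
    have hgi := H.integrable_levelDiff ha hgK hgd (x' - y)
    have hpi := H.integrable_levelDiff ha hCp.le hp (x' - y)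
    have hmeas : ∀ u v : E Θ.d, AEStronglyMeasurable (fun z => κ t u z - κ t v z) :=
      fun u v => ((H.measurable_kernel t u).sub (H.measurable_kernel t v)).aestronglyMeasurable
    have i1 : Integrable fun z =>
        levelDiff φ κ a g (x' - y) z / radVol Θ.d φ ‖z‖ * (κ t x z - κ t y z) :=
      hgi.mul_bdd (c := M) (hmeas x y) (ae_of_all _ hM)
    have i2 : Integrable fun z =>
        levelDiff φ κ a p (x' - y) z / radVol Θ.d φ ‖z‖ * (κ t x z - κ t x' z) :=
      hpi.mul_bdd (c := M') (hmeas x x') (ae_of_all _ hM')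
    have i3 : ∀ u v : E Θ.d, Integrable fun z =>
        levelDiff φ κ a p u z / radVol Θ.d φ ‖z‖ * (κ t v z - κ t y z) := fun u v =>
      (H.integrable_levelDiff ha hCp.le hp u).mul_bdd (c := Θ.κ₀) (hmeas v y)
        (ae_of_all _ fun z => H.abs_kernel_sub_le ht v y z)
    -- first the frozen kernel `p` is shifted by `w`, then the coefficient is moved from `x` to `x'`
    have heq : q0 φ κ t s x y - q0 φ κ t s x' y =
        (∫ z, levelDiff φ κ a g (x' - y) z / radVol Θ.d φ ‖z‖ * (κ t x z - κ t y z)) +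
          ∫ z, levelDiff φ κ a p (x' - y) z / radVol Θ.d φ ‖z‖ * (κ t x z - κ t x' z) := by
      rw [hq, hq, ← integral_sub (i3 _ _) (i3 _ _), ← integral_add i1 i2]
      congr 1; ext z
      rw [hg, levelDiff_sub κ a hpd, hxw]
      ring
    rw [heq]
    refine (abs_add_le _ _).trans ?_
    have b1 := hw _ g hgK hgd (x' - y) _ M hM
    have b2 := hw Cp p hCp.le hp (x' - y) _ M' hM'
    refine (add_le_add b1 b2).trans ?_
    have hr : 0 ≤ ‖w‖ / a := by positivity
    set V := 1 / radVol Θ.d φ (a + ‖x' - y‖) with hVd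
    have c1 : 0 ≤ Cd * Cp * M * (‖w‖ / a) * V := by positivity
    have c2 : 0 ≤ Cd * Cp * dblC Θ 2 * M' * V := by positivity
    calc _ = Cd * Cp * dblC Θ 2 * M * (‖w‖ / a) * V + Cd * Cp * M' * V := by ring
      _ ≤ Cd * Cp * dblC Θ 2 * M * (‖w‖ / a) * V + Cd * Cp * M' * V +
          Cd * Cp * M * (‖w‖ / a) * V + Cd * Cp * dblC Θ 2 * M' * V := by linarith
      _ = _ := by ring

/-! ### Measurability and continuity of the frozen heat kernel -/

lemma stronglyMeasurable_intervalIntegral {α F : Type*} [MeasurableSpace α] [NormedAddCommGroup F]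
    [NormedSpace ℝ F] {G : α → ℝ → F} (hG : StronglyMeasurable (Function.uncurry G)) {f g : α → ℝ}
    (hf : Measurable f) (hg : Measurable g) :
    StronglyMeasurable fun a => ∫ r in f a..g a, G a r := by
  have key : ∀ {u v : α → ℝ}, Measurable u → Measurable v →
      StronglyMeasurable fun a => ∫ r in Ioc (u a) (v a), G a r := fun {u v} hu hv => by
    have hs : MeasurableSet {p : α × ℝ | p.2 ∈ Ioc (u p.1) (v p.1)} :=
      (measurableSet_lt (hu.comp measurable_fst) measurable_snd).inter
        (measurableSet_le measurable_snd (hv.comp measurable_fst))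
    have := (hG.indicator hs).integral_prod_right' (ν := volume)
    convert this using 2 with a
    rw [← integral_indicator measurableSet_Ioc]
    rfl
  exact (key hf hg).sub (key hg hf)

lemma IsDini.pos' {ℓ : ℝ → ℝ} (h : IsDini ℓ) {t : ℝ} (ht : 0 < t) : 0 < ℓ t := by
  rcases le_total t 1 with h1 | h1
  · exact h.pos t ⟨ht, h1⟩
  · rw [h.extend t h1]; exact h.pos 1 ⟨one_pos, le_rfl⟩

lemma IsDini.mono {ℓ : ℝ → ℝ} (h : IsDini ℓ) : MonotoneOn ℓ (Ioi 0) := by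
  have hle : ∀ r ∈ Ioi (0 : ℝ), ℓ r = ℓ (min r 1) := fun r hr => by
    rcases le_total r 1 with h1 | h1
    · rw [min_eq_left h1]
    · rw [min_eq_right h1, h.extend r h1]
  intro r hr R hR hrR
  rw [hle r hr, hle R hR]
  exact h.monotoneOn ⟨lt_min hr one_pos, min_le_right _ _⟩ ⟨lt_min hR one_pos, min_le_right _ _⟩
    (min_le_min_right 1 hrR)

/-- A function that stays away from zero violates the Dini condition, as `∫ dt / t` diverges. -/
lemma IsDini.tendsto {ℓ : ℝ → ℝ} (h : IsDini ℓ) : Tendsto ℓ (𝓝[>] 0) (𝓝 0) := by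
  rw [Metric.tendsto_nhdsWithin_nhds]
  intro ε hε
  by_contra hcon
  push Not at hcon
  have hge : ∀ t, 0 < t → ε ≤ ℓ t := fun t ht => by
    obtain ⟨r, hr, hrt, hle⟩ := hcon t ht
    rw [dist_zero_right] at hle hrt
    rw [Real.norm_of_nonneg (h.pos' hr).le] at hle
    rw [Real.norm_of_nonneg (le_of_lt hr)] at hrt
    exact hle.trans (h.mono hr ht hrt.le)
  have hint : IntegrableOn (fun t : ℝ => ε⁻¹ * (ℓ t / t)) (Ioc 0 1) := h.integrableOn.const_mul _
  have : IntegrableOn (fun t : ℝ => t⁻¹) (Ioc 0 1) := by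
    refine hint.mono' measurable_inv.aestronglyMeasurable
      ((ae_restrict_iff' measurableSet_Ioc).2 (ae_of_all _ fun t ht => ?_))
    have ht0 : 0 < t := ht.1
    rw [Real.norm_of_nonneg (by positivity)]
    have := hge t ht0
    calc t⁻¹ = ε⁻¹ * (ε / t) := by field_simp
      _ ≤ _ := by gcongr
  have := (intervalIntegrable_iff_integrableOn_Ioc_of_le zero_le_one).2 this
  rw [intervalIntegrable_inv_iff] at this
  simp at this

section

variable {Θ : Theta} {φ ℓ : ℝ → ℝ} {κ : ℝ → E Θ.d → E Θ.d → ℝ} (H : Setting Θ φ ℓ κ)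

include H

/-- The coefficients are uniformly continuous in `x`, uniformly in the other variables. -/
lemma Setting.exists_modulus (hℓ : IsDini ℓ) {ε : ℝ} (hε : 0 < ε) : ∃ δ > 0, ∀ t, 0 ≤ t →
    ∀ x y z : E Θ.d, ‖x - y‖ < δ → |κ t x z - κ t y z| ≤ ε := by
  have h1 : Tendsto (fun r => ℓ r ^ 2) (𝓝[>] 0) (𝓝 0) := by
    have := hℓ.tendsto.pow 2
    rwa [zero_pow two_ne_zero] at this
  obtain ⟨δ, hδ, hlt⟩ := (Metric.tendsto_nhdsWithin_nhds.1 h1) ε hε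
  refine ⟨δ, hδ, fun t ht x y z hxy => ?_⟩
  rcases eq_or_ne x y with rfl | hne
  · simpa using hε.le
  · have hpos : 0 < ‖x - y‖ := norm_pos_iff.2 (sub_ne_zero.2 hne)
    have h2 := hlt hpos (by rwa [dist_zero_right, norm_norm])
    rw [dist_zero_right, Real.norm_of_nonneg (sq_nonneg _)] at h2
    exact (H.bounds.modulus t ht x y z).trans h2.le

lemma Setting.continuous_kernel (hℓ : IsDini ℓ) {t : ℝ} (ht : 0 ≤ t) (z : E Θ.d) :
    Continuous fun x => κ t x z := by
  rw [Metric.continuous_iff]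
  intro x ε hε
  obtain ⟨δ, hδ, h⟩ := H.exists_modulus hℓ (half_pos hε)
  refine ⟨δ, hδ, fun y hy => ?_⟩
  rw [dist_eq_norm] at hy
  have := h t ht y x z hy
  rw [Real.dist_eq]; linarith

lemma Setting.continuousAt_timeKernel (hℓ : IsDini ℓ) {t s : ℝ} (ht : 0 ≤ t) (hts : t < s)
    (y z : E Θ.d) : ContinuousAt (fun p : E Θ.d × ℝ => timeKernel κ p.1 t p.2 z) (y, s) := by
  have h1 := intervalIntegral.continuousAt_parametric_primitive_of_dominated (μ := volume)
    (F := fun (y : E Θ.d) r => κ (max r 0) y z) (fun _ => Θ.κ₀) (t - 1) (s + 1) (a₀ := t)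
    (b₀ := s) (x₀ := y)
    (fun y => (H.bounds.measurable_comp (measurable_id.max measurable_const) measurable_const
      measurable_const).aestronglyMeasurable)
    (Eventually.of_forall fun y => ae_of_all _ fun r => H.abs_kernel_le (le_max_right _ _) y z)
    intervalIntegrable_const
    (ae_of_all _ fun r => (H.continuous_kernel hℓ (le_max_right _ _) z).continuousAt)
    ⟨by linarith, by linarith⟩ ⟨by linarith, by linarith⟩ (by simp)
  refine h1.congr ?_
  have : ∀ᶠ p : E Θ.d × ℝ in 𝓝 (y, s), t < p.2 :=
    continuous_snd.continuousAt.eventually (lt_mem_nhds hts)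
  filter_upwards [this] with p hp
  refine intervalIntegral.integral_congr fun r hr => ?_
  rw [uIcc_of_le hp.le] at hr
  rw [max_eq_left (ht.trans hr.1)]

lemma KBound.integrable_compInt {k : E Θ.d → ℝ} {A B : ℝ} (hk : KBound k A B) (ξ : E Θ.d) :
    Integrable fun z => compInt φ ξ z * ((k z / radVol Θ.d φ ‖z‖ : ℝ) : ℂ) := by
  refine (hk.integrable_smul H.adm (f := compInt φ ξ) (D := 2 * (1 + ‖ξ‖) ^ 2)
    (measurable_compInt_comp φ measurable_const measurable_id).aestronglyMeasurable
    (norm_compInt_le φ ξ)).congr (ae_of_all _ fun z => ?_)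
  beta_reduce
  rw [Complex.real_smul, mul_comm]

lemma KBound.re_levyExponent {k : E Θ.d → ℝ} {A B : ℝ} (hk : KBound k A B) (ξ : E Θ.d) :
    (levyExponent φ k ξ).re =
      ∫ z, (Real.cos (inner ℝ ξ z) - 1) * (k z / radVol Θ.d φ ‖z‖) ∧
    Integrable fun z => (Real.cos (inner ℝ ξ z) - 1) * (k z / radVol Θ.d φ ‖z‖) := by
  have hi := hk.integrable_compInt H ξ
  have hre : ∀ z, (compInt φ ξ z * ((k z / radVol Θ.d φ ‖z‖ : ℝ) : ℂ)).re =
      (Real.cos (inner ℝ ξ z) - 1) * (k z / radVol Θ.d φ ‖z‖) := fun z => by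
    rw [Complex.re_mul_ofReal]
    congr 1
    rw [compInt, mul_comm Complex.I]
    simp only [Complex.sub_re, Complex.exp_ofReal_mul_I_re, Complex.one_re]
    simp
  refine ⟨?_, (Complex.reCLM.integrable_comp hi).congr (ae_of_all _ hre)⟩
  rw [levyExponent, ← Complex.reCLM_apply, ← Complex.reCLM.integral_comp_comm hi]
  exact integral_congr_ae (ae_of_all _ hre)

lemma Setting.measurable_compInt_integral :
    StronglyMeasurable fun p : ℝ × E Θ.d × E Θ.d =>
      ∫ z : E Θ.d, compInt φ p.2.2 z * ((κ p.1 p.2.1 z / radVol Θ.d φ ‖z‖ : ℝ) : ℂ) := by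
  have : StronglyMeasurable fun q : (ℝ × E Θ.d × E Θ.d) × E Θ.d =>
      compInt φ q.1.2.2 q.2 * ((κ q.1.1 q.1.2.1 q.2 / radVol Θ.d φ ‖q.2‖ : ℝ) : ℂ) := by
    have h1 : Measurable fun q : (ℝ × E Θ.d × E Θ.d) × E Θ.d => compInt φ q.1.2.2 q.2 :=
      measurable_compInt_comp φ (by fun_prop) (by fun_prop)
    have h2 : Measurable fun q : (ℝ × E Θ.d × E Θ.d) × E Θ.d => κ q.1.1 q.1.2.1 q.2 :=
      H.bounds.measurable_comp (by fun_prop) (by fun_prop) (by fun_prop)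
    have h3 : Measurable fun q : (ℝ × E Θ.d × E Θ.d) × E Θ.d => radVol Θ.d φ ‖q.2‖ :=
      H.adm.continuous_radVol_norm.measurable.comp measurable_snd
    exact (h1.mul (h2.div h3).complex_ofReal).stronglyMeasurable
  exact this.integral_prod_right'

/-- The frozen heat kernel is jointly measurable in all its variables. -/
lemma Setting.measurable_frozenKernel {α : Type*} [MeasurableSpace α] {t s : α → ℝ}
    {y x : α → E Θ.d} (ht : Measurable t) (hs : Measurable s) (hy : Measurable y)
    (hx : Measurable x) : Measurable fun a => frozenKernel φ κ (y a) (t a) (s a) (x a) := by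
  have hexp : StronglyMeasurable fun p : α × E Θ.d =>
      charExponent φ κ (y p.1) (t p.1) (s p.1) p.2 := by
    refine stronglyMeasurable_intervalIntegral (G := fun (p : α × E Θ.d) r => ∫ z : E Θ.d,
      compInt φ p.2 z * ((κ r (y p.1) z / radVol Θ.d φ ‖z‖ : ℝ) : ℂ)) ?_ (ht.comp measurable_fst)
      (hs.comp measurable_fst)
    exact H.measurable_compInt_integral.comp_measurable
      (g := fun q : (α × E Θ.d) × ℝ => (q.2, y q.1.1, q.1.2)) (by fun_prop)
  have hint : StronglyMeasurable fun p : α × E Θ.d =>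
      Complex.exp (-Complex.I * ((inner ℝ (-(x p.1)) p.2 : ℝ) : ℂ)) *
        Complex.exp (charExponent φ κ (y p.1) (t p.1) (s p.1) p.2) := by
    refine Measurable.stronglyMeasurable ?_
    have h1 := hexp.measurable
    have h2 : Measurable fun p : α × E Θ.d => inner ℝ (-(x p.1)) p.2 :=
      (hx.comp measurable_fst).neg.inner measurable_snd
    fun_prop
  have := hint.integral_prod_right' (ν := volume)
  exact (Complex.measurable_re.comp this.measurable).const_mul _

/-- For fixed `t`, the frozen heat kernel is jointly continuous in the other variables. -/
lemma Setting.continuousAt_frozenKernel (hℓ : IsDini ℓ) {t s : ℝ} (ht : 0 ≤ t) (hts : t < s)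
    (y x : E Θ.d) :
    ContinuousAt (fun p : ℝ × E Θ.d × E Θ.d => frozenKernel φ κ p.2.1 t p.1 p.2.2) (s, y, x) := by
  have h := H.adm
  have hβ := h.scaling.β₁_pos
  have hκ0 : 0 < Θ.κ₀ := zero_lt_one.trans_le h.κ₀_ge
  obtain ⟨c, hc, hsym⟩ := exists_symbol_lower Θ
  set u : ℝ := (s + t) / 2 with hu
  have htu : t < u := by rw [hu]; linarith
  have hus : u < s := by rw [hu]; linarith
  have hnear : ∀ᶠ p : ℝ × E Θ.d × E Θ.d in 𝓝 (s, y, x), p.1 ∈ Ioo u (s + 1) :=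
    continuous_fst.continuousAt.eventually (Ioo_mem_nhds hus (by linarith))
  -- domination of the characteristic functions
  set c' : ℝ := c * (Θ.κ₀⁻¹ * (u - t)) / lowC Θ with hc'
  have hlow := one_le_lowC Θ
  have hc0 : 0 < c' := by
    have : 0 < u - t := by linarith
    positivity
  obtain ⟨Ce, hCe, hexp⟩ := exists_exp_neg_rpow_le hc0 hβ (Θ.d + 1)
  have hchar : ∀ r, u < r → ∀ y ξ : E Θ.d,
      ‖Complex.exp (levyExponent φ (timeKernel κ y t r) ξ)‖ ≤
        (Ce + 2 ^ (Θ.d + 1)) * (1 + ‖ξ‖) ^ (-((Θ.d : ℝ) + 1)) := by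
    intro r hr y ξ
    have hk := H.bounds.kBound ht (htu.trans hr) y
    obtain ⟨hre, hint⟩ := hk.re_levyExponent H ξ
    have hp : (0 : ℝ) < (1 + ‖ξ‖) ^ (Θ.d + 1) := by positivity
    rw [Real.rpow_neg (by positivity), ← Nat.cast_succ, Real.rpow_natCast, ← div_eq_mul_inv,
      le_div_iff₀ hp, Complex.norm_exp, hre]
    have hneg : ∀ z, (Real.cos (inner ℝ ξ z) - 1) *
        (timeKernel κ y t r z / radVol Θ.d φ ‖z‖) ≤ 0 := fun z =>
      mul_nonpos_of_nonpos_of_nonneg (by linarith [Real.cos_le_one (inner ℝ ξ z)])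
        (hk.div_nonneg' h z)
    rcases le_or_gt 1 ‖ξ‖ with h1 | h1
    · have hb := hsym φ h 1 ⟨one_pos, le_rfl⟩ _ _ _ hk ξ (by rwa [one_mul])
      have hξ : 0 < ‖ξ‖ := by linarith
      have hle : ∫ z, (Real.cos (inner ℝ ξ z) - 1) *
          (timeKernel κ y t r z / radVol Θ.d φ ‖z‖) ≤ -(c' * ‖ξ‖ ^ Θ.β₁) := by
        have h2 : ∫ z in Metric.closedBall 0 1,
            (timeKernel κ y t r z / radVol Θ.d φ ‖z‖) • (1 - Real.cos (inner ℝ ξ z)) ≤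
            ∫ z, (timeKernel κ y t r z / radVol Θ.d φ ‖z‖) • (1 - Real.cos (inner ℝ ξ z)) := by
          refine setIntegral_le_integral (hint.neg.congr (ae_of_all _ fun z => ?_))
            (ae_of_all _ fun z => ?_)
          · simp only [Pi.neg_apply, smul_eq_mul]; ring
          · have := hneg z
            simp only [Pi.zero_apply, smul_eq_mul]; linarith
        have h3 : ∫ z, (timeKernel κ y t r z / radVol Θ.d φ ‖z‖) • (1 - Real.cos (inner ℝ ξ z)) =
            -∫ z, (Real.cos (inner ℝ ξ z) - 1) *
              (timeKernel κ y t r z / radVol Θ.d φ ‖z‖) := by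
          rw [← integral_neg]; congr 1; ext z; rw [smul_eq_mul]; ring
        have h4 := h.phi_lower (inv_pos.2 hξ) (inv_le_one_of_one_le₀ h1) le_rfl
        rw [div_one, h.scale.map_one, mul_one, Real.inv_rpow hξ.le] at h4
        have h5 : c' * ‖ξ‖ ^ Θ.β₁ ≤ c * (Θ.κ₀⁻¹ * (r - t)) / φ ‖ξ‖⁻¹ := by
          have hφ := h.phi_pos (inv_pos.2 hξ)
          have hp : 0 < ‖ξ‖ ^ Θ.β₁ := by positivity
          rw [le_div_iff₀ hφ]
          have hut : 0 < u - t := by linarith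
          calc c' * ‖ξ‖ ^ Θ.β₁ * φ ‖ξ‖⁻¹ ≤ c' * ‖ξ‖ ^ Θ.β₁ * (lowC Θ * (‖ξ‖ ^ Θ.β₁)⁻¹) := by
                gcongr
            _ = c * (Θ.κ₀⁻¹ * (u - t)) := by rw [hc']; field_simp
            _ ≤ _ := by gcongr
        linarith
      calc _ ≤ Real.exp (-(c' * ‖ξ‖ ^ Θ.β₁)) * (1 + ‖ξ‖) ^ (Θ.d + 1) := by gcongr
        _ ≤ Ce := hexp _ h1
        _ ≤ _ := by linarith [show (0 : ℝ) < 2 ^ (Θ.d + 1) by positivity]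
    · have h0 := integral_nonpos (μ := volume) hneg
      calc _ ≤ 1 * (1 + 1 : ℝ) ^ (Θ.d + 1) := by
            gcongr
            exact Real.exp_le_one_iff.2 h0
        _ ≤ _ := by norm_num; linarith
  -- continuity of the exponent
  have hpsi : ∀ ξ : E Θ.d, ContinuousAt
      (fun p : ℝ × E Θ.d × E Θ.d => levyExponent φ (timeKernel κ p.2.1 t p.1) ξ) (s, y, x) := by
    intro ξ
    refine continuousAt_of_dominated
      (bound := fun z => 2 * (1 + ‖ξ‖) ^ 2 * (Θ.κ₀ * (s + 1 - t)) *
        (gamma1 φ ‖z‖ / radVol Θ.d φ ‖z‖)) ?_ ?_ (h.integrable_gamma1.const_mul _)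
      (ae_of_all _ fun z => ?_)
    · filter_upwards [hnear] with p hp
      exact ((H.bounds.kBound ht (htu.trans hp.1) p.2.1).integrable_compInt H
        ξ).aestronglyMeasurable
    · filter_upwards [hnear] with p hp
      refine ae_of_all _ fun z => ?_
      have hk := H.bounds.kBound ht (htu.trans hp.1) p.2.1
      have hV := h.radVol_nonneg (norm_nonneg z)
      rw [norm_mul, Complex.norm_real, Real.norm_of_nonneg (hk.div_nonneg' h z)]
      calc _ ≤ (2 * (1 + ‖ξ‖) ^ 2 * gamma1 φ ‖z‖) * (Θ.κ₀ * (s + 1 - t) / radVol Θ.d φ ‖z‖) := by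
            refine mul_le_mul (norm_compInt_le φ ξ z) ?_ (hk.div_nonneg' h z)
              (mul_nonneg (by positivity) (gamma1_nonneg φ (norm_nonneg z)))
            refine div_le_div_of_nonneg_right ((hk.upper z).trans ?_) hV
            have := hp.2
            gcongr
        _ = _ := by ring
    · have h1 : ContinuousAt (fun p : ℝ × E Θ.d × E Θ.d => timeKernel κ p.2.1 t p.1 z)
          (s, y, x) :=
        (H.continuousAt_timeKernel hℓ ht hts y z).comp (f := fun p : ℝ × E Θ.d × E Θ.d =>
          (p.2.1, p.1)) (x := (s, y, x)) (by fun_prop)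
      exact continuousAt_const.mul
        (Complex.continuous_ofReal.continuousAt.comp (h1.div_const _))
  have hmain : ContinuousAt (fun p : ℝ × E Θ.d × E Θ.d =>
      levyDensity φ (timeKernel κ p.2.1 t p.1) p.2.2) (s, y, x) := by
    unfold levyDensity invFourier
    refine continuousAt_const.mul (Complex.continuous_re.continuousAt.comp ?_)
    refine continuousAt_of_dominated (bound := fun ξ =>
      (Ce + 2 ^ (Θ.d + 1)) * (1 + ‖ξ‖) ^ (-((Θ.d : ℝ) + 1))) ?_ ?_ ?_ (ae_of_all _ fun ξ => ?_)
    · filter_upwards [hnear] with p hp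
      have hm : StronglyMeasurable fun ξ => levyExponent φ (timeKernel κ p.2.1 t p.1) ξ := by
        refine StronglyMeasurable.integral_prod_right' (f := fun q : E Θ.d × E Θ.d =>
          compInt φ q.1 q.2 *
            ((timeKernel κ p.2.1 t p.1 q.2 / radVol Θ.d φ ‖q.2‖ : ℝ) : ℂ)) ?_
        have h1 : Measurable fun q : E Θ.d × E Θ.d => compInt φ q.1 q.2 :=
          measurable_compInt_comp φ measurable_fst measurable_snd
        have h2 : Measurable fun q : E Θ.d × E Θ.d =>
            timeKernel κ p.2.1 t p.1 q.2 / radVol Θ.d φ ‖q.2‖ :=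
          ((H.bounds.kBound ht (htu.trans hp.1) p.2.1).measurable_div h).comp measurable_snd
        exact (h1.mul h2.complex_ofReal).stronglyMeasurable
      have h1 := hm.measurable
      have h2 : Measurable fun ξ : E Θ.d => inner ℝ p.2.2 ξ := by fun_prop
      exact Measurable.aestronglyMeasurable (by fun_prop)
    · filter_upwards [hnear] with p hp
      refine ae_of_all _ fun ξ => ?_
      rw [norm_mul, norm_exp_I_mul, one_mul]
      exact hchar p.1 hp.1 p.2.1 ξ
    · refine (integrable_one_add_norm ?_).const_mul _
      rw [finrank_euclideanSpace, Fintype.card_fin]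
      linarith
    · refine ContinuousAt.mul ?_ (Complex.continuous_exp.continuousAt.comp (hpsi ξ))
      refine Continuous.continuousAt ?_
      fun_prop
  refine hmain.congr ?_
  filter_upwards [hnear] with p hp
  rw [H.frozenKernel_eq ht (htu.trans hp.1).le]

end

/-! ### Measurability and continuity of the parametrix error -/

open Classical in
/-- The numerator of the difference operator with the derivative replaced by a difference
quotient. -/
def quotDiff (φ : ℝ → ℝ) {d : ℕ} (κ : ℝ → E d → E d → ℝ) (c : ℝ) (f : E d → ℝ) (x z : E d) : ℝ :=
  if SymmKernel κ then (f (x + z) + f (x - z) - 2 * f x) / 2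
  else f (x + z) - f x - c * (f (x + c⁻¹ • zlevel φ 1 z) - f x)

lemma tendsto_quotDiff (φ : ℝ → ℝ) {d : ℕ} (κ : ℝ → E d → E d → ℝ) {f : E d → ℝ}
    (hf : Differentiable ℝ f) (x z : E d) :
    Tendsto (fun n : ℕ => quotDiff φ κ n f x z) atTop (𝓝 (levelDiff φ κ 1 f x z)) := by
  unfold quotDiff levelDiff
  split_ifs
  · exact tendsto_const_nhds
  · refine tendsto_const_nhds.sub ?_
    refine (hf x).hasFDerivAt.lim (zlevel φ 1 z) (c := fun n : ℕ => (n : ℝ)) (l := atTop) ?_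
    simpa using tendsto_natCast_atTop_atTop (R := ℝ)

/-- Replacing the derivative by difference quotients changes the operator by `O(1 / c)`, uniformly
in the base point. -/
lemma abs_levelDiff_sub_quotDiff_le (φ : ℝ → ℝ) {d : ℕ} (κ : ℝ → E d → E d → ℝ) {f : E d → ℝ}
    (hf : ContDiff ℝ 2 f) {M : ℝ} (hM : ∀ x, ‖iteratedFDeriv ℝ 2 f x‖ ≤ M) {c : ℝ} (hc : 0 < c)
    (x z : E d) :
    |levelDiff φ κ 1 f x z - quotDiff φ κ c f x z| ≤ M * ‖zlevel φ 1 z‖ ^ 2 / c := by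
  have hM0 : 0 ≤ M := (norm_nonneg _).trans (hM 0)
  unfold quotDiff levelDiff
  split_ifs
  · rw [sub_self, abs_zero]; positivity
  · set v := zlevel φ 1 z
    have h1 := norm_sub_fderiv_le hf x (c⁻¹ • v) (M := M) fun y _ => hM y
    rw [map_smul, smul_eq_mul, norm_smul, norm_inv, Real.norm_of_nonneg hc.le] at h1
    have h2 : f (x + z) - f x - fderiv ℝ f x v - (f (x + z) - f x - c * (f (x + c⁻¹ • v) - f x)) =
        c * (f (x + c⁻¹ • v) - f x - c⁻¹ * fderiv ℝ f x v) := by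
      field_simp; ring
    rw [h2, abs_mul, abs_of_pos hc]
    refine (mul_le_mul_of_nonneg_left h1 hc.le).trans (le_of_eq ?_)
    field_simp

section

variable {Θ : Theta} {φ : ℝ → ℝ} (h : Adm Θ φ)

include h

lemma Adm.inv_radVol_one_add_le (x : E Θ.d) : 1 / radVol Θ.d φ (1 + ‖x‖) ≤ 1 := by
  have h1 : radVol Θ.d φ 1 = 1 := by rw [radVol, one_pow, h.scale.map_one, one_mul]
  have h2 := h.radVol_mono zero_le_one (show 1 ≤ 1 + ‖x‖ by linarith [norm_nonneg x])
  rw [h1] at h2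
  exact (div_le_one (by linarith)).2 h2

/-- Decay at any level implies decay at the level one. -/
lemma Decay.level_one {a b K : ℝ} {f : E Θ.d → ℝ} (hb : 0 < b) (hba : b ≤ a) (ha1 : a ≤ 1)
    (hK : 0 ≤ K) (hf : Decay φ a K 2 f) :
    Decay φ 1 (K * b⁻¹ ^ 2 * dblC Θ b⁻¹) 2 f := by
  refine ⟨hf.contDiff, fun i hi x => (hf.bound i hi x).trans ?_⟩
  have ha : 0 < a := hb.trans_le hba
  have hb1 : 1 ≤ b⁻¹ := one_le_inv_iff₀.2 ⟨hb, hba.trans ha1⟩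
  have hV := h.inv_radVol_le hb1 (by positivity : 0 < a + ‖x‖) (by positivity : 0 < 1 + ‖x‖) (by
    have : 1 ≤ b⁻¹ * a := by rw [inv_mul_eq_div, one_le_div hb]; exact hba
    nlinarith [norm_nonneg x])
  have hφ : φ a ≤ 1 := by
    have := h.phi_mono ha.le ha1
    rwa [h.scale.map_one] at this
  have hφ0 := h.phi_pos ha
  have hD := dblC_pos Θ (k := b⁻¹) (by positivity)
  have hV0 : 0 < radVol Θ.d φ (a + ‖x‖) := h.radVol_pos (by positivity)
  have hV1 : 0 < radVol Θ.d φ (1 + ‖x‖) := h.radVol_pos (by positivity)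
  rw [h.scale.map_one, inv_one, one_pow, mul_one, div_eq_mul_one_div (φ a)]
  have hpow : a⁻¹ ^ i ≤ b⁻¹ ^ 2 := by
    calc a⁻¹ ^ i ≤ b⁻¹ ^ i := by gcongr
      _ ≤ _ := pow_le_pow_right₀ hb1 hi
  calc K * a⁻¹ ^ i * (φ a * (1 / radVol Θ.d φ (a + ‖x‖)))
      ≤ K * b⁻¹ ^ 2 * (1 * (dblC Θ b⁻¹ * (1 / radVol Θ.d φ (1 + ‖x‖)))) := by gcongr
    _ = _ := by ring

lemma Decay.norm_iteratedFDeriv_two_le {K : ℝ} {f : E Θ.d → ℝ} (hK : 0 ≤ K)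
    (hf : Decay φ 1 K 2 f) (x : E Θ.d) : ‖iteratedFDeriv ℝ 2 f x‖ ≤ K := by
  refine (hf.bound 2 le_rfl x).trans ?_
  rw [inv_one, one_pow, mul_one, h.scale.map_one]
  exact mul_le_of_le_one_right hK (h.inv_radVol_one_add_le x)

/-- The unscaled operator is dominated by the integrable function `γ / V`, uniformly in the base
point. -/
lemma Decay.abs_levelDiff_le {K : ℝ} {f : E Θ.d → ℝ} (hK : 0 ≤ K) (hf : Decay φ 1 K 2 f)
    (κ : ℝ → E Θ.d → E Θ.d → ℝ) (x z : E Θ.d) :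
    |levelDiff φ κ 1 f x z| ≤ K * (dblC Θ 2 + 4) * gammaK φ κ ‖z‖ := by
  have hD := dblC_pos Θ (k := 2) two_pos
  have hg := gammaK_nonneg φ κ (norm_nonneg z)
  have b0 := h.inv_radVol_one_add_le x
  rcases le_or_gt ‖z‖ 1 with hz | hz
  · refine (abs_levelDiff_le_small h κ one_pos hK hf x hz).trans ?_
    rw [h.scale.map_one, mul_one, div_one, mul_assoc]
    refine mul_le_mul_of_nonneg_left ?_ hK
    have : gammaK φ κ ‖z‖ * (1 / radVol Θ.d φ (1 + ‖x‖)) ≤ gammaK φ κ ‖z‖ :=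
      mul_le_of_le_one_right hg b0
    nlinarith
  · refine (abs_levelDiff_le_large h κ one_pos hK hf x hz).trans ?_
    rw [h.scale.map_one, mul_one, div_one, mul_assoc]
    refine mul_le_mul_of_nonneg_left ?_ hK
    have h1 : gammaK φ κ ‖z‖ * (1 / radVol Θ.d φ (1 + ‖x‖)) ≤ gammaK φ κ ‖z‖ :=
      mul_le_of_le_one_right hg b0
    have h2 := h.inv_radVol_one_add_le (x + z)
    have h3 := h.inv_radVol_one_add_le (x - z)
    have h4 := gamma_one_of_lt hz.le φ κ
    nlinarith

end

section

variable {Θ : Theta} {φ ℓ : ℝ → ℝ} {κ : ℝ → E Θ.d → E Θ.d → ℝ} (H : Setting Θ φ ℓ κ)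

include H

lemma Setting.integrable_gammaK :
    Integrable fun z : E Θ.d => gammaK φ κ ‖z‖ / radVol Θ.d φ ‖z‖ := by
  have h := H.adm
  refine ⟨(((continuous_gammaK φ κ).comp continuous_norm).measurable.div
    h.continuous_radVol_norm.measurable).aestronglyMeasurable, ?_⟩
  rw [hasFiniteIntegral_iff_ofReal (ae_of_all _ fun z => div_nonneg
    (gammaK_nonneg φ κ (norm_nonneg z)) (h.radVol_nonneg (norm_nonneg z)))]
  have := H.lintegral_gammaK_le (a := 1) ⟨one_pos, le_rfl⟩
  simp only [div_one, mul_one_div] at this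
  exact this.trans_lt ENNReal.ofReal_lt_top

/-- On `0 ≤ t < s ≤ t + 1` the parametrix error is a measurable function of all its variables. -/
lemma Setting.exists_measurable_q0 : ∃ Q : ℝ → ℝ → E Θ.d → E Θ.d → ℝ,
    Measurable (fun p : ℝ × ℝ × E Θ.d × E Θ.d => Q p.1 p.2.1 p.2.2.1 p.2.2.2) ∧
    ∀ t s x y, 0 ≤ t → t < s → s - t ≤ 1 → Q t s x y = q0 φ κ t s x y := by
  have h := H.adm
  obtain ⟨C, hC, hdec⟩ := exists_decay_frozenKernel Θ
  set R : Set (ℝ × ℝ × E Θ.d × E Θ.d) := {p | 0 ≤ p.1 ∧ p.1 < p.2.1 ∧ p.2.1 - p.1 ≤ 1} with hR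
  have hRm : MeasurableSet R :=
    (measurableSet_le measurable_const measurable_fst).inter
      ((measurableSet_lt measurable_fst measurable_snd.fst).inter
        (measurableSet_le (measurable_snd.fst.sub measurable_fst) measurable_const))
  set S : Set ((ℝ × ℝ × E Θ.d × E Θ.d) × E Θ.d) := Prod.fst ⁻¹' R with hS
  have hSm : MeasurableSet S := measurable_fst hRm
  set G : (ℝ × ℝ × E Θ.d × E Θ.d) × E Θ.d → ℝ := S.indicator fun q =>
    levelDiff φ κ 1 (frozenKernel φ κ q.1.2.2.2 q.1.1 q.1.2.1) (q.1.2.2.1 - q.1.2.2.2) q.2 with hG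
  have hGm : Measurable G := by
    -- the gradient is a limit of difference quotients of the jointly measurable frozen kernel
    refine measurable_of_tendsto_metrizable (f := fun (n : ℕ) => S.indicator fun q =>
      quotDiff φ κ n (frozenKernel φ κ q.1.2.2.2 q.1.1 q.1.2.1) (q.1.2.2.1 - q.1.2.2.2) q.2) ?_ ?_
    · intro n
      refine Measurable.indicator ?_ hSm
      have hp : ∀ {u : (ℝ × ℝ × E Θ.d × E Θ.d) × E Θ.d → E Θ.d}, Measurable u →
          Measurable fun q : (ℝ × ℝ × E Θ.d × E Θ.d) × E Θ.d =>
            frozenKernel φ κ q.1.2.2.2 q.1.1 q.1.2.1 (u q) := fun hu =>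
        H.measurable_frozenKernel (by fun_prop) (by fun_prop) (by fun_prop) hu
      have hz : Measurable fun q : (ℝ × ℝ × E Θ.d × E Θ.d) × E Θ.d => zlevel φ 1 q.2 :=
        (measurable_zlevel φ 1).comp measurable_snd
      unfold quotDiff
      split_ifs
      · exact (((hp (by fun_prop)).add (hp (by fun_prop))).sub
          ((hp (by fun_prop)).const_mul 2)).div_const 2
      · exact ((hp (by fun_prop)).sub (hp (by fun_prop))).sub
          (((hp (by fun_prop)).sub (hp (by fun_prop))).const_mul _)
    · rw [tendsto_pi_nhds]
      intro q
      by_cases hq : q ∈ S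
      · simp only [hG, indicator_of_mem hq]
        obtain ⟨h1, h2, h3⟩ : q.1 ∈ R := hq
        exact tendsto_quotDiff φ κ ((hdec φ ℓ κ H _ _ _ h1 h2 h3).contDiff.differentiable
          (by norm_num)) _ _
      · simp only [hG, indicator_of_notMem hq]
        exact tendsto_const_nhds
  have hint : ∀ {w : ℝ × ℝ × E Θ.d × E Θ.d → E Θ.d}, Measurable w → Measurable
      fun p => ∫ z, G (p, z) / radVol Θ.d φ ‖z‖ * κ p.1 (w p) z := fun {w} hw => by
    have h1 : Measurable fun q : (ℝ × ℝ × E Θ.d × E Θ.d) × E Θ.d => κ q.1.1 (w q.1) q.2 :=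
      H.bounds.measurable_comp (by fun_prop) (by fun_prop) (by fun_prop)
    have h2 : Measurable fun q : (ℝ × ℝ × E Θ.d × E Θ.d) × E Θ.d => radVol Θ.d φ ‖q.2‖ :=
      h.continuous_radVol_norm.measurable.comp measurable_snd
    have h3 := ((hGm.div h2).mul h1).stronglyMeasurable.integral_prod_right' (ν := volume)
    exact h3.measurable
  refine ⟨fun t s x y => (∫ z, G ((t, s, x, y), z) / radVol Θ.d φ ‖z‖ * κ t x z) -
    ∫ z, G ((t, s, x, y), z) / radVol Θ.d φ ‖z‖ * κ t y z, ?_, ?_⟩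
  · exact (hint (w := fun p => p.2.2.1) (by fun_prop)).sub
      (hint (w := fun p => p.2.2.2) (by fun_prop))
  · intro t s x y ht hts hts1
    have hmem : ∀ z, ((t, s, x, y), z) ∈ S := fun z => ⟨ht, hts, hts1⟩
    unfold q0 Lfrozen
    simp only [hG, indicator_of_mem (hmem _), Delta_eq]

/-- For fixed `t`, the parametrix error is jointly continuous in the other variables. -/
lemma Setting.continuousAt_q0 (hℓ : IsDini ℓ) {t s : ℝ} (ht : 0 ≤ t) (hts : t < s)
    (hts1 : s < t + 1) (x y : E Θ.d) :
    ContinuousAt (fun p : ℝ × E Θ.d × E Θ.d => q0 φ κ t p.1 p.2.1 p.2.2) (s, x, y) := by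
  have h := H.adm
  obtain ⟨C, hC, hdec⟩ := exists_decay_frozenKernel Θ
  set u : ℝ := (s + t) / 2 with hu
  have htu : t < u := by rw [hu]; linarith
  have hus : u < s := by rw [hu]; linarith
  have hnear : ∀ᶠ p : ℝ × E Θ.d × E Θ.d in 𝓝 (s, x, y), p.1 ∈ Ioo u (t + 1) :=
    continuous_fst.continuousAt.eventually (Ioo_mem_nhds hus hts1)
  set b := phiInv φ (u - t) with hb
  have hb0 : 0 < b := h.phiInv_pos (by linarith) (by linarith)
  set K : ℝ := C * b⁻¹ ^ 2 * dblC Θ b⁻¹ with hK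
  have hK0 : 0 ≤ K := by
    have := dblC_pos Θ (k := b⁻¹) (by positivity)
    positivity
  -- away from the initial time the frozen kernels have uniform bounds
  have hone : ∀ r ∈ Ioo u (t + 1), ∀ y, Decay φ 1 K 2 (frozenKernel φ κ y t r) := fun r hr y => by
    have h1 : t < r := htu.trans hr.1
    have h2 : r - t ≤ 1 := by linarith [hr.2]
    exact ((hdec φ ℓ κ H t r y ht h1 h2).of_le (by norm_num)).level_one h hb0
      (h.phiInv_mono (by linarith) (by linarith [hr.1]) h2)
      (h.phiInv_le_one (by linarith) h2) hC.le
  have hp : ∀ v : E Θ.d, ContinuousAt (fun p : ℝ × E Θ.d × E Θ.d =>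
      frozenKernel φ κ p.2.2 t p.1 (p.2.1 - p.2.2 + v)) (s, x, y) := fun v =>
    (H.continuousAt_frozenKernel hℓ ht hts y (x - y + v)).comp
      (f := fun p : ℝ × E Θ.d × E Θ.d => (p.1, p.2.2, p.2.1 - p.2.2 + v)) (x := (s, x, y))
      (by fun_prop)
  have hquot : ∀ (c : ℝ) (z : E Θ.d), ContinuousAt (fun p : ℝ × E Θ.d × E Θ.d =>
      quotDiff φ κ c (frozenKernel φ κ p.2.2 t p.1) (p.2.1 - p.2.2) z) (s, x, y) := by
    intro c z
    have hp0 := hp 0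
    simp only [add_zero] at hp0
    unfold quotDiff
    split_ifs
    · have h2 := hp (-z)
      simp only [← sub_eq_add_neg] at h2
      exact (((hp z).add h2).sub (hp0.const_mul 2)).div_const 2
    · exact ((hp z).sub hp0).sub (((hp _).sub hp0).const_mul c)
  have hlevel : ∀ z : E Θ.d, ContinuousAt (fun p : ℝ × E Θ.d × E Θ.d =>
      levelDiff φ κ 1 (frozenKernel φ κ p.2.2 t p.1) (p.2.1 - p.2.2) z) (s, x, y) := by
    intro z
    -- difference quotients, which are continuous, approximate the gradient locally uniformly
    refine continuousAt_of_locally_uniform_approx_of_continuousAt fun U hU => ?_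
    obtain ⟨ε, hε, hUε⟩ := Metric.mem_uniformity_dist.1 hU
    set B : ℝ := K * ‖zlevel φ 1 z‖ ^ 2 with hB
    have hB0 : 0 ≤ B := by positivity
    set c : ℝ := (B + 1) / ε with hc
    have hc0 : 0 < c := by positivity
    refine ⟨_, hnear, _, hquot c z, fun p hp => hUε ?_⟩
    have hd := hone p.1 hp p.2.2
    rw [Real.dist_eq]
    refine (abs_levelDiff_sub_quotDiff_le φ κ hd.contDiff
      (hd.norm_iteratedFDeriv_two_le h hK0) hc0 _ z).trans_lt ?_
    rw [div_lt_iff₀ hc0, hc, mul_div_cancel₀ _ hε.ne', ← hB]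
    linarith
  have hκ0 : 0 < Θ.κ₀ := zero_lt_one.trans_le h.κ₀_ge
  have hint : ∀ w : ℝ × E Θ.d × E Θ.d → E Θ.d, Continuous w → ContinuousAt
      (fun p : ℝ × E Θ.d × E Θ.d => ∫ z,
        Delta φ κ (frozenKernel φ κ p.2.2 t p.1) (p.2.1 - p.2.2) z * κ t (w p) z) (s, x, y) := by
    intro w hw
    refine continuousAt_of_dominated (bound := fun z =>
      K * (dblC Θ 2 + 4) * Θ.κ₀ * (gammaK φ κ ‖z‖ / radVol Θ.d φ ‖z‖)) ?_ ?_
      (H.integrable_gammaK.const_mul _) (ae_of_all _ fun z => ?_)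
    · filter_upwards [hnear] with p hp
      simp only [Delta_eq]
      exact (((measurable_levelDiff φ κ 1 (hone p.1 hp p.2.2).contDiff.continuous _).div
        h.continuous_radVol_norm.measurable).mul (H.measurable_kernel t _)).aestronglyMeasurable
    · filter_upwards [hnear] with p hp
      refine ae_of_all _ fun z => ?_
      have hV := h.radVol_nonneg (norm_nonneg z)
      have e1 := (hone p.1 hp p.2.2).abs_levelDiff_le h hK0 κ (p.2.1 - p.2.2) z
      have e2 := H.abs_kernel_le ht (w p) z
      have e3 := (abs_nonneg _).trans e1
      rw [Delta_eq, norm_mul, norm_div, Real.norm_eq_abs, Real.norm_of_nonneg hV,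
        Real.norm_eq_abs]
      calc _ ≤ (K * (dblC Θ 2 + 4) * gammaK φ κ ‖z‖) / radVol Θ.d φ ‖z‖ * Θ.κ₀ := by gcongr
        _ = _ := by ring
    · simp only [Delta_eq]
      exact ((hlevel z).div_const _).mul
        ((H.continuous_kernel hℓ ht z).comp hw).continuousAt
  exact (hint (fun p => p.2.1) (by fun_prop)).sub (hint (fun p => p.2.2) (by fun_prop))

end

/-! ### Slowly varying functions -/

/-- Potter's bound near zero: a slowly varying increasing function grows slower than any power. -/
lemma SlowlyVarying.exists_potter {ℓ : ℝ → ℝ} (hs : SlowlyVarying ℓ) (hℓ : IsDini ℓ) {b : ℝ}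
    (hb : 0 < b) : ∃ δ ∈ Ioc (0 : ℝ) 1, ∀ r R, 0 < r → r ≤ R → R ≤ δ →
      ℓ R ≤ 2 ^ b * (R / r) ^ b * ℓ r := by
  have h1 := hs.tendsto (1 / 2) (by norm_num)
  have hlt : (2 : ℝ) ^ (-b) < 1 := Real.rpow_lt_one_of_one_lt_of_neg one_lt_two (by linarith)
  obtain ⟨δ', hδ', hev⟩ := mem_nhdsGT_iff_exists_Ioo_subset.1 (h1.eventually (lt_mem_nhds hlt))
  have hδ0 : (0 : ℝ) < δ' := hδ'
  set δ : ℝ := min 1 (δ' / 2) with hδ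
  have hδpos : 0 < δ := lt_min one_pos (by linarith)
  -- slow variation controls one halving of the argument; iterating gives the power
  have hstep : ∀ R, 0 < R → R ≤ δ → ℓ R ≤ 2 ^ b * ℓ (R / 2) := fun R hR hRδ => by
    have hmem : R ∈ Ioo 0 δ' := ⟨hR, by linarith [hRδ.trans (min_le_right _ _)]⟩
    have h2 : (2 : ℝ) ^ (-b) < ℓ (1 / 2 * R) / ℓ R := hev hmem
    have hp : 0 < ℓ R := hℓ.pos' hR
    rw [lt_div_iff₀ hp, Real.rpow_neg zero_le_two] at h2
    have h2b : (0 : ℝ) < 2 ^ b := by positivity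
    calc ℓ R = 2 ^ b * ((2 ^ b)⁻¹ * ℓ R) := by field_simp
      _ ≤ 2 ^ b * ℓ (1 / 2 * R) := by gcongr
      _ = _ := by rw [one_div_mul_eq_div]
  have hiter : ∀ (n : ℕ) (R : ℝ), 0 < R → R ≤ δ → ℓ R ≤ (2 ^ b) ^ n * ℓ (R / 2 ^ n) := by
    intro n
    induction n with
    | zero => intro R _ _; simp
    | succ n ih =>
      intro R hR hRδ
      have hle : R / 2 ^ n ≤ δ := (div_le_self hR.le (one_le_pow₀ one_le_two)).trans hRδ
      calc ℓ R ≤ (2 ^ b) ^ n * ℓ (R / 2 ^ n) := ih R hR hRδ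
        _ ≤ (2 ^ b) ^ n * (2 ^ b * ℓ (R / 2 ^ n / 2)) := by
            gcongr
            exact hstep _ (by positivity) hle
        _ = _ := by rw [div_div, ← pow_succ, ← mul_assoc, ← pow_succ]
  refine ⟨δ, ⟨hδpos, min_le_left _ _⟩, fun r R hr hrR hRδ => ?_⟩
  have hR : 0 < R := hr.trans_le hrR
  obtain ⟨n, hn1, hn2⟩ := exists_nat_pow_near ((one_le_div hr).2 hrR) one_lt_two
  have hrn : R / 2 ^ (n + 1) ≤ r := by
    rw [div_lt_iff₀ hr] at hn2
    rw [div_le_iff₀ (by positivity)]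
    linarith
  have hpos : 0 < R / 2 ^ (n + 1) := by positivity
  have hpr := hℓ.pos' hr
  calc ℓ R ≤ (2 ^ b) ^ (n + 1) * ℓ (R / 2 ^ (n + 1)) := hiter _ R hR hRδ
    _ ≤ (2 ^ b) ^ (n + 1) * ℓ r := by
        gcongr
        exact hℓ.mono hpos hr hrn
    _ = 2 ^ b * (2 ^ n : ℝ) ^ b * ℓ r := by
        rw [pow_succ, ← Real.rpow_natCast (2 ^ b) n, ← Real.rpow_mul zero_le_two, mul_comm b,
          Real.rpow_mul zero_le_two, Real.rpow_natCast]
        ring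
    _ ≤ _ := by gcongr

lemma IsDini.le_one {ℓ : ℝ → ℝ} (h : IsDini ℓ) {r : ℝ} (hr : 0 < r) : ℓ r ≤ ℓ 1 := by
  rcases le_total r 1 with h1 | h1
  · exact h.mono hr (mem_Ioi.2 one_pos) h1
  · rw [h.extend r h1]

lemma IsDini.continuousOn_Ioi {ℓ : ℝ → ℝ} (h : IsDini ℓ) : ContinuousOn ℓ (Ioi 0) := by
  have heq : EqOn ℓ (fun r => ℓ (min r 1)) (Ioi 0) := fun r hr => by
    rcases le_total r 1 with h1 | h1
    · simp only [min_eq_left h1]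
    · simp only [min_eq_right h1, h.extend r h1]
  refine ContinuousOn.congr ?_ heq
  exact h.continuousOn.comp (by fun_prop) fun r hr => ⟨lt_min hr one_pos, min_le_right _ _⟩

/-- A slowly varying Dini function has growth of any positive order. -/
lemma SlowlyVarying.exists_powerGrowth {ℓ : ℝ → ℝ} (hs : SlowlyVarying ℓ) (hℓ : IsDini ℓ) {b : ℝ}
    (hb : 0 < b) : ∃ K, PowerGrowth ℓ b K := by
  obtain ⟨δ, ⟨hδ, hδ1⟩, hP⟩ := hs.exists_potter hℓ hb
  have hpδ := hℓ.pos' hδ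
  set Q : ℝ := ℓ 1 / ℓ δ with hQ
  have hQ1 : 1 ≤ Q := (one_le_div hpδ).2 (hℓ.le_one hδ)
  have h2b : (1 : ℝ) ≤ 2 ^ b := Real.one_le_rpow one_le_two hb.le
  refine ⟨Q * 2 ^ b, one_le_mul_of_one_le_of_one_le hQ1 h2b, hℓ.continuousOn_Ioi, hℓ.mono,
    fun r hr => (hℓ.pos' hr).le, hℓ.extend, fun r R hr hrR _ => ?_⟩
  have hR : 0 < R := hr.trans_le hrR
  have hpr := hℓ.pos' hr
  have hx : 1 ≤ (R / r) ^ b := Real.one_le_rpow ((one_le_div hr).2 hrR) hb.le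
  have hRQ : ℓ R ≤ Q * ℓ δ := by rw [hQ, div_mul_cancel₀ _ hpδ.ne']; exact hℓ.le_one hR
  rcases le_total R δ with h1 | h1
  · calc ℓ R ≤ 2 ^ b * (R / r) ^ b * ℓ r := hP r R hr hrR h1
      _ ≤ Q * (2 ^ b * (R / r) ^ b * ℓ r) := le_mul_of_one_le_left (by positivity) hQ1
      _ = _ := by ring
  · rcases le_total r δ with h2 | h2
    · calc ℓ R ≤ Q * ℓ δ := hRQ
        _ ≤ Q * (2 ^ b * (δ / r) ^ b * ℓ r) := by gcongr; exact hP r δ hr h2 le_rfl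
        _ ≤ Q * (2 ^ b * (R / r) ^ b * ℓ r) := by gcongr
        _ = _ := by ring
    · calc ℓ R ≤ Q * ℓ δ := hRQ
        _ ≤ Q * ℓ r := by gcongr; exact hℓ.mono hδ hr h2
        _ = Q * (1 * 1 * ℓ r) := by ring
        _ ≤ Q * (2 ^ b * (R / r) ^ b * ℓ r) := by gcongr
        _ = _ := by ring

lemma PowerGrowth.sq {g : ℝ → ℝ} {b K : ℝ} (h : PowerGrowth g b K) :
    PowerGrowth (fun r => g r ^ 2) (2 * b) (K ^ 2) where
  one_le := one_le_pow₀ h.one_le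
  continuousOn := h.continuousOn.pow 2
  mono r hr R hR hrR := by
    have := h.nonneg r hr
    exact pow_le_pow_left₀ this (h.mono hr hR hrR) 2
  nonneg r _ := sq_nonneg _
  const r hr := by rw [h.const r hr]
  growth r R hr hrR hR := by
    have hR0 : 0 < R := hr.trans_le hrR
    have h1 := pow_le_pow_left₀ (h.nonneg R hR0) (h.growth r R hr hrR hR) 2
    refine h1.trans (le_of_eq ?_)
    rw [mul_pow, mul_pow, ← Real.rpow_natCast ((R / r) ^ b), ← Real.rpow_mul (by positivity)]
    norm_num [mul_comm]

/-! ### The kernels `g / V` and their convolutions -/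

/-- The kernel `g(φ⁻¹(t) + |x|) / V(φ⁻¹(t) + |x|)`, comparable with `h^g_φ(t, x)`. -/
def kerF {d : ℕ} (φ g : ℝ → ℝ) (t : ℝ) (x : E d) : ℝ :=
  g (phiInv φ t + ‖x‖) / radVol d φ (phiInv φ t + ‖x‖)

/-- The kernel `g / V` is almost decreasing if `g` grows slower than the power `β₁ / 2`. -/
lemma PowerGrowth.div_radVol_le {Θ : Theta} {φ : ℝ → ℝ} (h : Adm Θ φ) {g : ℝ → ℝ} {K : ℝ}
    (hg : PowerGrowth g (Θ.β₁ / 2) K) {r R k : ℝ} (hk : 1 ≤ k) (hr : 0 < r) (hR : 0 < R)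
    (hle : R ≤ k * r) :
    g r / radVol Θ.d φ r ≤ K * lowC Θ * dblC Θ k * (g R / radVol Θ.d φ R) := by
  have hgr := hg.nonneg r hr
  have hgR := hg.nonneg R hR
  have hVr := h.radVol_pos hr
  have hVR := h.radVol_pos hR
  have hK := hg.one_le
  have hlow := one_le_lowC Θ
  have hD : 1 ≤ dblC Θ k := h.one_le_dblC hk
  rcases le_total r R with hrR | hrR
  · have e1 := h.inv_radVol_le hk hr hR hle
    have e2 := hg.mono hr hR hrR
    calc g r / radVol Θ.d φ r = g r * (1 / radVol Θ.d φ r) := by rw [mul_one_div]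
      _ ≤ g R * (dblC Θ k * (1 / radVol Θ.d φ R)) := by gcongr
      _ = 1 * 1 * dblC Θ k * (g R / radVol Θ.d φ R) := by ring
      _ ≤ _ := by gcongr
  · -- between `R` and `r` the quotient `g / φ` is almost decreasing
    have key : ∀ r, R ≤ r → r ≤ 1 → g r / φ r ≤ K * lowC Θ * (g R / φ R) := fun r hRr hr1 => by
      have hr : 0 < r := hR.trans_le hRr
      have hφr := h.phi_pos hr
      have hφR := h.phi_pos hR
      have e1 := hg.growth R r hR hRr hr1
      have e2 := h.phi_lower hR hRr hr1
      have e3 : (R / r) ^ Θ.β₁ * (r / R) ^ (Θ.β₁ / 2) ≤ 1 := by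
        have hx : R / r ≤ 1 := (div_le_one hr).2 hRr
        have hx0 : 0 < R / r := by positivity
        have : (r / R) = (R / r)⁻¹ := by rw [inv_div]
        rw [this, Real.inv_rpow hx0.le, ← Real.rpow_neg hx0.le, ← Real.rpow_add hx0]
        exact Real.rpow_le_one hx0.le hx (by have := h.scaling.β₁_pos; linarith)
      rw [div_le_iff₀ hφr]
      calc g r ≤ K * (r / R) ^ (Θ.β₁ / 2) * g R := e1
        _ = K * (r / R) ^ (Θ.β₁ / 2) * (g R / φ R) * φ R := by field_simp
        _ ≤ K * (r / R) ^ (Θ.β₁ / 2) * (g R / φ R) * (lowC Θ * (R / r) ^ Θ.β₁ * φ r) := by gcongr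
        _ = K * lowC Θ * (g R / φ R) * φ r * ((R / r) ^ Θ.β₁ * (r / R) ^ (Θ.β₁ / 2)) := by ring
        _ ≤ K * lowC Θ * (g R / φ R) * φ r * 1 := by gcongr
        _ = _ := by ring
    have hφr := h.phi_pos hr
    have hφR := h.phi_pos hR
    have e0 : g r / φ r ≤ K * lowC Θ * (g R / φ R) := by
      rcases le_total r 1 with h1 | h1
      · exact key r hrR h1
      · have e1 : g r = g 1 := hg.const r h1
        rcases le_total R 1 with h2 | h2
        · refine le_trans ?_ (key 1 h2 le_rfl)
          rw [e1]
          have := hg.nonneg 1 one_pos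
          have := h.phi_pos one_pos
          gcongr
          exact h.phi_mono zero_le_one h1
        · have e2 : g R = g 1 := hg.const R h2
          rw [e1, e2]
          have := hg.nonneg 1 one_pos
          calc g 1 / φ r ≤ 1 * (g 1 / φ R) := by
                rw [one_mul]; gcongr; exact h.phi_mono hR.le hrR
            _ ≤ _ := by
                gcongr
                exact one_le_mul_of_one_le_of_one_le hK hlow
    calc g r / radVol Θ.d φ r = (g r / φ r) / r ^ Θ.d := by
          unfold radVol; field_simp
      _ ≤ (K * lowC Θ * (g R / φ R)) / R ^ Θ.d := by gcongr
      _ = K * lowC Θ * 1 * (g R / radVol Θ.d φ R) := by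
          unfold radVol; field_simp
      _ ≤ _ := by gcongr

lemma lintegral_comp_sub_left {d : ℕ} (f : E d → ℝ≥0∞) (x : E d) :
    ∫⁻ z, f (x - z) = ∫⁻ z, f z := by
  rw [← lintegral_neg_eq_self]
  simp only [sub_neg_eq_add]
  exact lintegral_add_left_eq_self f x

section

variable {Θ : Theta} {φ : ℝ → ℝ} (h : Adm Θ φ) {g : ℝ → ℝ}

include h

lemma kerF_nonneg (hg : ∀ r, 0 < r → 0 ≤ g r) {t : ℝ} (h0 : 0 < t) (h1 : t ≤ 1) (x : E Θ.d) :
    0 ≤ kerF φ g t x := by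
  have hl : 0 < phiInv φ t + ‖x‖ := add_pos_of_pos_of_nonneg (h.phiInv_pos h0 h1) (norm_nonneg x)
  exact div_nonneg (hg _ hl) (h.radVol_pos hl).le

lemma continuous_kerF (hg : ContinuousOn g (Ioi 0)) {t : ℝ} (h0 : 0 < t) (h1 : t ≤ 1) :
    Continuous fun x : E Θ.d => kerF φ g t x := by
  have hp := h.phiInv_pos h0 h1
  have hl : ∀ x : E Θ.d, 0 < phiInv φ t + ‖x‖ := fun x =>
    add_pos_of_pos_of_nonneg hp (norm_nonneg x)
  have hc : Continuous fun x : E Θ.d => phiInv φ t + ‖x‖ := by fun_prop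
  refine Continuous.div (hg.comp_continuous hc hl) ?_ fun x => (h.radVol_pos (hl x)).ne'
  exact (hc.pow _).mul (h.continuousOn_phi.comp_continuous hc hl)

end

/-- Convolution of two kernels: the product is controlled by the kernel of the total time, and one
of the two factors is integrated out. -/
lemma exists_lintegral_kerF_mul_le (Θ : Theta) (g : ℝ → ℝ) {K : ℝ}
    (hg : PowerGrowth g (Θ.β₁ / 2) K) : ∃ A : ℝ, 0 < A ∧ ∀ φ : ℝ → ℝ, Adm Θ φ →
      ∀ u v : ℝ, 0 < u → 0 < v → u + v ≤ 1 → ∀ x y : E Θ.d,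
        ∫⁻ z, ENNReal.ofReal (kerF φ g u (x - z)) * ENNReal.ofReal (kerF φ g v (z - y)) ≤
          ENNReal.ofReal (A * kerF φ g (u + v) (x - y) *
            (g (phiInv φ u) / u + g (phiInv φ v) / v)) := by
  by_cases hΘ : ∃ φ, Adm Θ φ
  swap
  · exact ⟨1, one_pos, fun φ h => absurd ⟨φ, h⟩ hΘ⟩
  obtain ⟨φ₀, h₀⟩ := hΘ
  obtain ⟨C, hC, hint⟩ := exists_lintegral_weight_le Θ
  have hβ := h₀.scaling.β₁_pos
  have hlow := one_le_lowC Θ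
  have hK := hg.one_le
  set k : ℝ := (lowC Θ * 2) ^ (1 / Θ.β₁) with hk
  have hk1 : 1 ≤ k := Real.one_le_rpow (by linarith) (by positivity)
  have hD2 := dblC_pos Θ (k := 2) two_pos
  have hDk := dblC_pos Θ (k := k) (by positivity)
  set A₁ : ℝ := K * lowC Θ * dblC Θ 2 with hA₁
  set A₂ : ℝ := K * lowC Θ * dblC Θ k with hA₂
  have hA₁0 : 0 < A₁ := by positivity
  have hA₂0 : 0 < A₂ := by positivity
  refine ⟨A₁ * A₂ * (C * K), by positivity, fun φ h u v hu hv huv x y => ?_⟩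
  have hpu := h.phiInv_pos hu (by linarith)
  have hpv := h.phiInv_pos hv (by linarith)
  have hpuv := h.phiInv_pos (add_pos hu hv) huv
  -- the larger of `u` and `v` is at least half of `u + v`
  have hmax : phiInv φ (u + v) ≤ k * (phiInv φ u + phiInv φ v) := by
    have haux : ∀ w, 0 < w → w ≤ u + v → u + v ≤ 2 * w → phiInv φ (u + v) ≤ k * phiInv φ w :=
      fun w hw hle hle2 => by
        have e1 := h.phiInv_ratio hw hle huv
        have hpw := h.phiInv_pos hw (hle.trans huv)
        rw [div_le_iff₀ hpw] at e1
        refine e1.trans ?_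
        rw [hk]
        gcongr
        rw [div_le_iff₀ hw]; linarith
    rcases le_total u v with hle | hle
    · have := haux v hv (by linarith) (by linarith)
      have : 0 ≤ k * phiInv φ u := by positivity
      linarith
    · have := haux u hu (by linarith) (by linarith)
      have : 0 ≤ k * phiInv φ v := by positivity
      linarith
  have hF0 : ∀ t, 0 < t → t ≤ 1 → ∀ x : E Θ.d, 0 ≤ kerF φ g t x := fun t h0 h1 x =>
    kerF_nonneg h hg.nonneg h0 h1 x
  have hFuv := hF0 (u + v) (add_pos hu hv) huv (x - y)
  have hgu := hg.nonneg _ hpu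
  have hgv := hg.nonneg _ hpv
  -- a 3P-type inequality: the kernel with the larger argument is controlled by that of the total
  -- time, because `g / V` is almost decreasing
  have hpt : ∀ z, kerF φ g u (x - z) * kerF φ g v (z - y) ≤
      A₁ * A₂ * kerF φ g (u + v) (x - y) * (kerF φ g u (x - z) + kerF φ g v (z - y)) := by
    intro z
    set r₁ := phiInv φ u + ‖x - z‖ with hr₁
    set r₂ := phiInv φ v + ‖z - y‖ with hr₂
    set R := phiInv φ (u + v) + ‖x - y‖ with hR
    have p1 : 0 < r₁ := by positivity
    have p2 : 0 < r₂ := by positivity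
    have p3 : 0 < R := by positivity
    have hle : R / k ≤ r₁ + r₂ := by
      rw [div_le_iff₀ (by positivity)]
      have : ‖x - y‖ ≤ ‖x - z‖ + ‖z - y‖ := norm_sub_le_norm_sub_add_norm_sub x z y
      have : ‖x - z‖ + ‖z - y‖ ≤ k * (‖x - z‖ + ‖z - y‖) :=
        le_mul_of_one_le_left (by positivity) hk1
      nlinarith
    have e1 := mul_le_of_almost_antitone (F := fun r => g r / radVol Θ.d φ r) (C := A₁)
      (fun r hr => div_nonneg (hg.nonneg r hr) (h.radVol_pos hr).le)
      (fun r R hr hR hle => hg.div_radVol_le h one_le_two hr hR hle) p1 p2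
      (by positivity : 0 < R / k) hle
    have e2 := hg.div_radVol_le h hk1 (by positivity : 0 < R / k) p3
      (by rw [mul_div_cancel₀ _ (by positivity)])
    refine e1.trans ?_
    have q1 : 0 ≤ g r₁ / radVol Θ.d φ r₁ := div_nonneg (hg.nonneg _ p1) (h.radVol_pos p1).le
    have q2 : 0 ≤ g r₂ / radVol Θ.d φ r₂ := div_nonneg (hg.nonneg _ p2) (h.radVol_pos p2).le
    rw [mul_assoc A₁ A₂]
    unfold kerF
    gcongr
  have hFm : ∀ t, 0 < t → t ≤ 1 → Measurable fun x : E Θ.d => kerF φ g t x := fun t h0 h1 =>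
    (continuous_kerF h hg.continuousOn h0 h1).measurable
  have hI : ∀ t, 0 < t → t ≤ 1 → ∫⁻ z : E Θ.d, ENNReal.ofReal (kerF φ g t z) ≤
      ENNReal.ofReal (C * K * (g (phiInv φ t) / t)) := fun t h0 h1 => by
    have := hint φ h g K hg (phiInv φ t) ⟨h.phiInv_pos h0 h1, h.phiInv_le_one h0.le h1⟩
    rwa [h.phi_phiInv h0.le h1] at this
  calc ∫⁻ z, ENNReal.ofReal (kerF φ g u (x - z)) * ENNReal.ofReal (kerF φ g v (z - y))
      ≤ ∫⁻ z, ENNReal.ofReal (A₁ * A₂ * kerF φ g (u + v) (x - y)) *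
          (ENNReal.ofReal (kerF φ g u (x - z)) + ENNReal.ofReal (kerF φ g v (z - y))) := by
        refine lintegral_mono fun z => ?_
        have q1 := hF0 u hu (by linarith) (x - z)
        have q2 := hF0 v hv (by linarith) (z - y)
        rw [← ENNReal.ofReal_mul q1, ← ENNReal.ofReal_add q1 q2,
          ← ENNReal.ofReal_mul (by positivity)]
        exact ENNReal.ofReal_le_ofReal (hpt z)
    _ = ENNReal.ofReal (A₁ * A₂ * kerF φ g (u + v) (x - y)) *
          ((∫⁻ z, ENNReal.ofReal (kerF φ g u z)) + ∫⁻ z, ENNReal.ofReal (kerF φ g v z)) := by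
        have m1 : Measurable fun z : E Θ.d => ENNReal.ofReal (kerF φ g u (x - z)) :=
          ((hFm u hu (by linarith)).comp (measurable_const_sub x)).ennreal_ofReal
        rw [lintegral_const_mul' _ _ ENNReal.ofReal_ne_top, lintegral_add_left m1,
          lintegral_comp_sub_left (fun z => ENNReal.ofReal (kerF φ g u z)),
          lintegral_sub_right_eq_self (fun z => ENNReal.ofReal (kerF φ g v z))]
    _ ≤ ENNReal.ofReal (A₁ * A₂ * kerF φ g (u + v) (x - y)) *
          (ENNReal.ofReal (C * K * (g (phiInv φ u) / u)) +
            ENNReal.ofReal (C * K * (g (phiInv φ v) / v))) := by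
        gcongr
        · exact hI u hu (by linarith)
        · exact hI v hv (by linarith)
    _ = _ := by
        rw [← ENNReal.ofReal_add (by positivity) (by positivity),
          ← ENNReal.ofReal_mul (by positivity)]
        congr 1; ring

/-! ### Small time integrals -/

lemma setLIntegral_Ioo_comp_sub (f : ℝ → ℝ≥0∞) (t s : ℝ) :
    ∫⁻ r in Ioo t s, f (r - t) = ∫⁻ u in Ioo 0 (s - t), f u := by
  have := (measurePreserving_sub_right (volume : Measure ℝ) t).setLIntegral_comp_preimage_emb
    (MeasurableEquiv.subRight t).measurableEmbedding f (Ioo 0 (s - t))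
  rw [← this]
  congr 2
  ext r; simp

lemma setLIntegral_Ioo_reflect (f : ℝ → ℝ≥0∞) (τ : ℝ) :
    ∫⁻ u in Ioo 0 τ, f (τ - u) = ∫⁻ u in Ioo 0 τ, f u := by
  have := (Measure.measurePreserving_sub_left (volume : Measure ℝ)
    τ).setLIntegral_comp_preimage_emb (MeasurableEquiv.subLeft τ).measurableEmbedding f (Ioo 0 τ)
  rw [← this]
  congr 2
  ext r; simp [and_comm]

/-- The Dini condition after a change of variables. -/
lemma IsDini.lintegral_comp_rpow_lt_top {ℓ : ℝ → ℝ} (hℓ : IsDini ℓ) {c p : ℝ} (hc : 0 < c)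
    (hp : 0 < p) : ∫⁻ u in Ioc 0 c⁻¹, ENNReal.ofReal (ℓ ((c * u) ^ p) / u) < ∞ := by
  set f : ℝ → ℝ := (Ioc 0 1).indicator fun r => ℓ r / r with hf
  have h1 : IntegrableOn f (Ioi 0) := by
    have : IntegrableOn (fun r => ℓ r / r) (Ioc 0 1) (volume.restrict (Ioi 0)) := by
      rw [IntegrableOn, Measure.restrict_restrict measurableSet_Ioc,
        inter_eq_left.2 Ioc_subset_Ioi_self]
      exact hℓ.integrableOn
    exact (integrable_indicator_iff measurableSet_Ioc).2 this
  have h2 := (integrableOn_Ioi_comp_rpow_iff' f hp.ne').2 h1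
  have h3 := (integrableOn_Ioi_comp_mul_left_iff (fun x => x ^ (p - 1) • f (x ^ p)) 0 hc).2
    (by rwa [mul_zero])
  have h4 : IntegrableOn (fun u => ℓ ((c * u) ^ p) / u) (Ioc 0 c⁻¹) := by
    refine IntegrableOn.congr_fun ((h3.mono_set Ioc_subset_Ioi_self).const_mul c)
      (fun u hu => ?_) measurableSet_Ioc
    have hu0 : 0 < u := hu.1
    have hcu : 0 < c * u := by positivity
    have hcu1 : c * u ≤ 1 := by
      have := hu.2
      rwa [le_inv_comm₀ hu0 hc, inv_eq_one_div, le_div_iff₀ hu0] at this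
    have hmem : (c * u) ^ p ∈ Ioc (0 : ℝ) 1 :=
      ⟨by positivity, Real.rpow_le_one hcu.le hcu1 hp.le⟩
    simp only [hf, indicator_of_mem hmem, smul_eq_mul]
    rw [Real.rpow_sub hcu, Real.rpow_one]
    field_simp
  have := h4.2
  rwa [hasFiniteIntegral_iff_ofReal] at this
  refine (ae_restrict_iff' measurableSet_Ioc).2 (ae_of_all _ fun u hu => ?_)
  have hu0 : 0 < u := hu.1
  exact div_nonneg (hℓ.pos' (by positivity)).le hu0.le

/-- The time integral `∫₀^ε ℓ((c u)^p) du / u` and the boundary value are small for small `ε`. -/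
lemma IsDini.exists_small {ℓ : ℝ → ℝ} (hℓ : IsDini ℓ) {c p : ℝ} (hc : 0 < c)
    (hp : 0 < p) {η : ℝ} (hη : 0 < η) : ∃ ε ∈ Ioc (0 : ℝ) 1,
      ∫⁻ u in Ioo 0 ε, ENNReal.ofReal (ℓ ((c * u) ^ p) / u) ≤ ENNReal.ofReal η ∧
      ∀ u ∈ Ioc 0 ε, ℓ ((c * u) ^ p) ≤ η := by
  obtain ⟨δ, hδ, hsmall⟩ := exists_pos_setLIntegral_lt_of_measure_lt
    (hℓ.lintegral_comp_rpow_lt_top hc hp).ne (ENNReal.ofReal_pos.2 hη).ne'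
  have htend : Tendsto (fun u : ℝ => (c * u) ^ p) (𝓝[>] 0) (𝓝[>] 0) := by
    refine tendsto_nhdsWithin_of_tendsto_nhds_of_eventually_within _ ?_ ?_
    · have : Tendsto (fun u : ℝ => (c * u) ^ p) (𝓝 0) (𝓝 ((c * 0) ^ p)) :=
        ((continuous_const.mul continuous_id).rpow_const fun _ => Or.inr hp.le).tendsto 0
      rw [mul_zero, Real.zero_rpow hp.ne'] at this
      exact this.mono_left nhdsWithin_le_nhds
    · filter_upwards [self_mem_nhdsWithin] with u hu
      have : 0 < u := hu
      exact mem_Ioi.2 (by positivity)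
  have hev := (hℓ.tendsto.comp htend).eventually (ge_mem_nhds hη)
  obtain ⟨δ₁, hδ₁, hsub⟩ := mem_nhdsGT_iff_exists_Ioc_subset.1 hev
  have hδ₁0 : (0 : ℝ) < δ₁ := hδ₁
  obtain ⟨δ₂, hδ₂, hδ₂δ⟩ : ∃ δ₂ : ℝ, 0 < δ₂ ∧ ENNReal.ofReal δ₂ < δ := by
    obtain ⟨q, hq, hqδ⟩ := ENNReal.lt_iff_exists_nnreal_btwn.1 hδ
    refine ⟨q, by exact_mod_cast hq, by rwa [ENNReal.ofReal_coe_nnreal]⟩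
  refine ⟨min (min 1 c⁻¹) (min δ₁ δ₂), ⟨by positivity, (min_le_left _ _).trans (min_le_left _ _)⟩,
    ?_, fun u hu => ?_⟩
  · set ε := min (min 1 c⁻¹) (min δ₁ δ₂) with hε
    have hεc : ε ≤ c⁻¹ := (min_le_left _ _).trans (min_le_right _ _)
    have hεδ : ε ≤ δ₂ := (min_le_right _ _).trans (min_le_right _ _)
    have hmeas : (volume.restrict (Ioc 0 c⁻¹)) (Ioo 0 ε) < δ := by
      refine (Measure.restrict_apply_le _ _).trans_lt ?_
      rw [Real.volume_Ioo, sub_zero]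
      exact (ENNReal.ofReal_le_ofReal hεδ).trans_lt hδ₂δ
    have := (hsmall _ hmeas).le
    rwa [Measure.restrict_restrict measurableSet_Ioo, inter_eq_left.2
      (show Ioo 0 ε ⊆ Ioc 0 c⁻¹ from fun u hu => ⟨hu.1, hu.2.le.trans hεc⟩)] at this
  · exact hsub ⟨hu.1, hu.2.trans ((min_le_right _ _).trans (min_le_left _ _))⟩

section

variable {Θ : Theta} {φ ℓ : ℝ → ℝ}

lemma Adm.ell_phiInv_le (h : Adm Θ φ) (hℓ : IsDini ℓ) {u : ℝ} (hu : 0 < u) (hu1 : u ≤ 1) :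
    ℓ (phiInv φ u) ≤ ℓ ((upC Θ * u) ^ (1 / Θ.β₂)) := by
  have hup := one_le_upC Θ
  exact hℓ.mono (h.phiInv_pos hu hu1) (mem_Ioi.2 (by positivity)) (h.phiInv_le hu hu1)

/-- Potter's bound in the time variable. -/
lemma Adm.inv_ell_phiInv_le (h : Adm Θ φ) (hℓ : IsDini ℓ) {K : ℝ}
    (hg : PowerGrowth ℓ (Θ.β₁ / 4) K) {u τ : ℝ} (hu : 0 < u) (huτ : u ≤ τ) (hτ : τ ≤ 1) :
    1 / ℓ (phiInv φ u) ≤ K * lowC Θ * (τ / u) ^ (1 / 4 : ℝ) * (1 / ℓ (phiInv φ τ)) := by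
  have hβ := h.scaling.β₁_pos
  have hτ0 := hu.trans_le huτ
  have hpu := h.phiInv_pos hu (huτ.trans hτ)
  have hpτ := h.phiInv_pos hτ0 hτ
  have e1 := hg.growth _ _ hpu (h.phiInv_mono hu.le huτ hτ) (h.phiInv_le_one hτ0.le hτ)
  have e2 := h.phiInv_ratio hu huτ hτ
  have hlow := one_le_lowC Θ
  have e3 : (phiInv φ τ / phiInv φ u) ^ (Θ.β₁ / 4) ≤ lowC Θ * (τ / u) ^ (1 / 4 : ℝ) := by
    calc (phiInv φ τ / phiInv φ u) ^ (Θ.β₁ / 4)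
        ≤ ((lowC Θ * (τ / u)) ^ (1 / Θ.β₁)) ^ (Θ.β₁ / 4) := by gcongr
      _ = (lowC Θ) ^ (1 / 4 : ℝ) * (τ / u) ^ (1 / 4 : ℝ) := by
          rw [← Real.rpow_mul (by positivity), ← Real.mul_rpow (by positivity) (by positivity)]
          congr 1
          field_simp
      _ ≤ (lowC Θ) ^ (1 : ℝ) * (τ / u) ^ (1 / 4 : ℝ) := by
          gcongr
          · norm_num
      _ = _ := by rw [Real.rpow_one]
  have p1 := hℓ.pos' hpu
  have p2 := hℓ.pos' hpτ
  have hK := hg.one_le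
  rw [mul_one_div, div_le_div_iff₀ p1 p2, one_mul]
  calc ℓ (phiInv φ τ) ≤ K * (phiInv φ τ / phiInv φ u) ^ (Θ.β₁ / 4) * ℓ (phiInv φ u) := e1
    _ ≤ K * (lowC Θ * (τ / u) ^ (1 / 4 : ℝ)) * ℓ (phiInv φ u) := by gcongr
    _ = _ := by ring

end

/-- The time integral that remains when the growth of `ℓ` contributes `(τ / u)^{1/4}`. -/
lemma lintegral_rpow_neg_quarter {τ : ℝ} (hτ : 0 < τ) :
    ∫⁻ u in Ioo 0 τ, ENNReal.ofReal ((τ / u) ^ (1 / 4 : ℝ) / τ) ≤ ENNReal.ofReal (4 / 3) := by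
  have hint : IntegrableOn (fun u : ℝ => u ^ (-(1 / 4) : ℝ)) (Ioc 0 τ) :=
    (intervalIntegrable_iff_integrableOn_Ioc_of_le hτ.le).1
      (intervalIntegral.intervalIntegrable_rpow' (by norm_num))
  calc ∫⁻ u in Ioo 0 τ, ENNReal.ofReal ((τ / u) ^ (1 / 4 : ℝ) / τ)
      ≤ ∫⁻ u in Ioc 0 τ, ENNReal.ofReal ((τ / u) ^ (1 / 4 : ℝ) / τ) :=
        lintegral_mono_set Ioo_subset_Ioc_self
    _ = ∫⁻ u in Ioc 0 τ, ENNReal.ofReal (τ ^ (1 / 4 : ℝ) / τ * u ^ (-(1 / 4) : ℝ)) := by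
        refine setLIntegral_congr_fun measurableSet_Ioc fun u hu => ?_
        have hu0 : 0 < u := hu.1
        rw [Real.div_rpow hτ.le hu0.le, Real.rpow_neg hu0.le]
        congr 1; field_simp
    _ = ENNReal.ofReal (∫ u in Ioc 0 τ, τ ^ (1 / 4 : ℝ) / τ * u ^ (-(1 / 4) : ℝ)) := by
        rw [ofReal_integral_eq_lintegral_ofReal (hint.const_mul _)]
        refine (ae_restrict_iff' measurableSet_Ioc).2 (ae_of_all _ fun u hu => ?_)
        have hu0 : 0 < u := hu.1
        simp only [Pi.zero_apply]; positivity
    _ = _ := by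
        rw [integral_const_mul, ← intervalIntegral.integral_of_le hτ.le,
          integral_rpow (Or.inl (by norm_num))]
        congr 1
        rw [show (-(1 / 4) + 1 : ℝ) = 3 / 4 by norm_num, Real.zero_rpow (by norm_num), sub_zero]
        have : τ ^ (1 / 4 : ℝ) * τ ^ (3 / 4 : ℝ) = τ := by
          rw [← Real.rpow_add hτ]; norm_num
        calc τ ^ (1 / 4 : ℝ) / τ * (τ ^ (3 / 4 : ℝ) / (3 / 4)) =
            (τ ^ (1 / 4 : ℝ) * τ ^ (3 / 4 : ℝ)) / τ * (4 / 3) := by ring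
          _ = _ := by rw [this, div_self hτ.ne', one_mul]

/-- Space-time convolutions of the kernels `ℓ² / V` over a short time interval are small multiples
of the kernel, also with the weight `1 / ℓ_φ` of the first time variable. -/
theorem exists_small_time (Θ : Theta) {ℓ : ℝ → ℝ} (hs : SlowlyVarying ℓ) (hℓ : IsDini ℓ) {η : ℝ}
    (hη : 0 < η) : ∃ ε ∈ Ioc (0 : ℝ) 1, ∀ φ : ℝ → ℝ, Adm Θ φ →
      (∀ u ∈ Ioc 0 ε, ℓ (phiInv φ u) ≤ η) ∧
      ∀ t s : ℝ, t < s → s - t ≤ ε → ∀ x y : E Θ.d,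
        ∫⁻ r in Ioo t s, ∫⁻ z, ENNReal.ofReal (kerF φ (fun r => ℓ r ^ 2) (r - t) (x - z)) *
            ENNReal.ofReal (kerF φ (fun r => ℓ r ^ 2) (s - r) (z - y)) ≤
          ENNReal.ofReal (η * kerF φ (fun r => ℓ r ^ 2) (s - t) (x - y)) ∧
        ∫⁻ r in Ioo t s, ENNReal.ofReal (1 / ℓ (phiInv φ (r - t))) *
            ∫⁻ z, ENNReal.ofReal (kerF φ (fun r => ℓ r ^ 2) (r - t) (x - z)) *
            ENNReal.ofReal (kerF φ (fun r => ℓ r ^ 2) (s - r) (z - y)) ≤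
          ENNReal.ofReal (η * (1 / ℓ (phiInv φ (s - t))) *
            kerF φ (fun r => ℓ r ^ 2) (s - t) (x - y)) := by
  by_cases hΘ : ∃ φ, Adm Θ φ
  swap
  · exact ⟨1, ⟨one_pos, le_rfl⟩, fun φ h => absurd ⟨φ, h⟩ hΘ⟩
  obtain ⟨φ₀, h₀⟩ := hΘ
  have hβ := h₀.scaling.β₁_pos
  have hβ₂ := h₀.β₂_pos
  obtain ⟨K, hK⟩ := hs.exists_powerGrowth hℓ (b := Θ.β₁ / 4) (by positivity)
  have hg := hK.sq
  rw [show 2 * (Θ.β₁ / 4) = Θ.β₁ / 2 by ring] at hg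
  set g : ℝ → ℝ := fun r => ℓ r ^ 2 with hgdef
  obtain ⟨A, hA, hconv⟩ := exists_lintegral_kerF_mul_le Θ g hg
  have hup := one_le_upC Θ
  have hlow := one_le_lowC Θ
  have hK1 := hK.one_le
  set L : ℝ := ℓ 1 with hL
  have hL0 : 0 < L := hℓ.pos' one_pos
  set K₃ : ℝ := K * lowC Θ with hK₃
  have hK₃1 : 1 ≤ K₃ := one_le_mul_of_one_le_of_one_le hK1 hlow
  set D : ℝ := A * L * (1 + 2 * K₃ + 2 * K₃ * (4 / 3)) with hD
  have hD0 : 0 < D := by positivity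
  set η' : ℝ := min η (η / D) with hη'
  have hη'0 : 0 < η' := by positivity
  have hDη : D * η' ≤ η := by
    calc D * η' ≤ D * (η / D) := by gcongr; exact min_le_right _ _
      _ = η := by field_simp
  obtain ⟨ε, hε, hδ, hWε⟩ := hℓ.exists_small (c := upC Θ) (p := 1 / Θ.β₂) (by positivity)
    (by positivity) hη'0
  set W : ℝ → ℝ := fun u => ℓ ((upC Θ * u) ^ (1 / Θ.β₂)) with hW
  refine ⟨ε, hε, fun φ h => ⟨fun u hu => ?_, fun t s hts hsε x y => ?_⟩⟩
  · exact (h.ell_phiInv_le hℓ hu.1 (hu.2.trans hε.2)).trans ((hWε u hu).trans (min_le_left _ _))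
  set τ := s - t with hτ
  have hτ0 : 0 < τ := sub_pos.2 hts
  have hτ1 : τ ≤ 1 := hsε.trans hε.2
  have hF := kerF_nonneg h hg.nonneg hτ0 hτ1 (x - y)
  set F := kerF φ g τ (x - y) with hFdef
  have hWpos : ∀ u, 0 < u → 0 < W u := fun u hu => hℓ.pos' (by positivity)
  have hWle : ∀ u, 0 < u → u ≤ 1 → ℓ (phiInv φ u) ≤ W u := fun u hu hu1 =>
    h.ell_phiInv_le hℓ hu hu1
  have hpos : ∀ u, 0 < u → u ≤ 1 → 0 < ℓ (phiInv φ u) := fun u hu hu1 =>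
    hℓ.pos' (h.phiInv_pos hu hu1)
  have hgW : ∀ u, 0 < u → u ≤ 1 → g (phiInv φ u) ≤ L * W u := fun u hu hu1 => by
    have e1 := hWle u hu hu1
    have e2 := hpos u hu hu1
    have e3 : ℓ (phiInv φ u) ≤ L := hℓ.le_one (h.phiInv_pos hu hu1)
    calc g (phiInv φ u) = ℓ (phiInv φ u) * ℓ (phiInv φ u) := by rw [hgdef]; ring
      _ ≤ _ := by gcongr
  have hinner : ∀ u ∈ Ioo 0 τ, ∫⁻ z, ENNReal.ofReal (kerF φ g u (x - z)) *
      ENNReal.ofReal (kerF φ g (τ - u) (z - y)) ≤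
      ENNReal.ofReal (A * F * (g (phiInv φ u) / u + g (phiInv φ (τ - u)) / (τ - u))) :=
    fun u hu => by
      have := hconv φ h u (τ - u) hu.1 (by linarith [hu.2]) (by linarith) x y
      rwa [add_sub_cancel] at this
  -- the three time integrals
  set J₁ : ℝ≥0∞ := ∫⁻ u in Ioo 0 τ, ENNReal.ofReal (W u / u) with hJ₁
  have hJ₁le : J₁ ≤ ENNReal.ofReal η' :=
    (lintegral_mono_set (Ioo_subset_Ioo_right hsε)).trans hδ
  have hJ₂ : ∫⁻ u in Ioo 0 τ, ENNReal.ofReal (W (τ - u) / (τ - u)) = J₁ :=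
    setLIntegral_Ioo_reflect (fun u => ENNReal.ofReal (W u / u)) τ
  have hWc : ContinuousOn W (Ioi 0) := by
    refine hℓ.continuousOn_Ioi.comp ?_ fun u hu => ?_
    · refine ContinuousOn.rpow_const (by fun_prop) fun u hu => Or.inr (by positivity)
    · have hu0 : 0 < u := hu
      exact mem_Ioi.2 (by positivity)
  have hWm : AEMeasurable (fun u => ENNReal.ofReal (W u / u)) (volume.restrict (Ioo 0 τ)) := by
    refine AEMeasurable.ennreal_ofReal (ContinuousOn.aemeasurable ?_ measurableSet_Ioo)
    exact (hWc.mono Ioo_subset_Ioi_self).div continuousOn_id fun u hu => hu.1.ne'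
  have hWm' : AEMeasurable (fun u => ENNReal.ofReal (W (τ - u) / (τ - u)))
      (volume.restrict (Ioo 0 τ)) := by
    refine AEMeasurable.ennreal_ofReal (ContinuousOn.aemeasurable ?_ measurableSet_Ioo)
    refine ContinuousOn.div (hWc.comp (by fun_prop) fun u hu => ?_) (by fun_prop) fun u hu => ?_
    · exact mem_Ioi.2 (by linarith [hu.2])
    · exact (by linarith [hu.2] : 0 < τ - u).ne'
  constructor
  · have hshift := setLIntegral_Ioo_comp_sub (fun u => ∫⁻ z, ENNReal.ofReal (kerF φ g u (x - z)) *
      ENNReal.ofReal (kerF φ g (τ - u) (z - y))) t s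
    simp only [hτ, sub_sub_sub_cancel_right] at hshift
    rw [hshift, ← hτ]
    calc _ ≤ ∫⁻ u in Ioo 0 τ, ENNReal.ofReal (A * F * L) * (ENNReal.ofReal (W u / u) +
            ENNReal.ofReal (W (τ - u) / (τ - u))) := by
          refine setLIntegral_mono' measurableSet_Ioo fun u hu => ?_
          have hu0 := hu.1
          have hv0 : 0 < τ - u := by linarith [hu.2]
          have hu1 : u ≤ 1 := by linarith [hu.2]
          have hv1 : τ - u ≤ 1 := by linarith [hu.1]
          have w1 := hWpos u hu0
          have w2 := hWpos (τ - u) hv0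
          simp only [hτ] at hinner ⊢
          refine (hinner u hu).trans ?_
          rw [← hτ, ← ENNReal.ofReal_add (by positivity) (by positivity),
            ← ENNReal.ofReal_mul (by positivity)]
          refine ENNReal.ofReal_le_ofReal ?_
          have e1 := hgW u hu0 hu1
          have e2 := hgW (τ - u) hv0 hv1
          calc _ ≤ A * F * (L * W u / u + L * W (τ - u) / (τ - u)) := by gcongr
            _ = _ := by ring
      _ = ENNReal.ofReal (A * F * L) * (J₁ + J₁) := by
          rw [lintegral_const_mul' _ _ ENNReal.ofReal_ne_top, lintegral_add_left' hWm, hJ₂]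
      _ ≤ ENNReal.ofReal (A * F * L) * (ENNReal.ofReal η' + ENNReal.ofReal η') := by gcongr
      _ ≤ _ := by
          rw [← ENNReal.ofReal_add hη'0.le hη'0.le, ← ENNReal.ofReal_mul (by positivity)]
          refine ENNReal.ofReal_le_ofReal ?_
          calc A * F * L * (η' + η') = A * L * 2 * η' * F := by ring
            _ ≤ D * η' * F := by
                gcongr
                rw [hD]
                gcongr
                nlinarith
            _ ≤ _ := by gcongr
  · have hshift := setLIntegral_Ioo_comp_sub (fun u => ENNReal.ofReal (1 / ℓ (phiInv φ u)) *
      ∫⁻ z, ENNReal.ofReal (kerF φ g u (x - z)) * ENNReal.ofReal (kerF φ g (τ - u) (z - y))) t s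
    simp only [hτ, sub_sub_sub_cancel_right] at hshift
    rw [hshift, ← hτ]
    have hℓτ := hpos τ hτ0 hτ1
    have hWτ : W τ ≤ η' := hWε τ ⟨hτ0, hsε⟩
    set c₀ := A * F * L * (1 / ℓ (phiInv φ τ)) with hc₀
    have hc₀0 : 0 ≤ c₀ := by positivity
    calc _ ≤ ∫⁻ u in Ioo 0 τ, ENNReal.ofReal c₀ * (ENNReal.ofReal (W u / u) +
            (ENNReal.ofReal (2 * K₃) * ENNReal.ofReal (W (τ - u) / (τ - u)) +
            ENNReal.ofReal (2 * K₃ * η') * ENNReal.ofReal ((τ / u) ^ (1 / 4 : ℝ) / τ))) := by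
          refine setLIntegral_mono' measurableSet_Ioo fun u hu => ?_
          have hu0 := hu.1
          have hv0 : 0 < τ - u := by linarith [hu.2]
          have hu1 : u ≤ 1 := by linarith [hu.2]
          have hv1 : τ - u ≤ 1 := by linarith [hu.1]
          have w1 := hWpos u hu0
          have w2 := hWpos (τ - u) hv0
          have l1 := hpos u hu0 hu1
          have l2 := hpos (τ - u) hv0 hv1
          have hle := hinner u hu
          simp only [hτ] at hle ⊢
          refine (mul_le_mul_right hle _).trans ?_
          rw [← hτ, ← ENNReal.ofReal_mul (by positivity), ← ENNReal.ofReal_mul (by positivity),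
            ← ENNReal.ofReal_mul (by positivity),
            ← ENNReal.ofReal_add (by positivity) (by positivity),
            ← ENNReal.ofReal_add (by positivity) (by positivity),
            ← ENNReal.ofReal_mul (by positivity)]
          refine ENNReal.ofReal_le_ofReal ?_
          have e1 := hWle u hu0 hu1
          have e2 := hgW (τ - u) hv0 hv1
          have e3 := h.inv_ell_phiInv_le hℓ hK hu0 hu.2.le hτ1
          have hLτ : 1 ≤ L * (1 / ℓ (phiInv φ τ)) := by
            rw [mul_one_div, one_le_div hℓτ]
            exact hℓ.le_one (h.phiInv_pos hτ0 hτ1)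
          have a1 : 1 / ℓ (phiInv φ u) * (g (phiInv φ u) / u) ≤
              L * (1 / ℓ (phiInv φ τ)) * (W u / u) := by
            have : 1 / ℓ (phiInv φ u) * (g (phiInv φ u) / u) = 1 * (ℓ (phiInv φ u) / u) := by
              rw [hgdef]; field_simp
            rw [this]
            gcongr
          -- either `τ - u ≥ τ / 2` or `u ≥ τ / 2`
          have a2 : (τ / u) ^ (1 / 4 : ℝ) * (W (τ - u) / (τ - u)) ≤
              2 * (W (τ - u) / (τ - u)) + 2 * η' * ((τ / u) ^ (1 / 4 : ℝ) / τ) := by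
            have hq0 : (0 : ℝ) ≤ (τ / u) ^ (1 / 4 : ℝ) := by positivity
            rcases le_total (τ / 2) u with hc | hc
            · have hq : (τ / u) ^ (1 / 4 : ℝ) ≤ 2 := by
                calc (τ / u) ^ (1 / 4 : ℝ) ≤ (2 : ℝ) ^ (1 / 4 : ℝ) := by
                      gcongr
                      rw [div_le_iff₀ hu0]; linarith
                  _ ≤ (2 : ℝ) ^ (1 : ℝ) :=
                      Real.rpow_le_rpow_of_exponent_le one_le_two (by norm_num)
                  _ = 2 := Real.rpow_one 2
              have : 0 ≤ 2 * η' * ((τ / u) ^ (1 / 4 : ℝ) / τ) := by positivity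
              have : (τ / u) ^ (1 / 4 : ℝ) * (W (τ - u) / (τ - u)) ≤
                2 * (W (τ - u) / (τ - u)) := by gcongr
              linarith
            · have hWv : W (τ - u) ≤ η' := hWε _ ⟨hv0, by linarith⟩
              have : W (τ - u) / (τ - u) ≤ 2 * η' / τ := by
                rw [div_le_div_iff₀ hv0 hτ0]
                have : τ ≤ 2 * (τ - u) := by linarith
                calc W (τ - u) * τ ≤ η' * (2 * (τ - u)) := by gcongr
                  _ = _ := by ring
              have h3 : (τ / u) ^ (1 / 4 : ℝ) * (W (τ - u) / (τ - u)) ≤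
                (τ / u) ^ (1 / 4 : ℝ) * (2 * η' / τ) := by gcongr
              have h4 : (τ / u) ^ (1 / 4 : ℝ) * (2 * η' / τ) =
                2 * η' * ((τ / u) ^ (1 / 4 : ℝ) / τ) := by ring
              have : 0 ≤ 2 * (W (τ - u) / (τ - u)) := by positivity
              linarith
          have a3 : 1 / ℓ (phiInv φ u) * (g (phiInv φ (τ - u)) / (τ - u)) ≤
              L * (1 / ℓ (phiInv φ τ)) * (2 * K₃ * (W (τ - u) / (τ - u)) +
                2 * K₃ * η' * ((τ / u) ^ (1 / 4 : ℝ) / τ)) := by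
            calc _ ≤ K₃ * (τ / u) ^ (1 / 4 : ℝ) * (1 / ℓ (phiInv φ τ)) *
                  (L * W (τ - u) / (τ - u)) := by gcongr
              _ = L * (1 / ℓ (phiInv φ τ)) * K₃ *
                  ((τ / u) ^ (1 / 4 : ℝ) * (W (τ - u) / (τ - u))) := by ring
              _ ≤ L * (1 / ℓ (phiInv φ τ)) * K₃ * (2 * (W (τ - u) / (τ - u)) +
                  2 * η' * ((τ / u) ^ (1 / 4 : ℝ) / τ)) := by gcongr
              _ = _ := by ring
          calc _ = A * F * (1 / ℓ (phiInv φ u) * (g (phiInv φ u) / u) +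
                1 / ℓ (phiInv φ u) * (g (phiInv φ (τ - u)) / (τ - u))) := by ring
            _ ≤ A * F * (L * (1 / ℓ (phiInv φ τ)) * (W u / u) +
                L * (1 / ℓ (phiInv φ τ)) * (2 * K₃ * (W (τ - u) / (τ - u)) +
                2 * K₃ * η' * ((τ / u) ^ (1 / 4 : ℝ) / τ))) := by gcongr
            _ = _ := by rw [hc₀]; ring
      _ = ENNReal.ofReal c₀ * (J₁ + (ENNReal.ofReal (2 * K₃) * J₁ +
            ENNReal.ofReal (2 * K₃ * η') *
              ∫⁻ u in Ioo 0 τ, ENNReal.ofReal ((τ / u) ^ (1 / 4 : ℝ) / τ))) := by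
          rw [lintegral_const_mul' _ _ ENNReal.ofReal_ne_top, lintegral_add_left' hWm,
            lintegral_add_left' (hWm'.const_mul _), lintegral_const_mul' _ _ ENNReal.ofReal_ne_top,
            lintegral_const_mul' _ _ ENNReal.ofReal_ne_top, hJ₂]
      _ ≤ ENNReal.ofReal c₀ * (ENNReal.ofReal η' + (ENNReal.ofReal (2 * K₃) * ENNReal.ofReal η' +
            ENNReal.ofReal (2 * K₃ * η') * ENNReal.ofReal (4 / 3))) := by
          gcongr
          exact lintegral_rpow_neg_quarter hτ0
      _ ≤ _ := by
          rw [← ENNReal.ofReal_mul (by positivity), ← ENNReal.ofReal_mul (by positivity),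
            ← ENNReal.ofReal_add (by positivity) (by positivity),
            ← ENNReal.ofReal_add (by positivity) (by positivity),
            ← ENNReal.ofReal_mul (by positivity)]
          refine ENNReal.ofReal_le_ofReal ?_
          calc _ = D * η' * (1 / ℓ (phiInv φ τ)) * F := by rw [hc₀, hD]; ring
            _ ≤ _ := by gcongr

/-! ### The parametrix error in terms of the kernels -/

/-- Bounds for `q^{(0)}` and its oscillation in the first variable by the kernels with `ℓ²` and
with `ℓ`, for short times; the constant does not depend on `ℓ`. -/
theorem exists_q0_kerF_bound (Θ : Theta) : ∃ C : ℝ, 0 < C ∧ ∀ ℓ : ℝ → ℝ, SlowlyVarying ℓ →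
    IsDini ℓ → ∃ ε ∈ Ioc (0 : ℝ) 1, ∀ (φ : ℝ → ℝ) (κ : ℝ → E Θ.d → E Θ.d → ℝ),
      Setting Θ φ ℓ κ → ∀ t s : ℝ, 0 ≤ t → t < s → s - t ≤ ε →
        ∀ G ∈ ({fun r => ℓ r ^ 2, ℓ} : Set (ℝ → ℝ)), ∀ x y : E Θ.d,
          |q0 φ κ t s x y| ≤ C * kerF φ G (s - t) (x - y) ∧
          ∀ x', x ≠ x' → |q0 φ κ t s x y - q0 φ κ t s x' y| ≤
            C * (ℓ ‖x - x'‖ / ℓ (phiInv φ (s - t))) *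
              (kerF φ G (s - t) (x - y) + kerF φ G (s - t) (x' - y)) := by
  by_cases hΘ : ∃ φ, Adm Θ φ
  swap
  · exact ⟨1, one_pos, fun ℓ _ _ => ⟨1, ⟨one_pos, le_rfl⟩, fun φ κ H => absurd ⟨φ, H.adm⟩ hΘ⟩⟩
  obtain ⟨φ₀, h₀⟩ := hΘ
  have hκ1 := h₀.κ₀_ge
  have hβ₂ := h₀.β₂_pos
  have hup := one_le_upC Θ
  obtain ⟨C₀, hC₀, hq0⟩ := exists_q0_bound Θ
  have hD := dblC_pos Θ (k := 2) two_pos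
  refine ⟨C₀ * (Θ.κ₀ + 2 * Θ.κ₀ * dblC Θ 2 + 1), by positivity, fun ℓ hs hℓ => ?_⟩
  obtain ⟨ε₁, hε₁, hsmall⟩ := exists_small_time Θ hs hℓ one_pos
  obtain ⟨δ, hδ, hpotter⟩ := hs.exists_potter hℓ one_pos
  have hδ0 := hδ.1
  set ε : ℝ := min ε₁ (δ ^ Θ.β₂ / upC Θ) with hε
  have hε1 : ε ≤ 1 := (min_le_left _ _).trans hε₁.2
  refine ⟨ε, ⟨lt_min hε₁.1 (by positivity), hε1⟩, ?_⟩
  intro φ κ H t s ht hts hsε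
  have h := H.adm
  have hτ0 : 0 < s - t := sub_pos.2 hts
  have hts1 : s - t ≤ 1 := hsε.trans hε1
  have ha := H.phiInv_mem hts hts1
  set a := phiInv φ (s - t) with hadef
  have ha0 := ha.1
  have hℓa := hℓ.pos' ha0
  have hℓa1 : ℓ a ≤ 1 := (hsmall φ h).1 (s - t) ⟨hτ0, hsε.trans (min_le_left _ _)⟩
  have haδ : a ≤ δ := by
    refine (h.phiInv_le hτ0 hts1).trans ?_
    have : upC Θ * (s - t) ≤ δ ^ Θ.β₂ := by
      have := hsε.trans (min_le_right _ _)
      rw [le_div_iff₀ (by positivity)] at this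
      linarith
    calc (upC Θ * (s - t)) ^ (1 / Θ.β₂) ≤ (δ ^ Θ.β₂) ^ (1 / Θ.β₂) := by gcongr
      _ = δ := by rw [← Real.rpow_mul hδ0.le, mul_one_div_cancel hβ₂.ne', Real.rpow_one]
  have hrpos : ∀ x y : E Θ.d, 0 < a + ‖x - y‖ := fun x y => by positivity
  have key : ∀ G : ℝ → ℝ, MonotoneOn G (Ioi 0) → (∀ r, 0 < r → 0 ≤ G r) →
      (∀ x y z, |κ t x z - κ t y z| ≤ Θ.κ₀ * G (a + ‖x - y‖)) →
      (∀ r, 0 < r → r ≤ a → ℓ r ^ 2 ≤ ℓ r / ℓ a * G a) → ∀ x y : E Θ.d,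
        |q0 φ κ t s x y| ≤ C₀ * Θ.κ₀ * kerF φ G (s - t) (x - y) ∧
        ∀ x', x ≠ x' → |q0 φ κ t s x y - q0 φ κ t s x' y| ≤
          C₀ * (Θ.κ₀ + 2 * Θ.κ₀ * dblC Θ 2 + 1) * (ℓ ‖x - x'‖ / ℓ a) *
            (kerF φ G (s - t) (x - y) + kerF φ G (s - t) (x' - y)) := by
    intro G hmono hnn hM hG x y
    have hb : ∀ x, |q0 φ κ t s x y| ≤ C₀ * Θ.κ₀ * kerF φ G (s - t) (x - y) := fun x => by
      refine ((hq0 φ ℓ κ H t s ht hts hts1 x y).2.2 _ (hM x y)).1.trans (le_of_eq ?_)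
      unfold kerF
      ring
    refine ⟨hb x, fun x' hxx' => ?_⟩
    set r := ‖x - x'‖ with hr
    have hr0 : 0 < r := norm_pos_iff.2 (sub_ne_zero.2 hxx')
    have hℓr := hℓ.pos' hr0
    have hF : ∀ x : E Θ.d, 0 ≤ kerF φ G (s - t) (x - y) := fun x =>
      kerF_nonneg h hnn hτ0 hts1 (x - y)
    have hFx := hF x
    have hFx' := hF x'
    -- increments below the scale `a` use the smoothness of the frozen kernel, and Potter's bound
    -- `r / a ≤ 2 ℓ(r) / ℓ(a)`; for larger increments `ℓ(r) / ℓ(a) ≥ 1`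
    rcases le_or_gt r a with hra | hra
    · have hd := ((hq0 φ ℓ κ H t s ht hts hts1 x y).2.2 _ (hM x y)).2 x' (ℓ r ^ 2) hra
        fun z => H.bounds.modulus t ht x x' z
      refine hd.trans ?_
      have hp := hpotter r a hr0 hra haδ
      rw [Real.rpow_one, Real.rpow_one] at hp
      have e1 : r / a ≤ 2 * (ℓ r / ℓ a) := by
        rw [div_le_iff₀ ha0]
        calc r = r / ℓ a * ℓ a := by field_simp
          _ ≤ r / ℓ a * (2 * (a / r) * ℓ r) := by gcongr
          _ = _ := by field_simp
      have e2 : ℓ r ^ 2 ≤ ℓ r / ℓ a * G (a + ‖x' - y‖) := by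
        refine (hG r hr0 hra).trans ?_
        gcongr
        exact hmono ha0 (hrpos x' y) (by linarith [norm_nonneg (x' - y)])
      have e3 : 1 / radVol Θ.d φ (a + ‖x' - y‖) ≤
          dblC Θ 2 * (1 / radVol Θ.d φ (a + ‖x - y‖)) := by
        refine h.inv_radVol_le one_le_two (hrpos x' y) (hrpos x y) ?_
        have : ‖x - y‖ ≤ ‖x - x'‖ + ‖x' - y‖ := norm_sub_le_norm_sub_add_norm_sub x x' y
        have := norm_nonneg (x' - y)
        linarith
      have hV := h.radVol_pos (hrpos x y)
      have hV' := h.radVol_pos (hrpos x' y)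
      have hGx := hnn _ (hrpos x y)
      have hGx' := hnn _ (hrpos x' y)
      have hq : 0 ≤ ℓ r / ℓ a := by positivity
      calc C₀ * (Θ.κ₀ * G (a + ‖x - y‖) * (r / a) + ℓ r ^ 2) *
            (1 / radVol Θ.d φ (a + ‖x' - y‖))
          = C₀ * (Θ.κ₀ * G (a + ‖x - y‖) * (r / a)) * (1 / radVol Θ.d φ (a + ‖x' - y‖)) +
            C₀ * ℓ r ^ 2 * (1 / radVol Θ.d φ (a + ‖x' - y‖)) := by ring
        _ ≤ C₀ * (Θ.κ₀ * G (a + ‖x - y‖) * (2 * (ℓ r / ℓ a))) *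
              (dblC Θ 2 * (1 / radVol Θ.d φ (a + ‖x - y‖))) +
            C₀ * (ℓ r / ℓ a * G (a + ‖x' - y‖)) * (1 / radVol Θ.d φ (a + ‖x' - y‖)) := by
            gcongr
        _ = C₀ * (ℓ r / ℓ a) * (2 * Θ.κ₀ * dblC Θ 2 * kerF φ G (s - t) (x - y) +
              kerF φ G (s - t) (x' - y)) := by unfold kerF; ring
        _ ≤ C₀ * (ℓ r / ℓ a) * ((Θ.κ₀ + 2 * Θ.κ₀ * dblC Θ 2 + 1) *
              kerF φ G (s - t) (x - y) + (Θ.κ₀ + 2 * Θ.κ₀ * dblC Θ 2 + 1) *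
              kerF φ G (s - t) (x' - y)) := by
            have : 0 < Θ.κ₀ * dblC Θ 2 := by positivity
            have e4 : 2 * Θ.κ₀ * dblC Θ 2 ≤ Θ.κ₀ + 2 * Θ.κ₀ * dblC Θ 2 + 1 := by linarith
            have e5 : 1 ≤ Θ.κ₀ + 2 * Θ.κ₀ * dblC Θ 2 + 1 := by linarith
            have e6 := le_mul_of_one_le_left hFx' e5
            gcongr
        _ = _ := by ring
    · have e1 : 1 ≤ ℓ r / ℓ a := (one_le_div hℓa).2 (hℓ.mono ha0 hr0 hra.le)
      calc _ ≤ |q0 φ κ t s x y| + |q0 φ κ t s x' y| := abs_sub _ _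
        _ ≤ C₀ * Θ.κ₀ * kerF φ G (s - t) (x - y) + C₀ * Θ.κ₀ * kerF φ G (s - t) (x' - y) :=
            add_le_add (hb x) (hb x')
        _ = C₀ * Θ.κ₀ * 1 * (kerF φ G (s - t) (x - y) + kerF φ G (s - t) (x' - y)) := by ring
        _ ≤ _ := by
            gcongr
            have : 0 < Θ.κ₀ * dblC Θ 2 := by positivity
            linarith
  -- the differences of the coefficients
  have hM2 : ∀ x y z : E Θ.d, |κ t x z - κ t y z| ≤ ℓ (a + ‖x - y‖) ^ 2 := fun x y z => by
    rcases eq_or_ne x y with rfl | hne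
    · rw [sub_self, abs_zero]; positivity
    · have hpos : 0 < ‖x - y‖ := norm_pos_iff.2 (sub_ne_zero.2 hne)
      refine (H.bounds.modulus t ht x y z).trans ?_
      have := hℓ.pos' hpos
      gcongr
      exact hℓ.mono hpos (hrpos x y) (by linarith)
  have hmono2 : MonotoneOn (fun r => ℓ r ^ 2) (Ioi 0) := fun r hr R hR hrR =>
    pow_le_pow_left₀ (hℓ.pos' hr).le (hℓ.mono hr hR hrR) 2
  have hfinal : ∀ G : ℝ → ℝ, MonotoneOn G (Ioi 0) → (∀ r, 0 < r → 0 ≤ G r) →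
      (∀ x y z, |κ t x z - κ t y z| ≤ Θ.κ₀ * G (a + ‖x - y‖)) →
      (∀ r, 0 < r → r ≤ a → ℓ r ^ 2 ≤ ℓ r / ℓ a * G a) → ∀ x y : E Θ.d,
        |q0 φ κ t s x y| ≤ C₀ * (Θ.κ₀ + 2 * Θ.κ₀ * dblC Θ 2 + 1) * kerF φ G (s - t) (x - y) ∧
        ∀ x', x ≠ x' → |q0 φ κ t s x y - q0 φ κ t s x' y| ≤
          C₀ * (Θ.κ₀ + 2 * Θ.κ₀ * dblC Θ 2 + 1) * (ℓ ‖x - x'‖ / ℓ a) *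
            (kerF φ G (s - t) (x - y) + kerF φ G (s - t) (x' - y)) := fun G g1 g2 g3 g4 x y => by
    refine ⟨(key G g1 g2 g3 g4 x y).1.trans ?_, (key G g1 g2 g3 g4 x y).2⟩
    have := kerF_nonneg h g2 hτ0 hts1 (x - y)
    have : 0 < Θ.κ₀ * dblC Θ 2 := by positivity
    gcongr
    linarith
  intro G hG
  rcases hG with rfl | rfl
  · refine hfinal _ hmono2 (fun r _ => sq_nonneg _) (fun x y z => ?_) (fun r hr hra => ?_)
    · exact (hM2 x y z).trans (le_mul_of_one_le_left (sq_nonneg _) hκ1)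
    · have e1 := hℓ.mono hr ha0 hra
      have e2 := hℓ.pos' hr
      calc ℓ r ^ 2 = ℓ r * ℓ r := sq _
        _ ≤ ℓ r * ℓ a := by gcongr
        _ = _ := by field_simp
  · refine hfinal _ hℓ.mono (fun r hr => (hℓ.pos' hr).le) (fun x y z => ?_) (fun r hr hra => ?_)
    · -- interpolation between the bounds `ℓ²` and `κ₀`
      have e1 := hM2 x y z
      have e2 := H.abs_kernel_sub_le ht x y z
      have e3 := hℓ.pos' (hrpos x y)
      rcases le_total (G (a + ‖x - y‖)) Θ.κ₀ with hc | hc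
      · refine e1.trans ?_
        rw [sq]
        gcongr
      · refine e2.trans (le_mul_of_one_le_right (by linarith) (hκ1.trans hc))
    · have e1 := hℓ.mono hr ha0 hra
      have e2 := hℓ.pos' hr
      calc G r ^ 2 = G r * G r := sq _
        _ ≤ G r * 1 := by gcongr; exact e1.trans hℓa1
        _ = _ := by field_simp

/-! ### Space-time convolution of singular kernels -/

/-- The times `0 ≤ t < s ≤ t + ε`, with arbitrary space variables. -/
def timeDom (d : ℕ) (ε : ℝ) : Set (ℝ × ℝ × E d × E d) :=
  {p | 0 ≤ p.1 ∧ p.1 < p.2.1 ∧ p.2.1 - p.1 ≤ ε}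

lemma measurableSet_timeDom (d : ℕ) (ε : ℝ) : MeasurableSet (timeDom d ε) :=
  (measurableSet_le measurable_const measurable_fst).inter
    ((measurableSet_lt measurable_fst measurable_snd.fst).inter
      (measurableSet_le (measurable_snd.fst.sub measurable_fst) measurable_const))

/-- The space-time convolution of two kernels. -/
def leviStep {d : ℕ} (q w : ℝ → ℝ → E d → E d → ℝ) (t s : ℝ) (x y : E d) : ℝ :=
  ∫ r in t..s, ∫ z, q t r x z * w r s z y

/-- A family of integrable functions whose space-time convolution with itself is at most `η` times
the family, up to time `ε`; `B` and `b` bound their supremum and their integral. -/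
structure ConvKernel {d : ℕ} (ε η : ℝ) (F : ℝ → E d → ℝ) (B b : ℝ → ℝ) : Prop where
  nonneg : ∀ u ∈ Ioc 0 ε, ∀ x, 0 ≤ F u x
  η_nonneg : 0 ≤ η
  conv : ∀ t s : ℝ, t < s → s - t ≤ ε → ∀ x y : E d,
    ∫⁻ r in Ioo t s, ∫⁻ z, ENNReal.ofReal (F (r - t) (x - z)) * ENNReal.ofReal (F (s - r) (z - y)) ≤
      ENNReal.ofReal (η * F (s - t) (x - y))
  le : ∀ u ∈ Ioc 0 ε, ∀ x, F u x ≤ B u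
  antitone : AntitoneOn B (Ioc 0 ε)
  integrable : ∀ u ∈ Ioc 0 ε, Integrable (F u)
  integral_le : ∀ u ∈ Ioc 0 ε, ∫ x, F u x ≤ b u
  integrableOn : IntegrableOn b (Ioc 0 ε)
  measurable : Measurable ((Ioc 0 ε ×ˢ univ).indicator fun p : ℝ × E d => F p.1 p.2)

/-- A measurable kernel dominated by the multiple `R` of the family `F` up to time `ε`. -/
structure DomKernel {d : ℕ} (ε R : ℝ) (F : ℝ → E d → ℝ) (w : ℝ → ℝ → E d → E d → ℝ) : Prop where
  nonneg : 0 ≤ R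
  measurable : Measurable ((timeDom d ε).indicator fun p => w p.1 p.2.1 p.2.2.1 p.2.2.2)
  bound : ∀ t s : ℝ, 0 ≤ t → t < s → s - t ≤ ε → ∀ x y, |w t s x y| ≤ R * F (s - t) (x - y)

section

variable {d : ℕ} {ε η P R : ℝ} {F : ℝ → E d → ℝ} {B b : ℝ → ℝ}
  {q w : ℝ → ℝ → E d → E d → ℝ}

lemma ConvKernel.B_nonneg (hF : ConvKernel ε η F B b) {u : ℝ} (hu : u ∈ Ioc 0 ε) : 0 ≤ B u :=
  (hF.nonneg u hu 0).trans (hF.le u hu 0)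

lemma ConvKernel.b_nonneg (hF : ConvKernel ε η F B b) {u : ℝ} (hu : u ∈ Ioc 0 ε) : 0 ≤ b u :=
  (integral_nonneg (hF.nonneg u hu)).trans (hF.integral_le u hu)

/-- The integrand of the space-time convolution agrees with a jointly measurable function. -/
lemma DomKernel.exists_measurable_mul (hq : DomKernel ε P F q) (hw : DomKernel ε R F w) :
    ∃ G : (ℝ × ℝ × E d × E d) × ℝ × E d → ℝ, Measurable G ∧
      ∀ t s x y, 0 ≤ t → t < s → s - t ≤ ε → ∀ r ∈ Ioo t s, ∀ z,
        G ((t, s, x, y), r, z) = q t r x z * w r s z y := by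
  refine ⟨fun p => (timeDom d ε).indicator (fun p => q p.1 p.2.1 p.2.2.1 p.2.2.2)
      (p.1.1, p.2.1, p.1.2.2.1, p.2.2) *
    (timeDom d ε).indicator (fun p => w p.1 p.2.1 p.2.2.1 p.2.2.2)
      (p.2.1, p.1.2.1, p.2.2, p.1.2.2.2), ?_, ?_⟩
  · exact (hq.measurable.comp (by fun_prop)).mul (hw.measurable.comp (by fun_prop))
  · intro t s x y ht hts hsε r hr z
    have h1 : (t, r, x, z) ∈ timeDom d ε := ⟨ht, hr.1, by simp only; linarith [hr.2]⟩
    have h2 : (r, s, z, y) ∈ timeDom d ε := ⟨ht.trans hr.1.le, hr.2, by simp only; linarith [hr.1]⟩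
    simp only [indicator_of_mem h1, indicator_of_mem h2]

lemma restrict_prod_univ (t s : ℝ) :
    (volume : Measure (ℝ × E d)).restrict (Ioo t s ×ˢ univ) =
      (volume.restrict (Ioo t s)).prod volume := by
  rw [Measure.volume_eq_prod, ← Measure.prod_restrict, Measure.restrict_univ]

/-- The integrand of the space-time convolution is integrable, with a bound for its integral. -/
lemma ConvKernel.integrableOn_mul (hF : ConvKernel ε η F B b) (hq : DomKernel ε P F q)
    (hw : DomKernel ε R F w) {t s : ℝ} (ht : 0 ≤ t) (hts : t < s) (hsε : s - t ≤ ε) (x y : E d) :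
    IntegrableOn (fun p : ℝ × E d => q t p.1 x p.2 * w p.1 s p.2 y) (Ioo t s ×ˢ univ) ∧
    ∫ p in Ioo t s ×ˢ univ, ‖q t p.1 x p.2 * w p.1 s p.2 y‖ ≤
      P * R * η * F (s - t) (x - y) := by
  obtain ⟨G, hGm, hG⟩ := hq.exists_measurable_mul hw
  have hτ : s - t ∈ Ioc 0 ε := ⟨sub_pos.2 hts, hsε⟩
  have hP := hq.nonneg
  have hR := hw.nonneg
  have hη := hF.η_nonneg
  have hFτ := hF.nonneg _ hτ (x - y)
  set f : ℝ × E d → ℝ := fun p => q t p.1 x p.2 * w p.1 s p.2 y with hf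
  have hmeas : AEStronglyMeasurable f (volume.restrict (Ioo t s ×ˢ univ)) := by
    have hm : Measurable fun p : ℝ × E d => G ((t, s, x, y), p) := hGm.comp (by fun_prop)
    refine hm.aestronglyMeasurable.congr ?_
    refine ae_restrict_of_forall_mem (measurableSet_Ioo.prod MeasurableSet.univ) fun p hp => ?_
    exact hG t s x y ht hts hsε p.1 hp.1 p.2
  have hlin : ∫⁻ p in Ioo t s ×ˢ univ, ‖f p‖ₑ ≤
      ENNReal.ofReal (P * R * η * F (s - t) (x - y)) := by
    rw [restrict_prod_univ, lintegral_prod _ (by rw [← restrict_prod_univ]; exact hmeas.enorm)]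
    calc _ ≤ ∫⁻ r in Ioo t s, ENNReal.ofReal (P * R) * ∫⁻ z,
          ENNReal.ofReal (F (r - t) (x - z)) * ENNReal.ofReal (F (s - r) (z - y)) := by
          refine setLIntegral_mono' measurableSet_Ioo fun r hr => ?_
          rw [← lintegral_const_mul' _ _ ENNReal.ofReal_ne_top]
          refine lintegral_mono fun z => ?_
          have h1 := hq.bound t r ht hr.1 (by linarith [hr.2]) x z
          have h2 := hw.bound r s (ht.trans hr.1.le) hr.2 (by linarith [hr.1]) z y
          have p1 := hF.nonneg (r - t) ⟨by linarith [hr.1], by linarith [hr.2]⟩ (x - z)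
          have p2 := hF.nonneg (s - r) ⟨by linarith [hr.2], by linarith [hr.1]⟩ (z - y)
          rw [← ENNReal.ofReal_mul p1, ← ENNReal.ofReal_mul (by positivity), hf, Real.enorm_eq_ofReal_abs]
          refine ENNReal.ofReal_le_ofReal ?_
          rw [abs_mul]
          calc _ ≤ (P * F (r - t) (x - z)) * (R * F (s - r) (z - y)) := by gcongr
            _ = _ := by ring
      _ ≤ ENNReal.ofReal (P * R) * ENNReal.ofReal (η * F (s - t) (x - y)) := by
          rw [lintegral_const_mul' _ _ ENNReal.ofReal_ne_top]
          gcongr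
          exact hF.conv t s hts hsε x y
      _ = _ := by rw [← ENNReal.ofReal_mul (by positivity), mul_assoc (P * R)]
  refine ⟨⟨hmeas, hlin.trans_lt ENNReal.ofReal_lt_top⟩, ?_⟩
  rw [integral_norm_eq_lintegral_enorm hmeas]
  exact ENNReal.toReal_le_of_le_ofReal (by positivity) hlin

lemma ConvKernel.leviStep_eq (hF : ConvKernel ε η F B b) (hq : DomKernel ε P F q)
    (hw : DomKernel ε R F w) {t s : ℝ} (ht : 0 ≤ t) (hts : t < s) (hsε : s - t ≤ ε) (x y : E d) :
    leviStep q w t s x y = ∫ p in Ioo t s ×ˢ univ, q t p.1 x p.2 * w p.1 s p.2 y := by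
  have h := (hF.integrableOn_mul hq hw ht hts hsε x y).1
  rw [IntegrableOn, restrict_prod_univ] at h
  rw [restrict_prod_univ, integral_prod _ h, leviStep, intervalIntegral.integral_of_le hts.le,
    integral_Ioc_eq_integral_Ioo]

/-- The space-time convolution of dominated kernels is a dominated kernel. -/
lemma ConvKernel.domKernel_leviStep (hF : ConvKernel ε η F B b) (hq : DomKernel ε P F q)
    (hw : DomKernel ε R F w) : DomKernel ε (P * R * η) F (leviStep q w) where
  nonneg := mul_nonneg (mul_nonneg hq.nonneg hw.nonneg) hF.η_nonneg
  measurable := by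
    obtain ⟨G, hGm, hG⟩ := hq.exists_measurable_mul hw
    have h1 : StronglyMeasurable fun p : (ℝ × ℝ × E d × E d) × ℝ => ∫ z, G (p.1, p.2, z) := by
      have : StronglyMeasurable fun p : ((ℝ × ℝ × E d × E d) × ℝ) × E d => G (p.1.1, p.1.2, p.2) :=
        (hGm.comp (by fun_prop)).stronglyMeasurable
      exact this.integral_prod_right'
    have h2 := stronglyMeasurable_intervalIntegral
      (G := fun (p : ℝ × ℝ × E d × E d) (r : ℝ) => ∫ z, G (p, r, z)) h1 measurable_fst
      measurable_snd.fst
    have heq : EqOn (fun p : ℝ × ℝ × E d × E d => leviStep q w p.1 p.2.1 p.2.2.1 p.2.2.2)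
        (fun p => ∫ r in p.1..p.2.1, ∫ z, G (p, r, z)) (timeDom d ε) := ?_
    · rw [indicator_congr heq]
      exact h2.measurable.indicator (measurableSet_timeDom d ε)
    rintro p ⟨ht, hts, hsε⟩
    simp only
    rw [leviStep, intervalIntegral.integral_of_le hts.le, intervalIntegral.integral_of_le hts.le,
      integral_Ioc_eq_integral_Ioo, integral_Ioc_eq_integral_Ioo]
    refine setIntegral_congr_fun measurableSet_Ioo fun r hr => ?_
    exact integral_congr_ae (.of_forall fun z => (hG _ _ _ _ ht hts hsε r hr z).symm)
  bound := fun t s ht hts hsε x y => by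
    rw [hF.leviStep_eq hq hw ht hts hsε x y, ← Real.norm_eq_abs]
    exact (norm_integral_le_integral_norm _).trans (hF.integrableOn_mul hq hw ht hts hsε x y).2

/-- Continuity in the final time and the space variables. -/
def ContKernel {d : ℕ} (ε : ℝ) (w : ℝ → ℝ → E d → E d → ℝ) : Prop :=
  ∀ t s x y, 0 ≤ t → t < s → s < t + ε →
    ContinuousAt (fun p : ℝ × E d × E d => w t p.1 p.2.1 p.2.2) (s, x, y)

lemma DomKernel.measurable_left (hq : DomKernel ε P F q) {t s : ℝ} (ht : 0 ≤ t) (hts : t < s)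
    (hsε : s - t ≤ ε) : Measurable fun p : E d × E d => q t s p.1 p.2 := by
  have h : Measurable fun p : E d × E d =>
      (timeDom d ε).indicator (fun p => q p.1 p.2.1 p.2.2.1 p.2.2.2) (t, s, p.1, p.2) :=
    hq.measurable.comp (by fun_prop)
  convert h using 2 with p
  rw [indicator_of_mem]
  exact ⟨ht, hts, hsε⟩

/-- The spatial convolution at a fixed intermediate time is continuous. -/
lemma ConvKernel.continuousAt_integral_mul (hF : ConvKernel ε η F B b) (hq : DomKernel ε P F q)
    (hw : DomKernel ε R F w) (cq : ContKernel ε q) (cw : ContKernel ε w) {t r s : ℝ} (ht : 0 ≤ t)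
    (htr : t < r) (hrs : r < s) (hsε : s < t + ε) (x y : E d) :
    ContinuousAt (fun p : ℝ × E d × E d => ∫ z, q t r p.2.1 z * w r p.1 z p.2.2) (s, x, y) := by
  -- the substitution `z = x - u` makes the dominating function independent of `x`
  have heq : (fun p : ℝ × E d × E d => ∫ z, q t r p.2.1 z * w r p.1 z p.2.2) = fun p =>
      ∫ u, q t r p.2.1 (p.2.1 - u) * w r p.1 (p.2.1 - u) p.2.2 := by
    funext p
    exact (integral_sub_left_eq_self (fun z => q t r p.2.1 z * w r p.1 z p.2.2) volume p.2.1).symm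
  rw [heq]
  have hr0 : 0 ≤ r := ht.trans htr.le
  have hu : r - t ∈ Ioc 0 ε := ⟨by linarith, by linarith⟩
  have hv : (s - r) / 2 ∈ Ioc 0 ε := ⟨by linarith, by linarith⟩
  have hnear : ∀ᶠ p : ℝ × E d × E d in 𝓝 (s, x, y), p.1 ∈ Ioo ((s + r) / 2) (t + ε) :=
    continuousAt_fst.eventually (Ioo_mem_nhds (by simp only; linarith) hsε)
  have hB := hF.B_nonneg hv
  have hP := hq.nonneg
  have hR := hw.nonneg
  refine continuousAt_of_dominated (bound := fun u => P * F (r - t) u * (R * B ((s - r) / 2)))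
    ?_ ?_ (((hF.integrable _ hu).const_mul P).mul_const _) ?_
  · filter_upwards [hnear] with p hp
    have m1 := hq.measurable_left ht htr hu.2
    have m2 := hw.measurable_left (t := r) (s := p.1) hr0 (by linarith [hp.1])
      (by linarith [hp.2])
    exact ((m1.comp (by fun_prop : Measurable fun u : E d => (p.2.1, p.2.1 - u))).mul
      (m2.comp (by fun_prop : Measurable fun u : E d => (p.2.1 - u, p.2.2)))).aestronglyMeasurable
  · filter_upwards [hnear] with p hp
    refine .of_forall fun u => ?_
    have h1 := hq.bound t r ht htr hu.2 p.2.1 (p.2.1 - u)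
    rw [sub_sub_cancel] at h1
    have hv' : p.1 - r ∈ Ioc 0 ε := ⟨by linarith [hp.1], by linarith [hp.2]⟩
    have h2 := hw.bound r p.1 hr0 (by linarith [hp.1]) hv'.2 (p.2.1 - u) p.2.2
    have h3 := (hF.le _ hv' (p.2.1 - u - p.2.2)).trans
      (hF.antitone hv hv' (by linarith [hp.1]))
    have := hF.nonneg _ hu u
    rw [norm_mul, Real.norm_eq_abs, Real.norm_eq_abs]
    gcongr
    exact h2.trans (by gcongr)
  · refine .of_forall fun u => ContinuousAt.mul ?_ ?_
    · have h1 : r < t + ε := by linarith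
      have h2 : ContinuousAt (fun p : ℝ × E d × E d => (r, p.2.1, p.2.1 - u)) (s, x, y) := by
        fun_prop
      exact ContinuousAt.comp (x := (s, x, y)) (cq t r x (x - u) ht htr h1) h2
    · have h1 : s < r + ε := by linarith
      have h2 : ContinuousAt (fun p : ℝ × E d × E d => (p.1, p.2.1 - u, p.2.2)) (s, x, y) := by
        fun_prop
      exact ContinuousAt.comp (x := (s, x, y)) (cw r s (x - u) y hr0 hrs h1) h2

/-- The space-time convolution of continuous kernels is continuous. -/
lemma ConvKernel.contKernel_leviStep (hF : ConvKernel ε η F B b) (hq : DomKernel ε P F q)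
    (hw : DomKernel ε R F w) (cq : ContKernel ε q) (cw : ContKernel ε w) :
    ContKernel ε (leviStep q w) := by
  intro t s x y ht hts hsε
  have hP := hq.nonneg
  have hR := hw.nonneg
  have hm : (s - t) / 2 ∈ Ioc 0 ε := ⟨by linarith, by linarith⟩
  have hBm := hF.B_nonneg hm
  have hε0 : 0 < ε := by linarith
  set c : ℝ := P * B ((s - t) / 2) * R with hc
  have hc0 : 0 ≤ c := by positivity
  have hbi : IntervalIntegrable b volume 0 ε :=
    (intervalIntegrable_iff_integrableOn_Ioc_of_le hε0.le).2 hF.integrableOn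
  refine continuousAt_of_locally_uniform_approx_of_continuousAt fun V hV => ?_
  obtain ⟨e, he, heV⟩ := Metric.mem_uniformity_dist.1 hV
  -- the contribution of the last `2 δ` of the time interval is uniformly small
  obtain ⟨δ, hδ0, hδ1, hδ2, hδs⟩ : ∃ δ > 0, δ ≤ (s - t) / 4 ∧ δ ≤ t + ε - s ∧
      c * ∫ u in 0..(2 * δ), b u < e := by
    have hcont := intervalIntegral.continuousOn_primitive_interval' hbi left_mem_uIcc
    rw [uIcc_of_le hε0.le] at hcont
    have h0 := (hcont 0 ⟨le_rfl, hε0.le⟩).const_mul c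
    rw [ContinuousWithinAt, intervalIntegral.integral_same, mul_zero] at h0
    have h1 : Tendsto (fun δ : ℝ => 2 * δ) (𝓝[>] 0) (𝓝[Icc 0 ε] 0) := by
      refine tendsto_nhdsWithin_iff.2 ⟨?_, ?_⟩
      · have : Tendsto (fun δ : ℝ => 2 * δ) (𝓝 0) (𝓝 (2 * 0)) := by
          exact (continuous_const.mul continuous_id).tendsto 0
        rw [mul_zero] at this
        exact this.mono_left nhdsWithin_le_nhds
      · filter_upwards [Ioo_mem_nhdsGT (show (0 : ℝ) < ε / 2 by positivity)] with δ hδ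
        exact ⟨by linarith [hδ.1], by linarith [hδ.2]⟩
    have h2 := (h0.comp h1).eventually (gt_mem_nhds he)
    have h3 : (0 : ℝ) < min ((s - t) / 4) (t + ε - s) := lt_min (by linarith) (by linarith)
    obtain ⟨δ, hδ, hδ'⟩ := (h2.and (Ioo_mem_nhdsGT h3)).exists
    exact ⟨δ, hδ'.1, hδ'.2.le.trans (min_le_left _ _), hδ'.2.le.trans (min_le_right _ _), hδ⟩
  have hnear : ∀ᶠ p : ℝ × E d × E d in 𝓝 (s, x, y), p.1 ∈ Ioo (s - δ / 2) (s + δ) :=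
    continuousAt_fst.eventually (Ioo_mem_nhds (by simp only; linarith) (by simp only; linarith))
  have hint : ∀ s' ∈ Ioo (s - δ / 2) (s + δ), ∀ x' y' : E d,
      IntervalIntegrable (fun r => ∫ z, q t r x' z * w r s' z y') volume t s' :=
    fun s' hs' x' y' => by
    have h := (hF.integrableOn_mul hq hw ht (by linarith [hs'.1] : t < s')
      (by linarith [hs'.2]) x' y').1
    rw [IntegrableOn, restrict_prod_univ] at h
    rw [intervalIntegrable_iff_integrableOn_Ioo_of_le (by linarith [hs'.1])]
    exact h.integral_prod_left
  refine ⟨_, hnear, fun p => ∫ r in t..(s - δ), ∫ z, q t r p.2.1 z * w r p.1 z p.2.2, ?_, ?_⟩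
  -- up to the time `s - δ` the second factor is bounded, and dominated convergence applies
  · have hδB : δ / 2 ∈ Ioc 0 ε := ⟨by linarith, by linarith⟩
    have hB := hF.B_nonneg hδB
    refine intervalIntegral.continuousAt_of_dominated_interval
      (bound := fun r => P * b (r - t) * (R * B (δ / 2))) ?_ ?_ ?_ ?_
    · filter_upwards [hnear] with p hp
      have hi : IntervalIntegrable (fun r => ∫ z, q t r p.2.1 z * w r p.1 z p.2.2) volume t
          (s - δ) := (hint p.1 hp p.2.1 p.2.2).mono_set ?_
      · exact hi.def'.aestronglyMeasurable
      rw [uIcc_of_le (by linarith), uIcc_of_le (by linarith [hp.1])]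
      exact Icc_subset_Icc_right (by linarith [hp.1])
    · filter_upwards [hnear] with p hp
      refine .of_forall fun r hr => ?_
      rw [uIoc_of_le (by linarith)] at hr
      have hu : r - t ∈ Ioc 0 ε := ⟨by linarith [hr.1], by linarith [hr.2]⟩
      have hv : p.1 - r ∈ Ioc 0 ε := ⟨by linarith [hp.1, hr.2], by linarith [hp.2, hr.1]⟩
      calc _ ≤ ∫ z, P * F (r - t) (p.2.1 - z) * (R * B (δ / 2)) := by
            refine norm_integral_le_of_norm_le
              ((((hF.integrable _ hu).comp_sub_left p.2.1).const_mul P).mul_const _)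
              (.of_forall fun z => ?_)
            have h1 := hq.bound t r ht hr.1 hu.2 p.2.1 z
            have h2 := hw.bound r p.1 (ht.trans hr.1.le) (sub_pos.1 hv.1) hv.2 z p.2.2
            have h3 := (hF.le _ hv (z - p.2.2)).trans
              (hF.antitone hδB hv (by linarith [hp.1, hr.2]))
            have := hF.nonneg _ hu (p.2.1 - z)
            rw [norm_mul, Real.norm_eq_abs, Real.norm_eq_abs]
            gcongr
            exact h2.trans (by gcongr)
        _ = P * (∫ z, F (r - t) z) * (R * B (δ / 2)) := by
            rw [integral_mul_const, integral_const_mul,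
              integral_sub_left_eq_self (F (r - t)) volume p.2.1]
        _ ≤ _ := by
            gcongr
            exact hF.integral_le _ hu
    · refine IntervalIntegrable.mul_const (IntervalIntegrable.const_mul ?_ P) _
      have := (hbi.comp_sub_right t)
      refine this.mono_set ?_
      rw [uIcc_of_le (by linarith), uIcc_of_le (by linarith)]
      exact Icc_subset_Icc (by linarith) (by linarith)
    · refine .of_forall fun r hr => ?_
      rw [uIoc_of_le (by linarith)] at hr
      exact hF.continuousAt_integral_mul hq hw cq cw ht hr.1 (by linarith [hr.2]) hsε x y
  · intro p hp
    refine heV ?_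
    have hsp : s - δ ≤ p.1 := by linarith [hp.1]
    have hi := hint p.1 hp p.2.1 p.2.2
    have hi' : IntervalIntegrable (fun r => ∫ z, q t r p.2.1 z * w r p.1 z p.2.2) volume t
        (s - δ) := hi.mono_set (by
        rw [uIcc_of_le (by linarith), uIcc_of_le (by linarith)]
        exact Icc_subset_Icc_right hsp)
    rw [Real.dist_eq, leviStep, intervalIntegral.integral_interval_sub_left hi hi']
    refine lt_of_le_of_lt ?_ hδs
    have hbr : IntervalIntegrable (fun r => c * b (p.1 - r)) volume (s - δ) p.1 := by
      have := (hbi.comp_sub_left p.1).const_mul c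
      refine this.mono_set ?_
      rw [uIcc_of_le hsp, uIcc_of_ge (by linarith)]
      exact Icc_subset_Icc (by linarith [hp.2]) (by linarith)
    calc _ ≤ ∫ r in (s - δ)..p.1, c * b (p.1 - r) := by
          rw [← Real.norm_eq_abs]
          refine intervalIntegral.norm_integral_le_of_norm_le hsp ?_ hbr
          have hne : ∀ᵐ r : ℝ, r ≠ p.1 := by simp [ae_iff]
          filter_upwards [hne] with r hrne hr
          have hrp : r < p.1 := lt_of_le_of_ne hr.2 hrne
          have hu : r - t ∈ Ioc 0 ε := ⟨by linarith [hr.1], by linarith [hp.2]⟩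
          have hv : p.1 - r ∈ Ioc 0 ε := ⟨by linarith, by linarith [hp.2, hr.1]⟩
          calc _ ≤ ∫ z, P * B ((s - t) / 2) * (R * F (p.1 - r) (z - p.2.2)) := by
                refine norm_integral_le_of_norm_le
                  ((((hF.integrable _ hv).comp_sub_right p.2.2).const_mul R).const_mul _)
                  (.of_forall fun z => ?_)
                have h1 := hq.bound t r ht (by linarith [hr.1]) hu.2 p.2.1 z
                have h2 := hw.bound r p.1 (by linarith [hr.1]) hrp hv.2 z p.2.2
                have h3 := (hF.le _ hu (p.2.1 - z)).trans
                  (hF.antitone hm hu (by linarith [hr.1]))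
                have := hF.nonneg _ hv (z - p.2.2)
                rw [norm_mul, Real.norm_eq_abs, Real.norm_eq_abs]
                gcongr
                exact h1.trans (by gcongr)
            _ = c * ∫ z, F (p.1 - r) z := by
                rw [integral_const_mul, integral_const_mul,
                  integral_sub_right_eq_self (F (p.1 - r)) p.2.2, hc]
                ring
            _ ≤ _ := by
                gcongr
                exact hF.integral_le _ hv
      _ = c * ∫ u in 0..(p.1 - (s - δ)), b u := by
          rw [intervalIntegral.integral_const_mul,
            intervalIntegral.integral_comp_sub_left (fun u => b u) p.1, sub_self]
      _ ≤ c * ∫ u in 0..(2 * δ), b u := by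
          gcongr
          refine intervalIntegral.integral_mono_interval le_rfl (by linarith) (by linarith [hp.2])
            ?_ (hbi.mono_set ?_)
          · refine (ae_restrict_iff' measurableSet_Ioc).2 (.of_forall fun u hu => ?_)
            exact hF.b_nonneg ⟨hu.1, by linarith [hu.2]⟩
          · rw [uIcc_of_le (by linarith), uIcc_of_le hε0.le]
            exact Icc_subset_Icc_right (by linarith)

end

/-! ### The Levi series -/

section

variable {d : ℕ} {ε η C : ℝ} {F : ℝ → E d → ℝ} {B b : ℝ → ℝ}

/-- Oscillation in the first space variable of a space-time convolution, if that of the first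
factor is controlled by a weight `ω` with known effect on the convolution of `F` with itself. -/
lemma ConvKernel.abs_leviStep_sub_le {P R K : ℝ} {q w : ℝ → ℝ → E d → E d → ℝ}
    (hF : ConvKernel ε η F B b) (hq : DomKernel ε P F q) (hw : DomKernel ε R F w)
    {t s : ℝ} (ht : 0 ≤ t) (hts : t < s) (hsε : s - t ≤ ε) {x x' y : E d} {ω : ℝ → ℝ}
    (hω : AEMeasurable ω (volume.restrict (Ioo t s))) (hω0 : ∀ r ∈ Ioo t s, 0 ≤ ω r) (hK0 : 0 ≤ K)
    (hosc : ∀ r ∈ Ioo t s, ∀ z, |q t r x z - q t r x' z| ≤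
      ω r * (F (r - t) (x - z) + F (r - t) (x' - z)))
    (hK : ∀ x, ∫⁻ r in Ioo t s, ENNReal.ofReal (ω r) * ∫⁻ z,
      ENNReal.ofReal (F (r - t) (x - z)) * ENNReal.ofReal (F (s - r) (z - y)) ≤
        ENNReal.ofReal (K * F (s - t) (x - y))) :
    |leviStep q w t s x y - leviStep q w t s x' y| ≤
      R * K * (F (s - t) (x - y) + F (s - t) (x' - y)) := by
  have hR := hw.nonneg
  have hτ : s - t ∈ Ioc 0 ε := ⟨sub_pos.2 hts, hsε⟩
  have h1 := (hF.integrableOn_mul hq hw ht hts hsε x y).1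
  have h2 := (hF.integrableOn_mul hq hw ht hts hsε x' y).1
  rw [hF.leviStep_eq hq hw ht hts hsε, hF.leviStep_eq hq hw ht hts hsε, ← integral_sub h1 h2,
    ← Real.norm_eq_abs]
  have hF1 := hF.nonneg _ hτ (x - y)
  have hF2 := hF.nonneg _ hτ (x' - y)
  refine (norm_integral_le_integral_norm _).trans ?_
  have hm := (h1.sub h2).aestronglyMeasurable
  rw [show (fun p : ℝ × E d => q t p.1 x p.2 * w p.1 s p.2 y) -
    (fun p : ℝ × E d => q t p.1 x' p.2 * w p.1 s p.2 y) = fun p : ℝ × E d =>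
      q t p.1 x p.2 * w p.1 s p.2 y - q t p.1 x' p.2 * w p.1 s p.2 y from rfl] at hm
  rw [integral_norm_eq_lintegral_enorm hm]
  refine ENNReal.toReal_le_of_le_ofReal (by positivity) ?_
  rw [restrict_prod_univ, lintegral_prod _ (by rw [← restrict_prod_univ]; exact hm.enorm)]
  set I : E d → ℝ → ℝ≥0∞ := fun x r => ∫⁻ z,
    ENNReal.ofReal (F (r - t) (x - z)) * ENNReal.ofReal (F (s - r) (z - y)) with hI
  have hu : ∀ r ∈ Ioo t s, r - t ∈ Ioc 0 ε := fun r hr =>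
    ⟨by linarith [hr.1], by linarith [hr.2]⟩
  have hv : ∀ r ∈ Ioo t s, s - r ∈ Ioc 0 ε := fun r hr =>
    ⟨by linarith [hr.2], by linarith [hr.1]⟩
  -- `F` is measurable on positive times only
  have hIm : AEMeasurable (I x) (volume.restrict (Ioo t s)) := by
    set S : Set (ℝ × E d) := Ioc 0 ε ×ˢ univ
    have hm : Measurable fun p : ℝ × E d =>
        ENNReal.ofReal (S.indicator (fun p => F p.1 p.2) (p.1 - t, x - p.2)) *
          ENNReal.ofReal (S.indicator (fun p => F p.1 p.2) (s - p.1, p.2 - y)) :=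
      ((hF.measurable.comp (by fun_prop)).ennreal_ofReal).mul
        ((hF.measurable.comp (by fun_prop)).ennreal_ofReal)
    refine (hm.lintegral_prod_right' (ν := volume)).aemeasurable.congr ?_
    refine ae_restrict_of_forall_mem measurableSet_Ioo fun r hr => ?_
    refine lintegral_congr fun z => ?_
    have m1 : (r - t, x - z) ∈ S := ⟨hu r hr, mem_univ _⟩
    have m2 : (s - r, z - y) ∈ S := ⟨hv r hr, mem_univ _⟩
    simp only [indicator_of_mem m1, indicator_of_mem m2]
  calc _ ≤ ∫⁻ r in Ioo t s, ENNReal.ofReal R *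
        (ENNReal.ofReal (ω r) * I x r + ENNReal.ofReal (ω r) * I x' r) := by
        refine setLIntegral_mono' measurableSet_Ioo fun r hr => ?_
        have hmz : AEMeasurable (fun z => ENNReal.ofReal (F (r - t) (x - z)) *
            ENNReal.ofReal (F (s - r) (z - y))) :=
          (((hF.integrable _ (hu r hr)).comp_sub_left x).aemeasurable.ennreal_ofReal).mul
            (((hF.integrable _ (hv r hr)).comp_sub_right y).aemeasurable.ennreal_ofReal)
        have hω0r := hω0 r hr
        rw [← mul_add, hI, ← lintegral_add_left' hmz, ← mul_assoc, ← ENNReal.ofReal_mul hR,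
          ← lintegral_const_mul' _ _ ENNReal.ofReal_ne_top]
        refine lintegral_mono fun z => ?_
        have p1 := hF.nonneg _ (hu r hr) (x - z)
        have p2 := hF.nonneg _ (hu r hr) (x' - z)
        have p3 := hF.nonneg _ (hv r hr) (z - y)
        have b1 := hosc r hr z
        have b2 := hw.bound r s (ht.trans hr.1.le) hr.2 (hv r hr).2 z y
        rw [← add_mul, ← ENNReal.ofReal_add p1 p2, ← ENNReal.ofReal_mul (by positivity),
          ← ENNReal.ofReal_mul (by positivity), Real.enorm_eq_ofReal_abs, ← sub_mul, abs_mul]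
        refine ENNReal.ofReal_le_ofReal ?_
        calc _ ≤ (ω r * (F (r - t) (x - z) + F (r - t) (x' - z))) * (R * F (s - r) (z - y)) := by
              gcongr
          _ = _ := by ring
    _ = ENNReal.ofReal R * ((∫⁻ r in Ioo t s, ENNReal.ofReal (ω r) * I x r) +
          ∫⁻ r in Ioo t s, ENNReal.ofReal (ω r) * I x' r) := by
        have hm : AEMeasurable (fun r => ENNReal.ofReal (ω r) * I x r)
          (volume.restrict (Ioo t s)) := hω.ennreal_ofReal.mul hIm
        rw [lintegral_const_mul' _ _ ENNReal.ofReal_ne_top, lintegral_add_left' hm]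
    _ ≤ ENNReal.ofReal R * (ENNReal.ofReal (K * F (s - t) (x - y)) +
          ENNReal.ofReal (K * F (s - t) (x' - y))) := by
        gcongr
        · exact hK x
        · exact hK x'
    _ = _ := by
        rw [← ENNReal.ofReal_add (by positivity) (by positivity), ← ENNReal.ofReal_mul hR]
        ring_nf

variable {φ : ℝ → ℝ} {κ : ℝ → E d → E d → ℝ} (hF : ConvKernel ε η F B b)
  (hq : DomKernel ε C F (q0 φ κ)) (hη : C * η ≤ 1 / 2)

lemma qn_succ (φ : ℝ → ℝ) (κ : ℝ → E d → E d → ℝ) (n : ℕ) :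
    qn φ κ (n + 1) = leviStep (q0 φ κ) (qn φ κ n) := rfl

include hF hq hη

/-- Each space-time convolution with `q^{(0)}` gains a factor `1 / 2`. -/
lemma domKernel_qn (n : ℕ) : DomKernel ε (C * (1 / 2) ^ n) F (qn φ κ n) := by
  have hC := hq.nonneg
  induction n with
  | zero => rw [pow_zero, mul_one]; exact hq
  | succ n ih =>
    rw [qn_succ]
    have h := hF.domKernel_leviStep hq ih
    refine ⟨by positivity, h.measurable, fun t s ht hts hsε x y => ?_⟩
    refine (h.bound t s ht hts hsε x y).trans ?_
    have := hF.nonneg _ ⟨sub_pos.2 hts, hsε⟩ (x - y)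
    refine mul_le_mul_of_nonneg_right ?_ this
    calc C * (C * (1 / 2) ^ n) * η = C * (1 / 2) ^ n * (C * η) := by ring
      _ ≤ C * (1 / 2) ^ n * (1 / 2) := by gcongr
      _ = C * (1 / 2) ^ (n + 1) := by ring

lemma summable_abs_qn {t s : ℝ} (ht : 0 ≤ t) (hts : t < s) (hsε : s - t ≤ ε) (x y : E d) :
    Summable fun n => |qn φ κ n t s x y| := by
  refine Summable.of_nonneg_of_le (fun n => abs_nonneg _)
    (fun n => (domKernel_qn hF hq hη n).bound t s ht hts hsε x y) ?_
  exact (summable_geometric_two.mul_left C).mul_right _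

/-- The sum of the Levi series is dominated by the same family as its first term. -/
lemma domKernel_qsum : DomKernel ε (2 * C) F (qsum φ κ) where
  nonneg := mul_nonneg zero_le_two hq.nonneg
  measurable := by
    refine measurable_of_tendsto_metrizable
      (f := fun (N : ℕ) p => ∑ n ∈ Finset.range N,
        (timeDom d ε).indicator (fun p => qn φ κ n p.1 p.2.1 p.2.2.1 p.2.2.2) p)
      (fun N => Finset.measurable_fun_sum _ fun n _ => (domKernel_qn hF hq hη n).measurable) ?_
    rw [tendsto_pi_nhds]
    intro p
    by_cases hp : p ∈ timeDom d ε
    · simp only [indicator_of_mem hp]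
      obtain ⟨ht, hts, hsε⟩ := hp
      exact (summable_abs_qn hF hq hη ht hts hsε _ _).of_abs.hasSum.tendsto_sum_nat
    · simp only [indicator_of_notMem hp, Finset.sum_const_zero]
      exact tendsto_const_nhds
  bound := fun t s ht hts hsε x y => by
    have h := tsum_of_norm_bounded (f := fun n => qn φ κ n t s x y)
      ((hasSum_geometric_two.mul_left C).mul_right (F (s - t) (x - y)))
      (fun n => (domKernel_qn hF hq hη n).bound t s ht hts hsε x y)
    rw [Real.norm_eq_abs, mul_comm C] at h
    exact h

/-- The sum of the Levi series solves the Volterra equation of the parametrix method. -/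
lemma qsum_eq_add_leviStep {t s : ℝ} (ht : 0 ≤ t) (hts : t < s) (hsε : s - t ≤ ε) (x y : E d) :
    qsum φ κ t s x y = q0 φ κ t s x y + leviStep (q0 φ κ) (qsum φ κ) t s x y := by
  have hC := hq.nonneg
  have hsum : ∀ {t s : ℝ}, 0 ≤ t → t < s → s - t ≤ ε → ∀ x y : E d,
      Summable fun n => qn φ κ n t s x y := fun ht hts hsε x y =>
    (summable_abs_qn hF hq hη ht hts hsε x y).of_abs
  have hqn := domKernel_qn hF hq hη
  rw [qsum, (hsum ht hts hsε x y).tsum_eq_zero_add]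
  congr 1
  have hFτ := hF.nonneg _ ⟨sub_pos.2 hts, hsε⟩ (x - y)
  have hη0 := hF.η_nonneg
  have key := hasSum_integral_of_summable_integral_norm
    (F := fun n (p : ℝ × E d) => q0 φ κ t p.1 x p.2 * qn φ κ n p.1 s p.2 y)
    (fun n => (hF.integrableOn_mul hq (hqn n) ht hts hsε x y).1)
    (Summable.of_nonneg_of_le (fun n => integral_nonneg fun p => norm_nonneg _)
      (fun n => (hF.integrableOn_mul hq (hqn n) ht hts hsε x y).2)
      ((((summable_geometric_two.mul_left C).mul_left C).mul_right η).mul_right _))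
  rw [hF.leviStep_eq hq (domKernel_qsum hF hq hη) ht hts hsε]
  have hstep : ∀ n, qn φ κ (n + 1) t s x y =
      ∫ p in Ioo t s ×ˢ univ, q0 φ κ t p.1 x p.2 * qn φ κ n p.1 s p.2 y := fun n => by
    rw [qn_succ, hF.leviStep_eq hq (hqn n) ht hts hsε]
  simp_rw [hstep]
  rw [key.tsum_eq]
  refine setIntegral_congr_fun (measurableSet_Ioo.prod MeasurableSet.univ) fun p hp => ?_
  simp only [qsum, tsum_mul_left]

/-- Uniform bound for the terms of the series at times bounded away from the singularity. -/
lemma abs_qn_le_of_half_lt {u t s : ℝ} (hu : u ∈ Ioc 0 ε) (ht : 0 ≤ t) (hus : u < s - t)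
    (hsε : s - t ≤ ε) (x y : E d) (n : ℕ) :
    |qn φ κ n t s x y| ≤ C * (1 / 2) ^ n * B u := by
  have hC := hq.nonneg
  have hts : t < s := by linarith [hu.1]
  have hτ : s - t ∈ Ioc 0 ε := ⟨sub_pos.2 hts, hsε⟩
  refine ((domKernel_qn hF hq hη n).bound t s ht hts hsε x y).trans ?_
  gcongr
  exact (hF.le _ hτ _).trans (hF.antitone hu hτ hus.le)

lemma contKernel_qsum (cq : ContKernel ε (q0 φ κ)) : ContKernel ε (qsum φ κ) := by
  have hcn : ∀ n, ContKernel ε (qn φ κ n) := fun n => by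
    induction n with
    | zero => exact cq
    | succ n ih => exact hF.contKernel_leviStep hq (domKernel_qn hF hq hη n) cq ih
  intro t s x y ht hts hsε
  have hu : (s - t) / 2 ∈ Ioc 0 ε := ⟨by linarith, by linarith⟩
  set S : Set (ℝ × E d × E d) := Prod.fst ⁻¹' Ioo (t + (s - t) / 2) (t + ε) with hS
  have hSo : IsOpen S := isOpen_Ioo.preimage continuous_fst
  have hmem : (s, x, y) ∈ S := ⟨by simp only; linarith, hsε⟩
  refine ContinuousOn.continuousAt (s := S) ?_ (hSo.mem_nhds hmem)
  refine continuousOn_tsum (f := fun n (p : ℝ × E d × E d) => qn φ κ n t p.1 p.2.1 p.2.2)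
    (fun n p hp => ?_) ((summable_geometric_two.mul_left C).mul_right (B ((s - t) / 2)))
    (fun n p hp => ?_)
  · exact (hcn n t p.1 p.2.1 p.2.2 ht (by linarith [hp.1, hu.1]) hp.2).continuousWithinAt
  · exact abs_qn_le_of_half_lt hF hq hη hu ht (by linarith [hp.1]) (by linarith [hp.2]) _ _ n

/-- Weierstrass' test for the Levi series; `g` is the identity, or the absolute value for the series
of the absolute values. -/
lemma tendstoLocallyUniformlyOn_qn {g : ℝ → ℝ} (hg : ∀ a, |g a| ≤ |a|) :
    TendstoLocallyUniformlyOn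
      (fun (N : ℕ) (p : ℝ × E d × ℝ × E d) =>
        ∑ n ∈ Finset.range N, g (qn φ κ n p.1 p.2.2.1 p.2.1 p.2.2.2))
      (fun p => ∑' n : ℕ, g (qn φ κ n p.1 p.2.2.1 p.2.1 p.2.2.2)) atTop (domD d 0 ε) := by
  intro V hV p hp
  obtain ⟨ht, hs, hts, hsε⟩ := hp
  set u : ℝ := (p.2.2.1 - p.1) / 2 with hu
  have hu' : u ∈ Ioc 0 ε := ⟨by linarith, by linarith⟩
  set S : Set (ℝ × E d × ℝ × E d) := domD d 0 ε ∩ {p | u < p.2.2.1 - p.1} with hS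
  refine ⟨S, ?_, ?_⟩
  · have hop : IsOpen {p : ℝ × E d × ℝ × E d | u < p.2.2.1 - p.1} :=
      isOpen_lt continuous_const (by fun_prop)
    exact inter_mem self_mem_nhdsWithin (mem_nhdsWithin_of_mem_nhds (hop.mem_nhds (by
      simp only [mem_ofPred_eq]; linarith)))
  · refine tendstoUniformlyOn_tsum_nat
      ((summable_geometric_two.mul_left C).mul_right (B u)) (fun n p hp => ?_) V hV
    obtain ⟨⟨h1, -, h3, h4⟩, h5⟩ := hp
    exact (hg _).trans (abs_qn_le_of_half_lt hF hq hη hu' h1 h5 h4.le _ _ n)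

end

/-! ### The Levi series of the parametrix error -/

section

variable {Θ : Theta} {φ : ℝ → ℝ} (h : Adm Θ φ)

include h

lemma Adm.exists_measurable_phiInv : ∃ a : ℝ → ℝ, Measurable a ∧
    ∀ u ∈ Ioc (0 : ℝ) 1, a u = phiInv φ u := by
  refine ⟨fun u => phiInv φ (projIcc 0 1 zero_le_one u : ℝ), Monotone.measurable fun u v huv => ?_,
    fun u hu => ?_⟩
  · have h1 := (projIcc (0 : ℝ) 1 zero_le_one u).2
    have h2 := (projIcc (0 : ℝ) 1 zero_le_one v).2
    exact h.phiInv_mono h1.1 (monotone_projIcc _ huv) h2.2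
  · simp only [projIcc_of_mem zero_le_one ⟨hu.1.le, hu.2⟩]

/-- `phiInv` has junk values outside the range of `φ`, hence the restriction to `(0, ε]`. -/
lemma Adm.measurable_kerF {g : ℝ → ℝ} (hg : ContinuousOn g (Ioi 0)) {ε : ℝ} (hε : ε ≤ 1) :
    Measurable ((Ioc 0 ε ×ˢ univ).indicator fun p : ℝ × E Θ.d => kerF φ g p.1 p.2) := by
  obtain ⟨a, ham, ha⟩ := h.exists_measurable_phiInv
  have hG : Measurable ((Ioi (0 : ℝ)).piecewise (fun r => g r / radVol Θ.d φ r) fun _ => 0) := by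
    refine ContinuousOn.measurable_piecewise ?_ continuousOn_const measurableSet_Ioi
    exact hg.div ((continuousOn_id.pow _).mul h.continuousOn_phi) fun r hr => (h.radVol_pos hr).ne'
  have hm : Measurable fun p : ℝ × E Θ.d => (Ioi (0 : ℝ)).piecewise
      (fun r => g r / radVol Θ.d φ r) (fun _ => 0) (a p.1 + ‖p.2‖) := hG.comp (by fun_prop)
  have heq : EqOn (fun p : ℝ × E Θ.d => kerF φ g p.1 p.2) (fun p => (Ioi (0 : ℝ)).piecewise
      (fun r => g r / radVol Θ.d φ r) (fun _ => 0) (a p.1 + ‖p.2‖)) (Ioc 0 ε ×ˢ univ) := by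
    rintro ⟨u, x⟩ ⟨hu, -⟩
    have hu1 : u ∈ Ioc (0 : ℝ) 1 := ⟨hu.1, hu.2.trans hε⟩
    have hpos : phiInv φ u + ‖x‖ ∈ Ioi (0 : ℝ) :=
      add_pos_of_pos_of_nonneg (h.phiInv_pos hu1.1 hu1.2) (norm_nonneg x)
    rw [← ha u hu1] at hpos
    simp only [kerF]
    rw [piecewise_eq_of_mem _ _ _ hpos, ha u hu1]
  rw [indicator_congr heq]
  exact hm.indicator (measurableSet_Ioc.prod MeasurableSet.univ)

/-- The kernels `h^g_φ` and `g / V` are comparable. -/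
lemma Adm.kerF_le_hfun {g : ℝ → ℝ} (hg : ∀ r, 0 < r → 0 ≤ g r) {t : ℝ} (h0 : 0 < t) (h1 : t ≤ 1)
    (x : E Θ.d) : kerF φ g t x ≤ 2 * hfun φ g t x := by
  have hp := h.phiInv_pos h0 h1
  have hx := norm_nonneg x
  have hpos : 0 < phiInv φ t + ‖x‖ := by positivity
  have hV := h.radVol_pos hpos
  have hV1 := h.radVol_mono hp.le (show phiInv φ t ≤ phiInv φ t + ‖x‖ by linarith)
  have hV2 := h.radVol_mono hx (show ‖x‖ ≤ phiInv φ t + ‖x‖ by linarith)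
  have hV3 := h.radVol_pos hp
  have hV4 := h.radVol_nonneg hx
  have hden : t * phiInv φ t ^ Θ.d + ‖x‖ ^ Θ.d * φ ‖x‖ =
      radVol Θ.d φ (phiInv φ t) + radVol Θ.d φ ‖x‖ := by
    rw [radVol, radVol, h.phi_phiInv h0.le h1, mul_comm t]
  have hgr := hg _ hpos
  rw [kerF, hfun, rho, hden, mul_one_div, mul_div_assoc', div_le_div_iff₀ hV (by linarith)]
  nlinarith

lemma Adm.hfun_nonneg {g : ℝ → ℝ} (hg : ∀ r, 0 < r → 0 ≤ g r) {t : ℝ} (h0 : 0 < t) (h1 : t ≤ 1)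
    (x : E Θ.d) : 0 ≤ hfun φ g t x := by
  have := h.kerF_le_hfun hg h0 h1 x
  have := kerF_nonneg h hg h0 h1 x
  linarith

/-- The kernels `ℓ² / V` form a family to which the abstract convolution estimates apply. -/
lemma Adm.exists_convKernel {ℓ : ℝ → ℝ} (hs : SlowlyVarying ℓ) (hℓ : IsDini ℓ) {ε η : ℝ}
    (hε : ε ∈ Ioc (0 : ℝ) 1) (hη : 0 ≤ η)
    (hconv : ∀ t s : ℝ, t < s → s - t ≤ ε → ∀ x y : E Θ.d,
      ∫⁻ r in Ioo t s, ∫⁻ z, ENNReal.ofReal (kerF φ (fun r => ℓ r ^ 2) (r - t) (x - z)) *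
          ENNReal.ofReal (kerF φ (fun r => ℓ r ^ 2) (s - r) (z - y)) ≤
        ENNReal.ofReal (η * kerF φ (fun r => ℓ r ^ 2) (s - t) (x - y))) :
    ∃ B b : ℝ → ℝ, ConvKernel (d := Θ.d) ε η (kerF φ fun r => ℓ r ^ 2) B b := by
  have hβ := h.scaling.β₁_pos
  have hβ₂ := h.β₂_pos
  have hup := one_le_upC Θ
  obtain ⟨K, hK⟩ := hs.exists_powerGrowth hℓ (b := Θ.β₁ / 4) (by positivity)
  have hg := hK.sq
  rw [show 2 * (Θ.β₁ / 4) = Θ.β₁ / 2 by ring] at hg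
  have hK1 := hK.one_le
  obtain ⟨C, hC, hint⟩ := exists_lintegral_weight_le Θ
  have hle : ∀ u ∈ Ioc 0 ε, u ≤ 1 := fun u hu => hu.2.trans hε.2
  set L : ℝ := ℓ 1 with hL
  have hL0 : 0 < L := hℓ.pos' one_pos
  -- a bound for `ℓ(φ⁻¹(u))` that is continuous in `u`, and for which `W(u) / u` is integrable
  -- by a power substitution in the Dini integral
  set W : ℝ → ℝ := fun u => ℓ ((upC Θ * u) ^ (1 / Θ.β₂)) with hW
  have hWpos : ∀ u, 0 < u → 0 < W u := fun u hu => hℓ.pos' (by positivity)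
  have hnn : ∀ u ∈ Ioc 0 ε, ∀ x : E Θ.d, 0 ≤ kerF φ (fun r => ℓ r ^ 2) u x := fun u hu =>
    kerF_nonneg h hg.nonneg hu.1 (hle u hu)
  have hlin : ∀ u ∈ Ioc 0 ε, ∫⁻ x : E Θ.d, ENNReal.ofReal (kerF φ (fun r => ℓ r ^ 2) u x) ≤
      ENNReal.ofReal (C * K ^ 2 * L * (W u / u)) := fun u hu => by
    have hp := h.phiInv_pos hu.1 (hle u hu)
    have h1 := hint φ h _ _ hg (phiInv φ u) ⟨hp, h.phiInv_le_one hu.1.le (hle u hu)⟩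
    rw [h.phi_phiInv hu.1.le (hle u hu)] at h1
    refine h1.trans (ENNReal.ofReal_le_ofReal ?_)
    have h2 := h.ell_phiInv_le hℓ hu.1 (hle u hu)
    have h3 := hℓ.le_one hp
    have h4 := hℓ.pos' hp
    have hu0 := hu.1
    calc C * K ^ 2 * (ℓ (phiInv φ u) ^ 2 / u)
        = C * K ^ 2 * (ℓ (phiInv φ u) * ℓ (phiInv φ u) / u) := by rw [sq (ℓ _)]
      _ ≤ C * K ^ 2 * (L * W u / u) := by gcongr
      _ = _ := by ring
  have hcont : ∀ u ∈ Ioc 0 ε, Continuous fun x : E Θ.d => kerF φ (fun r => ℓ r ^ 2) u x :=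
    fun u hu => continuous_kerF h hg.continuousOn hu.1 (hle u hu)
  refine ⟨fun u => L ^ 2 / radVol Θ.d φ (phiInv φ u), fun u => C * K ^ 2 * L * (W u / u), ?_⟩
  constructor
  · exact hnn
  · exact hη
  · exact hconv
  · intro u hu x
    have hp := h.phiInv_pos hu.1 (hle u hu)
    have hpos : 0 < phiInv φ u + ‖x‖ := by positivity
    have h1 := hℓ.le_one hpos
    have h2 := hℓ.pos' hpos
    have h3 := h.radVol_pos hp
    rw [kerF]
    gcongr
    exact h.radVol_mono hp.le (by linarith [norm_nonneg x])
  · intro u hu v hv huv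
    have hp := h.phiInv_pos hu.1 (hle u hu)
    have h3 := h.radVol_pos hp
    simp only
    gcongr
    exact h.radVol_mono hp.le (h.phiInv_mono hu.1.le huv (hle v hv))
  · intro u hu
    refine ⟨(hcont u hu).aestronglyMeasurable, ?_⟩
    rw [hasFiniteIntegral_iff_ofReal (.of_forall (hnn u hu))]
    exact (hlin u hu).trans_lt ENNReal.ofReal_lt_top
  · intro u hu
    have h1 := hWpos u hu.1
    have h2 := hu.1
    rw [integral_eq_lintegral_of_nonneg_ae (.of_forall (hnn u hu))
      (hcont u hu).aestronglyMeasurable]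
    exact ENNReal.toReal_le_of_le_ofReal (by positivity) (hlin u hu)
  · refine Integrable.const_mul ?_ _
    have hWc : ContinuousOn W (Ioi 0) := by
      refine hℓ.continuousOn_Ioi.comp ?_ fun u hu => ?_
      · refine ContinuousOn.rpow_const (by fun_prop) fun u hu => Or.inr (by positivity)
      · have hu0 : 0 < u := hu
        exact mem_Ioi.2 (by positivity)
    have hc : ContinuousOn (fun u => W u / u) (Ioi 0) :=
      hWc.div continuousOn_id fun u hu => ne_of_gt hu
    have hi0 : 0 < (upC Θ)⁻¹ := by positivity
    have h1 : IntegrableOn (fun u => W u / u) (Ioc 0 (upC Θ)⁻¹) := by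
      refine ⟨(hc.mono Ioc_subset_Ioi_self).aestronglyMeasurable measurableSet_Ioc, ?_⟩
      rw [hasFiniteIntegral_iff_ofReal (ae_restrict_of_forall_mem measurableSet_Ioc fun u hu =>
        div_nonneg (hWpos u hu.1).le hu.1.le)]
      exact hℓ.lintegral_comp_rpow_lt_top (by positivity) (by positivity)
    have h2 : IntegrableOn (fun u => W u / u) (Icc (upC Θ)⁻¹ 1) :=
      (hc.mono fun u hu => hi0.trans_le hu.1).integrableOn_Icc
    refine (h1.union h2).mono_set fun u hu => ?_
    rcases le_total u (upC Θ)⁻¹ with hu1 | hu1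
    · exact Or.inl ⟨hu.1, hu1⟩
    · exact Or.inr ⟨hu1, hle u hu⟩
  · exact h.measurable_kerF hg.continuousOn hε.2

end

lemma kerF_sq_le {Θ : Theta} {φ ℓ : ℝ → ℝ} (h : Adm Θ φ) (hℓ : IsDini ℓ) {t : ℝ} (h0 : 0 < t)
    (h1 : t ≤ 1) (x : E Θ.d) : kerF φ (fun r => ℓ r ^ 2) t x ≤ ℓ 1 * kerF φ ℓ t x := by
  have hpos : 0 < phiInv φ t + ‖x‖ :=
    add_pos_of_pos_of_nonneg (h.phiInv_pos h0 h1) (norm_nonneg x)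
  have hV := h.radVol_pos hpos
  have hp := hℓ.pos' hpos
  rw [kerF, kerF, mul_div_assoc', sq]
  gcongr
  exact hℓ.le_one hpos

/-- For short times the parametrix error is a kernel to which the abstract theory of the Levi
series applies, and the sum of the series inherits its oscillation in the first variable. The
constant `C` does not depend on `ℓ`. -/
theorem exists_levi_series (Θ : Theta) : ∃ C : ℝ, 0 < C ∧ ∀ ℓ : ℝ → ℝ, SlowlyVarying ℓ →
    IsDini ℓ → ∃ ε ∈ Ioc (0 : ℝ) 1, ∃ η : ℝ, C * η ≤ 1 / 2 ∧
      ∀ (φ : ℝ → ℝ) (κ : ℝ → E Θ.d → E Θ.d → ℝ), Setting Θ φ ℓ κ →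
        (∃ B b, ConvKernel (d := Θ.d) ε η (kerF φ fun r => ℓ r ^ 2) B b) ∧
        DomKernel ε C (kerF φ fun r => ℓ r ^ 2) (q0 φ κ) ∧ ContKernel ε (q0 φ κ) ∧
        ∀ t s : ℝ, 0 ≤ t → t < s → s - t ≤ ε → ∀ x x' y : E Θ.d, x ≠ x' →
          |qsum φ κ t s x y - qsum φ κ t s x' y| ≤
            (C + 2 * C ^ 2) * (ℓ ‖x - x'‖ / ℓ (phiInv φ (s - t))) *
              (kerF φ ℓ (s - t) (x - y) + kerF φ ℓ (s - t) (x' - y)) := by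
  obtain ⟨C, hC, hmain⟩ := exists_q0_kerF_bound Θ
  refine ⟨C, hC, fun ℓ hs hℓ => ?_⟩
  obtain ⟨ε₁, hε₁, hq0⟩ := hmain ℓ hs hℓ
  have hL : 0 < ℓ 1 := hℓ.pos' one_pos
  set η : ℝ := min (1 / (2 * C)) (1 / ℓ 1) with hη
  have hη0 : 0 < η := by positivity
  have hη1 : C * η ≤ 1 / 2 := by
    calc C * η ≤ C * (1 / (2 * C)) := by gcongr; exact min_le_left _ _
      _ = 1 / 2 := by field_simp
  have hη2 : η * ℓ 1 ≤ 1 := by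
    calc η * ℓ 1 ≤ 1 / ℓ 1 * ℓ 1 := by gcongr; exact min_le_right _ _
      _ = 1 := by field_simp
  obtain ⟨ε₂, hε₂, hsmall⟩ := exists_small_time Θ hs hℓ hη0
  set ε : ℝ := min ε₁ ε₂ with hε
  have hεε₁ : ε ≤ ε₁ := min_le_left _ _
  have hεε₂ : ε ≤ ε₂ := min_le_right _ _
  have hε1 : ε ∈ Ioc (0 : ℝ) 1 := ⟨lt_min hε₁.1 hε₂.1, hεε₁.trans hε₁.2⟩
  refine ⟨ε, hε1, η, hη1, fun φ κ H => ?_⟩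
  have h := H.adm
  have hconv := (hsmall φ h).2
  obtain ⟨B, b, hF⟩ := h.exists_convKernel hs hℓ hε1 hη0.le
    fun t s hts hsε => fun x y => (hconv t s hts (hsε.trans hεε₂) x y).1
  have hq : DomKernel ε C (kerF φ fun r => ℓ r ^ 2) (q0 φ κ) := by
    refine ⟨hC.le, ?_, fun t s ht hts hsε x y => ?_⟩
    · obtain ⟨Q, hQm, hQ⟩ := H.exists_measurable_q0
      have heq : EqOn (fun p : ℝ × ℝ × E Θ.d × E Θ.d => q0 φ κ p.1 p.2.1 p.2.2.1 p.2.2.2)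
          (fun p => Q p.1 p.2.1 p.2.2.1 p.2.2.2) (timeDom Θ.d ε) := fun p hp =>
        (hQ p.1 p.2.1 p.2.2.1 p.2.2.2 hp.1 hp.2.1 (hp.2.2.trans hε1.2)).symm
      rw [indicator_congr heq]
      exact hQm.indicator (measurableSet_timeDom _ _)
    · exact (hq0 φ κ H t s ht hts (hsε.trans hεε₁) _ (Or.inl rfl) x y).1
  refine ⟨⟨B, b, hF⟩, hq, fun t s x y ht hts hsε => ?_, fun t s ht hts hsε x x' y hne => ?_⟩
  · exact H.continuousAt_q0 hℓ ht hts (by linarith [hε1.2]) x y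
  have hτ0 : 0 < s - t := sub_pos.2 hts
  have hτ1 : s - t ≤ 1 := hsε.trans hε1.2
  have hh : 0 < ‖x - x'‖ := norm_pos_iff.2 (sub_ne_zero.2 hne)
  have hℓh := hℓ.pos' hh
  have hℓτ := hℓ.pos' (h.phiInv_pos hτ0 hτ1)
  have hpos : ∀ r ∈ Ioo t s, 0 < phiInv φ (r - t) := fun r hr =>
    h.phiInv_pos (by linarith [hr.1]) (by linarith [hr.2])
  have hℓr : ∀ r ∈ Ioo t s, 0 < ℓ (phiInv φ (r - t)) := fun r hr => hℓ.pos' (hpos r hr)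
  -- the oscillation of the convolution term
  have hosc := hF.abs_leviStep_sub_le hq (domKernel_qsum hF hq hη1) ht hts hsε (x := x) (x' := x')
    (y := y) (ω := fun r => C * ℓ ‖x - x'‖ * (1 / ℓ (phiInv φ (r - t))))
    (K := C * ℓ ‖x - x'‖ * (η * (1 / ℓ (phiInv φ (s - t)))))
    (by
      refine AEMeasurable.const_mul ?_ _
      refine aemeasurable_restrict_of_antitoneOn measurableSet_Ioo fun r hr r' hr' hrr => ?_
      have := hℓr r hr
      refine one_div_le_one_div_of_le this (hℓ.mono (hpos r hr) (hpos r' hr') ?_)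
      exact h.phiInv_mono (by linarith [hr.1]) (by linarith) (by linarith [hr'.2]))
    (fun r hr => by have := hℓr r hr; positivity) (by positivity)
    (fun r hr z => by
      have := (hq0 φ κ H t r ht hr.1 (by linarith [hr.2]) _ (Or.inl rfl) x z).2 x' hne
      rwa [mul_div_assoc', ← mul_one_div] at this)
    (fun v => by
      refine le_trans (le_of_eq ?_) ((mul_le_mul_right (hconv t s hts (hsε.trans hεε₂) v y).2
        (ENNReal.ofReal (C * ℓ ‖x - x'‖))).trans (le_of_eq ?_))
      · rw [← lintegral_const_mul' _ _ ENNReal.ofReal_ne_top]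
        refine lintegral_congr fun r => ?_
        rw [ENNReal.ofReal_mul (by positivity), mul_assoc]
      · rw [← ENNReal.ofReal_mul (by positivity), mul_assoc (C * ℓ ‖x - x'‖)])
  have hq0d := (hq0 φ κ H t s ht hts (hsε.trans hεε₁) ℓ (Or.inr rfl) x y).2 x' hne
  have hk1 := kerF_nonneg h (fun r hr => (hℓ.pos' hr).le) hτ0 hτ1 (x - y)
  have hk2 := kerF_nonneg h (fun r hr => (hℓ.pos' hr).le) hτ0 hτ1 (x' - y)
  rw [qsum_eq_add_leviStep hF hq hη1 ht hts hsε, qsum_eq_add_leviStep hF hq hη1 ht hts hsε,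
    add_sub_add_comm]
  set S : ℝ := kerF φ ℓ (s - t) (x - y) + kerF φ ℓ (s - t) (x' - y) with hS
  calc _ ≤ C * (ℓ ‖x - x'‖ / ℓ (phiInv φ (s - t))) * S + 2 * C *
        (C * ℓ ‖x - x'‖ * (η * (1 / ℓ (phiInv φ (s - t))))) * (ℓ 1 * S) := by
        refine (abs_add_le _ _).trans (add_le_add hq0d (hosc.trans ?_))
        gcongr
        rw [hS, mul_add]
        exact add_le_add (kerF_sq_le h hℓ hτ0 hτ1 _) (kerF_sq_le h hℓ hτ0 hτ1 _)
    _ = (C + 2 * C ^ 2 * (η * ℓ 1)) * (ℓ ‖x - x'‖ / ℓ (phiInv φ (s - t))) * S := by ring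
    _ ≤ (C + 2 * C ^ 2 * 1) * (ℓ ‖x - x'‖ / ℓ (phiInv φ (s - t))) * S := by gcongr
    _ = _ := by rw [mul_one]

/-! ### Conclusion -/

/-- The moment `𝒜^{(0)}_φ` is finite as soon as `𝒜^{(1)}_φ` is. -/
lemma A0_le_A1 (φ : ℝ → ℝ) (hφ : IsScale φ) : A0 φ ≤ A1 φ := by
  refine iSup₂_mono fun l hl => setLIntegral_mono' measurableSet_Ioi fun r hr => ?_
  have hr0 : 0 < r := hr
  have hpos : ∀ u, 0 < u → 0 ≤ φ u := fun u hu => by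
    rw [← hφ.map_zero]
    exact hφ.strictMonoOn.monotoneOn self_mem_Ici (mem_Ici.2 hu.le) hu.le
  have h1 := hpos l hl.1
  have h2 := hpos (l * r) (mul_pos hl.1 hr0)
  have h3 := gamma0_le_gamma1 φ hr0.le
  gcongr

lemma setting_of_hypotheses {Θ : Theta} {φ ℓ : ℝ → ℝ} {κ : ℝ → E Θ.d → E Θ.d → ℝ} (hd : 1 ≤ Θ.d)
    (hφ : IsScale φ) (hΘ : Θ.Fits φ) (h : H1 Θ φ ℓ κ ∨ H2' Θ φ ℓ κ) : Setting Θ φ ℓ κ := by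
  rcases h with h | h
  · exact ⟨⟨hd, h.bounds.one_le, hφ, h.scaling, hΘ.c₀_eq, hΘ.A₀_eq, h.A0_lt_top⟩, h.bounds,
      Or.inl h.symm⟩
  · exact ⟨⟨hd, h.bounds.one_le, hφ, h.scaling, hΘ.c₀_eq, hΘ.A₀_eq,
      (A0_le_A1 φ hφ).trans_lt h.A1_lt_top⟩, h.bounds,
      Or.inr ⟨h.not_symm, hΘ.A₁_eq, h.A1_lt_top, h.centered⟩⟩

lemma IsDini.le_supNorm {ℓ : ℝ → ℝ} (hℓ : IsDini ℓ) {r : ℝ} (hr : 0 < r) : ℓ r ≤ supNorm ℓ := by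
  have hb : BddAbove (range fun r : Ioi (0 : ℝ) => |ℓ r|) := by
    refine ⟨ℓ 1, ?_⟩
    rintro _ ⟨⟨u, hu⟩, rfl⟩
    simp only [abs_of_pos (hℓ.pos' hu)]
    exact hℓ.le_one hu
  exact (le_abs_self _).trans (le_ciSup hb ⟨r, hr⟩)

lemma Adm.hfun_sq_le {Θ : Theta} {φ ℓ : ℝ → ℝ} (h : Adm Θ φ) (hℓ : IsDini ℓ) {t : ℝ} (h0 : 0 < t)
    (h1 : t ≤ 1) (x : E Θ.d) :
    hfun φ (fun r => ℓ r ^ 2) t x ≤ supNorm ℓ * hfun φ ℓ t x := by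
  have hpos : 0 < phiInv φ t + ‖x‖ :=
    add_pos_of_pos_of_nonneg (h.phiInv_pos h0 h1) (norm_nonneg x)
  have hp := hℓ.pos' hpos
  have hh := h.hfun_nonneg (fun r hr => (hℓ.pos' hr).le) h0 h1 x
  calc hfun φ (fun r => ℓ r ^ 2) t x = ℓ (phiInv φ t + ‖x‖) * hfun φ ℓ t x := by
        rw [hfun, hfun]; ring
    _ ≤ _ := by
        gcongr
        exact hℓ.le_supNorm hpos

end LevyLevi

end

theorem mainTheorem3 :
    ∃ c₁ : ℝ → LevyLevi.Theta → ℝ,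
    ∀ ℓ : ℝ → ℝ, LevyLevi.SlowlyVarying ℓ → LevyLevi.IsDini ℓ →
    ∀ Θ : LevyLevi.Theta, 1 ≤ Θ.d →
    ∃ ε₀ : ℝ, 0 < ε₀ ∧ 0 < c₁ ε₀ Θ ∧
    ∀ (φ : ℝ → ℝ) (κ : ℝ → LevyLevi.E Θ.d → LevyLevi.E Θ.d → ℝ),
      LevyLevi.IsScale φ → Θ.Fits φ →
      (LevyLevi.H1 Θ φ ℓ κ ∨ LevyLevi.H2' Θ φ ℓ κ) →
      -- the integrals defining the functions `q^{(n)}` converge absolutely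
      (∀ t s x y, (t, x, s, y) ∈ LevyLevi.domD Θ.d 0 ε₀ →
        MeasureTheory.Integrable (fun z => LevyLevi.Delta φ κ
          (LevyLevi.frozenKernel φ κ y t s) (x - y) z * κ t x z) ∧
        MeasureTheory.Integrable (fun z => LevyLevi.Delta φ κ
          (LevyLevi.frozenKernel φ κ y t s) (x - y) z * κ t y z) ∧
        ∀ n : ℕ, MeasureTheory.IntegrableOn
          (fun p : ℝ × LevyLevi.E Θ.d =>
            LevyLevi.q0 φ κ t p.1 x p.2 * LevyLevi.qn φ κ n p.1 s p.2 y)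
          (Set.Ioo t s ×ˢ Set.univ)) ∧
      -- the series converges absolutely and locally uniformly
      (∀ t s x y, (t, x, s, y) ∈ LevyLevi.domD Θ.d 0 ε₀ →
        Summable (fun n : ℕ => |LevyLevi.qn φ κ n t s x y|)) ∧
      TendstoLocallyUniformlyOn
        (fun (N : ℕ) (p : ℝ × LevyLevi.E Θ.d × ℝ × LevyLevi.E Θ.d) =>
          ∑ n ∈ Finset.range N, |LevyLevi.qn φ κ n p.1 p.2.2.1 p.2.1 p.2.2.2|)
        (fun p => ∑' n : ℕ, |LevyLevi.qn φ κ n p.1 p.2.2.1 p.2.1 p.2.2.2|)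
        Filter.atTop (LevyLevi.domD Θ.d 0 ε₀) ∧
      TendstoLocallyUniformlyOn
        (fun (N : ℕ) (p : ℝ × LevyLevi.E Θ.d × ℝ × LevyLevi.E Θ.d) =>
          ∑ n ∈ Finset.range N, LevyLevi.qn φ κ n p.1 p.2.2.1 p.2.1 p.2.2.2)
        (fun p => LevyLevi.qsum φ κ p.1 p.2.2.1 p.2.1 p.2.2.2)
        Filter.atTop (LevyLevi.domD Θ.d 0 ε₀) ∧
      -- the sum solves the integral equation, whose integral converges absolutely
      (∀ t s x y, (t, x, s, y) ∈ LevyLevi.domD Θ.d 0 ε₀ →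
        MeasureTheory.IntegrableOn
          (fun p : ℝ × LevyLevi.E Θ.d =>
            LevyLevi.q0 φ κ t p.1 x p.2 * LevyLevi.qsum φ κ p.1 s p.2 y)
          (Set.Ioo t s ×ˢ Set.univ) ∧
        LevyLevi.qsum φ κ t s x y = LevyLevi.q0 φ κ t s x y +
          ∫ r in t..s, ∫ z : LevyLevi.E Θ.d,
            LevyLevi.q0 φ κ t r x z * LevyLevi.qsum φ κ r s z y) ∧
      -- joint continuity
      (∀ t : ℝ, 0 < t → ContinuousOn
        (fun p : ℝ × LevyLevi.E Θ.d × LevyLevi.E Θ.d => LevyLevi.qsum φ κ t p.1 p.2.1 p.2.2)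
        (LevyLevi.domK Θ.d ε₀ t)) ∧
      -- pointwise bound
      (∀ t s x y, (t, x, s, y) ∈ LevyLevi.domD Θ.d 0 ε₀ →
        |LevyLevi.qsum φ κ t s x y|
            ≤ c₁ ε₀ Θ * LevyLevi.hfun φ (fun r => ℓ r ^ 2) (s - t) (x - y) ∧
        c₁ ε₀ Θ * LevyLevi.hfun φ (fun r => ℓ r ^ 2) (s - t) (x - y)
            ≤ c₁ ε₀ Θ * LevyLevi.supNorm ℓ * LevyLevi.hfun φ ℓ (s - t) (x - y)) ∧
      -- Dini-type continuity in `x`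
      (∀ t s x x' y, (t, x, s, y) ∈ LevyLevi.domD Θ.d 0 ε₀ → x ≠ x' →
        |LevyLevi.qsum φ κ t s x y - LevyLevi.qsum φ κ t s x' y|
            ≤ c₁ ε₀ Θ * (ℓ ‖x - x'‖ / LevyLevi.ellPhi φ ℓ (s - t)) *
              (LevyLevi.hfun φ ℓ (s - t) (x - y) + LevyLevi.hfun φ ℓ (s - t) (x' - y))) := by
  choose C hC hmain using LevyLevi.exists_levi_series
  refine ⟨fun _ Θ => 6 * C Θ + 4 * C Θ ^ 2, fun ℓ hs hℓ Θ hd => ?_⟩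
  have hC0 := hC Θ
  obtain ⟨ε, hε, η, hη, hser⟩ := hmain Θ ℓ hs hℓ
  refine ⟨ε, hε.1, by positivity, fun φ κ hφ hΘ hcase => ?_⟩
  have H := LevyLevi.setting_of_hypotheses hd hφ hΘ hcase
  obtain ⟨⟨B, b, hF⟩, hq, cq, hosc⟩ := hser φ κ H
  have h := H.adm
  have hℓ0 : ∀ r, 0 < r → 0 ≤ ℓ r := fun r hr => (hℓ.pos' hr).le
  have hqn := LevyLevi.domKernel_qn hF hq hη
  have hqs := LevyLevi.domKernel_qsum hF hq hη
  obtain ⟨Cq, -, hq0⟩ := LevyLevi.exists_q0_bound Θ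
  refine ⟨?_, ?_, ?_, ?_, ?_, ?_, ?_, ?_⟩
  · rintro t s x y ⟨ht, -, hts, hsε⟩
    have hts' : t < s := sub_pos.1 hts
    have hsε' : s - t ≤ ε := hsε.le
    obtain ⟨h1, h2, -⟩ := hq0 φ ℓ κ H t s ht hts' (hsε'.trans hε.2) x y
    exact ⟨h1, h2, fun n => (hF.integrableOn_mul hq (hqn n) ht hts' hsε' x y).1⟩
  · rintro t s x y ⟨ht, -, hts, hsε⟩
    exact LevyLevi.summable_abs_qn hF hq hη ht (sub_pos.1 hts) hsε.le x y
  · exact LevyLevi.tendstoLocallyUniformlyOn_qn hF hq hη (g := fun a => |a|)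
      fun a => (abs_abs a).le
  · exact LevyLevi.tendstoLocallyUniformlyOn_qn hF hq hη (g := fun a => a) fun a => le_rfl
  · rintro t s x y ⟨ht, -, hts, hsε⟩
    have hts' : t < s := sub_pos.1 hts
    exact ⟨(hF.integrableOn_mul hq hqs ht hts' hsε.le x y).1,
      LevyLevi.qsum_eq_add_leviStep hF hq hη ht hts' hsε.le x y⟩
  · rintro t ht ⟨s, x, y⟩ ⟨⟨hts, hsε⟩, -⟩
    exact (LevyLevi.contKernel_qsum hF hq hη cq t s x y ht.le hts hsε).continuousWithinAt
  · rintro t s x y ⟨ht, -, hts, hsε⟩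
    have hτ1 : s - t ≤ 1 := hsε.le.trans hε.2
    have hg : ∀ r, 0 < r → 0 ≤ ℓ r ^ 2 := fun r _ => sq_nonneg _
    have hh := h.hfun_nonneg hg hts hτ1 (x - y)
    constructor
    · refine (hqs.bound t s ht (sub_pos.1 hts) hsε.le x y).trans ?_
      have hk := h.kerF_le_hfun hg hts hτ1 (x - y)
      calc _ ≤ 2 * C Θ * (2 * LevyLevi.hfun φ (fun r => ℓ r ^ 2) (s - t) (x - y)) := by gcongr
        _ = 4 * C Θ * LevyLevi.hfun φ (fun r => ℓ r ^ 2) (s - t) (x - y) := by ring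
        _ ≤ _ := by
            gcongr
            nlinarith
    · rw [mul_assoc]
      gcongr
      exact h.hfun_sq_le hℓ hts hτ1 (x - y)
  · rintro t s x x' y ⟨ht, -, hts, hsε⟩ hne
    have hτ1 : s - t ≤ 1 := hsε.le.trans hε.2
    have h1 := h.hfun_nonneg hℓ0 hts hτ1 (x - y)
    have h2 := h.hfun_nonneg hℓ0 hts hτ1 (x' - y)
    have k1 := h.kerF_le_hfun hℓ0 hts hτ1 (x - y)
    have k2 := h.kerF_le_hfun hℓ0 hts hτ1 (x' - y)
    have e1 := hℓ.pos' (norm_pos_iff.2 (sub_ne_zero.2 hne))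
    have e2 := hℓ.pos' (h.phiInv_pos hts hτ1)
    refine (hosc t s ht (sub_pos.1 hts) hsε.le x x' y hne).trans ?_
    rw [LevyLevi.ellPhi]
    set A := ℓ ‖x - x'‖ / ℓ (LevyLevi.phiInv φ (s - t)) with hA
    have hA0 : 0 ≤ A := by positivity
    calc _ ≤ (C Θ + 2 * C Θ ^ 2) * A * (2 * (LevyLevi.hfun φ ℓ (s - t) (x - y) +
          LevyLevi.hfun φ ℓ (s - t) (x' - y))) := by
          gcongr
          linarith
      _ = (2 * C Θ + 4 * C Θ ^ 2) * A * (LevyLevi.hfun φ ℓ (s - t) (x - y) +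
          LevyLevi.hfun φ ℓ (s - t) (x' - y)) := by ring
      _ ≤ _ := by
          gcongr
          linarith
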